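/- Work on the Schwarzschild background $g=y_{AB}dx^Adx^B+r^2\gamma_{pq}dx^pdx^q$ with $y=-f\,dt^2+f^{-1}dr^2$, $f=1-2M/r$ ($M\in\mathbb R$) and $\gamma=d\theta^2+\sin^2\theta\,d\phi^2$, over an open set $\Omega$ of the $(t,r)$-plane with $r>0$, $r\ne 2M$, and for $0<\theta<\pi$. Indices $A,B,\dots$ refer to $(t,r)$, indices $p,q,\dots$ to $(\theta,\phi)$; $\bar D$ and $\hat D$ are the covariant derivatives of $y$ and $\gamma$; $\epsilon_{\theta\phi}=\sin\theta$. The linearized Einstein tensor is $$\mathscr G_a{}^b[A]=\Sigma_a{}^b[A]-\tfrac12\delta_a{}^b\Sigma_c{}^c[A],\quad \Sigma_a{}^b[A]=-2\nabla_{[a}H_{d]}{}^{bd}[A]-A^{cb}R_{ac},\quad H_{abc}[A]=\nabla_{(a}A_{b)c}-\tfrac12\nabla_cA_{ab}.$$ *Harmonics.* For $\delta\in\mathbb R$ let $S_\delta=Y_{lm}$ for $l\ge2$; for $l=1$: $S_\delta=\cos\theta+\delta(\frac12\cos\theta\ln\frac{1+\cos\theta}{1-\cos\theta}-1)$ if $m=0$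 and $S_\delta=[\sin\theta+\delta(\frac12\sin\theta\ln\frac{1+\cos\theta}{1-\cos\theta}+\cot\theta)]e^{\pm i\phi}$ if $m=\pm1$; for $l=0$: $S_\delta=1+\delta\ln\sqrt{(1-\cos\theta)/(1+\cos\theta)}$. *Variables.* From mode coefficients $\tilde h_{AB},\tilde h_{(e1)A},\tilde h_{(o1)A},\tilde h_{(e0)},\tilde h_{(e2)},\tilde h_{(o2)}$ (one set for each $l\ge0$, $|m|\le l$) of a metric perturbation $h_{AB}=\sum\tilde h_{AB}S_\delta$, $h_{Ap}=r\sum[\tilde h_{(e1)A}\hat D_pS_\delta+\tilde h_{(o1)A}\epsilon_{pq}\hat D^qS_\delta]$, $h_{pq}=r^2\sum[\frac12\gamma_{pq}\tilde h_{(e0)}S_\delta+\tilde h_{(e2)}(\hat D_p\hat D_q-\frac12\gamma_{pq}\hat D^r\hat D_r)S_\delta+2\tilde h_{(o2)}\epsilon_{r(p}\hat D_{q)}\hat D^rS_\delta]$, form, with $\tilde Y_A=r\tilde h_{(e1)A}-\frac{r^2}{2}\bar D_A\tilde h_{(e2)}$, the gauge-invariant variables $$\tilde F_A=\tilde h_{(o1)A}+r\bar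 D_A\tilde h_{(o2)},\quad \tilde F=\tilde h_{(e0)}-\tfrac4r\tilde Y_A\bar D^Ar+l(l+1)\tilde h_{(e2)},\quad \tilde F_{AB}=\tilde h_{AB}-2\bar D_{(A}\tilde Y_{B)},$$ and $\tilde{\mathbb F}_{AB}=\tilde F_{AB}-\frac12y_{AB}\tilde F_C{}^C$. The gauge-invariant part $\mathscr F$ of the perturbation has components $\mathscr F_{AB}=\sum\tilde F_{AB}S_\delta$, $\mathscr F_{Ap}=r\sum\tilde F_A\epsilon_{pq}\hat D^qS_\delta$, $\mathscr F_{pq}=\frac12\gamma_{pq}r^2\sum\tilde FS_\delta$. Let the linearized energy-momentum tensor be $\mathscr T_A{}^B=\sum\tilde T_A{}^BS_\delta$, $\mathscr T_A{}^q=\frac1r\sum\{\tilde T_{(e1)A}\hat D^qS_\delta+\tilde T_{(o1)A}\epsilon^{qr}\hat D_rS_\delta\}$, $\mathscr T_p{}^B=r\sum\{\tilde T_{(e1)}^B\hat D_pS_\delta+\tilde T_{(o1)}^B\epsilon_{pr}\hat D^rS_\delta\}$, $\mathscr T_p{}^q=\sum\{\frac12\gamma_p{}^q\tilde T_{(e0)}S_\delta+\tilde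 T_{(e2)}(\hat D_p\hat D^q-\frac12\gamma_p{}^q\hat D_r\hat D^r)S_\delta+\tilde T_{(o2)}(\epsilon_{sp}\hat D^q\hat D^s+\epsilon^{sq}\hat D_p\hat D_s)S_\delta\}$. Assume that $\tilde F_{AB}$ and $\tilde T_{AB}$ are symmetric, and that each of the families $c_{lm}$ among $\tilde F_{AB},\tilde F_A,\tilde F,\tilde T_{AB},\tilde T_{(e1)A},\tilde T_{(o1)A},\tilde T_{(e0)},\tilde T_{(e2)},\tilde T_{(o2)}$ consists of smooth complex-valued functions on $\Omega$ for which $\sum_{l\ge2,m}(l+1)^N\partial^\alpha(c_{lm}Y_{lm})$ converges normally on the compact subsets of $\Omega\times\mathbb R^2\ni((t,r),(\theta,\phi))$, for all $N$ and all multi-indices $\alpha$. Then: **(1)** At every point, and with convergent series over all $l\ge0$, $|m|\le l$, $$\begin{aligned}\mathscr G_A{}^B[\mathscr F]=&\tfrac12\sum\Big[\big(-\bar D_D\bar D^D+\tfrac{l(l+1)}{r^2}-\tfrac2r(\bar D_Dr)\bar D^D\big)\tilde F_A{}^B+\big(\bar D_D\bar D_A+\tfrac2r(\bar D_Dr)\bar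 D_A\big)\tilde F^{BD}\\&+\big(\bar D^D\bar D^B+\tfrac2r(\bar D^Dr)\bar D^B\big)\tilde F_{AD}-\bar D_A\bar D^B\tilde F_D{}^D-\big(\bar D_A\bar D^B+\tfrac1r(\bar D_Ar)\bar D^B+\tfrac1r(\bar D^Br)\bar D_A\big)\tilde F\Big]S_\delta\\&+\tfrac12\delta_A{}^B\sum\Big[\big(\bar D_E\bar D^E-\tfrac{l(l+1)+1}{r^2}+\tfrac2r(\bar D_Er)\bar D^E+\tfrac1{r^2}(\bar D^Er)(\bar D_Er)\big)\tilde F_D{}^D\\&-\big(\bar D_D\bar D_E+\tfrac4r(\bar D_Dr)\bar D_E+\tfrac2{r^2}(\bar D_Er)(\bar D_Dr)\big)\tilde F^{ED}+\big(\bar D_D\bar D^D-\tfrac{l(l+1)-2}{2r^2}+\tfrac3r(\bar D^Dr)\bar D_D\big)\tilde F\Big]S_\delta,\end{aligned}$$ and, with $$\mathcal E_A=\big(-\bar D_A+\tfrac1r(\bar D_Ar)\big)\tilde F_D{}^D+\bar D^D\tilde F_{AD}-\tfrac12\bar D_A\tilde F,$$ $$\begin{aligned}\mathcal O_A=&\big(-\bar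 D^D\bar D_D+\tfrac{l(l+1)}{r^2}-\tfrac2r(\bar D^Dr)\bar D_D+\tfrac3{2r^2}\{(\bar D^Dr)(\bar D_Dr)-1\}\big)\tilde F_A\\&+\big(\bar D^D\bar D_A+\tfrac3r(\bar D^Dr)\bar D_A-\tfrac1r(\bar D_Ar)\bar D^D-\tfrac2{r^2}(\bar D_Ar)(\bar D^Dr)\big)\tilde F_D,\end{aligned}$$ $$\mathscr G_A{}^q[\mathscr F]=\tfrac1{2r^2}\sum\mathcal E_A\hat D^qS_\delta+\tfrac1{2r}\sum\mathcal O_A\epsilon^{qt}\hat D_tS_\delta,\qquad \mathscr G_p{}^B[\mathscr F]=\tfrac12\sum\mathcal E^B\hat D_pS_\delta+\tfrac r2\sum\mathcal O^B\epsilon_{pq}\hat D^qS_\delta,$$ $$\begin{aligned}\mathscr G_p{}^q[\mathscr F]=&\sum\Big[\tfrac1{2r^2}\bar D_D(r^2\bar D^D\tilde F)-\tfrac1{r^2}\bar D_D(r^2\bar D_E\tilde F^{ED})+\big(\bar D_E\bar D^E+\tfrac1r(\bar D_Er)\bar D^E-\tfrac{l(l+1)}{2r^2}\big)\tilde F_D{}^D\Big]\tfrac12\gamma_p{}^qS_\delta\\&+\tfrac1{2r^2}\sum\Big[-\tilde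 F_D{}^D\big(\hat D_p\hat D^q-\tfrac12\gamma_p{}^q\hat D^s\hat D_s\big)S_\delta-\bar D_D(r\tilde F^D)\big(\epsilon^{sq}\hat D_p\hat D_s+\epsilon_{sp}\hat D^q\hat D^s\big)S_\delta\Big].\end{aligned}$$ **(2)** Consider, for each mode and at every point of $\Omega$, the odd equations $$\bar D_D(r\tilde F^D)=-16\pi r^2\tilde T_{(o2)},$$ $$-\Big[\bar D^D\bar D_D-\tfrac{l(l+1)}{r^2}\Big](r\tilde F_A)-\tfrac2{r^2}(\bar D^Dr)(\bar D_Ar)(r\tilde F_D)+\tfrac2r(\bar D^Dr)\bar D_A(r\tilde F_D)=16\pi r\big(\tilde T_{(o1)A}+r\bar D_A\tilde T_{(o2)}\big),$$ the four even equations $$\tilde F_D{}^D=-16\pi r^2\tilde T_{(e2)},\qquad \bar D^D\tilde{\mathbb F}_{AD}-\tfrac12\bar D_A\tilde F=16\pi\big[r\tilde T_{(e1)A}-\tfrac12r^2\bar D_A\tilde T_{(e2)}\big],$$ $$\begin{aligned}&\Big(\bar D_D\bar D^D+\tfrac2r(\bar D^Dr)\bar D_D-\tfrac{(l-1)(l+2)}{r^2}\Big)\tilde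 F-\tfrac4{r^2}(\bar D_Cr)(\bar D_Dr)\tilde{\mathbb F}^{CD}\\&\quad=16\pi\big[\tilde T_C{}^C+4(\bar D_Dr)\tilde T_{(e1)}^D-2r(\bar D_Dr)\bar D^D\tilde T_{(e2)}-(l(l+1)+2)\tilde T_{(e2)}\big],\end{aligned}$$ $$\begin{aligned}&\Big[-\bar D_D\bar D^D-\tfrac2r(\bar D_Dr)\bar D^D+\tfrac4r(\bar D^D\bar D_Dr)+\tfrac{l(l+1)}{r^2}\Big]\tilde{\mathbb F}_{AB}+\tfrac4r(\bar D^Dr)\bar D_{(A}\tilde{\mathbb F}_{B)D}-\tfrac2r(\bar D_{(A}r)\bar D_{B)}\tilde F\\&\quad=16\pi\Big[\tilde T_{AB}-\tfrac12y_{AB}\tilde T_C{}^C-2\big(\bar D_{(A}(r\tilde T_{(e1)B)})-\tfrac12y_{AB}\bar D^D(r\tilde T_{(e1)D})\big)\\&\qquad+2\big((\bar D_{(A}r)\bar D_{B)}-\tfrac12y_{AB}(\bar D^Dr)\bar D_D\big)(r\tilde T_{(e2)})+r\big(\bar D_A\bar D_B-\tfrac12y_{AB}\bar D^D\bar D_D\big)(r\tilde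 T_{(e2)})\\&\qquad+2\big((\bar D_Ar)(\bar D_Br)-\tfrac12y_{AB}(\bar D^Cr)(\bar D_Cr)\big)\tilde T_{(e2)}+2y_{AB}(\bar D^Cr)\tilde T_{(e1)C}-ry_{AB}(\bar D^Cr)\bar D_C\tilde T_{(e2)}\Big],\end{aligned}$$ and the continuity equations $$\text{(a)}\ \ \bar D^C\tilde T_C{}^B+\tfrac2r(\bar D^Dr)\tilde T_D{}^B-\tfrac1rl(l+1)\tilde T_{(e1)}^B-\tfrac1r(\bar D^Br)\tilde T_{(e0)}=0,$$ $$\text{(b)}\ \ \bar D^C\tilde T_{(e1)C}+\tfrac3r(\bar D^Cr)\tilde T_{(e1)C}+\tfrac1{2r}\tilde T_{(e0)}-\tfrac1{2r}(l-1)(l+2)\tilde T_{(e2)}=0,$$ $$\text{(c)}\ \ \bar D^C\tilde T_{(o1)C}+\tfrac3r(\bar D^Dr)\tilde T_{(o1)D}+\tfrac1r(l-1)(l+2)\tilde T_{(o2)}=0.$$ If $\mathscr G_a{}^b[\mathscr F]=8\pi\mathscr T_a{}^b$ at all points, then all of these equations hold for every mode with $l\ge2$, and for every mode with $l\ge0$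 if $\delta\ne0$. Conversely, for every $\delta$, if the odd equations, the four even equations and (b) hold for all modes $l\ge0$, then $\mathscr G_a{}^b[\mathscr F]=8\pi\mathscr T_a{}^b$. **(3)** If $\nabla_a\mathscr T_b{}^a=0$ at all points, then (a), (b), (c) hold for every mode with $l\ge2$, and for every mode with $l\ge0$ if $\delta\neq0$. Conversely, for every $\delta$, if (a), (b), (c) hold for all modes, then $\nabla_a\mathscr T_b{}^a=0$. -/

import Mathlib

open scoped ContDiff

noncomputable section

namespace SchwarzschildModes

/-! ### Tensor calculus in one coordinate chart

Points are coordinate tuples `ι → ℝ`.  All components are complex valued, because the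
harmonics are.  A tensor field is given by its component functions. -/

section Tensor

variable {ι : Type} [Fintype ι] [DecidableEq ι]

/-- The partial derivative `∂ᵢ f`. -/
def pd (i : ι) (f : (ι → ℝ) → ℂ) : (ι → ℝ) → ℂ :=
  fun x => fderiv ℝ f x (Pi.single i 1)

/-- The Christoffel symbol `Γ_{ab}{}^c` of the metric `g`. -/
def christoffel (g : (ι → ℝ) → Matrix ι ι ℂ) (a b c : ι) : (ι → ℝ) → ℂ := fun x =>
  (1 / 2) * ∑ d, (g x)⁻¹ c d *
    (pd a (fun z => g z d b) x + pd b (fun z => g z d a) x - pd d (fun z => g z a b) x)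

/-- The Ricci tensor `R_{ac} = R_{abc}{}^b`, with
`R_{abc}{}^d = ∂_b Γ_{ac}^d - ∂_a Γ_{bc}^d + Γ_{ac}^e Γ_{eb}^d - Γ_{bc}^e Γ_{ea}^d`. -/
def ricci (g : (ι → ℝ) → Matrix ι ι ℂ) (a c : ι) : (ι → ℝ) → ℂ := fun x =>
  ∑ b, (pd b (christoffel g a c b) x - pd a (christoffel g b c b) x
    + ∑ e, (christoffel g a c e x * christoffel g e b b x
      - christoffel g b c e x * christoffel g e a b x))

/-- `∇_a v_b` for a covector field. -/
def cov1 (g : (ι → ℝ) → Matrix ι ι ℂ) (v : ι → (ι → ℝ) → ℂ) (a b : ι) : (ι → ℝ) → ℂ :=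
  fun x => pd a (v b) x - ∑ e, christoffel g a b e x * v e x

/-- `∇_a T_{bc}`. -/
def cov2 (g : (ι → ℝ) → Matrix ι ι ℂ) (T : ι → ι → (ι → ℝ) → ℂ) (a b c : ι) :
    (ι → ℝ) → ℂ := fun x =>
  pd a (T b c) x - ∑ e, christoffel g a b e x * T e c x
    - ∑ e, christoffel g a c e x * T b e x

/-- `∇_a T_{bcd}`. -/
def cov3 (g : (ι → ℝ) → Matrix ι ι ℂ) (T : ι → ι → ι → (ι → ℝ) → ℂ) (a b c d : ι) :
    (ι → ℝ) → ℂ := fun x =>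
  pd a (T b c d) x - ∑ e, christoffel g a b e x * T e c d x
    - ∑ e, christoffel g a c e x * T b e d x - ∑ e, christoffel g a d e x * T b c e x

/-- The divergence `∇_a T_b{}^a` of a mixed tensor; `T b a` is `T_b{}^a`. -/
def divMixed (g : (ι → ℝ) → Matrix ι ι ℂ) (T : ι → ι → (ι → ℝ) → ℂ) (b : ι) :
    (ι → ℝ) → ℂ := fun x =>
  ∑ a, (pd a (T b a) x - ∑ e, christoffel g a b e x * T e a x
    + ∑ e, christoffel g a e a x * T b e x)

/-- `H_{abc}[A] = ∇_{(a} A_{b)c} - ½ ∇_c A_{ab}`. -/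
def linH (g : (ι → ℝ) → Matrix ι ι ℂ) (A : ι → ι → (ι → ℝ) → ℂ) (a b c : ι) :
    (ι → ℝ) → ℂ := fun x =>
  (1 / 2) * (cov2 g A a b c x + cov2 g A b a c x) - (1 / 2) * cov2 g A c a b x

/-- `∇_a H_d{}^{bc}[A]`, the last two indices raised with `g`. -/
def covHUp (g : (ι → ℝ) → Matrix ι ι ℂ) (A : ι → ι → (ι → ℝ) → ℂ) (a d b c : ι) :
    (ι → ℝ) → ℂ := fun x =>
  ∑ e, ∑ f, (g x)⁻¹ b e * (g x)⁻¹ c f * cov3 g (linH g A) a d e f x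

/-- `Σ_a{}^b[A] = -2 ∇_{[a} H_{d]}{}^{bd}[A] - A^{cb} R_{ac}`. -/
def linSigma (g : (ι → ℝ) → Matrix ι ι ℂ) (A : ι → ι → (ι → ℝ) → ℂ) (a b : ι) :
    (ι → ℝ) → ℂ := fun x =>
  -(∑ d, (covHUp g A a d b d x - covHUp g A d a b d x))
    - ∑ c, (∑ e, ∑ f, (g x)⁻¹ c e * (g x)⁻¹ b f * A e f x) * ricci g a c x

/-- The linearized Einstein tensor `𝒢_a{}^b[A] = Σ_a{}^b[A] - ½ δ_a{}^b Σ_c{}^c[A]`. -/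
def linEinstein (g : (ι → ℝ) → Matrix ι ι ℂ) (A : ι → ι → (ι → ℝ) → ℂ) (a b : ι) :
    (ι → ℝ) → ℂ := fun x =>
  linSigma g A a b x - (1 / 2) * (if a = b then 1 else 0) * ∑ c, linSigma g A c c x

end Tensor

/-! ### The Schwarzschild background in its 2+2 form -/

/-- Coordinates `(t, r)`, or `(θ, φ)`. -/
abbrev Plane : Type := Fin 2 → ℝ

/-- Coordinates `(t, r, θ, φ)`: `Sum.inl` labels `(t, r)` and `Sum.inr` labels `(θ, φ)`. -/
abbrev Pt : Type := Fin 2 ⊕ Fin 2 → ℝ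

/-- The `(t, r)` part of a point. -/
def base (x : Pt) : Plane := fun A => x (Sum.inl A)

/-- The `(θ, φ)` part of a point. -/
def sph (x : Pt) : Plane := fun p => x (Sum.inr p)

/-- The area radius `r`. -/
def rad (q : Plane) : ℂ := (q 1 : ℂ)

/-- `f = 1 - 2M/r`. -/
def lapse (M : ℝ) (q : Plane) : ℂ := 1 - 2 * (M : ℂ) / rad q

/-- `y_{AB}`: the metric `-f dt² + f⁻¹ dr²`. -/
def yMet (M : ℝ) (q : Plane) : Matrix (Fin 2) (Fin 2) ℂ :=
  Matrix.diagonal ![-lapse M q, (lapse M q)⁻¹]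

/-- `γ_{pq}`: the unit sphere metric `dθ² + sin²θ dφ²`. -/
def gam (s : Plane) : Matrix (Fin 2) (Fin 2) ℂ :=
  Matrix.diagonal ![1, ((Real.sin (s 0) ^ 2 : ℝ) : ℂ)]

/-- The Schwarzschild metric `y_{ab} + r² γ_{ab}`. -/
def gMet (M : ℝ) (x : Pt) : Matrix (Fin 2 ⊕ Fin 2) (Fin 2 ⊕ Fin 2) ℂ :=
  Matrix.fromBlocks (yMet M (base x)) 0 0 (rad (base x) ^ 2 • gam (sph x))

/-- The part of the coordinate domain over `Ω`, poles removed. -/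
def chart (Ω : Set Plane) : Set Pt :=
  {x | base x ∈ Ω ∧ 0 < x (Sum.inr 0) ∧ x (Sum.inr 0) < Real.pi}

/-! ### Harmonics -/

/-- A pair `(l, m)` with `|m| ≤ l`. -/
@[ext]
structure Mode where
  l : ℕ
  m : ℤ
  abs_le : |m| ≤ (l : ℤ)

/-- `l (l + 1)` as a complex number. -/
def Mode.ev (k : Mode) : ℂ := (k.l : ℂ) * ((k.l : ℂ) + 1)

/-- `(l - 1) (l + 2)` as a complex number. -/
def Mode.ev' (k : Mode) : ℂ := ((k.l : ℂ) - 1) * ((k.l : ℂ) + 2)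

/-- `d^k P_l / dz^k` at `z`, by Rodrigues' formula. -/
def legendreDeriv (l k : ℕ) (z : ℝ) : ℝ :=
  ((Polynomial.derivative^[l + k] ((Polynomial.X ^ 2 - 1 : Polynomial ℝ) ^ l)).eval z)
    / (2 ^ l * (l.factorial : ℝ))

/-- The normalized spherical harmonic
`Y_{lm} = √((2l+1)(l-m)! / (4π (l+m)!)) P_l^m(cos θ) e^{imφ}`, where
`P_l^m(cos θ) = sin^m θ P_l^{(m)}(cos θ)` for `m ≥ 0` and
`P_l^{-m} = (-1)^m (l-m)!/(l+m)! P_l^m`. -/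
def sphericalY (k : Mode) (s : Plane) : ℂ :=
  (if k.m < 0 then (-1) ^ k.m.natAbs else 1)
    * ((Real.sqrt ((2 * k.l + 1) * ((k.l - k.m.natAbs).factorial : ℝ)
        / (4 * Real.pi * ((k.l + k.m.natAbs).factorial : ℝ)))
      * Real.sin (s 0) ^ k.m.natAbs
      * legendreDeriv k.l k.m.natAbs (Real.cos (s 0)) : ℝ) : ℂ)
    * Complex.exp (Complex.I * (k.m : ℂ) * ((s 1 : ℝ) : ℂ))

/-- The `l = 0` mode function, in the kernel of the Laplacian `Δ` of the sphere. -/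
def kernelZero (δ : ℝ) (s : Plane) : ℂ :=
  ((1 + δ * Real.log (Real.sqrt ((1 - Real.cos (s 0)) / (1 + Real.cos (s 0)))) : ℝ) : ℂ)

/-- The `l = 1` mode functions, in the kernel of `Δ + 2`; `m ∈ {-1, 0, 1}`. -/
def kernelOne (δ : ℝ) (m : ℤ) (s : Plane) : ℂ :=
  if m = 0 then
    ((Real.cos (s 0) + δ * ((1 / 2) * Real.cos (s 0)
      * Real.log ((1 + Real.cos (s 0)) / (1 - Real.cos (s 0))) - 1) : ℝ) : ℂ)
  else
    ((Real.sin (s 0) + δ * ((1 / 2) * Real.sin (s 0)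
      * Real.log ((1 + Real.cos (s 0)) / (1 - Real.cos (s 0))) + Real.cot (s 0)) : ℝ) : ℂ)
      * Complex.exp (Complex.I * (m : ℂ) * ((s 1 : ℝ) : ℂ))

/-- The scalar harmonics `S_δ`. -/
def harm (δ : ℝ) (k : Mode) : Plane → ℂ :=
  if k.l = 0 then kernelZero δ else if k.l = 1 then kernelOne δ k.m else sphericalY k

/-- `ε_{pq}` of the unit sphere, `ε_{θφ} = sin θ`. -/
def epsDn (p q : Fin 2) (s : Plane) : ℂ :=
  !![0, ((Real.sin (s 0) : ℝ) : ℂ); -((Real.sin (s 0) : ℝ) : ℂ), 0] p q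

/-- `ε^{pq}`. -/
def epsUp (p q : Fin 2) (s : Plane) : ℂ :=
  ∑ u, ∑ v, (gam s)⁻¹ p u * (gam s)⁻¹ q v * epsDn u v s

/-- `D_p S`. -/
def gradDn (S : Plane → ℂ) (p : Fin 2) : Plane → ℂ := pd p S

/-- `D^p S`. -/
def gradUp (S : Plane → ℂ) (p : Fin 2) (s : Plane) : ℂ := ∑ q, (gam s)⁻¹ p q * gradDn S q s

/-- `ε_{pq} D^q S`. -/
def curlDn (S : Plane → ℂ) (p : Fin 2) (s : Plane) : ℂ := ∑ q, epsDn p q s * gradUp S q s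

/-- `ε^{pq} D_q S`. -/
def curlUp (S : Plane → ℂ) (p : Fin 2) (s : Plane) : ℂ := ∑ q, epsUp p q s * gradDn S q s

/-- `D_p D_q S`. -/
def hessDn (S : Plane → ℂ) (p q : Fin 2) : Plane → ℂ := cov1 gam (gradDn S) p q

/-- `D_p D^q S`. -/
def hessMix (S : Plane → ℂ) (p q : Fin 2) (s : Plane) : ℂ :=
  ∑ u, (gam s)⁻¹ q u * hessDn S p u s

/-- `D^p D^q S`. -/
def hessUp (S : Plane → ℂ) (p q : Fin 2) (s : Plane) : ℂ :=
  ∑ u, (gam s)⁻¹ p u * hessMix S u q s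

/-- `γ_p{}^q`. -/
def kron (p q : Fin 2) : ℂ := if p = q then 1 else 0

/-- `D_p D^q S - ½ γ_p{}^q D_s D^s S`. -/
def evenMix (S : Plane → ℂ) (p q : Fin 2) (s : Plane) : ℂ :=
  hessMix S p q s - (1 / 2) * kron p q * ∑ u, hessMix S u u s

/-- `ε^{sq} D_p D_s S + ε_{sp} D^q D^s S`. -/
def oddMix (S : Plane → ℂ) (p q : Fin 2) (s : Plane) : ℂ :=
  (∑ u, epsUp u q s * hessDn S p u s) + ∑ u, epsDn u p s * hessUp S q u s

/-! ### Calculus on the orbit space `(t, r)` -/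

/-- The contraction `y^{AB} t_{AB}` at `q`. -/
def ctr (M : ℝ) (q : Plane) (t : Fin 2 → Fin 2 → ℂ) : ℂ :=
  ∑ A, ∑ B, (yMet M q)⁻¹ A B * t A B

/-- The raised covector `y^{AB} v_B` at `q`. -/
def raise (M : ℝ) (q : Plane) (v : Fin 2 → ℂ) (A : Fin 2) : ℂ :=
  ∑ B, (yMet M q)⁻¹ A B * v B

/-- `D_A r`. -/
def dr (A : Fin 2) : Plane → ℂ := pd A rad

/-- `D_A u` for a function `u` on the orbit space. -/
def D0 (u : Plane → ℂ) (A : Fin 2) : Plane → ℂ := pd A u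

/-- `D_A D_B u`. -/
def DD0 (M : ℝ) (u : Plane → ℂ) (A B : Fin 2) : Plane → ℂ := cov1 (yMet M) (D0 u) A B

/-- `D_A v_B`. -/
def D1 (M : ℝ) (v : Fin 2 → Plane → ℂ) (A B : Fin 2) : Plane → ℂ := cov1 (yMet M) v A B

/-- `D_A D_B v_C`. -/
def DD1 (M : ℝ) (v : Fin 2 → Plane → ℂ) (A B C : Fin 2) : Plane → ℂ :=
  cov2 (yMet M) (D1 M v) A B C

/-- `D_A w_{BC}`. -/
def D2 (M : ℝ) (w : Fin 2 → Fin 2 → Plane → ℂ) (A B C : Fin 2) : Plane → ℂ :=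
  cov2 (yMet M) w A B C

/-- `D_A D_B w_{CD}`. -/
def DD2 (M : ℝ) (w : Fin 2 → Fin 2 → Plane → ℂ) (A B C D : Fin 2) : Plane → ℂ :=
  cov3 (yMet M) (D2 M w) A B C D

/-- `D^A v_A`. -/
def div1 (M : ℝ) (v : Fin 2 → Plane → ℂ) (q : Plane) : ℂ := ctr M q fun A B => D1 M v A B q

/-- `D^B w_{AB}`. -/
def div2 (M : ℝ) (w : Fin 2 → Fin 2 → Plane → ℂ) (A : Fin 2) (q : Plane) : ℂ :=
  ctr M q fun D E => D2 M w D A E q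

/-- `w_C{}^C`. -/
def trace2 (M : ℝ) (w : Fin 2 → Fin 2 → Plane → ℂ) (q : Plane) : ℂ :=
  ctr M q fun A B => w A B q

/-- `(D^A r)(D_A r)`. -/
def drSq (M : ℝ) (q : Plane) : ℂ := ctr M q fun A B => dr A q * dr B q

/-! ### Mode coefficients -/

/-- Mode coefficients of a metric perturbation: all components have lower indices, and
`h_{AB} = ∑ hAB S`, `h_{Ap} = r ∑ (he1 D_p S + ho1 ε_{pq} D^q S)`,
`h_{pq} = r² ∑ (½ γ_{pq} he0 S + he2 (D_p D_q - ½ γ_{pq} Δ) S + 2 ho2 ε_{r(p} D_{q)} D^r S)`. -/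
structure MetricModes where
  hAB : Mode → Fin 2 → Fin 2 → Plane → ℂ
  he1 : Mode → Fin 2 → Plane → ℂ
  ho1 : Mode → Fin 2 → Plane → ℂ
  he0 : Mode → Plane → ℂ
  he2 : Mode → Plane → ℂ
  ho2 : Mode → Plane → ℂ

/-- The gauge-invariant mode variables `F_{AB}`, `F_A`, `F` (with tildes). -/
structure InvModes where
  FAB : Mode → Fin 2 → Fin 2 → Plane → ℂ
  FA : Mode → Fin 2 → Plane → ℂ
  F : Mode → Plane → ℂ

/-- `Y_A = r he1_A - ½ r² D_A he2`. -/
def MetricModes.Y (h : MetricModes) (k : Mode) (A : Fin 2) (q : Plane) : ℂ :=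
  rad q * h.he1 k A q - rad q ^ 2 / 2 * D0 (h.he2 k) A q

/-- The gauge-invariant variables of a metric perturbation. -/
def MetricModes.inv (M : ℝ) (h : MetricModes) : InvModes where
  FAB k A B q := h.hAB k A B q - (D1 M (h.Y k) A B q + D1 M (h.Y k) B A q)
  FA k A q := h.ho1 k A q + rad q * D0 (h.ho2 k) A q
  F k q := h.he0 k q - 4 / rad q * (ctr M q fun A B => h.Y k A q * dr B q) + k.ev * h.he2 k q

/-- Mode coefficients of the linearized energy-momentum tensor, with lower indices. -/
structure MatterModes where
  TAB : Mode → Fin 2 → Fin 2 → Plane → ℂ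
  Te1 : Mode → Fin 2 → Plane → ℂ
  To1 : Mode → Fin 2 → Plane → ℂ
  Te0 : Mode → Plane → ℂ
  Te2 : Mode → Plane → ℂ
  To2 : Mode → Plane → ℂ

/-- The coefficients `c` are smooth on `Ω`, and `∑ c_{lm}(t,r) Y_{lm}(θ,φ)` over `l ≥ 2`
converges rapidly: normally on compact sets, poles included, together with all its partial
derivatives and with any power of `l + 1` as a weight. -/
def SmoothModes (Ω : Set Plane) (c : Mode → Plane → ℂ) : Prop :=
  (∀ k, ContDiffOn ℝ ∞ (c k) Ω) ∧
  ∀ n N : ℕ, ∀ K : Set Pt, IsCompact K → (∀ x ∈ K, base x ∈ Ω) →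
    ∃ u : Mode → ℝ, Summable u ∧ ∀ k : Mode, 2 ≤ k.l → ∀ x ∈ K,
      ((k.l : ℝ) + 1) ^ N
        * ‖iteratedFDeriv ℝ n (fun z : Pt => c k (base z) * sphericalY k (sph z)) x‖ ≤ u k

/-- All coefficient families are smooth, and `F_{AB}` is symmetric. -/
structure InvModes.Smooth (Ω : Set Plane) (F : InvModes) : Prop where
  symm : ∀ k A B, F.FAB k A B = F.FAB k B A
  FAB : ∀ A B, SmoothModes Ω fun k => F.FAB k A B
  FA : ∀ A, SmoothModes Ω fun k => F.FA k A
  F : SmoothModes Ω F.F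

/-- All coefficient families are smooth, and `T_{AB}` is symmetric. -/
structure MatterModes.Smooth (Ω : Set Plane) (T : MatterModes) : Prop where
  symm : ∀ k A B, T.TAB k A B = T.TAB k B A
  TAB : ∀ A B, SmoothModes Ω fun k => T.TAB k A B
  Te1 : ∀ A, SmoothModes Ω fun k => T.Te1 k A
  To1 : ∀ A, SmoothModes Ω fun k => T.To1 k A
  Te0 : SmoothModes Ω T.Te0
  Te2 : SmoothModes Ω T.Te2
  To2 : SmoothModes Ω T.To2

/-- The gauge-invariant metric perturbation:
`F_{AB} = ∑ FAB S`, `F_{Ap} = r ∑ FA ε_{pq} D^q S`, `F_{pq} = ½ γ_{pq} r² ∑ F S`. -/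
def calF (δ : ℝ) (F : InvModes) (a b : Fin 2 ⊕ Fin 2) (x : Pt) : ℂ :=
  match a, b with
  | Sum.inl A, Sum.inl B => ∑' k, F.FAB k A B (base x) * harm δ k (sph x)
  | Sum.inl A, Sum.inr p => rad (base x) * ∑' k, F.FA k A (base x) * curlDn (harm δ k) p (sph x)
  | Sum.inr p, Sum.inl A => rad (base x) * ∑' k, F.FA k A (base x) * curlDn (harm δ k) p (sph x)
  | Sum.inr p, Sum.inr q => (1 / 2) * gam (sph x) p q * rad (base x) ^ 2
      * ∑' k, F.F k (base x) * harm δ k (sph x)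

/-- The linearized energy-momentum tensor; `calT M δ T a b` is `T_a{}^b`. -/
def calT (M δ : ℝ) (T : MatterModes) (a b : Fin 2 ⊕ Fin 2) (x : Pt) : ℂ :=
  match a, b with
  | Sum.inl A, Sum.inl B =>
      ∑' k, raise M (base x) (fun E => T.TAB k A E (base x)) B * harm δ k (sph x)
  | Sum.inl A, Sum.inr q => 1 / rad (base x) *
      ∑' k, (T.Te1 k A (base x) * gradUp (harm δ k) q (sph x)
        + T.To1 k A (base x) * curlUp (harm δ k) q (sph x))
  | Sum.inr p, Sum.inl B => rad (base x) *
      ∑' k, (raise M (base x) (fun E => T.Te1 k E (base x)) B * gradDn (harm δ k) p (sph x)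
        + raise M (base x) (fun E => T.To1 k E (base x)) B * curlDn (harm δ k) p (sph x))
  | Sum.inr p, Sum.inr q =>
      ∑' k, (T.Te0 k (base x) * ((1 / 2) * kron p q * harm δ k (sph x))
        + T.Te2 k (base x) * evenMix (harm δ k) p q (sph x)
        + T.To2 k (base x) * oddMix (harm δ k) p q (sph x))

/-- The linearized Einstein equation `𝒢_a{}^b = 8π T_a{}^b` over `Ω`. -/
def EinsteinEq (M δ : ℝ) (Ω : Set Plane) (F : InvModes) (T : MatterModes) : Prop :=
  ∀ x ∈ chart Ω, ∀ a b,
    linEinstein (gMet M) (calF δ F) a b x = 8 * (Real.pi : ℂ) * calT M δ T a b x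

/-- The linearized continuity equation `∇_a T_b{}^a = 0` over `Ω`. -/
def ContinuityEq (M δ : ℝ) (Ω : Set Plane) (T : MatterModes) : Prop :=
  ∀ x ∈ chart Ω, ∀ b, divMixed (gMet M) (calT M δ T) b x = 0

/-! ### Mode components of the linearized Einstein tensor -/

/-- First bracket of `𝒢_A{}^B`, with `B` lowered:
`(-D_D D^D + l(l+1)/r² - (2/r)(D_D r) D^D) F_{AB} + (D_D D_A + (2/r)(D_D r) D_A) F_B{}^D`
`+ (D^D D_B + (2/r)(D^D r) D_B) F_{AD} - D_A D_B F_D{}^D`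
`- (D_A D_B + (1/r)(D_A r) D_B + (1/r)(D_B r) D_A) F`. -/
def gABfirst (M : ℝ) (F : InvModes) (k : Mode) (A B : Fin 2) (q : Plane) : ℂ :=
  - (ctr M q fun D E => DD2 M (F.FAB k) D E A B q)
    + k.ev / rad q ^ 2 * F.FAB k A B q
    - 2 / rad q * (ctr M q fun D E => dr D q * D2 M (F.FAB k) E A B q)
    + (ctr M q fun D E => DD2 M (F.FAB k) D A B E q
        + 2 / rad q * dr D q * D2 M (F.FAB k) A B E q)
    + (ctr M q fun D E => DD2 M (F.FAB k) D B A E q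
        + 2 / rad q * dr D q * D2 M (F.FAB k) B A E q)
    - DD0 M (trace2 M (F.FAB k)) A B q
    - (DD0 M (F.F k) A B q + 1 / rad q * dr A q * D0 (F.F k) B q
        + 1 / rad q * dr B q * D0 (F.F k) A q)

/-- Second bracket of `𝒢_A{}^B`, the factor of `½ δ_A{}^B`:
`(D_E D^E - (l(l+1)+1)/r² + (2/r)(D_E r) D^E + (1/r²)(D^E r)(D_E r)) F_D{}^D`
`- (D_D D_E + (4/r)(D_D r) D_E + (2/r²)(D_E r)(D_D r)) F^{ED}`
`+ (D_D D^D - (l(l+1)-2)/(2r²) + (3/r)(D^D r) D_D) F`. -/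
def gABsecond (M : ℝ) (F : InvModes) (k : Mode) (q : Plane) : ℂ :=
  (ctr M q fun D E => DD0 M (trace2 M (F.FAB k)) D E q)
    - (k.ev + 1) / rad q ^ 2 * trace2 M (F.FAB k) q
    + 2 / rad q * (ctr M q fun D E => dr D q * D0 (trace2 M (F.FAB k)) E q)
    + 1 / rad q ^ 2 * drSq M q * trace2 M (F.FAB k) q
    - (ctr M q fun D D' => ctr M q fun E E' =>
        DD2 M (F.FAB k) D E E' D' q + 4 / rad q * dr D q * D2 M (F.FAB k) E E' D' q
          + 2 / rad q ^ 2 * dr E q * dr D q * F.FAB k E' D' q)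
    + (ctr M q fun D E => DD0 M (F.F k) D E q)
    - (k.ev - 2) / (2 * rad q ^ 2) * F.F k q
    + 3 / rad q * (ctr M q fun D E => dr D q * D0 (F.F k) E q)

/-- Even bracket of `𝒢_A{}^q` and `𝒢_p{}^A`:
`(-D_A + (1/r) D_A r) F_D{}^D + D^D F_{AD} - ½ D_A F`. -/
def gEven (M : ℝ) (F : InvModes) (k : Mode) (A : Fin 2) (q : Plane) : ℂ :=
  - D0 (trace2 M (F.FAB k)) A q + 1 / rad q * dr A q * trace2 M (F.FAB k) q
    + div2 M (F.FAB k) A q - (1 / 2) * D0 (F.F k) A q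

/-- Odd bracket of `𝒢_A{}^q` and `𝒢_p{}^A`:
`(-D^D D_D + l(l+1)/r² - (2/r)(D^D r) D_D + (3/(2r²)){(D^D r)(D_D r) - 1}) F_A`
`+ (D^D D_A + (3/r)(D^D r) D_A - (1/r)(D_A r) D^D - (2/r²)(D_A r)(D^D r)) F_D`. -/
def gOdd (M : ℝ) (F : InvModes) (k : Mode) (A : Fin 2) (q : Plane) : ℂ :=
  - (ctr M q fun D E => DD1 M (F.FA k) D E A q)
    + k.ev / rad q ^ 2 * F.FA k A q
    - 2 / rad q * (ctr M q fun D E => dr D q * D1 M (F.FA k) E A q)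
    + 3 / (2 * rad q ^ 2) * (drSq M q - 1) * F.FA k A q
    + (ctr M q fun D E => DD1 M (F.FA k) D A E q
        + 3 / rad q * dr D q * D1 M (F.FA k) A E q
        - 1 / rad q * dr A q * D1 M (F.FA k) D E q
        - 2 / rad q ^ 2 * dr A q * dr D q * F.FA k E q)

/-- Bracket of the trace part of `𝒢_p{}^q`:
`(1/(2r²)) D_D(r² D^D F) - (1/r²) D_D(r² D_E F^{ED})`
`+ (D_E D^E + (1/r)(D_E r) D^E - l(l+1)/(2r²)) F_D{}^D`. -/
def gTrace (M : ℝ) (F : InvModes) (k : Mode) (q : Plane) : ℂ :=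
  1 / (2 * rad q ^ 2) * div1 M (fun A z => rad z ^ 2 * D0 (F.F k) A z) q
    - 1 / rad q ^ 2 * div1 M (fun A z => rad z ^ 2 * div2 M (F.FAB k) A z) q
    + (ctr M q fun D E => DD0 M (trace2 M (F.FAB k)) D E q)
    + 1 / rad q * (ctr M q fun D E => dr D q * D0 (trace2 M (F.FAB k)) E q)
    - k.ev / (2 * rad q ^ 2) * trace2 M (F.FAB k) q

/-- The covector `r F_A`. -/
def rFA (F : InvModes) (k : Mode) (A : Fin 2) (q : Plane) : ℂ := rad q * F.FA k A q

/-- The mode expansion of `𝒢_a{}^b` at the point `x`, in terms of the invariant variables. -/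
def EinsteinComponents (M δ : ℝ) (F : InvModes) (x : Pt) : Prop :=
  (∀ A B : Fin 2, HasSum (fun k =>
      (1 / 2) * raise M (base x) (fun E => gABfirst M F k A E (base x)) B * harm δ k (sph x)
        + (1 / 2) * kron A B * (gABsecond M F k (base x) * harm δ k (sph x)))
    (linEinstein (gMet M) (calF δ F) (Sum.inl A) (Sum.inl B) x)) ∧
  (∀ A q : Fin 2, HasSum (fun k =>
      1 / (2 * rad (base x) ^ 2) * (gEven M F k A (base x) * gradUp (harm δ k) q (sph x))
        + 1 / (2 * rad (base x)) * (gOdd M F k A (base x) * curlUp (harm δ k) q (sph x)))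
    (linEinstein (gMet M) (calF δ F) (Sum.inl A) (Sum.inr q) x)) ∧
  (∀ p B : Fin 2, HasSum (fun k =>
      (1 / 2) * (raise M (base x) (fun E => gEven M F k E (base x)) B
          * gradDn (harm δ k) p (sph x))
        + rad (base x) / 2 * (raise M (base x) (fun E => gOdd M F k E (base x)) B
          * curlDn (harm δ k) p (sph x)))
    (linEinstein (gMet M) (calF δ F) (Sum.inr p) (Sum.inl B) x)) ∧
  (∀ p q : Fin 2, HasSum (fun k =>
      gTrace M F k (base x) * ((1 / 2) * kron p q * harm δ k (sph x))
        + 1 / (2 * rad (base x) ^ 2)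
          * (- trace2 M (F.FAB k) (base x) * evenMix (harm δ k) p q (sph x)
            - div1 M (rFA F k) (base x) * oddMix (harm δ k) p q (sph x)))
    (linEinstein (gMet M) (calF δ F) (Sum.inr p) (Sum.inr q) x))

/-! ### Mode equations -/

/-- `D_D (r F^D) = -16π r² T_{(o2)}`. -/
def OddConstraint (M : ℝ) (F : InvModes) (T : MatterModes) (k : Mode) (q : Plane) : Prop :=
  div1 M (rFA F k) q = -16 * (Real.pi : ℂ) * rad q ^ 2 * T.To2 k q

/-- `-[D^D D_D - l(l+1)/r²](r F_A) - (2/r²)(D^D r)(D_A r)(r F_D) + (2/r)(D^D r) D_A(r F_D)`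
`= 16π r (T_{(o1)A} + r D_A T_{(o2)})`. -/
def OddEvolution (M : ℝ) (F : InvModes) (T : MatterModes) (k : Mode) (q : Plane) : Prop :=
  ∀ A : Fin 2,
    - ((ctr M q fun D E => DD1 M (rFA F k) D E A q) - k.ev / rad q ^ 2 * rFA F k A q)
      - 2 / rad q ^ 2 * (ctr M q fun D E => dr D q * dr A q * rFA F k E q)
      + 2 / rad q * (ctr M q fun D E => dr D q * D1 M (rFA F k) A E q)
    = 16 * (Real.pi : ℂ) * rad q * (T.To1 k A q + rad q * D0 (T.To2 k) A q)

/-- The trace-free part `𝔽_{AB} = F_{AB} - ½ y_{AB} F_C{}^C`. -/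
def FF (M : ℝ) (F : InvModes) (k : Mode) (A B : Fin 2) (q : Plane) : ℂ :=
  F.FAB k A B q - (1 / 2) * yMet M q A B * trace2 M (F.FAB k) q

/-- `F_D{}^D = -16π r² T_{(e2)}`. -/
def EvenTrace (M : ℝ) (F : InvModes) (T : MatterModes) (k : Mode) (q : Plane) : Prop :=
  trace2 M (F.FAB k) q = -16 * (Real.pi : ℂ) * rad q ^ 2 * T.Te2 k q

/-- `D^D 𝔽_{AD} - ½ D_A F = 16π (r T_{(e1)A} - ½ r² D_A T_{(e2)})`. -/
def EvenDivergence (M : ℝ) (F : InvModes) (T : MatterModes) (k : Mode) (q : Plane) : Prop :=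
  ∀ A : Fin 2, div2 M (FF M F k) A q - (1 / 2) * D0 (F.F k) A q
    = 16 * (Real.pi : ℂ) * (rad q * T.Te1 k A q - (1 / 2) * rad q ^ 2 * D0 (T.Te2 k) A q)

/-- `S_{(F)} = T_C{}^C + 4 (D_D r) T_{(e1)}^D - 2r (D_D r) D^D T_{(e2)} - (l(l+1)+2) T_{(e2)}`. -/
def sourceF (M : ℝ) (T : MatterModes) (k : Mode) (q : Plane) : ℂ :=
  trace2 M (T.TAB k) q + 4 * (ctr M q fun D E => dr D q * T.Te1 k E q)
    - 2 * rad q * (ctr M q fun D E => dr D q * D0 (T.Te2 k) E q) - (k.ev + 2) * T.Te2 k q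

/-- `(D_D D^D + (2/r)(D^D r) D_D - (l-1)(l+2)/r²) F - (4/r²)(D_C r)(D_D r) 𝔽^{CD}`
`= 16π S_{(F)}`. -/
def EvenScalar (M : ℝ) (F : InvModes) (T : MatterModes) (k : Mode) (q : Plane) : Prop :=
  (ctr M q fun D E => DD0 M (F.F k) D E q)
      + 2 / rad q * (ctr M q fun D E => dr D q * D0 (F.F k) E q)
      - k.ev' / rad q ^ 2 * F.F k q
      - 4 / rad q ^ 2 *
        (ctr M q fun C C' => ctr M q fun D D' => dr C q * dr D q * FF M F k C' D' q)
    = 16 * (Real.pi : ℂ) * sourceF M T k q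

/-- The covector `r T_{(e1)A}`. -/
def rTe1 (T : MatterModes) (k : Mode) (A : Fin 2) (q : Plane) : ℂ := rad q * T.Te1 k A q

/-- The function `r T_{(e2)}`. -/
def rTe2 (T : MatterModes) (k : Mode) (q : Plane) : ℂ := rad q * T.Te2 k q

/-- The source `S_{(𝔽)AB}`:
`T_{AB} - ½ y_{AB} T_C{}^C - 2 (D_{(A}(r T_{(e1)B)}) - ½ y_{AB} D^D(r T_{(e1)D}))`
`+ 2 ((D_{(A} r) D_{B)} - ½ y_{AB} (D^D r) D_D)(r T_{(e2)})`
`+ r (D_A D_B - ½ y_{AB} D^D D_D)(r T_{(e2)})`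
`+ 2 ((D_A r)(D_B r) - ½ y_{AB} (D^C r)(D_C r)) T_{(e2)}`
`+ 2 y_{AB} (D^C r) T_{(e1)C} - r y_{AB} (D^C r) D_C T_{(e2)}`. -/
def sourceFF (M : ℝ) (T : MatterModes) (k : Mode) (A B : Fin 2) (q : Plane) : ℂ :=
  T.TAB k A B q - (1 / 2) * yMet M q A B * trace2 M (T.TAB k) q
    - 2 * ((1 / 2) * (D1 M (rTe1 T k) A B q + D1 M (rTe1 T k) B A q)
      - (1 / 2) * yMet M q A B * div1 M (rTe1 T k) q)
    + 2 * ((1 / 2) * (dr A q * D0 (rTe2 T k) B q + dr B q * D0 (rTe2 T k) A q)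
      - (1 / 2) * yMet M q A B * (ctr M q fun D E => dr D q * D0 (rTe2 T k) E q))
    + rad q * (DD0 M (rTe2 T k) A B q
      - (1 / 2) * yMet M q A B * (ctr M q fun D E => DD0 M (rTe2 T k) D E q))
    + 2 * (dr A q * dr B q - (1 / 2) * yMet M q A B * drSq M q) * T.Te2 k q
    + 2 * yMet M q A B * (ctr M q fun C D => dr C q * T.Te1 k D q)
    - rad q * yMet M q A B * (ctr M q fun C D => dr C q * D0 (T.Te2 k) D q)

/-- `[-D_D D^D - (2/r)(D_D r) D^D + (4/r)(D^D D_D r) + l(l+1)/r²] 𝔽_{AB}`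
`+ (4/r)(D^D r) D_{(A} 𝔽_{B)D} - (2/r)(D_{(A} r) D_{B)} F = 16π S_{(𝔽)AB}`. -/
def EvenTensor (M : ℝ) (F : InvModes) (T : MatterModes) (k : Mode) (q : Plane) : Prop :=
  ∀ A B : Fin 2,
    - (ctr M q fun D E => DD2 M (FF M F k) D E A B q)
      - 2 / rad q * (ctr M q fun D E => dr D q * D2 M (FF M F k) E A B q)
      + 4 / rad q * (ctr M q fun D E => DD0 M rad D E q) * FF M F k A B q
      + k.ev / rad q ^ 2 * FF M F k A B q
      + 4 / rad q * (ctr M q fun D E => dr D q *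
          ((1 / 2) * (D2 M (FF M F k) A B E q + D2 M (FF M F k) B A E q)))
      - 2 / rad q * ((1 / 2) * (dr A q * D0 (F.F k) B q + dr B q * D0 (F.F k) A q))
    = 16 * (Real.pi : ℂ) * sourceFF M T k A B q

/-- `D^C T_C{}^B + (2/r)(D^D r) T_D{}^B - (1/r) l(l+1) T_{(e1)}^B - (1/r)(D^B r) T_{(e0)} = 0`,
with `B` lowered. -/
def ContinuityBase (M : ℝ) (T : MatterModes) (k : Mode) (q : Plane) : Prop :=
  ∀ B : Fin 2,
    (ctr M q fun C E => D2 M (T.TAB k) C E B q)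
      + 2 / rad q * (ctr M q fun D E => dr D q * T.TAB k E B q)
      - 1 / rad q * k.ev * T.Te1 k B q - 1 / rad q * dr B q * T.Te0 k q = 0

/-- `D^C T_{(e1)C} + (3/r)(D^C r) T_{(e1)C} + (1/(2r)) T_{(e0)} - ((l-1)(l+2)/(2r)) T_{(e2)} = 0`. -/
def ContinuityEven (M : ℝ) (T : MatterModes) (k : Mode) (q : Plane) : Prop :=
  div1 M (T.Te1 k) q + 3 / rad q * (ctr M q fun C D => dr C q * T.Te1 k D q)
    + 1 / (2 * rad q) * T.Te0 k q - 1 / (2 * rad q) * k.ev' * T.Te2 k q = 0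

/-- `D^C T_{(o1)C} + (3/r)(D^D r) T_{(o1)D} + (1/r)(l-1)(l+2) T_{(o2)} = 0`. -/
def ContinuityOdd (M : ℝ) (T : MatterModes) (k : Mode) (q : Plane) : Prop :=
  div1 M (T.To1 k) q + 3 / rad q * (ctr M q fun C D => dr C q * T.To1 k D q)
    + 1 / rad q * k.ev' * T.To2 k q = 0

/-- The odd-mode equations: the constraint and the evolution equation. -/
def OddEqs (M : ℝ) (F : InvModes) (T : MatterModes) (k : Mode) (q : Plane) : Prop :=
  OddConstraint M F T k q ∧ OddEvolution M F T k q

/-- The four even-mode equations. -/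
def EvenEqs (M : ℝ) (F : InvModes) (T : MatterModes) (k : Mode) (q : Plane) : Prop :=
  EvenTrace M F T k q ∧ EvenDivergence M F T k q ∧ EvenScalar M F T k q ∧ EvenTensor M F T k q

/-- The three mode components of the linearized continuity equation. -/
def ContinuityEqs (M : ℝ) (T : MatterModes) (k : Mode) (q : Plane) : Prop :=
  ContinuityBase M T k q ∧ ContinuityEven M T k q ∧ ContinuityOdd M T k q

end SchwarzschildModes

end

open SchwarzschildModes

/-! All operators in the statement are linear in the perturbation, and away from the poles
everything is smooth. The theorem therefore splits into algebra for one mode and analysis of series.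

Algebra. The smooth complex functions on the chart form a commutative ring with four commuting
derivations. In it the background consists of r, f, sin θ, their inverses, cot θ and n = (1 -
f)/(2r) = M/r², and the derivatives of these elements are polynomials in them (`Bg`). The mass
disappears, and the vacuum condition becomes f' = (1 - f)/r. A mode enters through coefficients that
do not depend on the angles and a function S with (Δ + ev) S = 0, which eliminates ∂_φ² S. The
tensors H, Σ, 𝒢 and the divergence of one mode are then finite computations (`lnH_modeR`,
`lnSigma_modeR`, `lnEinstein_modeR`, `dvm_matR`). Points separate ring elements, so each of them
reduces to an identity of rational expressions in values at a point. The covariant brackets of the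
statement are compared with the resulting coordinate coefficients in the same way (`gAB_base`,
`gEven_base`, `gOdd_base`, `gTrace_base`).

Sums. The scalar series ∑ c_k S_k converge normally with all derivatives on compact subsets of the
chart (`nc_modes`): for l ≥ 2 this is assumed, and only four other modes exist. Linear differential
operators therefore act term by term (`HS`), which gives part (1) and the mode series of the
divergence.

Mode equations. For one mode the Einstein equation says that the tuple `einC` of coefficients of 𝒢
equals 8π times the tuple `srcR` of the matter. Up to a nonzero factor, each odd or even equation
says that a fixed linear operator (the component e2 or o2, or `sDiv`, `sOdd`, `sScal` combined with
the trace, `sTens` combined with the trace-free part) takes the same value on both tuples. Equality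
of the tuples thus implies the equations. Conversely these operators determine every component
except e0, in triangular order (`src_eq_of_sources`). The component e0 is supplied by (b), which
`einC` satisfies identically by the linearized Bianchi identity (`cbR_einR`). The Bianchi identities
also yield (a), (b), (c) for the matter.

Extraction of modes. A vanishing scalar series has vanishing coefficients (`eq_zero_of_hs_harm`).
Applying Δ(Δ + 2) kills the modes l ≤ 1, which are singular at the poles for δ ≠ 0. What remains is
a rapidly convergent series of ordinary Y_lm, to which Fourier analysis in φ and Sturm-Liouville
orthogonality in θ apply. The modes l = 1 and l = 0 are then read off at single angles. For
covectors the divergence and the curl reduce to the scalar case with a factor l(l+1), and l = 0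
requires δ ≠ 0 so that S is not constant. For trace-free tensors the divergence gives a factor
(l-1)(l+2), and l = 1 requires δ ≠ 0 so that the trace-free Hessian of S does not vanish
(`eq_zero_of_hs_matC`). -/

noncomputable section

namespace SchwarzschildModes

set_option linter.unusedSectionVars false
set_option linter.unusedSimpArgs false

open TopologicalSpace Filter Topology

/-! ### The differential ring of smooth functions on an open set -/

section SmoothRing

variable {κ : Type} [Fintype κ] [DecidableEq κ]

/-- Extension by zero. -/
def zeroExt (V : Opens (κ → ℝ)) (f : V → ℂ) (x : κ → ℝ) : ℂ :=
  open Classical in if h : x ∈ V then f ⟨x, h⟩ else 0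

theorem zeroExt_of_mem (V : Opens (κ → ℝ)) (f : V → ℂ) {x : κ → ℝ} (hx : x ∈ V) :
    zeroExt V f x = f ⟨x, hx⟩ := by simp [zeroExt, hx]

/-- The algebra of smooth complex-valued functions on the open set `V`. -/
def smoothSubalgebra (V : Opens (κ → ℝ)) : Subalgebra ℂ (V → ℂ) where
  carrier := {f | ContDiffOn ℝ ∞ (zeroExt V f) V}
  mul_mem' {f g} hf hg := (ContDiffOn.mul hf hg).congr fun x hx => by
    change _ = zeroExt V f x * zeroExt V g x
    simp only [zeroExt_of_mem V _ hx, Pi.mul_apply]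
  add_mem' {f g} hf hg := (ContDiffOn.add hf hg).congr fun x hx => by
    change _ = zeroExt V f x + zeroExt V g x
    simp only [zeroExt_of_mem V _ hx, Pi.add_apply]
  algebraMap_mem' c := (contDiffOn_const (c := c)).congr fun x hx => by
    simp only [zeroExt_of_mem V _ hx]; rfl

/-- The ring of smooth complex-valued functions on the open set `V`. -/
def smoothRing (V : Opens (κ → ℝ)) : Type := smoothSubalgebra V

instance (V : Opens (κ → ℝ)) : CommRing (smoothRing V) :=
  inferInstanceAs (CommRing (smoothSubalgebra V))

instance (V : Opens (κ → ℝ)) : Algebra ℂ (smoothRing V) :=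
  inferInstanceAs (Algebra ℂ (smoothSubalgebra V))

variable {V : Opens (κ → ℝ)}

/-- The restriction to `V` of a function that is smooth on `V`. -/
def ofFun (V : Opens (κ → ℝ)) (F : (κ → ℝ) → ℂ) (hF : ContDiffOn ℝ ∞ F V) : smoothRing V :=
  ⟨fun x => F x, hF.congr fun x hx => by rw [zeroExt_of_mem V _ hx]⟩

theorem contDiffOn_pd {F : (κ → ℝ) → ℂ} (hF : ContDiffOn ℝ ∞ F V) (i : κ) :
    ContDiffOn ℝ ∞ (pd i F) V := by
  have h := (hF.fderiv_of_isOpen V.isOpen (m := ∞) (by simp)).clm_apply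
    (contDiffOn_const (c := (Pi.single i 1 : κ → ℝ)))
  exact h

theorem pd_congr {F G : (κ → ℝ) → ℂ} {x : κ → ℝ} (h : F =ᶠ[𝓝 x] G) (i : κ) :
    pd i F x = pd i G x := by
  rw [pd, pd, h.fderiv_eq]

theorem pd_congrOn {F G : (κ → ℝ) → ℂ} (h : ∀ x ∈ V, F x = G x) {x : κ → ℝ} (hx : x ∈ V) (i : κ) :
    pd i F x = pd i G x :=
  pd_congr (Filter.eventually_of_mem (V.isOpen.mem_nhds hx) h) i

theorem diffAt_zeroExt (f : smoothRing V) {x : κ → ℝ} (hx : x ∈ V) :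
    DifferentiableAt ℝ (zeroExt V f.1) x :=
  (f.2.contDiffAt (V.isOpen.mem_nhds hx)).differentiableAt (by simp)

/-- Partial derivatives as derivations of the ring of smooth functions. -/
def deriv (V : Opens (κ → ℝ)) (i : κ) : Derivation ℂ (smoothRing V) (smoothRing V) :=
  Derivation.mk'
    { toFun := fun f => ofFun V (pd i (zeroExt V f.1)) (contDiffOn_pd f.2 i)
      map_add' := fun f g => by
        refine Subtype.ext (funext fun x => ?_)
        change pd i (zeroExt V (f + g : smoothRing V).1) x
          = pd i (zeroExt V f.1) x + pd i (zeroExt V g.1) x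
        rw [pd_congrOn (G := zeroExt V f.1 + zeroExt V g.1) (V := V) (fun y hy => by
          simp only [Pi.add_apply, Pi.mul_apply, Pi.smul_apply, zeroExt_of_mem V _ hy]; rfl) x.2]
        simp only [pd]
        rw [fderiv_add (diffAt_zeroExt f x.2) (diffAt_zeroExt g x.2)]; rfl
      map_smul' := fun c f => by
        refine Subtype.ext (funext fun x => ?_)
        change pd i (zeroExt V (c • f : smoothRing V).1) x = c * pd i (zeroExt V f.1) x
        rw [pd_congrOn (G := c • zeroExt V f.1) (V := V) (fun y hy => by
          simp only [Pi.add_apply, Pi.mul_apply, Pi.smul_apply, zeroExt_of_mem V _ hy]; rfl) x.2]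
        simp only [pd]
        rw [fderiv_const_smul (diffAt_zeroExt f x.2)]; rfl }
    (fun f g => by
        refine Subtype.ext (funext fun x => ?_)
        change pd i (zeroExt V (f * g : smoothRing V).1) x
          = f.1 x * pd i (zeroExt V g.1) x + g.1 x * pd i (zeroExt V f.1) x
        rw [pd_congrOn (G := zeroExt V f.1 * zeroExt V g.1) (V := V) (fun y hy => by
          simp only [Pi.add_apply, Pi.mul_apply, Pi.smul_apply, zeroExt_of_mem V _ hy]; rfl) x.2]
        simp only [pd]
        rw [fderiv_mul (diffAt_zeroExt f x.2) (diffAt_zeroExt g x.2)]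
        simp [zeroExt_of_mem V _ x.2])

theorem deriv_apply (i : κ) (f : smoothRing V) (x : V) :
    (deriv V i f).1 x = pd i (zeroExt V f.1) x := rfl

theorem deriv_comm (i j : κ) (f : smoothRing V) :
    deriv V i (deriv V j f) = deriv V j (deriv V i f) := by
  have key : ∀ (i j : κ) (x : V), (deriv V i (deriv V j f)).1 x
      = fderiv ℝ (fderiv ℝ (zeroExt V f.1)) x (Pi.single i 1) (Pi.single j 1) := fun i j x => by
    rw [deriv_apply, pd_congrOn (G := pd j (zeroExt V f.1)) (V := V) (fun y hy => by
      rw [zeroExt_of_mem V _ hy, deriv_apply]) x.2]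
    have hd : DifferentiableAt ℝ (fderiv ℝ (zeroExt V f.1)) x :=
      ((f.2.fderiv_of_isOpen V.isOpen (m := ∞) (by simp)).contDiffAt
        (V.isOpen.mem_nhds x.2)).differentiableAt (by simp)
    change fderiv ℝ (fun y => fderiv ℝ (zeroExt V f.1) y (Pi.single j 1)) x _ = _
    rw [fderiv_clm_apply hd (by fun_prop)]
    simp
  refine Subtype.ext (funext fun x => ?_)
  rw [key, key]
  exact ((f.2.contDiffAt (V.isOpen.mem_nhds x.2)).isSymmSndFDerivAt
    (by simpa using WithTop.coe_le_coe.2 (le_top : (2 : ℕ∞) ≤ ⊤))).eq _ _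

/-- Evaluation at a point. -/
def evalAt (x : V) : smoothRing V →ₐ[ℂ] ℂ :=
  (Pi.evalAlgHom ℂ (fun _ : V => ℂ) x).comp (smoothSubalgebra V).val

theorem evalAt_apply (x : V) (f : smoothRing V) : evalAt x f = f.1 x := rfl

theorem evalAt_injective {f g : smoothRing V} (h : ∀ x : V, evalAt x f = evalAt x g) : f = g :=
  Subtype.ext (funext h)

/-! ### Functions of some of the coordinates as elements of the ring -/

variable {ι : Type} [Fintype ι] [DecidableEq ι]

/-- The coordinates labelled by `ι`. -/
def proj (j : ι → κ) (x : κ → ℝ) : ι → ℝ := fun i => x (j i)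

/-- `G`, as a function of the coordinates labelled by `ι`, restricts to `g`. -/
def Rep (j : ι → κ) (G : (ι → ℝ) → ℂ) (g : smoothRing V) : Prop :=
  ∀ x : V, G (proj j x) = evalAt x g

/-- Smoothness of `G` is not assumed: near the projection of x, `G` equals g composed with an affine
section of the projection through x, and the chain rule applies to that composite. Injectivity of
`j` makes the section exist. -/
theorem Rep.pd {j : ι → κ} (hj : Function.Injective j) {G : (ι → ℝ) → ℂ} {g : smoothRing V}
    (h : Rep j G g) (i : ι) : Rep j (pd i G) (deriv V (j i) g) := by
  intro x
  rw [evalAt_apply, deriv_apply]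
  let L : (ι → ℝ) →L[ℝ] (κ → ℝ) :=
    ∑ i, (ContinuousLinearMap.proj (R := ℝ) (φ := fun _ : ι => ℝ) i).smulRight
      (Pi.single (j i) (1 : ℝ))
  have hL : ∀ q, proj j (L q) = q := fun q => by
    funext i
    simp only [proj, L, _root_.sum_apply, ContinuousLinearMap.smulRight_apply,
      ContinuousLinearMap.proj_apply, Finset.sum_apply, Pi.smul_apply, smul_eq_mul]
    rw [Finset.sum_eq_single i]
    · simp
    · intro b _ hb
      rw [Pi.single_eq_of_ne (fun h => hb (hj h).symm), mul_zero]
    · simp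
  have hLi : L (Pi.single i 1) = Pi.single (j i) 1 := by
    simp only [L, _root_.sum_apply, ContinuousLinearMap.smulRight_apply,
      ContinuousLinearMap.proj_apply]
    rw [Finset.sum_eq_single i]
    · simp
    · intro b _ hb
      rw [Pi.single_eq_of_ne hb, zero_smul]
    · simp
  -- The affine section: it keeps the coordinates of x outside the range of `j` and passes through x
  -- itself.
  let σ : (ι → ℝ) → (κ → ℝ) := fun q => x + L (q - proj j x)
  have hσ0 : σ (proj j x) = x := by simp [σ]
  have hσ : HasFDerivAt σ L (proj j x) := by
    have := (HasFDerivAt.comp (g := L) (proj j x.1) L.hasFDerivAt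
      ((hasFDerivAt_id (proj j x.1)).sub_const (proj j x.1))).const_add (x : κ → ℝ)
    exact this
  have hσc : Continuous σ := by fun_prop
  have hev : G =ᶠ[𝓝 (proj j x)] fun q => zeroExt V g.1 (σ q) := by
    have : ∀ᶠ q in 𝓝 (proj j x.1), σ q ∈ V :=
      hσc.continuousAt.eventually_mem (V.isOpen.mem_nhds (by rw [hσ0]; exact x.2))
    filter_upwards [this] with q hq
    rw [zeroExt_of_mem V _ hq, ← evalAt_apply, ← h]
    congr 1
    have : proj j (σ q) = proj j x + proj j (L (q - proj j x)) := rfl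
    rw [this, hL]; abel
  rw [pd_congr hev]
  have hE : HasFDerivAt (zeroExt V g.1) (fderiv ℝ (zeroExt V g.1) x) (σ (proj j x)) := by
    rw [hσ0]; exact (diffAt_zeroExt g x.2).hasFDerivAt
  have := (hE.comp (proj j x.1) hσ).fderiv
  simp only [SchwarzschildModes.pd]
  change fderiv ℝ (zeroExt V g.1 ∘ σ) (proj j x) _ = _
  rw [this, ContinuousLinearMap.comp_apply, hLi]

section RepAlg

variable {j : ι → κ} {F G : (ι → ℝ) → ℂ} {f g : smoothRing V}

theorem Rep.congr (h : Rep j F f) (hFG : ∀ x : V, G (proj j x) = F (proj j x)) : Rep j G f :=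
  fun x => (hFG x).trans (h x)

theorem Rep.add (hF : Rep j F f) (hG : Rep j G g) : Rep j (fun q => F q + G q) (f + g) :=
  fun x => by rw [map_add, ← hF, ← hG]

theorem Rep.sub (hF : Rep j F f) (hG : Rep j G g) : Rep j (fun q => F q - G q) (f - g) :=
  fun x => by rw [map_sub, ← hF, ← hG]

theorem Rep.neg (hF : Rep j F f) : Rep j (fun q => - F q) (-f) :=
  fun x => by rw [map_neg, ← hF]

theorem Rep.mul (hF : Rep j F f) (hG : Rep j G g) : Rep j (fun q => F q * G q) (f * g) :=
  fun x => by rw [map_mul, ← hF, ← hG]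

theorem Rep.pow (hF : Rep j F f) (n : ℕ) : Rep j (fun q => F q ^ n) (f ^ n) :=
  fun x => by rw [map_pow, ← hF]

theorem Rep.const_mul (c : ℂ) (hF : Rep j F f) : Rep j (fun q => c * F q) (c • f) :=
  fun x => by rw [map_smul, ← hF, smul_eq_mul]

theorem Rep.zero : Rep j (fun _ => 0) (0 : smoothRing V) := fun x => by rw [map_zero]

theorem Rep.sum {α : Type} [Fintype α] {F : α → (ι → ℝ) → ℂ} {f : α → smoothRing V}
    (h : ∀ a, Rep j (F a) (f a)) : Rep j (fun q => ∑ a, F a q) (∑ a, f a) :=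
  fun x => by rw [map_sum]; exact Finset.sum_congr rfl fun a _ => h a x

end RepAlg

end SmoothRing

/-! ### Tensor calculus over a differential ring -/

section TensorAlg

variable {R : Type} [CommRing R] [Algebra ℂ R] {ι : Type} [Fintype ι]

/-- Christoffel symbols of a metric `g` with inverse `gi`. -/
def chr (d : ι → Derivation ℂ R R) (g gi : ι → ι → R) (a b c : ι) : R :=
  (1 / 2 : ℂ) • ∑ e, gi c e * (d a (g e b) + d b (g e a) - d e (g a b))

/-- The Ricci tensor. -/
def ric (d : ι → Derivation ℂ R R) (Γ : ι → ι → ι → R) (a c : ι) : R :=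
  ∑ b, (d b (Γ a c b) - d a (Γ b c b) + ∑ e, (Γ a c e * Γ e b b - Γ b c e * Γ e a b))

/-- `∇_a v_b`. -/
def cv1 (d : ι → Derivation ℂ R R) (Γ : ι → ι → ι → R) (v : ι → R) (a b : ι) : R :=
  d a (v b) - ∑ e, Γ a b e * v e

/-- `∇_a T_{bc}`. -/
def cv2 (d : ι → Derivation ℂ R R) (Γ : ι → ι → ι → R) (T : ι → ι → R) (a b c : ι) : R :=
  d a (T b c) - ∑ e, Γ a b e * T e c - ∑ e, Γ a c e * T b e

/-- `∇_a T_{bcd}`. -/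
def cv3 (d : ι → Derivation ℂ R R) (Γ : ι → ι → ι → R) (T : ι → ι → ι → R) (a b c f : ι) : R :=
  d a (T b c f) - ∑ e, Γ a b e * T e c f - ∑ e, Γ a c e * T b e f - ∑ e, Γ a f e * T b c e

/-- `∇_a T_b{}^a`. -/
def dvm (d : ι → Derivation ℂ R R) (Γ : ι → ι → ι → R) (T : ι → ι → R) (b : ι) : R :=
  ∑ a, (d a (T b a) - ∑ e, Γ a b e * T e a + ∑ e, Γ a e a * T b e)

/-- `∇_{(a} A_{b)c} - ½ ∇_c A_{ab}`. -/
def lnH (d : ι → Derivation ℂ R R) (Γ : ι → ι → ι → R) (A : ι → ι → R) (a b c : ι) : R :=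
  (1 / 2 : ℂ) • (cv2 d Γ A a b c + cv2 d Γ A b a c) - (1 / 2 : ℂ) • cv2 d Γ A c a b

/-- `-2 ∇_{[a} H_{d]}{}^{bd}[A]`. -/
def lnSigma (d : ι → Derivation ℂ R R) (Γ : ι → ι → ι → R) (gi A : ι → ι → R) (a b : ι) : R :=
  -(∑ c, ((∑ e, ∑ f, gi b e * gi c f * cv3 d Γ (lnH d Γ A) a c e f)
    - ∑ e, ∑ f, gi b e * gi c f * cv3 d Γ (lnH d Γ A) c a e f))

end TensorAlg

/-! ### Transfer between tensor fields in coordinates and tensors over the ring -/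

section RepTensor

variable {κ : Type} [Fintype κ] [DecidableEq κ] {V : Opens (κ → ℝ)}
  {ι : Type} [Fintype ι] [DecidableEq ι] {j : ι → κ}

theorem rep_christoffel (hj : Function.Injective j) {g : (ι → ℝ) → Matrix ι ι ℂ}
    {gR giR : ι → ι → smoothRing V}
    (hg : ∀ a b, Rep j (fun q => g q a b) (gR a b))
    (hgi : ∀ a b, Rep j (fun q => (g q)⁻¹ a b) (giR a b)) (a b c : ι) :
    Rep j (christoffel g a b c) (chr (fun i => deriv V (j i)) gR giR a b c) :=
  Rep.const_mul _ (Rep.sum fun e => (hgi c e).mul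
    ((((hg e b).pd hj a).add ((hg e a).pd hj b)).sub ((hg a b).pd hj e)))

variable {g : (ι → ℝ) → Matrix ι ι ℂ} {Γ : ι → ι → ι → smoothRing V}

theorem rep_ricci (hj : Function.Injective j)
    (hΓ : ∀ a b c, Rep j (christoffel g a b c) (Γ a b c)) (a c : ι) :
    Rep j (ricci g a c) (ric (fun i => deriv V (j i)) Γ a c) :=
  Rep.sum fun b => (((hΓ a c b).pd hj b).sub ((hΓ b c b).pd hj a)).add
    (Rep.sum fun e => ((hΓ a c e).mul (hΓ e b b)).sub ((hΓ b c e).mul (hΓ e a b)))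

theorem rep_cov1 (hj : Function.Injective j)
    (hΓ : ∀ a b c, Rep j (christoffel g a b c) (Γ a b c))
    {T : ι → (ι → ℝ) → ℂ} {t : ι → smoothRing V} (hT : ∀ a, Rep j (T a) (t a)) (a b : ι) :
    Rep j (cov1 g T a b) (cv1 (fun i => deriv V (j i)) Γ t a b) :=
  ((hT b).pd hj a).sub (Rep.sum fun e => (hΓ a b e).mul (hT e))

theorem rep_cov2 (hj : Function.Injective j)
    (hΓ : ∀ a b c, Rep j (christoffel g a b c) (Γ a b c))
    {T : ι → ι → (ι → ℝ) → ℂ} {t : ι → ι → smoothRing V} (hT : ∀ a b, Rep j (T a b) (t a b))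
    (a b c : ι) : Rep j (cov2 g T a b c) (cv2 (fun i => deriv V (j i)) Γ t a b c) :=
  (((hT b c).pd hj a).sub (Rep.sum fun e => (hΓ a b e).mul (hT e c))).sub
    (Rep.sum fun e => (hΓ a c e).mul (hT b e))

theorem rep_cov3 (hj : Function.Injective j)
    (hΓ : ∀ a b c, Rep j (christoffel g a b c) (Γ a b c))
    {T : ι → ι → ι → (ι → ℝ) → ℂ} {t : ι → ι → ι → smoothRing V}
    (hT : ∀ a b c, Rep j (T a b c) (t a b c))
    (a b c d : ι) : Rep j (cov3 g T a b c d) (cv3 (fun i => deriv V (j i)) Γ t a b c d) :=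
  ((((hT b c d).pd hj a).sub (Rep.sum fun e => (hΓ a b e).mul (hT e c d))).sub
    (Rep.sum fun e => (hΓ a c e).mul (hT b e d))).sub
    (Rep.sum fun e => (hΓ a d e).mul (hT b c e))

theorem rep_divMixed (hj : Function.Injective j)
    (hΓ : ∀ a b c, Rep j (christoffel g a b c) (Γ a b c))
    {T : ι → ι → (ι → ℝ) → ℂ} {t : ι → ι → smoothRing V} (hT : ∀ a b, Rep j (T a b) (t a b))
    (b : ι) : Rep j (divMixed g T b) (dvm (fun i => deriv V (j i)) Γ t b) :=
  Rep.sum fun a => (((hT b a).pd hj a).sub (Rep.sum fun e => (hΓ a b e).mul (hT e a))).add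
    (Rep.sum fun e => (hΓ a e a).mul (hT b e))

theorem rep_linH (hj : Function.Injective j)
    (hΓ : ∀ a b c, Rep j (christoffel g a b c) (Γ a b c))
    {T : ι → ι → (ι → ℝ) → ℂ} {t : ι → ι → smoothRing V} (hT : ∀ a b, Rep j (T a b) (t a b))
    (a b c : ι) : Rep j (linH g T a b c) (lnH (fun i => deriv V (j i)) Γ t a b c) :=
  (((rep_cov2 hj hΓ hT a b c).add (rep_cov2 hj hΓ hT b a c)).const_mul _).sub
    ((rep_cov2 hj hΓ hT c a b).const_mul _)

/-- On a Ricci-flat background the term A^{cb} R_{ac} drops out, so only the derivative part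
`lnSigma` has to be represented. -/
theorem rep_linSigma (hj : Function.Injective j) {giR : ι → ι → smoothRing V}
    (hgi : ∀ a b, Rep j (fun q => (g q)⁻¹ a b) (giR a b))
    (hΓ : ∀ a b c, Rep j (christoffel g a b c) (Γ a b c))
    (hric : ∀ a c, ric (fun i => deriv V (j i)) Γ a c = 0)
    {T : ι → ι → (ι → ℝ) → ℂ} {t : ι → ι → smoothRing V} (hT : ∀ a b, Rep j (T a b) (t a b))
    (a b : ι) : Rep j (linSigma g T a b) (lnSigma (fun i => deriv V (j i)) Γ giR t a b) := by
  have hup : ∀ a c b d, Rep j (covHUp g T a c b d) (∑ e, ∑ f, giR b e * giR d f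
      * cv3 (fun i => deriv V (j i)) Γ (lnH (fun i => deriv V (j i)) Γ t) a c e f) :=
    fun a c b d => Rep.sum fun e => Rep.sum fun f => ((hgi b e).mul (hgi d f)).mul
      (rep_cov3 hj hΓ (rep_linH hj hΓ hT) a c e f)
  refine Rep.congr (Rep.neg (Rep.sum fun c => (hup a c b c).sub (hup c a b c))) fun x => ?_
  simp only [SchwarzschildModes.linSigma, (rep_ricci hj hΓ a _) x, hric, map_zero, mul_zero, Finset.sum_const_zero, sub_zero]

end RepTensor

/-! ### The Schwarzschild background in a differential ring -/

section Background

variable {R : Type} [CommRing R] [Algebra ℂ R]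

/-- Elements `r`, `f`, `n = (1 - f) / (2 r)`, `s = sin θ`, `k = cot θ` and inverses of a differential ring that satisfy
the differential relations of the Schwarzschild background; the homomorphisms to `ℂ` separate
the elements of the ring. -/
structure Bg (d : Fin 2 ⊕ Fin 2 → Derivation ℂ R R) (r ri f fi n s si k : R) : Prop where
  sep : ∀ a b : R, (∀ φ : R →ₐ[ℂ] ℂ, φ a = φ b) → a = b
  comm : ∀ i j x, d i (d j x) = d j (d i x)
  hr : r * ri = 1
  hf : f * fi = 1
  hs : s * si = 1
  hn : n = (1 / 2 : ℂ) • ((1 - f) * ri)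
  r0 : d (.inl 0) r = 0
  r1 : d (.inl 1) r = 1
  r2 : ∀ p, d (.inr p) r = 0
  f0 : d (.inl 0) f = 0
  f1 : d (.inl 1) f = 2 * n
  f2 : ∀ p, d (.inr p) f = 0
  s0 : ∀ A, d (.inl A) s = 0
  s1 : d (.inr 0) s = s * k
  s2 : d (.inr 1) s = 0
  k0 : ∀ A, d (.inl A) k = 0
  k1 : d (.inr 0) k = -(1 + k * k)
  k2 : d (.inr 1) k = 0

section Rules

variable (D : Derivation ℂ R R) (φ : R →ₐ[ℂ] ℂ) (a b : R) (z : ℂ)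

theorem der_mul : D (a * b) = a * D b + b * D a := D.leibniz a b
theorem der_add : D (a + b) = D a + D b := map_add D a b
theorem der_sub : D (a - b) = D a - D b := map_sub D a b
theorem der_neg : D (-a) = -D a := map_neg D a
theorem der_smul : D (z • a) = z • D a := D.map_smul z a
theorem der_zero : D 0 = 0 := map_zero D
theorem der_one : D 1 = 0 := D.map_one_eq_zero
theorem der_ofNat (m : ℕ) [m.AtLeastTwo] : D (ofNat(m) : R) = 0 := D.map_natCast m
theorem ev_mul : φ (a * b) = φ a * φ b := map_mul φ a b
theorem ev_add : φ (a + b) = φ a + φ b := map_add φ a b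
theorem ev_sub : φ (a - b) = φ a - φ b := map_sub φ a b
theorem ev_neg : φ (-a) = -φ a := map_neg φ a
theorem ev_smul : φ (z • a) = z * φ a := map_smul φ z a
theorem ev_zero : φ 0 = 0 := map_zero φ
theorem ev_one : φ 1 = 1 := map_one φ
theorem ev_ofNat (m : ℕ) [m.AtLeastTwo] : φ (ofNat(m) : R) = ofNat(m) := map_ofNat φ m

end Rules

theorem deriv_inv (D : Derivation ℂ R R) {a b : R} (h : a * b = 1) : D b = -(b * b * D a) := by
  have h1 := congrArg D h
  simp only [Derivation.leibniz, smul_eq_mul, Derivation.map_one_eq_zero] at h1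
  linear_combination b * h1 - D b * h

namespace Bg

variable {d : Fin 2 ⊕ Fin 2 → Derivation ℂ R R} {r ri f fi n s si k : R}

theorem ri0 (hB : Bg d r ri f fi n s si k) : d (.inl 0) ri = 0 := by
  rw [deriv_inv _ hB.hr, hB.r0]; ring

theorem ri1 (hB : Bg d r ri f fi n s si k) : d (.inl 1) ri = -(ri * ri) := by
  rw [deriv_inv _ hB.hr, hB.r1]; ring

theorem ri2 (hB : Bg d r ri f fi n s si k) (p : Fin 2) : d (.inr p) ri = 0 := by
  rw [deriv_inv _ hB.hr, hB.r2]; ring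

theorem fi0 (hB : Bg d r ri f fi n s si k) : d (.inl 0) fi = 0 := by
  rw [deriv_inv _ hB.hf, hB.f0]; ring

theorem fi1 (hB : Bg d r ri f fi n s si k) : d (.inl 1) fi = -(fi * fi * (2 * n)) := by
  rw [deriv_inv _ hB.hf, hB.f1]

theorem fi2 (hB : Bg d r ri f fi n s si k) (p : Fin 2) : d (.inr p) fi = 0 := by
  rw [deriv_inv _ hB.hf, hB.f2]; ring

theorem n0 (hB : Bg d r ri f fi n s si k) : d (.inl 0) n = 0 := by
  simp only [hB.hn, Derivation.map_smul, Derivation.leibniz, map_sub, Derivation.map_one_eq_zero,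
    hB.f0, hB.ri0, smul_zero, sub_zero, add_zero]

/-- This closes the list of background relations: n is M/r², so its derivative is again a polynomial
in the background elements and the mass never has to be named. -/
theorem n1 (hB : Bg d r ri f fi n s si k) : d (.inl 1) n = -(2 * ri * n) := by
  have h : d (.inl 1) n = (1 / 2 : ℂ) • ((1 - f) * -(ri * ri) + ri * (0 - 2 * n)) := by
    conv_lhs => rw [hB.hn]
    simp only [Derivation.map_smul, Derivation.leibniz, map_sub, Derivation.map_one_eq_zero,
      hB.f1, hB.ri1, smul_eq_mul]
  rw [h]
  simp only [hB.hn, mul_smul_comm, smul_mul_assoc]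
  rw [← mul_smul_comm, ← smul_neg]
  apply hB.sep
  intro φ
  simp only [map_smul, map_add, map_mul, map_sub, map_neg, map_one, map_zero, map_ofNat, smul_eq_mul]
  ring

theorem n2 (hB : Bg d r ri f fi n s si k) (p : Fin 2) : d (.inr p) n = 0 := by
  simp only [hB.hn, Derivation.map_smul, Derivation.leibniz, map_sub, Derivation.map_one_eq_zero,
    hB.f2, hB.ri2, smul_zero, sub_zero, add_zero]

theorem si0 (hB : Bg d r ri f fi n s si k) (A : Fin 2) : d (.inl A) si = 0 := by
  rw [deriv_inv _ hB.hs, hB.s0]; ring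

theorem si1 (hB : Bg d r ri f fi n s si k) : d (.inr 0) si = -(si * k) := by
  rw [deriv_inv _ hB.hs, hB.s1]; linear_combination -(si * k) * hB.hs

theorem si2 (hB : Bg d r ri f fi n s si k) : d (.inr 1) si = 0 := by
  rw [deriv_inv _ hB.hs, hB.s2]; ring

end Bg

/-- The components `y_{AB}` or `y^{AB}`. -/
def yR (f fi : R) (A B : Fin 2) : R := !![-f, 0; 0, fi] A B

/-- The components `γ_{pq}` or `γ^{pq}`. -/
def gamR (s : R) (p q : Fin 2) : R := !![1, 0; 0, s * s] p q

/-- The components `g_{ab}` or `g^{ab}`. -/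
def gR (r f fi s : R) : Fin 2 ⊕ Fin 2 → Fin 2 ⊕ Fin 2 → R
  | .inl A, .inl B => yR f fi A B
  | .inr p, .inr q => r * r * gamR s p q
  | _, _ => 0

/-- The Christoffel symbols of `y`. -/
def chrY (f fi n : R) (A B C : Fin 2) : R :=
  ![!![0, f * n; fi * n, 0], !![fi * n, 0; 0, -(fi * n)]] A B C

/-- The Christoffel symbols of `γ`. -/
def chrS (s k : R) (p q u : Fin 2) : R :=
  ![!![0, 0; 0, k], !![0, k; -(s * s * k), 0]] p q u

/-- The Christoffel symbols of the Schwarzschild metric. -/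
def chrG (r ri f fi n s k : R) : Fin 2 ⊕ Fin 2 → Fin 2 ⊕ Fin 2 → Fin 2 ⊕ Fin 2 → R
  | .inl A, .inl B, .inl C => chrY f fi n A B C
  | .inl A, .inr p, .inr q => ![0, ri] A * !![1, 0; 0, 1] p q
  | .inr p, .inl A, .inr q => ![0, ri] A * !![1, 0; 0, 1] p q
  | .inr p, .inr q, .inl A => ![0, -(r * f)] A * gamR s p q
  | .inr p, .inr q, .inr u => chrS s k p q u
  | _, _, _ => 0

/-! ### Entries of the background tables -/

section Tables

variable (r ri f fi n s si k : R)

theorem yR_00 : yR f fi 0 0 = -f := rfl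
theorem yR_01 : yR f fi 0 1 = 0 := rfl
theorem yR_10 : yR f fi 1 0 = 0 := rfl
theorem yR_11 : yR f fi 1 1 = fi := rfl
theorem gamR_00 : gamR s 0 0 = 1 := rfl
theorem gamR_01 : gamR s 0 1 = 0 := rfl
theorem gamR_10 : gamR s 1 0 = 0 := rfl
theorem gamR_11 : gamR s 1 1 = s * s := rfl
theorem chrY_000 : chrY f fi n 0 0 0 = 0 := rfl
theorem chrY_001 : chrY f fi n 0 0 1 = f * n := rfl
theorem chrY_010 : chrY f fi n 0 1 0 = fi * n := rfl
theorem chrY_011 : chrY f fi n 0 1 1 = 0 := rfl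
theorem chrY_100 : chrY f fi n 1 0 0 = fi * n := rfl
theorem chrY_101 : chrY f fi n 1 0 1 = 0 := rfl
theorem chrY_110 : chrY f fi n 1 1 0 = 0 := rfl
theorem chrY_111 : chrY f fi n 1 1 1 = -(fi * n) := rfl
theorem chrS_000 : chrS s k 0 0 0 = 0 := rfl
theorem chrS_001 : chrS s k 0 0 1 = 0 := rfl
theorem chrS_010 : chrS s k 0 1 0 = 0 := rfl
theorem chrS_011 : chrS s k 0 1 1 = k := rfl
theorem chrS_100 : chrS s k 1 0 0 = 0 := rfl
theorem chrS_101 : chrS s k 1 0 1 = k := rfl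
theorem chrS_110 : chrS s k 1 1 0 = -(s * s * k) := rfl
theorem chrS_111 : chrS s k 1 1 1 = 0 := rfl

end Tables

variable {d : Fin 2 ⊕ Fin 2 → Derivation ℂ R R} {r ri f fi n s si k : R}

theorem Bg.eval_ri (hB : Bg d r ri f fi n s si k) (φ : R →ₐ[ℂ] ℂ) : φ ri = (φ r)⁻¹ :=
  eq_inv_of_mul_eq_one_right (by rw [← map_mul, hB.hr, map_one])

theorem Bg.eval_fi (hB : Bg d r ri f fi n s si k) (φ : R →ₐ[ℂ] ℂ) : φ fi = (φ f)⁻¹ :=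
  eq_inv_of_mul_eq_one_right (by rw [← map_mul, hB.hf, map_one])

theorem Bg.eval_si (hB : Bg d r ri f fi n s si k) (φ : R →ₐ[ℂ] ℂ) : φ si = (φ s)⁻¹ :=
  eq_inv_of_mul_eq_one_right (by rw [← map_mul, hB.hs, map_one])

theorem Bg.eval_n (hB : Bg d r ri f fi n s si k) (φ : R →ₐ[ℂ] ℂ) :
    φ n = 1 / 2 * ((1 - φ f) * (φ r)⁻¹) := by
  rw [hB.hn, map_smul, map_mul, map_sub, map_one, hB.eval_ri, smul_eq_mul]

theorem Bg.r_ne (hB : Bg d r ri f fi n s si k) (φ : R →ₐ[ℂ] ℂ) : φ r ≠ 0 :=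
  left_ne_zero_of_mul_eq_one (by rw [← map_mul, hB.hr, map_one])

theorem Bg.f_ne (hB : Bg d r ri f fi n s si k) (φ : R →ₐ[ℂ] ℂ) : φ f ≠ 0 :=
  left_ne_zero_of_mul_eq_one (by rw [← map_mul, hB.hf, map_one])

theorem Bg.s_ne (hB : Bg d r ri f fi n s si k) (φ : R →ₐ[ℂ] ℂ) : φ s ≠ 0 :=
  left_ne_zero_of_mul_eq_one (by rw [← map_mul, hB.hs, map_one])

/-- The pattern of all finite computations below: expand with the relations of `Bg`, pass to values
by `sep`, and finish in the field ℂ, where r, f and sin θ have nonzero values. -/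
theorem chr_y (hB : Bg d r ri f fi n s si k) : ∀ A B C : Fin 2,
    chr (fun A => d (.inl A)) (yR f fi) (yR fi f) A B C = chrY f fi n A B C := by
  simp only [Fin.forall_fin_two, chr, Fin.sum_univ_two, yR_00, yR_01, yR_10, yR_11, chrY_000, chrY_001,
    chrY_010, chrY_011, chrY_100, chrY_101, chrY_110, chrY_111, hB.f0, hB.f1, hB.fi0, hB.fi1,
    map_neg, map_zero, mul_zero, zero_mul, add_zero, zero_add, sub_zero, zero_sub, neg_zero,
    smul_zero, true_and, and_true]
  and_intros <;>
  · apply hB.sep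
    intro φ
    have h1 := hB.r_ne φ
    have h2 := hB.f_ne φ
    simp only [map_smul, map_mul, map_add, map_sub, map_neg, map_one, map_ofNat, smul_eq_mul, hB.eval_ri,
      hB.eval_fi]
    field_simp
    try ring

theorem chr_gam (hB : Bg d r ri f fi n s si k) : ∀ p q u : Fin 2,
    chr (fun p => d (.inr p)) (gamR s) (gamR si) p q u = chrS s k p q u := by
  simp only [Fin.forall_fin_two, chr, Fin.sum_univ_two, gamR_00, gamR_01, gamR_10, gamR_11,
    chrS_000, chrS_001,
    chrS_010, chrS_011, chrS_100, chrS_101, chrS_110, chrS_111, Derivation.leibniz, hB.s1, hB.s2,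
    map_neg, map_zero, mul_zero, zero_mul, add_zero, zero_add, sub_zero, zero_sub, neg_zero,
    smul_zero, true_and, and_true, Derivation.map_one_eq_zero, smul_eq_mul]
  and_intros <;>
  · apply hB.sep
    intro φ
    have h1 := hB.s_ne φ
    simp only [map_smul, map_mul, map_add, map_sub, map_neg, map_one, map_ofNat, smul_eq_mul, hB.eval_si]
    field_simp
    try ring

theorem chr_g (hB : Bg d r ri f fi n s si k) : ∀ a b c : Fin 2 ⊕ Fin 2,
    chr d (gR r f fi s) (gR ri fi f si) a b c = chrG r ri f fi n s k a b c := by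
  simp only [Sum.forall, Fin.forall_fin_two, chr, Fintype.sum_sum_type, Fin.sum_univ_two,
    gR, chrG,
    yR_00, yR_01, yR_10, yR_11, chrY_000, chrY_001,
    chrY_010, chrY_011, chrY_100, chrY_101, chrY_110, chrY_111,
    gamR_00, gamR_01, gamR_10, gamR_11,
    chrS_000, chrS_001,
    chrS_010, chrS_011, chrS_100, chrS_101, chrS_110, chrS_111, Derivation.leibniz, hB.s1, hB.s2,
    hB.s0, hB.f0, hB.f1, hB.f2, hB.fi0, hB.fi1, hB.fi2, hB.r0, hB.r1, hB.r2,
    map_neg, map_zero, mul_zero, zero_mul, add_zero, zero_add, sub_zero, zero_sub, neg_zero,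
    smul_zero, true_and, and_true, Derivation.map_one_eq_zero, smul_eq_mul, mul_one,
    Matrix.cons_val_zero, Matrix.cons_val_one, Matrix.of_apply]
  and_intros <;>
  · apply hB.sep
    intro φ
    have h1 := hB.r_ne φ
    have h2 := hB.f_ne φ
    have h3 := hB.s_ne φ
    simp only [map_smul, map_mul, map_add, map_sub, map_neg, map_one, map_ofNat, smul_eq_mul, hB.eval_si,
      hB.eval_ri, hB.eval_fi]
    field_simp
    try ring

end Background

/-! ### The linearized Einstein tensor of a single mode -/

section SingleMode

variable {R : Type} [CommRing R] [Algebra ℂ R]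

/-- For a torsion-free connection the terms with Γ_{ac} and Γ_{bc} cancel between the symmetrized
derivatives and ∇_c A_{ab}, while the two halves of the Γ_{ab} term add up. What is left is the
lowered perturbation of the Christoffel symbol. -/
theorem lnH_of_symm {ι : Type} [Fintype ι] (d : ι → Derivation ℂ R R) {Γ : ι → ι → ι → R}
    (hΓ : ∀ a b c, Γ a b c = Γ b a c) {A : ι → ι → R} (hA : ∀ a b, A a b = A b a) (a b c : ι) :
    lnH d Γ A a b c = (1 / 2 : ℂ) • (d a (A b c) + d b (A a c) - d c (A a b))
      - ∑ e, Γ a b e * A e c := by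
  have h1 : ∑ e, Γ c a e * A e b = ∑ e, Γ a c e * A b e :=
    Finset.sum_congr rfl fun e _ => by rw [hΓ, hA]
  have h2 : ∑ e, Γ c b e * A a e = ∑ e, Γ b c e * A a e :=
    Finset.sum_congr rfl fun e _ => by rw [hΓ]
  have h3 : ∑ e, Γ b a e * A e c = ∑ e, Γ a b e * A e c :=
    Finset.sum_congr rfl fun e _ => by rw [hΓ]
  simp only [lnH, cv2, h1, h2, h3]
  module

/-- A diagonal inverse metric collapses the two contractions to single terms. The connection term
that acts on the antisymmetrized pair of indices cancels because Γ is symmetric. -/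
theorem lnSigma_of_diag {ι : Type} [Fintype ι] [DecidableEq ι] (d : ι → Derivation ℂ R R)
    {Γ : ι → ι → ι → R} (hΓ : ∀ a b c, Γ a b c = Γ b a c) {gi : ι → ι → R}
    (hgi : ∀ a b, a ≠ b → gi a b = 0) (A : ι → ι → R) (a b : ι) :
    lnSigma d Γ gi A a b = -∑ c, gi b b * gi c c * (d a (lnH d Γ A c b c) - d c (lnH d Γ A a b c)
      + ∑ e, (Γ c b e * lnH d Γ A a e c + Γ c c e * lnH d Γ A a b e
        - Γ a b e * lnH d Γ A c e c - Γ a c e * lnH d Γ A c b e)) := by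
  have hs : ∀ (X : ι → ι → R) (c : ι), ∑ e, ∑ f, gi b e * gi c f * X e f
      = gi b b * gi c c * X b c := fun X c => by
    rw [Finset.sum_eq_single b, Finset.sum_eq_single c]
    · intro f _ hf; rw [hgi c f hf.symm]; ring
    · simp
    · intro e _ he; simp [hgi b e he.symm]
    · simp
  rw [lnSigma]
  congr 1
  refine Finset.sum_congr rfl fun c _ => ?_
  rw [hs (fun e f => cv3 d Γ (lnH d Γ A) a c e f), hs (fun e f => cv3 d Γ (lnH d Γ A) c a e f)]
  have h1 : ∑ e, Γ c a e * lnH d Γ A e b c = ∑ e, Γ a c e * lnH d Γ A e b c :=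
    Finset.sum_congr rfl fun e _ => by rw [hΓ]
  simp only [cv3, h1, Finset.sum_sub_distrib, Finset.sum_add_distrib]
  ring

variable (d : Fin 2 ⊕ Fin 2 → Derivation ℂ R R) (r ri f fi s si k S : R) (ev : ℂ)
  (w : Fin 2 → Fin 2 → R) (v : Fin 2 → R) (u : R)

/-- `ε_{pq} D^q S`. -/
def curlR (p : Fin 2) : R := ![si * d (.inr 1) S, -(s * d (.inr 0) S)] p

theorem curlR_0 : curlR d s si S 0 = si * d (.inr 1) S := rfl
theorem curlR_1 : curlR d s si S 1 = -(s * d (.inr 0) S) := rfl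

/-- A metric perturbation with a single mode. -/
def modeR : Fin 2 ⊕ Fin 2 → Fin 2 ⊕ Fin 2 → R
  | .inl A, .inl B => w A B * S
  | .inl A, .inr p => r * (v A * curlR d s si S p)
  | .inr p, .inl A => r * (v A * curlR d s si S p)
  | .inr p, .inr q => (1 / 2 : ℂ) • (gamR s p q * (r * r) * (u * S))

/-- The trace `F_D{}^D`. -/
def trR : R := f * w 1 1 - fi * w 0 0

/-- The divergence `D_D (r F^D)`. -/
def dvR : R := v 1 + r * f * d (.inl 1) (v 1) - r * fi * d (.inl 0) (v 0)

/-- The coefficient of `𝒢_{tt}`. -/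
def e00R : R :=
  (1 / 4 * (ev - 2)) • (ri * ri * f * u) - (1 / 4 : ℂ) • (ri * f * (1 + 5 * f) * d (.inl 1) u)
    - (1 / 2 : ℂ) • (f * f * d (.inl 1) (d (.inl 1) u))
    + (1 / 2 * ev) • (ri * ri * f * f * w 1 1) + ri * ri * f * f * (2 - f) * w 1 1
    + ri * f * f * f * d (.inl 1) (w 1 1)

/-- The coefficient of `𝒢_{tr}`. -/
def e01R : R :=
  (1 / 4 : ℂ) • (ri * (fi - 3) * d (.inl 0) u) - (1 / 2 : ℂ) • d (.inl 1) (d (.inl 0) u)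
    + ri * f * d (.inl 0) (w 1 1) + (1 / 2 * ev) • (ri * ri * w 0 1)

/-- The coefficient of `𝒢_{rr}`. -/
def e11R : R :=
  -((1 / 4 * (ev - 2)) • (ri * ri * fi * u)) + (1 / 4 : ℂ) • (ri * (fi + 1) * d (.inl 1) u)
    - (1 / 2 : ℂ) • (fi * fi * d (.inl 0) (d (.inl 0) u)) - ri * ri * w 1 1
    + 2 * ri * fi * d (.inl 0) (w 0 1)
    + (1 / 2 * ev) • (ri * ri * fi * fi * w 0 0) + ri * ri * fi * (fi - 1) * w 0 0
    - ri * fi * d (.inl 1) (w 0 0)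

/-- The coefficient of `𝒢_{AB}`. -/
def eR (A B : Fin 2) : R :=
  !![e00R d ri f ev w u, e01R d ri f fi ev w u; e01R d ri f fi ev w u, e11R d ri fi ev w u] A B

/-- The even coefficient of `𝒢_{Aq}`. -/
def gER (A : Fin 2) : R :=
  ![-((1 / 2 : ℂ) • d (.inl 0) u) - f * d (.inl 0) (w 1 1) + ri * (1 - f) * w 0 1
      + f * d (.inl 1) (w 0 1),
    -((1 / 2 : ℂ) • d (.inl 1) u) + (1 / 2 : ℂ) • (ri * (1 + f) * w 1 1)
      - fi * d (.inl 0) (w 0 1) - (1 / 2 : ℂ) • (ri * fi * (fi + 1) * w 0 0)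
      + fi * d (.inl 1) (w 0 0)] A

/-- The odd coefficient of `𝒢_{Aq}`. -/
def gOR (A : Fin 2) : R :=
  ![3 * ri * f * d (.inl 0) (v 1) + f * d (.inl 1) (d (.inl 0) (v 1))
      + (ev - 2) • (ri * ri * v 0) + 2 * ri * ri * f * v 0 - 2 * ri * f * d (.inl 1) (v 0)
      - f * d (.inl 1) (d (.inl 1) (v 0)),
    (ev - 2) • (ri * ri * v 1) + fi * d (.inl 0) (d (.inl 0) (v 1))
      + ri * fi * d (.inl 0) (v 0) - fi * d (.inl 1) (d (.inl 0) (v 0))] A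

/-- The coefficient of the trace part of `𝒢_p{}^q`. -/
def gTR : R :=
  (1 / 2 : ℂ) • (ri * (1 + f) * d (.inl 1) u) + (1 / 2 : ℂ) • (f * d (.inl 1) (d (.inl 1) u))
    - (1 / 2 : ℂ) • (fi * d (.inl 0) (d (.inl 0) u))
    - (1 / 2 : ℂ) • (ri * ri * (1 - f * f) * w 1 1) - (1 / 2 * ev) • (ri * ri * f * w 1 1)
    - (1 / 2 : ℂ) • (ri * f * (1 + f) * d (.inl 1) (w 1 1)) - d (.inl 0) (d (.inl 0) (w 1 1))
    + ri * (1 + fi) * d (.inl 0) (w 0 1) + 2 * d (.inl 1) (d (.inl 0) (w 0 1))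
    + (1 / 2 : ℂ) • (ri * ri * (1 - fi * fi) * w 0 0) + (1 / 2 * ev) • (ri * ri * fi * w 0 0)
    + (1 / 2 : ℂ) • (ri * (fi - 3) * d (.inl 1) (w 0 0)) - d (.inl 1) (d (.inl 1) (w 0 0))

/-- `D_p D^q S - ½ γ_p{}^q D_s D^s S`. -/
def evenR (p q : Fin 2) : R :=
  !![d (.inr 0) (d (.inr 0) S) + (1 / 2 * ev) • S,
      si * si * (d (.inr 0) (d (.inr 1) S) - k * d (.inr 1) S);
    d (.inr 0) (d (.inr 1) S) - k * d (.inr 1) S,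
      -(d (.inr 0) (d (.inr 0) S) + (1 / 2 * ev) • S)] p q

/-- `ε^{sq} D_p D_s S + ε_{sp} D^q D^s S`. -/
def oddR (p q : Fin 2) : R :=
  !![-(2 * si * (d (.inr 0) (d (.inr 1) S) - k * d (.inr 1) S)),
      si * (2 * d (.inr 0) (d (.inr 0) S) + ev • S);
    s * (2 * d (.inr 0) (d (.inr 0) S) + ev • S),
      2 * si * (d (.inr 0) (d (.inr 1) S) - k * d (.inr 1) S)] p q

/-- `f` does not depend on the angles. -/
def IsBase (x : R) : Prop := ∀ p, d (.inr p) x = 0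

/-- `S` depends on the angles only and satisfies `(Δ + ev) S = 0`. -/
structure IsHarm : Prop where
  base : ∀ A, d (.inl A) S = 0
  lap : d (.inr 1) (d (.inr 1) S)
    = -(s * s * (ev • S + d (.inr 0) (d (.inr 0) S) + k * d (.inr 0) S))

variable {d r ri f fi s si k S ev w v u} {n : R}

theorem IsBase.deriv (hB : Bg d r ri f fi n s si k) {x : R} (hx : IsBase d x) (A : Fin 2) :
    IsBase d (d (.inl A) x) := fun p => by rw [hB.comm, hx, map_zero]

theorem IsHarm.base_deriv (hB : Bg d r ri f fi n s si k) {x : R} (hx : ∀ A, d (.inl A) x = 0)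
    (p A : Fin 2) : d (.inl A) (d (.inr p) x) = 0 := by rw [hB.comm, hx, map_zero]

theorem chrG_symm (a b c : Fin 2 ⊕ Fin 2) : chrG r ri f fi n s k a b c = chrG r ri f fi n s k b a c := by
  have h1 : ∀ A B C : Fin 2, chrY f fi n A B C = chrY f fi n B A C := by
    simp only [Fin.forall_fin_two]; and_intros <;> trivial
  have h2 : ∀ A B C : Fin 2, chrS s k A B C = chrS s k B A C := by
    simp only [Fin.forall_fin_two]; and_intros <;> trivial
  have h3 : ∀ p q : Fin 2, gamR s p q = gamR s q p := by
    simp only [Fin.forall_fin_two]; and_intros <;> trivial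
  rcases a with a | a <;> rcases b with b | b <;> rcases c with c | c <;>
    simp only [chrG, h1 a b, h2 a b, h3 a b]

theorem gR_diag : ∀ a b : Fin 2 ⊕ Fin 2, a ≠ b → gR r f fi s a b = 0 := by
  simp only [Sum.forall, Fin.forall_fin_two, gR, yR_01, yR_10, gamR_01, gamR_10, mul_zero,
    implies_true, ne_eq, not_true_eq_false, IsEmpty.forall_iff, and_self]

theorem modeR_symm (hw : ∀ A B, w A B = w B A) (a b : Fin 2 ⊕ Fin 2) :
    modeR d r s si S w v u a b = modeR d r s si S w v u b a := by
  have h3 : ∀ p q : Fin 2, gamR s p q = gamR s q p := by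
    simp only [Fin.forall_fin_two]; and_intros <;> trivial
  rcases a with a | a <;> rcases b with b | b <;> simp only [modeR, hw a b, h3 a b]

/-- The components of `H_{abc}` of a single mode. -/
def hR (d : Fin 2 ⊕ Fin 2 → Derivation ℂ R R) (r f fi n s si k S : R) (ev : ℂ)
    (w : Fin 2 → Fin 2 → R) (v : Fin 2 → R) (u : R) :
    Fin 2 ⊕ Fin 2 → Fin 2 ⊕ Fin 2 → Fin 2 ⊕ Fin 2 → R
  | .inl A, .inl B, .inl C =>
    ![!![(1 / 2 : ℂ) • d (.inl 0) (w 0 0) - f * n * w 0 1,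
          d (.inl 0) (w 0 1) - (1 / 2 : ℂ) • d (.inl 1) (w 0 0) - f * n * w 1 1;
        (1 / 2 : ℂ) • d (.inl 1) (w 0 0) - fi * n * w 0 0,
          (1 / 2 : ℂ) • d (.inl 0) (w 1 1) - fi * n * w 0 1],
      !![(1 / 2 : ℂ) • d (.inl 1) (w 0 0) - fi * n * w 0 0,
          (1 / 2 : ℂ) • d (.inl 0) (w 1 1) - fi * n * w 0 1;
        d (.inl 1) (w 0 1) - (1 / 2 : ℂ) • d (.inl 0) (w 1 1) + fi * n * w 0 1,
          (1 / 2 : ℂ) • d (.inl 1) (w 1 1) + fi * n * w 1 1]] A B C * S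
  | .inl A, .inl B, .inr p =>
    !![r * d (.inl 0) (v 0) - f * n * r * v 1,
        (1 / 2 : ℂ) • (r * d (.inl 0) (v 1) + v 0 + r * d (.inl 1) (v 0)) - fi * n * r * v 0;
      (1 / 2 : ℂ) • (r * d (.inl 0) (v 1) + v 0 + r * d (.inl 1) (v 0)) - fi * n * r * v 0,
        v 1 + r * d (.inl 1) (v 1) + fi * n * r * v 1] A B * curlR d s si S p
      - (1 / 2 : ℂ) • (w A B * d (.inr p) S)
  | .inl A, .inr p, .inl B =>
    !![0, (1 / 2 : ℂ) • (r * d (.inl 0) (v 1) - v 0 - r * d (.inl 1) (v 0));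
      -((1 / 2 : ℂ) • (r * d (.inl 0) (v 1) + v 0 - r * d (.inl 1) (v 0))), -v 1] A B
        * curlR d s si S p + (1 / 2 : ℂ) • (w A B * d (.inr p) S)
  | .inr p, .inl A, .inl B =>
    !![0, (1 / 2 : ℂ) • (r * d (.inl 0) (v 1) - v 0 - r * d (.inl 1) (v 0));
      -((1 / 2 : ℂ) • (r * d (.inl 0) (v 1) + v 0 - r * d (.inl 1) (v 0))), -v 1] A B
        * curlR d s si S p + (1 / 2 : ℂ) • (w A B * d (.inr p) S)
  | .inl A, .inr p, .inr q => (1 / 4 : ℂ) • (r * r * d (.inl A) u * gamR s p q * S)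
      + !![0, 1; -1, 0] p q * (1 / 2 * ev) • (r * v A * s * S)
  | .inr p, .inl A, .inr q => (1 / 4 : ℂ) • (r * r * d (.inl A) u * gamR s p q * S)
      + !![0, 1; -1, 0] p q * (1 / 2 * ev) • (r * v A * s * S)
  | .inr p, .inr q, .inl A =>
    (r * f * w 1 A - (1 / 4 : ℂ) • (2 * r * ![0, 1] A * u + r * r * d (.inl A) u)) * gamR s p q * S
      + r * v A * !![si * (d (.inr 0) (d (.inr 1) S) - k * d (.inr 1) S),
          -(s * (d (.inr 0) (d (.inr 0) S) + (1 / 2 * ev) • S));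
        -(s * (d (.inr 0) (d (.inr 0) S) + (1 / 2 * ev) • S)),
          -(s * (d (.inr 0) (d (.inr 1) S) - k * d (.inr 1) S))] p q
  | .inr p, .inr q, .inr t => (1 / 4 : ℂ) • (r * r * u * (gamR s q t * d (.inr p) S
      + gamR s p t * d (.inr q) S - gamR s p q * d (.inr t) S))
      + r * r * f * v 1 * gamR s p q * curlR d s si S t

-- Tabulating H keeps the computation of Σ to one differentiation of explicit entries. The
-- eigenvalue appears in the components with one orbit index in front because the antisymmetrized
-- angular derivative of ε_{pq} D^q S is a multiple of Δ S.
set_option maxHeartbeats 4000000 in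
theorem lnH_modeR (hB : Bg d r ri f fi n s si k) (hS : IsHarm d s k S ev)
    (hw : ∀ A B, w A B = w B A) (hwb : ∀ A B, IsBase d (w A B)) (hvb : ∀ A, IsBase d (v A))
    (hub : IsBase d u) : ∀ a b c,
    lnH d (chrG r ri f fi n s k) (modeR d r s si S w v u) a b c
      = hR d r f fi n s si k S ev w v u a b c := by
  simp only [lnH_of_symm d chrG_symm (modeR_symm hw)]
  have hw10 := hw 1 0
  have hc2 := fun x => hB.comm (.inr 1) (.inr 0) x
  simp only [IsBase] at hwb hvb hub
  simp only [Sum.forall, Fin.forall_fin_two]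
  and_intros
  all_goals
    simp only [Fintype.sum_sum_type, Fin.sum_univ_two, modeR, chrG,
      chrY_000, chrY_001, chrY_010, chrY_011, chrY_100, chrY_101, chrY_110, chrY_111,
      gamR_00, gamR_01, gamR_10, gamR_11, curlR_0, curlR_1,
      chrS_000, chrS_001,
      chrS_010, chrS_011, chrS_100, chrS_101, chrS_110, chrS_111, der_mul,
      hwb, hvb, hub, hS.base, hw10, hc2, hS.lap, IsHarm.base_deriv hB hS.base,
      hB.s1, hB.s2, hB.si0, hB.si1, hB.si2, hB.s0, hB.r0, hB.r1, hB.r2,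
      der_neg, der_zero, mul_zero, zero_mul, add_zero, zero_add, sub_zero, zero_sub, neg_zero,
      smul_zero, der_one, mul_one, one_mul,
      Matrix.cons_val_zero, Matrix.cons_val_one, Matrix.of_apply, der_smul, hR,
      Matrix.cons_val', Matrix.cons_val_fin_one]
    apply hB.sep
    intro φ
    have h1 := hB.r_ne φ
    have h2 := hB.f_ne φ
    have h3 := hB.s_ne φ
    simp only [ev_smul, ev_mul, ev_add, ev_sub, ev_neg, ev_one, ev_zero, ev_ofNat, hB.eval_si,
      hB.eval_ri]
    try field_simp
    try ring

/-- The components of `Σ_a{}^b` of a single mode. -/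
def sigmaR (d : Fin 2 ⊕ Fin 2 → Derivation ℂ R R) (r ri f fi s si k S : R) (ev : ℂ)
    (w : Fin 2 → Fin 2 → R) (v : Fin 2 → R) (u : R) : Fin 2 ⊕ Fin 2 → Fin 2 ⊕ Fin 2 → R
  | .inl A, .inl B => yR fi f B B * eR d ri f fi ev w u A B * S
      - !![1, 0; 0, 1] A B * (1 / 2 : ℂ) • ((f * e11R d ri fi ev w u - fi * e00R d ri f ev w u
        + gTR d ri f fi ev w u) * S)
  | .inl A, .inr q => (1 / 2 : ℂ) • (ri * ri * gER d ri f fi w u A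
        * (gamR si q q * d (.inr q) S))
      + (1 / 2 : ℂ) • (ri * gOR d ri f fi ev v A * (gamR si q q * curlR d s si S q))
  | .inr p, .inl B => (1 / 2 : ℂ) • (yR fi f B B * gER d ri f fi w u B * d (.inr p) S)
      + (1 / 2 : ℂ) • (r * (yR fi f B B * gOR d ri f fi ev v B * curlR d s si S p))
  | .inr p, .inr q => !![1, 0; 0, 1] p q * (1 / 2 : ℂ) • (gTR d ri f fi ev w u * S)
      + (1 / 2 : ℂ) • (ri * ri * (- trR f fi w * evenR d si k S ev p q
          - dvR d r f fi v * oddR d s si k S ev p q))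
      - !![1, 0; 0, 1] p q * (1 / 2 : ℂ) • ((f * e11R d ri fi ev w u - fi * e00R d ri f ev w u
        + gTR d ri f fi ev w u) * S)

-- In four dimensions trace reversal is an involution, so Σ is the Einstein tensor minus half its
-- own trace. `sigmaR` is written in that form: the bracket f e₁₁ - f⁻¹ e₀₀ + `gTR` is the trace of
-- the Einstein tensor, to which the trace-free angular parts do not contribute.
set_option maxHeartbeats 4000000 in
theorem lnSigma_modeR (hB : Bg d r ri f fi n s si k) (hS : IsHarm d s k S ev)
    (hw : ∀ A B, w A B = w B A) (hwb : ∀ A B, IsBase d (w A B)) (hvb : ∀ A, IsBase d (v A))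
    (hub : IsBase d u) : ∀ a b,
    lnSigma d (chrG r ri f fi n s k) (gR ri fi f si) (modeR d r s si S w v u) a b
      = sigmaR d r ri f fi s si k S ev w v u a b := by
  simp only [lnSigma_of_diag d chrG_symm gR_diag, lnH_modeR hB hS hw hwb hvb hub]
  have hw10 := hw 1 0
  have hwb' := fun A B C => (hwb A B).deriv hB C
  have hvb' := fun A C => (hvb A).deriv hB C
  have hub' := fun C => hub.deriv hB C
  have hS1 := fun p => IsHarm.base_deriv hB hS.base p
  -- Derivatives along the orbit space annihilate S and its first and second angular derivatives;
  -- this follows from commuting the derivations.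
  have hS2 := fun p q => IsHarm.base_deriv hB (hS1 p) q
  have hc1 := fun x => hB.comm (.inl 0) (.inl 1) x
  have hc2 := fun x => hB.comm (.inr 1) (.inr 0) x
  simp only [IsBase] at hwb hvb hub hwb' hvb' hub'
  simp only [Sum.forall, Fin.forall_fin_two]
  and_intros
  all_goals
    apply hB.sep
    intro φ
    have h1 := hB.r_ne φ
    have h2 := hB.f_ne φ
    have h3 := hB.s_ne φ
    simp only [Fintype.sum_sum_type, Fin.sum_univ_two, hR, gR, chrG,
      yR_00, yR_01, yR_10, yR_11, chrY_000, chrY_001,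
      chrY_010, chrY_011, chrY_100, chrY_101, chrY_110, chrY_111,
      gamR_00, gamR_01, gamR_10, gamR_11, curlR_0, curlR_1,
      chrS_000, chrS_001,
      chrS_010, chrS_011, chrS_100, chrS_101, chrS_110, chrS_111, der_mul,
      hwb, hvb, hub, hS.base, hS1, hS2, hw10, hwb', hvb', hub', hc1, hc2, hS.lap,
      hB.s1, hB.s2, hB.si0, hB.si1, hB.si2, hB.ri0, hB.ri1, hB.ri2,
      hB.s0, hB.f0, hB.f1, hB.f2, hB.fi0, hB.fi1, hB.fi2, hB.r0, hB.r1, hB.r2,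
      hB.k0, hB.k1, hB.k2, hB.n0, hB.n1, hB.n2,
      der_neg, der_zero, mul_zero, zero_mul, add_zero, zero_add, sub_zero, zero_sub, neg_zero,
      smul_zero, der_one, mul_one, one_mul, der_ofNat,
      Matrix.cons_val_zero, Matrix.cons_val_one, Matrix.of_apply, Matrix.cons_val',
      Matrix.cons_val_fin_one, der_add, der_sub, der_smul]
    simp only [sigmaR, eR, e00R, e01R, e11R, gER, gOR, gTR, trR, dvR, evenR, oddR,
      yR_00, yR_11, gamR_00, gamR_11, curlR_0, curlR_1,
      Matrix.cons_val_zero, Matrix.cons_val_one, Matrix.of_apply, Matrix.cons_val', Matrix.cons_val_fin_one,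
      ev_smul, ev_mul, ev_add, ev_sub, ev_neg, ev_one, ev_zero, ev_ofNat, hB.eval_si,
      hB.eval_ri, hB.eval_fi, hB.eval_n, zero_mul, sub_zero, zero_add, one_mul]
    field_simp
    ring

end SingleMode

/-! ### The Schwarzschild background on the chart -/

section Chart

theorem isOpen_chart {Ω : Set Plane} (hΩ : IsOpen Ω) : IsOpen (chart Ω) := by
  have hb : Continuous base := by unfold base; fun_prop
  have h0 : Continuous fun x : Pt => x (Sum.inr 0) := continuous_apply _
  exact (hΩ.preimage hb).inter ((isOpen_lt continuous_const h0).inter (isOpen_lt h0 continuous_const))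

/-- The part of the coordinate domain over `Ω`, as an open set. -/
def chartO (Ω : Set Plane) (hΩ : IsOpen Ω) : Opens Pt := ⟨chart Ω, isOpen_chart hΩ⟩

theorem deriv_ofFun {κ : Type} [Fintype κ] [DecidableEq κ] {V : Opens (κ → ℝ)} {F : (κ → ℝ) → ℂ}
    (hF : ContDiffOn ℝ ∞ F V) (i : κ) (x : V) : evalAt x (deriv V i (ofFun V F hF)) = pd i F x := by
  rw [evalAt_apply, deriv_apply]
  exact pd_congrOn (fun y hy => zeroExt_of_mem V _ hy) x.2 i

theorem hasFDerivAt_coord {κ : Type} [Fintype κ] [DecidableEq κ] {φ : ℝ → ℂ} {φ' : ℂ} {x : κ → ℝ}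
    {a : κ} (h : HasDerivAt φ φ' (x a)) :
    HasFDerivAt (fun y : κ → ℝ => φ (y a))
      ((ContinuousLinearMap.smulRight (1 : ℝ →L[ℝ] ℝ) φ').comp
        (ContinuousLinearMap.proj (R := ℝ) (φ := fun _ : κ => ℝ) a)) x :=
  HasFDerivAt.comp (g := φ) x h.hasFDerivAt
    ((ContinuousLinearMap.proj (R := ℝ) (φ := fun _ : κ => ℝ) a).hasFDerivAt (x := x))

theorem pd_coord {κ : Type} [Fintype κ] [DecidableEq κ] {φ : ℝ → ℂ} {φ' : ℂ} {x : κ → ℝ} {a : κ}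
    (h : HasDerivAt φ φ' (x a)) (i : κ) :
    pd i (fun y => φ (y a)) x = if i = a then φ' else 0 := by
  rw [pd, (hasFDerivAt_coord h).fderiv]
  by_cases hia : i = a
  · subst hia; simp
  · simp [hia, Pi.single_eq_of_ne (Ne.symm hia)]

theorem ContDiffOn.div_complex {E : Type} [NormedAddCommGroup E] [NormedSpace ℝ E] {F G : E → ℂ}
    {s : Set E} (hF : ContDiffOn ℝ ∞ F s) (hG : ContDiffOn ℝ ∞ G s) (h : ∀ x ∈ s, G x ≠ 0) :
    ContDiffOn ℝ ∞ (fun x => F x / G x) s := by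
  simp only [div_eq_mul_inv]
  exact hF.mul (hG.inv h)

theorem contDiff_ofReal : ContDiff ℝ ∞ (fun x : ℝ => (x : ℂ)) := Complex.ofRealCLM.contDiff

variable {Ω : Set Plane} (hΩ : IsOpen Ω) (M : ℝ)

theorem mem_chart (x : chartO Ω hΩ) : base x ∈ Ω ∧ 0 < x.1 (Sum.inr 0) ∧ x.1 (Sum.inr 0) < Real.pi :=
  x.2

theorem lapse_ne_zero {M ρ : ℝ} (h0 : 0 < ρ) (h : ρ ≠ 2 * M) : (1 - 2 * (M : ℂ) / (ρ : ℂ)) ≠ 0 := by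
  have h0' : (ρ : ℂ) ≠ 0 := by exact_mod_cast h0.ne'
  rw [sub_ne_zero, Ne, eq_comm, div_eq_one_iff_eq h0']
  exact_mod_cast Ne.symm h

variable (hr : ∀ q ∈ Ω, 0 < q 1 ∧ q 1 ≠ 2 * M)

theorem contDiffOn_coord {φ : ℝ → ℂ} {s : Set ℝ} {a : Fin 2 ⊕ Fin 2} (hφ : ContDiffOn ℝ ∞ φ s)
    (h : ∀ x : chartO Ω hΩ, x.1 a ∈ s) : ContDiffOn ℝ ∞ (fun x : Pt => φ (x a)) (chartO Ω hΩ) :=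
  hφ.comp (contDiff_apply ℝ ℝ a).contDiffOn fun x hx => h ⟨x, hx⟩

theorem contDiffOn_rad : ContDiffOn ℝ ∞ (fun x : Pt => ((x (Sum.inl 1) : ℝ) : ℂ)) (chartO Ω hΩ) :=
  contDiffOn_coord hΩ (s := Set.univ) contDiff_ofReal.contDiffOn fun _ => trivial

theorem contDiffOn_lapse (hr : ∀ q ∈ Ω, 0 < q 1 ∧ q 1 ≠ 2 * M) :
    ContDiffOn ℝ ∞ (fun x : Pt => 1 - 2 * (M : ℂ) / ((x (Sum.inl 1) : ℝ) : ℂ)) (chartO Ω hΩ) :=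
  contDiffOn_const.sub (ContDiffOn.div_complex contDiffOn_const (contDiffOn_rad hΩ) fun x hx => by
    exact_mod_cast (hr _ (mem_chart hΩ ⟨x, hx⟩).1).1.ne')

theorem sin_ne_zero (x : chartO Ω hΩ) : ((Real.sin (x.1 (Sum.inr 0)) : ℝ) : ℂ) ≠ 0 := by
  exact_mod_cast (Real.sin_pos_of_pos_of_lt_pi (mem_chart hΩ x).2.1 (mem_chart hΩ x).2.2).ne'

theorem contDiffOn_sin :
    ContDiffOn ℝ ∞ (fun x : Pt => ((Real.sin (x (Sum.inr 0)) : ℝ) : ℂ)) (chartO Ω hΩ) :=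
  contDiffOn_coord hΩ (s := Set.univ) (contDiff_ofReal.comp Real.contDiff_sin).contDiffOn
    fun _ => trivial

theorem contDiffOn_cos :
    ContDiffOn ℝ ∞ (fun x : Pt => ((Real.cos (x (Sum.inr 0)) : ℝ) : ℂ)) (chartO Ω hΩ) :=
  contDiffOn_coord hΩ (s := Set.univ) (contDiff_ofReal.comp Real.contDiff_cos).contDiffOn
    fun _ => trivial

/-- The area radius in the ring of smooth functions. -/
def rR : smoothRing (chartO Ω hΩ) := ofFun _ _ (contDiffOn_rad hΩ)

/-- The inverse of the area radius. -/
def riR : smoothRing (chartO Ω hΩ) := ofFun _ _ ((contDiffOn_rad hΩ).inv fun x hx => by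
  exact_mod_cast (hr _ (mem_chart hΩ ⟨x, hx⟩).1).1.ne')

/-- The function `f`. -/
def fR : smoothRing (chartO Ω hΩ) := ofFun _ _ (contDiffOn_lapse hΩ M hr)

/-- The inverse of `f`. -/
def fiR : smoothRing (chartO Ω hΩ) := ofFun _ _ ((contDiffOn_lapse hΩ M hr).inv fun x hx =>
  lapse_ne_zero (hr _ (mem_chart hΩ ⟨x, hx⟩).1).1 (hr _ (mem_chart hΩ ⟨x, hx⟩).1).2)

/-- The function `sin θ`. -/
def sR : smoothRing (chartO Ω hΩ) := ofFun _ _ (contDiffOn_sin hΩ)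

/-- The inverse of `sin θ`. -/
def siR : smoothRing (chartO Ω hΩ) :=
  ofFun _ _ ((contDiffOn_sin hΩ).inv fun x hx => sin_ne_zero hΩ ⟨x, hx⟩)

/-- The function `cot θ`. -/
def kR : smoothRing (chartO Ω hΩ) :=
  ofFun _ _ (ContDiffOn.div_complex (contDiffOn_cos hΩ) (contDiffOn_sin hΩ) fun x hx => sin_ne_zero hΩ ⟨x, hx⟩)

/-- The function `(1 - f) / (2 r)`. -/
def nR : smoothRing (chartO Ω hΩ) := (1 / 2 : ℂ) • ((1 - fR hΩ M hr) * riR hΩ M hr)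

theorem deriv_coord {φ ψ : ℝ → ℂ} {a : Fin 2 ⊕ Fin 2}
    (hF : ContDiffOn ℝ ∞ (fun x : Pt => φ (x a)) (chartO Ω hΩ))
    (h : ∀ x : chartO Ω hΩ, HasDerivAt φ (ψ (x.1 a)) (x.1 a)) (i : Fin 2 ⊕ Fin 2)
    (x : chartO Ω hΩ) :
    evalAt x (deriv _ i (ofFun _ _ hF)) = if i = a then ψ (x.1 a) else 0 := by
  rw [deriv_ofFun, pd_coord (h x)]

theorem hasDerivAt_ofReal (t : ℝ) : HasDerivAt (fun x : ℝ => (x : ℂ)) 1 t := by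
  simpa using (hasDerivAt_id t).ofReal_comp

/-- The only place where the formula f = 1 - 2M/r is differentiated: its derivative 2M/r² is
rewritten as (1 - f)/r. Separation of elements holds because evaluations at points are among the
homomorphisms to ℂ. -/
theorem bg_chart : Bg (deriv (chartO Ω hΩ)) (rR hΩ) (riR hΩ M hr) (fR hΩ M hr) (fiR hΩ M hr)
    (nR hΩ M hr) (sR hΩ) (siR hΩ) (kR hΩ) := by
  have hrne : ∀ x : chartO Ω hΩ, ((x.1 (Sum.inl 1) : ℝ) : ℂ) ≠ 0 := fun x => by
    exact_mod_cast (hr _ (mem_chart hΩ x).1).1.ne'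
  have hr' := fun i x => deriv_coord hΩ (φ := fun t => (t : ℂ)) (ψ := fun _ => 1) (contDiffOn_rad hΩ)
    (fun x => hasDerivAt_ofReal _) i x
  have hf' := fun i x => deriv_coord hΩ (φ := fun t => 1 - 2 * (M : ℂ) / (t : ℂ))
    (ψ := fun t => (1 - (1 - 2 * (M : ℂ) / (t : ℂ))) * (t : ℂ)⁻¹) (contDiffOn_lapse hΩ M hr)
    (fun x => by
      have := ((hasDerivAt_const (x.1 (Sum.inl 1)) (2 * (M : ℂ))).div
        (hasDerivAt_ofReal (x.1 (Sum.inl 1))) (hrne x)).const_sub 1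
      refine this.congr_deriv ?_
      have := hrne x
      field_simp
      ring) i x
  have hs' := fun i x => deriv_coord hΩ (φ := fun t => ((Real.sin t : ℝ) : ℂ))
    (ψ := fun t => ((Real.cos t : ℝ) : ℂ)) (contDiffOn_sin hΩ)
    (fun x => (Real.hasDerivAt_sin _).ofReal_comp) i x
  have hk' := fun i x => deriv_coord hΩ (φ := fun t => ((Real.cos t : ℝ) : ℂ) / ((Real.sin t : ℝ) : ℂ))
    (ψ := fun t => -(1 + ((Real.cos t : ℝ) : ℂ) / ((Real.sin t : ℝ) : ℂ)
      * (((Real.cos t : ℝ) : ℂ) / ((Real.sin t : ℝ) : ℂ))))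
    (ContDiffOn.div_complex (contDiffOn_cos hΩ) (contDiffOn_sin hΩ) fun x hx => sin_ne_zero hΩ ⟨x, hx⟩)
    (fun x => by
      have := (Real.hasDerivAt_cos (x.1 (Sum.inr 0))).ofReal_comp.div
        (Real.hasDerivAt_sin (x.1 (Sum.inr 0))).ofReal_comp (sin_ne_zero hΩ x)
      refine this.congr_deriv ?_
      have := sin_ne_zero hΩ x
      have h2 : ((Real.sin (x.1 (Sum.inr 0)) : ℝ) : ℂ) ^ 2 + ((Real.cos (x.1 (Sum.inr 0)) : ℝ) : ℂ) ^ 2 = 1 := by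
        exact_mod_cast Real.sin_sq_add_cos_sq _
      field_simp
      push_cast
      ring) i x
  refine ⟨fun a b h => evalAt_injective fun x => h (evalAt x), fun i j x => deriv_comm i j x,
    ?_, ?_, ?_, rfl, ?_, ?_, fun p => ?_, ?_, ?_, fun p => ?_, fun p => ?_, ?_, ?_, fun p => ?_, ?_, ?_⟩
  all_goals
    refine evalAt_injective fun x => ?_
  · exact mul_inv_cancel₀ (hrne x)
  · exact mul_inv_cancel₀ (lapse_ne_zero (hr _ (mem_chart hΩ x).1).1 (hr _ (mem_chart hΩ x).1).2)
  · exact mul_inv_cancel₀ (sin_ne_zero hΩ x)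
  · rw [rR, hr', map_zero]; simp
  · rw [rR, hr', map_one]; simp
  · rw [rR, hr', map_zero]; simp
  · rw [fR, hf', map_zero]; simp
  · have e : evalAt x (2 * nR hΩ M hr) = evalAt x ((1 - fR hΩ M hr) * riR hΩ M hr) := by
      rw [nR, ev_mul, ev_smul, ev_ofNat]; ring
    rw [fR, hf', if_pos rfl, e]
    rfl
  · rw [fR, hf', map_zero]; simp
  · rw [sR, hs', map_zero]; simp
  · rw [sR, hs', if_pos rfl]; exact (mul_div_cancel₀ _ (sin_ne_zero hΩ x)).symm
  · rw [sR, hs', map_zero]; simp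
  · rw [kR, hk', map_zero]; simp
  · rw [kR, hk', if_pos rfl]; rfl
  · rw [kR, hk', map_zero]; simp

/-! ### Metrics and Christoffel symbols -/

theorem rep_yMet (A B : Fin 2) : Rep (V := chartO Ω hΩ) Sum.inl (fun q => yMet M q A B)
    (yR (fR hΩ M hr) (fiR hΩ M hr) A B) := by
  intro x
  revert A B
  simp only [Fin.forall_fin_two]
  and_intros <;> simp [yMet, yR, proj] <;> rfl

theorem yMet_inv (q : Plane) (h : lapse M q ≠ 0) :
    (yMet M q)⁻¹ = Matrix.diagonal ![-(lapse M q)⁻¹, lapse M q] := by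
  refine Matrix.inv_eq_right_inv ?_
  rw [yMet, Matrix.diagonal_mul_diagonal, ← Matrix.diagonal_one]
  congr 1
  funext i
  revert i
  simp [Fin.forall_fin_two, h]

theorem gam_inv (s : Plane) (h : ((Real.sin (s 0) : ℝ) : ℂ) ≠ 0) :
    (gam s)⁻¹ = Matrix.diagonal
      ![1, ((Real.sin (s 0) : ℝ) : ℂ)⁻¹ * ((Real.sin (s 0) : ℝ) : ℂ)⁻¹] := by
  refine Matrix.inv_eq_right_inv ?_
  rw [gam, Matrix.diagonal_mul_diagonal, ← Matrix.diagonal_one]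
  congr 1
  funext i
  revert i
  simp only [Fin.forall_fin_two]
  refine ⟨by simp, ?_⟩
  change ((Real.sin (s 0) ^ 2 : ℝ) : ℂ) * (((Real.sin (s 0) : ℝ) : ℂ)⁻¹ * ((Real.sin (s 0) : ℝ) : ℂ)⁻¹) = 1
  rw [Complex.ofReal_pow, pow_two, mul_assoc, mul_inv_cancel_left₀ h, mul_inv_cancel₀ h]

theorem base_ne (hr : ∀ q ∈ Ω, 0 < q 1 ∧ q 1 ≠ 2 * M) (x : chartO Ω hΩ) : lapse M (base x) ≠ 0 :=
  lapse_ne_zero (hr _ (mem_chart hΩ x).1).1 (hr _ (mem_chart hΩ x).1).2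

theorem rep_yMet_inv (A B : Fin 2) : Rep (V := chartO Ω hΩ) Sum.inl (fun q => (yMet M q)⁻¹ A B)
    (yR (fiR hΩ M hr) (fR hΩ M hr) A B) := by
  intro x
  change (yMet M (base x))⁻¹ A B = _
  rw [yMet_inv M _ (base_ne hΩ M hr x)]
  revert A B
  simp only [Fin.forall_fin_two]
  and_intros <;> simp [yR] <;> rfl

theorem rep_gam (p q : Fin 2) : Rep (V := chartO Ω hΩ) Sum.inr (fun s => gam s p q)
    (gamR (sR hΩ) p q) := by
  intro x
  revert p q
  simp only [Fin.forall_fin_two]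
  refine ⟨⟨?_, ?_⟩, ?_, ?_⟩
  · rw [gamR_00, map_one]; rfl
  · rw [gamR_01, map_zero]; rfl
  · rw [gamR_10, map_zero]; rfl
  · rw [gamR_11, map_mul, ← pow_two]; exact Complex.ofReal_pow _ _

theorem rep_gam_inv (p q : Fin 2) : Rep (V := chartO Ω hΩ) Sum.inr (fun s => (gam s)⁻¹ p q)
    (gamR (siR hΩ) p q) := by
  intro x
  change (gam (sph x))⁻¹ p q = _
  have h : ((Real.sin (sph x 0) : ℝ) : ℂ) ≠ 0 := sin_ne_zero hΩ x
  rw [gam_inv (sph x) h]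
  revert p q
  simp only [Fin.forall_fin_two]
  refine ⟨⟨?_, ?_⟩, ?_, ?_⟩
  · rw [gamR_00, map_one]; rfl
  · rw [gamR_01, map_zero]; rfl
  · rw [gamR_10, map_zero]; rfl
  · rw [gamR_11, map_mul]; rfl

theorem gMet_inv (x : Pt) (h0 : rad (base x) ≠ 0) (h1 : IsUnit (yMet M (base x)).det)
    (h2 : IsUnit (gam (sph x)).det) : (gMet M x)⁻¹
      = Matrix.fromBlocks (yMet M (base x))⁻¹ 0 0 ((rad (base x) ^ 2)⁻¹ • (gam (sph x))⁻¹) := by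
  refine Matrix.inv_eq_right_inv ?_
  rw [gMet, Matrix.fromBlocks_multiply, ← Matrix.fromBlocks_one]
  congr 1
  · simp [Matrix.mul_nonsing_inv _ h1]
  · simp
  · simp
  · rw [Matrix.zero_mul, zero_add, Matrix.smul_mul, Matrix.mul_smul, smul_smul,
      Matrix.mul_nonsing_inv _ h2, mul_inv_cancel₀ (pow_ne_zero 2 h0), one_smul]

theorem rep_gMet (a b : Fin 2 ⊕ Fin 2) : Rep (V := chartO Ω hΩ) id (fun x => gMet M x a b)
    (gR (rR hΩ) (fR hΩ M hr) (fiR hΩ M hr) (sR hΩ) a b) := by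
  intro x
  rcases a with a | a <;> rcases b with b | b
  · exact rep_yMet hΩ M hr a b x
  · exact (map_zero (evalAt x)).symm
  · exact (map_zero (evalAt x)).symm
  · have := rep_gam hΩ a b x
    simp only [gR, map_mul, ← this, gMet, Matrix.fromBlocks_apply₂₂, Matrix.smul_apply, smul_eq_mul,
      pow_two]
    rfl

theorem rep_gMet_inv (a b : Fin 2 ⊕ Fin 2) : Rep (V := chartO Ω hΩ) id (fun x => (gMet M x)⁻¹ a b)
    (gR (riR hΩ M hr) (fiR hΩ M hr) (fR hΩ M hr) (siR hΩ) a b) := by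
  intro x
  have h0 : rad (base x) ≠ 0 := by
    have : rad (base x) = ((x.1 (Sum.inl 1) : ℝ) : ℂ) := rfl
    rw [this]
    exact_mod_cast (hr _ (mem_chart hΩ x).1).1.ne'
  have h1 : IsUnit (yMet M (base x)).det := by
    have := base_ne hΩ M hr x
    simp [yMet, this]
  have h2 : IsUnit (gam (sph x)).det := by
    have := sin_ne_zero hΩ x
    simpa [gam, sph] using this
  change (gMet M x)⁻¹ a b = _
  rw [gMet_inv M x h0 h1 h2]
  rcases a with a | a <;> rcases b with b | b
  · exact rep_yMet_inv hΩ M hr a b x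
  · exact (map_zero (evalAt x)).symm
  · exact (map_zero (evalAt x)).symm
  · have := rep_gam_inv hΩ a b x
    simp only [gR, map_mul, ← this, Matrix.fromBlocks_apply₂₂, Matrix.smul_apply, smul_eq_mul,
      pow_two, mul_inv]
    rfl

theorem rep_chrY (A B C : Fin 2) : Rep (V := chartO Ω hΩ) Sum.inl (christoffel (yMet M) A B C)
    (chrY (fR hΩ M hr) (fiR hΩ M hr) (nR hΩ M hr) A B C) := by
  rw [← chr_y (bg_chart hΩ M hr)]
  exact rep_christoffel Sum.inl_injective (rep_yMet hΩ M hr) (rep_yMet_inv hΩ M hr) A B C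

theorem rep_chrS (M : ℝ) (hr : ∀ q ∈ Ω, 0 < q 1 ∧ q 1 ≠ 2 * M) (p q u : Fin 2) : Rep (V := chartO Ω hΩ) Sum.inr (christoffel gam p q u)
    (chrS (sR hΩ) (kR hΩ) p q u) := by
  rw [← chr_gam (bg_chart hΩ M hr)]
  exact rep_christoffel Sum.inr_injective (rep_gam hΩ) (rep_gam_inv hΩ) p q u

theorem rep_chrG (a b c : Fin 2 ⊕ Fin 2) : Rep (V := chartO Ω hΩ) id (christoffel (gMet M) a b c)
    (chrG (rR hΩ) (riR hΩ M hr) (fR hΩ M hr) (fiR hΩ M hr) (nR hΩ M hr) (sR hΩ) (kR hΩ) a b c) := by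
  rw [← chr_g (bg_chart hΩ M hr)]
  exact rep_christoffel Function.injective_id (rep_gMet hΩ M hr) (rep_gMet_inv hΩ M hr) a b c

end Chart

/-! ### Orbit space operators in the ring -/

section Orbit

variable {Ω : Set Plane} (hΩ : IsOpen Ω) (M : ℝ) (hr : ∀ q ∈ Ω, 0 < q 1 ∧ q 1 ≠ 2 * M)

/-- The derivatives along the orbit space. -/
def dY : Fin 2 → Derivation ℂ (smoothRing (chartO Ω hΩ)) (smoothRing (chartO Ω hΩ)) :=
  fun A => deriv (chartO Ω hΩ) (Sum.inl A)

/-- The Christoffel symbols of the orbit space. -/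
def gY : Fin 2 → Fin 2 → Fin 2 → smoothRing (chartO Ω hΩ) :=
  chrY (fR hΩ M hr) (fiR hΩ M hr) (nR hΩ M hr)

theorem ctr_base (x : chartO Ω hΩ) (t : Fin 2 → Fin 2 → ℂ) : ctr M (base x) t
    = evalAt x (fR hΩ M hr) * t 1 1 - evalAt x (fiR hΩ M hr) * t 0 0 := by
  have h : ∀ A B, (yMet M (base x))⁻¹ A B = _ := fun A B => rep_yMet_inv hΩ M hr A B x
  simp only [ctr, Fin.sum_univ_two, h, yR_00, yR_01, yR_10, yR_11, map_zero, map_neg]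
  ring

theorem raise_base (x : chartO Ω hΩ) (t : Fin 2 → ℂ) (A : Fin 2) : raise M (base x) t A
    = evalAt x (yR (fiR hΩ M hr) (fR hΩ M hr) A A) * t A := by
  have h : ∀ A B, (yMet M (base x))⁻¹ A B = _ := fun A B => rep_yMet_inv hΩ M hr A B x
  simp only [raise, Fin.sum_univ_two, h]
  revert A
  simp only [Fin.forall_fin_two, yR_00, yR_01, yR_10, yR_11, map_zero, map_neg]
  constructor <;> ring

theorem rep_rad : Rep (V := chartO Ω hΩ) Sum.inl rad (rR hΩ) := fun _ => rfl

theorem rad_base (x : chartO Ω hΩ) : rad (base x) = evalAt x (rR hΩ) := rfl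

theorem dr_base (x : chartO Ω hΩ) (A : Fin 2) :
    dr A (base x) = evalAt x (dY hΩ A (rR hΩ)) := (rep_rad hΩ).pd Sum.inl_injective A x

theorem rep_ctr {t : Fin 2 → Fin 2 → Plane → ℂ} {τ : Fin 2 → Fin 2 → smoothRing (chartO Ω hΩ)}
    (h : ∀ A B, Rep Sum.inl (t A B) (τ A B)) : Rep Sum.inl (fun q => ctr M q fun A B => t A B q)
      (fR hΩ M hr * τ 1 1 - fiR hΩ M hr * τ 0 0) := by
  intro x
  rw [map_sub, map_mul, map_mul, ← h, ← h]
  exact ctr_base hΩ M hr x _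

variable {c : Plane → ℂ} {γ : smoothRing (chartO Ω hΩ)}
  {V : Fin 2 → Plane → ℂ} {v : Fin 2 → smoothRing (chartO Ω hΩ)}
  {W : Fin 2 → Fin 2 → Plane → ℂ} {w : Fin 2 → Fin 2 → smoothRing (chartO Ω hΩ)}

theorem rep_D0 (hc : Rep Sum.inl c γ) (A : Fin 2) : Rep Sum.inl (D0 c A) (dY hΩ A γ) :=
  hc.pd Sum.inl_injective A

theorem rep_DD0 (hc : Rep Sum.inl c γ) (A B : Fin 2) : Rep Sum.inl (DD0 M c A B)
    (cv1 (dY hΩ) (gY hΩ M hr) (fun A => dY hΩ A γ) A B) :=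
  rep_cov1 Sum.inl_injective (rep_chrY hΩ M hr) (rep_D0 hΩ hc) A B

theorem rep_D1 (hv : ∀ A, Rep Sum.inl (V A) (v A)) (A B : Fin 2) : Rep Sum.inl (D1 M V A B)
    (cv1 (dY hΩ) (gY hΩ M hr) v A B) :=
  rep_cov1 Sum.inl_injective (rep_chrY hΩ M hr) hv A B

theorem rep_DD1 (hv : ∀ A, Rep Sum.inl (V A) (v A)) (A B C : Fin 2) :
    Rep Sum.inl (DD1 M V A B C)
      (cv2 (dY hΩ) (gY hΩ M hr) (cv1 (dY hΩ) (gY hΩ M hr) v) A B C) :=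
  rep_cov2 Sum.inl_injective (rep_chrY hΩ M hr) (rep_D1 hΩ M hr hv) A B C

theorem rep_D2 (hw : ∀ A B, Rep Sum.inl (W A B) (w A B)) (A B C : Fin 2) :
    Rep Sum.inl (D2 M W A B C) (cv2 (dY hΩ) (gY hΩ M hr) w A B C) :=
  rep_cov2 Sum.inl_injective (rep_chrY hΩ M hr) hw A B C

theorem rep_DD2 (hw : ∀ A B, Rep Sum.inl (W A B) (w A B)) (A B C D : Fin 2) :
    Rep Sum.inl (DD2 M W A B C D)
      (cv3 (dY hΩ) (gY hΩ M hr) (cv2 (dY hΩ) (gY hΩ M hr) w) A B C D) :=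
  rep_cov3 Sum.inl_injective (rep_chrY hΩ M hr) (rep_D2 hΩ M hr hw) A B C D

theorem rep_trace2 (hw : ∀ A B, Rep Sum.inl (W A B) (w A B)) :
    Rep Sum.inl (trace2 M W) (trR (fR hΩ M hr) (fiR hΩ M hr) w) := rep_ctr hΩ M hr hw

theorem rep_div1 (hv : ∀ A, Rep Sum.inl (V A) (v A)) : Rep Sum.inl (div1 M V)
    (fR hΩ M hr * cv1 (dY hΩ) (gY hΩ M hr) v 1 1 - fiR hΩ M hr * cv1 (dY hΩ) (gY hΩ M hr) v 0 0) :=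
  rep_ctr hΩ M hr (rep_D1 hΩ M hr hv)

theorem rep_div2 (hw : ∀ A B, Rep Sum.inl (W A B) (w A B)) (A : Fin 2) : Rep Sum.inl (div2 M W A)
    (fR hΩ M hr * cv2 (dY hΩ) (gY hΩ M hr) w 1 A 1
      - fiR hΩ M hr * cv2 (dY hΩ) (gY hΩ M hr) w 0 A 0) :=
  rep_ctr hΩ M hr (t := fun D E => D2 M W D A E)
    (τ := fun D E => cv2 (dY hΩ) (gY hΩ M hr) w D A E) fun D E => rep_D2 hΩ M hr hw D A E

end Orbit

/-! ### The covariant brackets of the Einstein tensor in coordinates -/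

section Brackets

variable {Ω : Set Plane} (hΩ : IsOpen Ω) (M : ℝ) (hr : ∀ q ∈ Ω, 0 < q 1 ∧ q 1 ≠ 2 * M)
  (F : InvModes) (k : Mode)
  {w : Fin 2 → Fin 2 → smoothRing (chartO Ω hΩ)} {v : Fin 2 → smoothRing (chartO Ω hΩ)}
  {u : smoothRing (chartO Ω hΩ)}

-- Covariant derivatives are unfolded with the Christoffel symbols of y, and mixed partial
-- derivatives are put into one order. After the substitution n = (1 - f)/(2r) both sides are the
-- same rational expression in the values at x. Since y is diagonal, raising the index B is
-- multiplication by one entry, also in the term with δ_A{}^B.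
set_option maxHeartbeats 4000000 in
theorem gAB_base (hw : ∀ A B, Rep Sum.inl (F.FAB k A B) (w A B)) (hu : Rep Sum.inl (F.F k) u)
    (hsymm : ∀ A B, w A B = w B A) (x : chartO Ω hΩ) : ∀ A B : Fin 2,
    (1 / 2) * raise M (base x) (fun E => gABfirst M F k A E (base x)) B
        + (1 / 2) * kron A B * gABsecond M F k (base x)
      = evalAt x (yR (fiR hΩ M hr) (fR hΩ M hr) B B
        * eR (deriv _) (riR hΩ M hr) (fR hΩ M hr) (fiR hΩ M hr) k.ev w u A B) := by
  have hB := bg_chart hΩ M hr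
  have h1 := hB.r_ne (evalAt x)
  have h2 := hB.f_ne (evalAt x)
  have hw10 := hsymm 1 0
  have hc1 := fun y => hB.comm (.inl 0) (.inl 1) y
  have e1 : ∀ A B C, D2 M (F.FAB k) A B C (base x) = _ := fun A B C => rep_D2 hΩ M hr hw A B C x
  have e2 : ∀ A B C D, DD2 M (F.FAB k) A B C D (base x) = _ :=
    fun A B C D => rep_DD2 hΩ M hr hw A B C D x
  have e3 : trace2 M (F.FAB k) (base x) = _ := rep_trace2 hΩ M hr hw x
  have e4 : ∀ A, D0 (trace2 M (F.FAB k)) A (base x) = _ :=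
    fun A => rep_D0 hΩ (rep_trace2 hΩ M hr hw) A x
  have e5 : ∀ A B, DD0 M (trace2 M (F.FAB k)) A B (base x) = _ :=
    fun A B => rep_DD0 hΩ M hr (rep_trace2 hΩ M hr hw) A B x
  have e6 : ∀ A, D0 (F.F k) A (base x) = _ := fun A => rep_D0 hΩ hu A x
  have e7 : ∀ A B, DD0 M (F.F k) A B (base x) = _ := fun A B => rep_DD0 hΩ M hr hu A B x
  have e8 : ∀ A B, F.FAB k A B (base x) = _ := fun A B => hw A B x
  have e9 : F.F k (base x) = _ := hu x
  simp only [Fin.forall_fin_two]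
  and_intros
  all_goals
    simp only [raise_base hΩ M hr, gABfirst, gABsecond, drSq, ctr_base hΩ M hr, rad_base, dr_base,
      e1, e2, e3, e4, e5, e6, e7, e8, e9, dY, gY, cv1, cv2, cv3, trR, Fin.sum_univ_two,
      yR_00, yR_01, yR_10, yR_11, chrY_000, chrY_001,
      chrY_010, chrY_011, chrY_100, chrY_101, chrY_110, chrY_111, hw10, hc1, kron,
      hB.ri0, hB.ri1, hB.f0, hB.f1, hB.fi0, hB.fi1, hB.r0, hB.r1, der_mul, hB.n0, hB.n1,
      der_neg, der_zero, mul_zero, zero_mul, add_zero, zero_add, sub_zero, zero_sub, neg_zero,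
      smul_zero, der_one, der_ofNat, mul_one, one_mul,
      der_add, der_sub, der_smul, if_true, if_false, zero_ne_one, one_ne_zero, reduceIte]
    simp only [eR, e00R, e01R, e11R, Matrix.cons_val_zero, Matrix.cons_val_one, Matrix.of_apply,
      Matrix.cons_val', Matrix.cons_val_fin_one,
      ev_smul, ev_mul, ev_add, ev_sub, ev_neg, ev_one, ev_zero, ev_ofNat,
      hB.eval_ri, hB.eval_fi, hB.eval_n, zero_mul, sub_zero, zero_add, one_mul]
    field_simp
    ring

theorem gEven_base (hw : ∀ A B, Rep Sum.inl (F.FAB k A B) (w A B)) (hu : Rep Sum.inl (F.F k) u)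
    (hsymm : ∀ A B, w A B = w B A) (x : chartO Ω hΩ) : ∀ A : Fin 2,
    gEven M F k A (base x)
      = evalAt x (gER (deriv _) (riR hΩ M hr) (fR hΩ M hr) (fiR hΩ M hr) w u A) := by
  have hB := bg_chart hΩ M hr
  have h1 := hB.r_ne (evalAt x)
  have h2 := hB.f_ne (evalAt x)
  have hw10 := hsymm 1 0
  have e3 : trace2 M (F.FAB k) (base x) = _ := rep_trace2 hΩ M hr hw x
  have e4 : ∀ A, D0 (trace2 M (F.FAB k)) A (base x) = _ :=
    fun A => rep_D0 hΩ (rep_trace2 hΩ M hr hw) A x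
  have e6 : ∀ A, D0 (F.F k) A (base x) = _ := fun A => rep_D0 hΩ hu A x
  have e8 : ∀ A, div2 M (F.FAB k) A (base x) = _ := fun A => rep_div2 hΩ M hr hw A x
  simp only [Fin.forall_fin_two]
  and_intros
  all_goals
    simp only [gEven, rad_base, dr_base,
      e3, e4, e6, e8, dY, gY, cv1, cv2, cv3, trR, Fin.sum_univ_two,
      chrY_000, chrY_001,
      chrY_010, chrY_011, chrY_100, chrY_101, chrY_110, chrY_111, hw10,
      hB.ri0, hB.ri1, hB.f0, hB.f1, hB.fi0, hB.fi1, hB.r0, hB.r1, der_mul, hB.n0, hB.n1,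
      der_neg, der_zero, mul_zero, zero_mul, add_zero, zero_add, sub_zero, zero_sub, neg_zero,
      smul_zero, der_one, der_ofNat, mul_one, one_mul,
      der_add, der_sub, der_smul]
    simp only [gER, Matrix.cons_val_zero, Matrix.cons_val_one,
      ev_smul, ev_mul, ev_add, ev_sub, ev_neg, ev_one, ev_zero, ev_ofNat,
      hB.eval_ri, hB.eval_fi, hB.eval_n]
    field_simp
    ring

set_option maxHeartbeats 1000000 in
theorem gOdd_base (hv : ∀ A, Rep Sum.inl (F.FA k A) (v A)) (x : chartO Ω hΩ) : ∀ A : Fin 2,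
    gOdd M F k A (base x)
      = evalAt x (gOR (deriv _) (riR hΩ M hr) (fR hΩ M hr) (fiR hΩ M hr) k.ev v A) := by
  have hB := bg_chart hΩ M hr
  have h1 := hB.r_ne (evalAt x)
  have h2 := hB.f_ne (evalAt x)
  have hc1 := fun y => hB.comm (.inl 0) (.inl 1) y
  have e1 : ∀ A B, D1 M (F.FA k) A B (base x) = _ := fun A B => rep_D1 hΩ M hr hv A B x
  have e2 : ∀ A B C, DD1 M (F.FA k) A B C (base x) = _ :=
    fun A B C => rep_DD1 hΩ M hr hv A B C x
  have e3 : ∀ A, F.FA k A (base x) = _ := fun A => hv A x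
  simp only [Fin.forall_fin_two]
  and_intros
  all_goals
    simp only [gOdd, drSq, ctr_base hΩ M hr, rad_base, dr_base, e1, e2, e3, hc1,
      dY, gY, cv1, cv2, cv3, Fin.sum_univ_two,
      chrY_000, chrY_001,
      chrY_010, chrY_011, chrY_100, chrY_101, chrY_110, chrY_111,
      hB.ri0, hB.ri1, hB.f0, hB.f1, hB.fi0, hB.fi1, hB.r0, hB.r1, der_mul, hB.n0, hB.n1,
      der_neg, der_zero, mul_zero, zero_mul, add_zero, zero_add, sub_zero, zero_sub, neg_zero,
      smul_zero, der_one, der_ofNat, mul_one, one_mul,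
      der_add, der_sub, der_smul]
    simp only [gOR, Matrix.cons_val_zero, Matrix.cons_val_one,
      ev_smul, ev_mul, ev_add, ev_sub, ev_neg, ev_one, ev_zero, ev_ofNat,
      hB.eval_ri, hB.eval_fi, hB.eval_n]
    field_simp
    ring

set_option maxHeartbeats 1000000 in
theorem gTrace_base (hw : ∀ A B, Rep Sum.inl (F.FAB k A B) (w A B)) (hu : Rep Sum.inl (F.F k) u)
    (hsymm : ∀ A B, w A B = w B A) (x : chartO Ω hΩ) :
    gTrace M F k (base x)
      = evalAt x (gTR (deriv _) (riR hΩ M hr) (fR hΩ M hr) (fiR hΩ M hr) k.ev w u) := by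
  have hB := bg_chart hΩ M hr
  have h1 := hB.r_ne (evalAt x)
  have h2 := hB.f_ne (evalAt x)
  have hw10 := hsymm 1 0
  have hc1 := fun y => hB.comm (.inl 0) (.inl 1) y
  have e3 : trace2 M (F.FAB k) (base x) = _ := rep_trace2 hΩ M hr hw x
  have e4 : ∀ A, D0 (trace2 M (F.FAB k)) A (base x) = _ :=
    fun A => rep_D0 hΩ (rep_trace2 hΩ M hr hw) A x
  have e5 : ∀ A B, DD0 M (trace2 M (F.FAB k)) A B (base x) = _ :=
    fun A B => rep_DD0 hΩ M hr (rep_trace2 hΩ M hr hw) A B x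
  have e6 : div1 M (fun A z => rad z ^ 2 * D0 (F.F k) A z) (base x) = _ :=
    rep_div1 hΩ M hr (fun A => ((rep_rad hΩ).pow 2).mul (rep_D0 hΩ hu A)) x
  have e7 : div1 M (fun A z => rad z ^ 2 * div2 M (F.FAB k) A z) (base x) = _ :=
    rep_div1 hΩ M hr (fun A => ((rep_rad hΩ).pow 2).mul (rep_div2 hΩ M hr hw A)) x
  rw [gTrace, e6, e7]
  simp only [drSq, ctr_base hΩ M hr, rad_base, dr_base, e3, e4, e5, hw10, hc1,
      dY, gY, cv1, cv2, cv3, trR, Fin.sum_univ_two, pow_two,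
      chrY_000, chrY_001,
      chrY_010, chrY_011, chrY_100, chrY_101, chrY_110, chrY_111,
      hB.ri0, hB.ri1, hB.f0, hB.f1, hB.fi0, hB.fi1, hB.r0, hB.r1, der_mul, hB.n0, hB.n1,
      der_neg, der_zero, mul_zero, zero_mul, add_zero, zero_add, sub_zero, zero_sub, neg_zero,
      smul_zero, der_one, der_ofNat, mul_one, one_mul,
      der_add, der_sub, der_smul]
  simp only [gTR,
      ev_smul, ev_mul, ev_add, ev_sub, ev_neg, ev_one, ev_zero, ev_ofNat,
      hB.eval_ri, hB.eval_fi, hB.eval_n]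
  field_simp
  ring

theorem div_rFA_base (hv : ∀ A, Rep Sum.inl (F.FA k A) (v A)) (x : chartO Ω hΩ) :
    div1 M (rFA F k) (base x)
      = evalAt x (dvR (deriv _) (rR hΩ) (fR hΩ M hr) (fiR hΩ M hr) v) := by
  have hB := bg_chart hΩ M hr
  have h1 := hB.r_ne (evalAt x)
  have h2 := hB.f_ne (evalAt x)
  have e1 : div1 M (rFA F k) (base x) = _ :=
    rep_div1 hΩ M hr (fun A => (rep_rad hΩ).mul (hv A)) x
  simp only [e1, dY, gY, cv1, cv2, cv3, Fin.sum_univ_two,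
      chrY_000, chrY_001,
      chrY_010, chrY_011, chrY_100, chrY_101, chrY_110, chrY_111,
      hB.ri0, hB.ri1, hB.f0, hB.f1, hB.fi0, hB.fi1, hB.r0, hB.r1, der_mul, hB.n0, hB.n1,
      der_neg, der_zero, mul_zero, zero_mul, add_zero, zero_add, sub_zero, zero_sub, neg_zero,
      smul_zero, der_one, der_ofNat, mul_one, one_mul,
      der_add, der_sub, der_smul]
  simp only [dvR, ev_smul, ev_mul, ev_add, ev_sub, ev_neg, ev_one, ev_zero, ev_ofNat,
      hB.eval_ri, hB.eval_fi, hB.eval_n]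
  field_simp
  ring

end Brackets

/-! ### Mixed tensors built from mode coefficients -/

section Matter

/-- Coefficients of a mixed tensor, or such coefficients multiplied by a harmonic. -/
structure Src (R : Type) where
  AB : Fin 2 → Fin 2 → R
  e1 : Fin 2 → R
  o1 : Fin 2 → R
  e0 : R
  e2 : R
  o2 : R

/-- Apply a map to all coefficients. -/
def Src.map {R R' : Type} (g : R → R') (t : Src R) : Src R' :=
  ⟨fun A B => g (t.AB A B), fun A => g (t.e1 A), fun A => g (t.o1 A), g t.e0, g t.e2, g t.o2⟩

variable {R : Type} [CommRing R] [Algebra ℂ R]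

variable (d : Fin 2 ⊕ Fin 2 → Derivation ℂ R R) (r ri f fi n s si k : R)

/-- `D_p D^q S - ½ γ_p{}^q Δ S`. -/
def evOp (S : R) (p q : Fin 2) : R :=
  !![(1 / 2 : ℂ) • (d (.inr 0) (d (.inr 0) S) - k * d (.inr 0) S - si * si * d (.inr 1) (d (.inr 1) S)),
      si * si * (d (.inr 0) (d (.inr 1) S) - k * d (.inr 1) S);
    d (.inr 0) (d (.inr 1) S) - k * d (.inr 1) S,
      -((1 / 2 : ℂ) • (d (.inr 0) (d (.inr 0) S) - k * d (.inr 0) S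
        - si * si * d (.inr 1) (d (.inr 1) S)))] p q

/-- `ε^{sq} D_p D_s S + ε_{sp} D^q D^s S`. -/
def odOp (S : R) (p q : Fin 2) : R :=
  !![-(2 * si * (d (.inr 0) (d (.inr 1) S) - k * d (.inr 1) S)),
      si * (d (.inr 0) (d (.inr 0) S) - k * d (.inr 0) S - si * si * d (.inr 1) (d (.inr 1) S));
    s * (d (.inr 0) (d (.inr 0) S) - k * d (.inr 0) S - si * si * d (.inr 1) (d (.inr 1) S)),
      2 * si * (d (.inr 0) (d (.inr 1) S) - k * d (.inr 1) S)] p q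

/-- The mixed tensor `T_a{}^b` with given scalar potentials. -/
def matOp (t : Src R) : Fin 2 ⊕ Fin 2 → Fin 2 ⊕ Fin 2 → R
  | .inl A, .inl B => yR fi f B B * t.AB A B
  | .inl A, .inr q => ri * (gamR si q q * (d (.inr q) (t.e1 A) + curlR d s si (t.o1 A) q))
  | .inr p, .inl B => r * (yR fi f B B * (d (.inr p) (t.e1 B) + curlR d s si (t.o1 B) p))
  | .inr p, .inr q => !![1, 0; 0, 1] p q * (1 / 2 : ℂ) • t.e0 + evOp d si k t.e2 p q
      + odOp d s si k t.o2 p q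

variable {d r ri f fi n s si k}

-- Ricci-flatness comes down to f' = (1 - f)/r, that is (r f)' = 1, together with the unit curvature
-- of the sphere, which is contained in the derivative of cot θ.
set_option maxHeartbeats 1000000 in
theorem ric_chrG (hB : Bg d r ri f fi n s si k) : ∀ a b,
    ric d (chrG r ri f fi n s k) a b = 0 := by
  simp only [Sum.forall, Fin.forall_fin_two]
  and_intros
  all_goals
    apply hB.sep
    intro φ
    have h1 := hB.r_ne φ
    have h2 := hB.f_ne φ
    have h3 := hB.s_ne φ
    simp only [ric, Fintype.sum_sum_type, Fin.sum_univ_two, gR, chrG,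
      yR_00, yR_01, yR_10, yR_11, chrY_000, chrY_001,
      chrY_010, chrY_011, chrY_100, chrY_101, chrY_110, chrY_111,
      gamR_00, gamR_01, gamR_10, gamR_11,
      chrS_000, chrS_001,
      chrS_010, chrS_011, chrS_100, chrS_101, chrS_110, chrS_111, der_mul,
      hB.s1, hB.s2, hB.si0, hB.si1, hB.si2, hB.ri0, hB.ri1, hB.ri2,
      hB.s0, hB.f0, hB.f1, hB.f2, hB.fi0, hB.fi1, hB.fi2, hB.r0, hB.r1, hB.r2,
      hB.k0, hB.k1, hB.k2, hB.n0, hB.n1, hB.n2,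
      der_neg, der_zero, mul_zero, zero_mul, add_zero, zero_add, sub_zero, zero_sub, neg_zero,
      smul_zero, der_one, mul_one, one_mul, der_ofNat,
      Matrix.cons_val_zero, Matrix.cons_val_one, Matrix.of_apply, Matrix.cons_val',
      Matrix.cons_val_fin_one, der_add, der_sub, der_smul]
    try simp only [ev_smul, ev_mul, ev_add, ev_sub, ev_neg, ev_one, ev_zero, ev_ofNat, hB.eval_si,
      hB.eval_ri, hB.eval_fi, hB.eval_n, zero_mul, sub_zero, zero_add, one_mul]
    try field_simp
    try ring

variable {S : R} {ev : ℂ} {w : Fin 2 → Fin 2 → R} {v : Fin 2 → R} {u : R}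

/-- `evOp` is a differential operator without reference to an eigenvalue, as is needed for summing
over modes. On one mode the equation (Δ + ev) S = 0 removes ∂_φ² S and produces `evenR`. The same
holds for `odOp` and `oddR`. -/
theorem evOp_mul (hB : Bg d r ri f fi n s si k) (hS : IsHarm d s k S ev) {a : R}
    (ha : IsBase d a) : ∀ p q, evOp d si k (a * S) p q = a * evenR d si k S ev p q := by
  simp only [IsBase] at ha
  simp only [Fin.forall_fin_two]
  and_intros
  all_goals
    apply hB.sep
    intro φ
    have h3 := hB.s_ne φ
    simp only [evOp, evenR, Matrix.cons_val_zero, Matrix.cons_val_one, Matrix.of_apply,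
      Matrix.cons_val', Matrix.cons_val_fin_one, der_mul, ha, mul_zero, add_zero, hS.lap]
    simp only [ev_smul, ev_mul, ev_add, ev_sub, ev_neg, ev_ofNat, hB.eval_si]
    field_simp
    try ring

theorem odOp_mul (hB : Bg d r ri f fi n s si k) (hS : IsHarm d s k S ev) {a : R}
    (ha : IsBase d a) : ∀ p q, odOp d s si k (a * S) p q = a * oddR d s si k S ev p q := by
  simp only [IsBase] at ha
  simp only [Fin.forall_fin_two]
  and_intros
  all_goals
    apply hB.sep
    intro φ
    have h3 := hB.s_ne φ
    simp only [odOp, oddR, Matrix.cons_val_zero, Matrix.cons_val_one, Matrix.of_apply,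
      Matrix.cons_val', Matrix.cons_val_fin_one, der_mul, ha, mul_zero, add_zero, hS.lap]
    simp only [ev_smul, ev_mul, ev_add, ev_sub, ev_neg, ev_ofNat, hB.eval_si]
    field_simp
    try ring

theorem curlR_mul {a : R} (ha : IsBase d a) (p : Fin 2) :
    curlR d s si (a * S) p = a * curlR d s si S p := by
  revert p
  simp only [Fin.forall_fin_two, curlR_0, curlR_1, der_mul, ha _]
  constructor <;> ring

theorem base_mul {a : R} (ha : IsBase d a) (p : Fin 2) :
    d (.inr p) (a * S) = a * d (.inr p) S := by
  rw [der_mul, ha, mul_zero, add_zero]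

/-- All coefficients depend on the orbit space only. -/
structure Src.IsBase (d : Fin 2 ⊕ Fin 2 → Derivation ℂ R R) (t : Src R) : Prop where
  AB : ∀ A B, SchwarzschildModes.IsBase d (t.AB A B)
  e1 : ∀ A, SchwarzschildModes.IsBase d (t.e1 A)
  o1 : ∀ A, SchwarzschildModes.IsBase d (t.o1 A)
  e0 : SchwarzschildModes.IsBase d t.e0
  e2 : SchwarzschildModes.IsBase d t.e2
  o2 : SchwarzschildModes.IsBase d t.o2

/-- The mixed tensor `T_a{}^b` of a single mode. -/
def matR (d : Fin 2 ⊕ Fin 2 → Derivation ℂ R R) (r ri f fi s si k S : R) (ev : ℂ) (t : Src R) :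
    Fin 2 ⊕ Fin 2 → Fin 2 ⊕ Fin 2 → R
  | .inl A, .inl B => yR fi f B B * t.AB A B * S
  | .inl A, .inr q => ri * (t.e1 A * (gamR si q q * d (.inr q) S)
      + t.o1 A * (gamR si q q * curlR d s si S q))
  | .inr p, .inl B => r * (yR fi f B B * t.e1 B * d (.inr p) S
      + yR fi f B B * t.o1 B * curlR d s si S p)
  | .inr p, .inr q => t.e0 * (!![1, 0; 0, 1] p q * (1 / 2 : ℂ) • S)
      + t.e2 * evenR d si k S ev p q + t.o2 * oddR d s si k S ev p q

/-- This links the two descriptions of a mixed tensor: `matOp` commutes with summation over modes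
because its coefficients do not depend on the mode, while `matR` is adapted to one mode and its
eigenvalue. -/
theorem matOp_mul (hB : Bg d r ri f fi n s si k) (hS : IsHarm d s k S ev) {t : Src R}
    (ht : t.IsBase d) (a b : Fin 2 ⊕ Fin 2) :
    matOp d r ri f fi s si k (t.map (· * S)) a b = matR d r ri f fi s si k S ev t a b := by
  rcases a with a | a <;> rcases b with b | b
  · simp only [matOp, matR, Src.map]; ring
  · simp only [matOp, matR, Src.map, base_mul (ht.e1 _), curlR_mul (ht.o1 _)]; ring
  · simp only [matOp, matR, Src.map, base_mul (ht.e1 _), curlR_mul (ht.o1 _)]; ring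
  · simp only [matOp, matR, Src.map, evOp_mul hB hS ht.e2, odOp_mul hB hS ht.o2,
      mul_smul_comm]
    congr 3
    ring

/-- The coefficients of the linearized Einstein tensor of a single mode. -/
def einR (d : Fin 2 ⊕ Fin 2 → Derivation ℂ R R) (r ri f fi : R) (ev : ℂ)
    (w : Fin 2 → Fin 2 → R) (v : Fin 2 → R) (u : R) : Src R where
  AB := eR d ri f fi ev w u
  e1 A := (1 / 2 : ℂ) • (ri * gER d ri f fi w u A)
  o1 A := (1 / 2 : ℂ) • gOR d ri f fi ev v A
  e0 := gTR d ri f fi ev w u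
  e2 := -((1 / 2 : ℂ) • (ri * ri * trR f fi w))
  o2 := -((1 / 2 : ℂ) • (ri * ri * dvR d r f fi v))

/-- `sigmaR` is a trace-reversed tensor, and reversing the trace a second time restores the tensor
with coefficients `einR`. Thus the linearized Einstein tensor of a mode has the same shape as an
energy-momentum tensor. -/
theorem lnEinstein_modeR (hB : Bg d r ri f fi n s si k) (hS : IsHarm d s k S ev)
    (hw : ∀ A B, w A B = w B A) (hwb : ∀ A B, IsBase d (w A B)) (hvb : ∀ A, IsBase d (v A))
    (hub : IsBase d u) : ∀ a b : Fin 2 ⊕ Fin 2,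
    lnSigma d (chrG r ri f fi n s k) (gR ri fi f si) (modeR d r s si S w v u) a b
      - (1 / 2 * (if a = b then 1 else 0) : ℂ) •
        ∑ c, lnSigma d (chrG r ri f fi n s k) (gR ri fi f si) (modeR d r s si S w v u) c c
      = matR d r ri f fi s si k S ev (einR d r ri f fi ev w v u) a b := by
  simp only [lnSigma_modeR hB hS hw hwb hvb hub, Fintype.sum_sum_type, Fin.sum_univ_two]
  simp only [Sum.forall, Fin.forall_fin_two]
  and_intros
  all_goals
    apply hB.sep
    intro φ
    have h1 := hB.r_ne φ
    have h2 := hB.f_ne φ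
    have h3 := hB.s_ne φ
    simp only [sigmaR, matR, einR, eR, reduceIte, Sum.inl.injEq, Sum.inr.injEq, zero_ne_one,
      one_ne_zero, reduceCtorEq, yR_00, yR_11, evenR, oddR,
      Matrix.cons_val_zero, Matrix.cons_val_one, Matrix.of_apply, Matrix.cons_val', Matrix.cons_val_fin_one,
      ev_smul, ev_mul, ev_add, ev_sub, ev_neg, ev_one, ev_zero, ev_ofNat, hB.eval_si,
      hB.eval_ri, hB.eval_fi, hB.eval_n, zero_mul, sub_zero, zero_add, one_mul, mul_zero, mul_one]
    try field_simp
    try ring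

/-- The coefficient of the `(t, r)` part of the divergence. -/
def caR (d : Fin 2 ⊕ Fin 2 → Derivation ℂ R R) (ri f fi n : R) (ev : ℂ) (t : Src R) (B : Fin 2) : R :=
  f * cv2 (fun A => d (.inl A)) (chrY f fi n) t.AB 1 1 B
    - fi * cv2 (fun A => d (.inl A)) (chrY f fi n) t.AB 0 0 B
    + 2 * ri * f * t.AB 1 B - ev • (ri * t.e1 B) - ri * ![0, 1] B * t.e0

/-- The even coefficient of the angular part of the divergence. -/
def cbR (d : Fin 2 ⊕ Fin 2 → Derivation ℂ R R) (ri f fi n : R) (ev : ℂ) (t : Src R) : R :=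
  f * cv1 (fun A => d (.inl A)) (chrY f fi n) t.e1 1 1
    - fi * cv1 (fun A => d (.inl A)) (chrY f fi n) t.e1 0 0
    + 3 * ri * f * t.e1 1 + (1 / 2 : ℂ) • (ri * t.e0) - (1 / 2 * (ev - 2)) • (ri * t.e2)

/-- The odd coefficient of the angular part of the divergence. -/
def ccR (d : Fin 2 ⊕ Fin 2 → Derivation ℂ R R) (ri f fi n : R) (ev : ℂ) (t : Src R) : R :=
  f * cv1 (fun A => d (.inl A)) (chrY f fi n) t.o1 1 1
    - fi * cv1 (fun A => d (.inl A)) (chrY f fi n) t.o1 0 0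
    + 3 * ri * f * t.o1 1 + (ev - 2) • (ri * t.o2)

-- Commuting derivatives on the unit sphere gives D^q (D_p D_q - ½ γ_{pq} Δ) S = ½ D_p (Δ + 2) S.
-- This is the origin of the factor ev - 2 = (l-1)(l+2) in front of e2; the odd tensor yields the
-- same factor in front of o2.
set_option maxHeartbeats 4000000 in
theorem dvm_matR (hB : Bg d r ri f fi n s si k) (hS : IsHarm d s k S ev) {t : Src R}
    (ht : t.IsBase d) (hs : ∀ A B, t.AB A B = t.AB B A) :
    (∀ B, dvm d (chrG r ri f fi n s k) (matR d r ri f fi s si k S ev t) (.inl B)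
      = caR d ri f fi n ev t B * S) ∧
    ∀ p, dvm d (chrG r ri f fi n s k) (matR d r ri f fi s si k S ev t) (.inr p)
      = r * (cbR d ri f fi n ev t * d (.inr p) S + ccR d ri f fi n ev t * curlR d s si S p) := by
  have ht1 := ht.AB
  have ht2 := ht.e1
  have ht3 := ht.o1
  have ht4 := ht.e0
  have ht5 := ht.e2
  have ht6 := ht.o2
  have hs10 := hs 1 0
  have hS1 := fun p => IsHarm.base_deriv hB hS.base p
  have hS2 := fun p q => IsHarm.base_deriv hB (hS1 p) q
  have hc1 := fun x => hB.comm (.inl 0) (.inl 1) x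
  have hc2 := fun x => hB.comm (.inr 1) (.inr 0) x
  simp only [IsBase] at ht1 ht2 ht3 ht4 ht5 ht6
  simp only [Fin.forall_fin_two]
  and_intros
  all_goals
    apply hB.sep
    intro φ
    have h1 := hB.r_ne φ
    have h2 := hB.f_ne φ
    have h3 := hB.s_ne φ
    simp only [dvm, matR, evenR, oddR, caR, cbR, ccR, cv1, cv2,
      Fintype.sum_sum_type, Fin.sum_univ_two, gR, chrG,
      yR_00, yR_01, yR_10, yR_11, chrY_000, chrY_001,
      chrY_010, chrY_011, chrY_100, chrY_101, chrY_110, chrY_111,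
      gamR_00, gamR_01, gamR_10, gamR_11, curlR_0, curlR_1,
      chrS_000, chrS_001,
      chrS_010, chrS_011, chrS_100, chrS_101, chrS_110, chrS_111,
      Matrix.cons_val_zero, Matrix.cons_val_one, Matrix.of_apply, Matrix.cons_val',
      Matrix.cons_val_fin_one, der_mul,
      ht1, ht2, ht3, ht4, ht5, ht6, hS.base, hS1, hS2, hs10, hc1, hc2, hS.lap,
      hB.s1, hB.s2, hB.si0, hB.si1, hB.si2, hB.ri0, hB.ri1, hB.ri2,
      hB.s0, hB.f0, hB.f1, hB.f2, hB.fi0, hB.fi1, hB.fi2, hB.r0, hB.r1, hB.r2,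
      hB.k0, hB.k1, hB.k2, hB.n0, hB.n1, hB.n2,
      der_neg, der_zero, mul_zero, zero_mul, add_zero, zero_add, sub_zero, zero_sub, neg_zero,
      smul_zero, der_one, mul_one, one_mul, der_ofNat, der_add, der_sub, der_smul]
    simp only [ev_smul, ev_mul, ev_add, ev_sub, ev_neg, ev_one, ev_zero, ev_ofNat, hB.eval_si,
      hB.eval_ri, hB.eval_fi, hB.eval_n, zero_mul, sub_zero, zero_add, one_mul]
    field_simp
    ring

end Matter

/-! ### Normally convergent series of smooth functions -/

section Families

variable {κ : Type} [Fintype κ] [DecidableEq κ] {V : Opens (κ → ℝ)} {J : Type}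

/-- Normal convergence on compact sets, with all derivatives up to order `n`. -/
def NCn : ℕ → (J → smoothRing V) → Prop
  | 0, γ => ∀ K : Set (κ → ℝ), IsCompact K → K ⊆ V → ∃ u : J → ℝ, Summable u ∧
      ∀ k, ∀ x : V, x.1 ∈ K → ‖evalAt x (γ k)‖ ≤ u k
  | n + 1, γ => NCn n γ ∧ ∀ i, NCn n fun k => deriv V i (γ k)

/-- Normal convergence on compact sets, with all derivatives. -/
def NC (γ : J → smoothRing V) : Prop := ∀ n, NCn n γ

theorem continuous_evalAt (a : smoothRing V) : ContinuousOn (zeroExt V a.1) V :=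
  a.2.continuousOn

theorem zeroExt_eq (a : smoothRing V) (x : V) : zeroExt V a.1 x = evalAt x a :=
  zeroExt_of_mem V _ x.2

theorem exists_bound (a : smoothRing V) {K : Set (κ → ℝ)} (hK : IsCompact K) (h : K ⊆ V) :
    ∃ C : ℝ, 0 ≤ C ∧ ∀ x : V, x.1 ∈ K → ‖evalAt x a‖ ≤ C := by
  obtain ⟨C, hC⟩ := hK.exists_bound_of_continuousOn ((continuous_evalAt a).mono h)
  refine ⟨max C 0, le_max_right _ _, fun x hx => ?_⟩
  rw [← zeroExt_eq]
  exact (hC x hx).trans (le_max_left _ _)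

theorem NCn.add {n : ℕ} : ∀ {γ η : J → smoothRing V}, NCn n γ → NCn n η →
    NCn n fun k => γ k + η k := by
  induction n with
  | zero =>
    intro γ η h1 h2 K hK hKV
    obtain ⟨u, hu, hu'⟩ := h1 K hK hKV
    obtain ⟨w, hw, hw'⟩ := h2 K hK hKV
    exact ⟨fun k => u k + w k, hu.add hw, fun k x hx => by
      rw [ev_add]; exact (norm_add_le _ _).trans (add_le_add (hu' k x hx) (hw' k x hx))⟩
  | succ n ih =>
    intro γ η h1 h2
    refine ⟨ih h1.1 h2.1, fun i => ?_⟩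
    simp only [der_add]
    exact ih (h1.2 i) (h2.2 i)

theorem NCn.const_mul {n : ℕ} : ∀ {γ : J → smoothRing V} (a : smoothRing V), NCn n γ →
    NCn n fun k => a * γ k := by
  induction n with
  | zero =>
    intro γ a h K hK hKV
    obtain ⟨u, hu, hu'⟩ := h K hK hKV
    obtain ⟨C, hC0, hC⟩ := exists_bound a hK hKV
    exact ⟨fun k => C * u k, hu.mul_left C, fun k x hx => by
      rw [ev_mul, norm_mul]
      exact mul_le_mul (hC x hx) (hu' k x hx) (norm_nonneg _) hC0⟩
  | succ n ih =>
    intro γ a h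
    refine ⟨ih a h.1, fun i => ?_⟩
    simp only [der_mul, mul_comm (γ _)]
    exact (ih a (h.2 i)).add (ih _ h.1)

theorem NC.add {γ η : J → smoothRing V} (h1 : NC γ) (h2 : NC η) : NC fun k => γ k + η k :=
  fun n => (h1 n).add (h2 n)

theorem NC.const_mul {γ : J → smoothRing V} (a : smoothRing V) (h : NC γ) : NC fun k => a * γ k :=
  fun n => (h n).const_mul a

theorem NC.deriv {γ : J → smoothRing V} (h : NC γ) (i : κ) : NC fun k => deriv V i (γ k) :=
  fun n => (h (n + 1)).2 i

theorem NC.zero : NC fun _ : J => (0 : smoothRing V) := by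
  intro n
  induction n with
  | zero => exact fun K _ _ => ⟨fun _ => 0, summable_zero, fun k x _ => by simp⟩
  | succ n ih => exact ⟨ih, fun i => by simpa only [map_zero] using ih⟩

/-- A coordinate as a continuous linear form. -/
def prj (i : κ) : (κ → ℝ) →L[ℝ] ℝ := ContinuousLinearMap.proj i

theorem prj_apply (i : κ) (y : κ → ℝ) : prj i y = y i := rfl

theorem continuousLinearMap_eq_sum (L : (κ → ℝ) →L[ℝ] ℂ) :
    L = ∑ i, (prj i).smulRight (L (Pi.single i 1)) := by
  ext y
  have h : y = ∑ i, y i • (Pi.single i 1 : κ → ℝ) := by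
    simpa using pi_eq_sum_univ' y
  conv_lhs => rw [h, map_sum]
  simp only [_root_.sum_apply, ContinuousLinearMap.smulRight_apply, prj_apply, map_smul]

/-- Sums of normally convergent series may be differentiated term by term. -/
theorem NC.hasFDerivAt {γ : J → smoothRing V} (h : NC γ) {x : κ → ℝ} (hx : x ∈ V) :
    HasFDerivAt (fun y => ∑' k, zeroExt V (γ k).1 y)
      (∑ i, (prj i).smulRight
        (∑' k, zeroExt V (SchwarzschildModes.deriv V i (γ k)).1 x)) x := by
  obtain ⟨ε, hε, hball⟩ := Metric.isOpen_iff.1 V.isOpen x hx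
  have hsub : Metric.closedBall x (ε / 2) ⊆ V :=
    -- Halving the radius gives a compact ball inside `V`, where normal convergence provides
    -- summable bounds. The open ball in it is convex, hence preconnected, as termwise
    -- differentiation requires.
    (Metric.closedBall_subset_ball (half_lt_self hε)).trans hball
  have hK := isCompact_closedBall x (ε / 2)
  choose u hu hu' using fun i => (h 1).2 i _ hK hsub
  obtain ⟨u0, hu0, hu0'⟩ := h 0 _ hK hsub
  have hfd : ∀ k y, y ∈ Metric.ball x (ε / 2) → HasFDerivAt (zeroExt V (γ k).1)
      (∑ i, (prj i).smulRight
        (zeroExt V (SchwarzschildModes.deriv V i (γ k)).1 y)) y := fun k y hy => by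
    have hyV := hsub (Metric.ball_subset_closedBall hy)
    have h1 := (diffAt_zeroExt (γ k) hyV).hasFDerivAt
    rw [continuousLinearMap_eq_sum (fderiv ℝ (zeroExt V (γ k).1) y)] at h1
    refine h1.congr_fderiv (Finset.sum_congr rfl fun i _ => ?_)
    rw [zeroExt_of_mem V _ hyV]
    exact congrArg _ (deriv_apply i (γ k) ⟨y, hyV⟩).symm
  have hx0 : x ∈ Metric.ball x (ε / 2) := Metric.mem_ball_self (half_pos hε)
  have hsum : ∀ i, Summable fun k => zeroExt V (SchwarzschildModes.deriv V i (γ k)).1 x :=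
    fun i => Summable.of_norm_bounded (hu i) fun k => by
      rw [zeroExt_eq _ ⟨x, hx⟩]
      exact hu' i k ⟨x, hx⟩ (Metric.ball_subset_closedBall hx0)
  have key := hasFDerivAt_tsum_of_isPreconnected (u := fun k => ∑ i, u i k)
    (summable_sum fun i _ => hu i) Metric.isOpen_ball
    (convex_ball x (ε / 2)).isPreconnected hfd (fun k y hy => ?_) hx0
    (Summable.of_norm_bounded hu0 fun k => by
      rw [zeroExt_eq _ ⟨x, hx⟩]
      exact hu0' k ⟨x, hx⟩ (Metric.ball_subset_closedBall hx0)) hx0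
  · refine key.congr_fderiv ?_
    refine HasSum.tsum_eq ?_
    refine hasSum_sum fun i _ => ?_
    exact ((ContinuousLinearMap.smulRightL ℝ (κ → ℝ) ℂ
      (prj i)).hasSum (hsum i).hasSum)
  · have hyV := hsub (Metric.ball_subset_closedBall hy)
    refine (norm_sum_le _ _).trans (Finset.sum_le_sum fun i _ => ?_)
    rw [ContinuousLinearMap.norm_smulRight_apply]
    have h1 : ‖prj i‖ ≤ 1 :=
      ContinuousLinearMap.opNorm_le_bound _ zero_le_one fun z => by
        rw [one_mul]; exact norm_le_pi_norm z i
    refine (mul_le_of_le_one_left (norm_nonneg _) h1).trans ?_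
    rw [zeroExt_eq _ ⟨y, hyV⟩]
    exact hu' i k ⟨y, hyV⟩ (Metric.ball_subset_closedBall hy)

/-- Induction on the order for all families at once: the derivative of the sum has as components the
sums of the differentiated families, and these converge normally again. -/
theorem NC.contDiffOn_tsum {γ : J → smoothRing V} (h : NC γ) :
    ContDiffOn ℝ ∞ (fun y => ∑' k, zeroExt V (γ k).1 y) V := by
  rw [contDiffOn_infty]
  intro n
  induction n generalizing γ with
  | zero =>
    exact contDiffOn_zero.2 fun x hx => (h.hasFDerivAt hx).continuousAt.continuousWithinAt
  | succ n ih =>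
    rw [Nat.cast_succ, contDiffOn_succ_iff_fderiv_of_isOpen V.isOpen]
    refine ⟨fun x hx => (h.hasFDerivAt hx).differentiableAt.differentiableWithinAt, by simp, ?_⟩
    have : ContDiffOn ℝ n (fun x => ∑ i, (prj i).smulRight
        (∑' k, zeroExt V (SchwarzschildModes.deriv V i (γ k)).1 x)) V :=
      ContDiffOn.sum fun i _ => contDiffOn_const.smulRight (ih (h.deriv i))
    exact this.congr fun x hx => (h.hasFDerivAt hx).fderiv

/-- The series `∑ γ k` converges normally with all derivatives, and its sum is `g`. -/
def HS (γ : J → smoothRing V) (g : smoothRing V) : Prop :=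
  NC γ ∧ ∀ x : V, HasSum (fun k => evalAt x (γ k)) (evalAt x g)

theorem NC.summable {γ : J → smoothRing V} (h : NC γ) (x : V) :
    Summable fun k => evalAt x (γ k) := by
  obtain ⟨u, hu, hu'⟩ := h 0 {x.1} isCompact_singleton (by simp)
  exact Summable.of_norm_bounded hu fun k => hu' k x rfl

theorem NC.exists_hs {γ : J → smoothRing V} (h : NC γ) : ∃ g, HS γ g := by
  refine ⟨ofFun V _ h.contDiffOn_tsum, h, fun x => ?_⟩
  have := (h.summable x).hasSum
  simp only [← zeroExt_eq] at this ⊢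
  rw [zeroExt_eq]
  exact this

variable {γ η : J → smoothRing V} {g g' : smoothRing V}

theorem HS.unique (h : HS γ g) (h' : HS γ g') : g = g' :=
  evalAt_injective fun x => (h.2 x).unique (h'.2 x)

theorem HS.congr (h : HS γ g) (e : ∀ k, η k = γ k) : HS η g := by rwa [funext e]

theorem HS.add (h : HS γ g) (h' : HS η g') : HS (fun k => γ k + η k) (g + g') :=
  ⟨h.1.add h'.1, fun x => by simpa only [ev_add] using (h.2 x).add (h'.2 x)⟩

theorem HS.const_mul (a : smoothRing V) (h : HS γ g) : HS (fun k => a * γ k) (a * g) :=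
  ⟨h.1.const_mul a, fun x => by simpa only [ev_mul] using (h.2 x).mul_left (evalAt x a)⟩

theorem HS.smul (z : ℂ) (h : HS γ g) : HS (fun k => z • γ k) (z • g) := by
  have := h.const_mul (algebraMap ℂ _ z)
  simpa only [← Algebra.smul_def] using this

theorem HS.neg (h : HS γ g) : HS (fun k => -γ k) (-g) := by
  simpa only [neg_smul, one_smul] using h.smul (-1)

theorem HS.sub (h : HS γ g) (h' : HS η g') : HS (fun k => γ k - η k) (g - g') := by
  simpa only [sub_eq_add_neg] using h.add h'.neg

theorem HS.zero : HS (fun _ : J => (0 : smoothRing V)) 0 :=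
  ⟨NC.zero, fun x => by simpa only [ev_zero] using hasSum_zero⟩

theorem HS.sum {α : Type} {s : Finset α} {γ : α → J → smoothRing V} {g : α → smoothRing V}
    (h : ∀ a, HS (γ a) (g a)) : HS (fun k => ∑ a ∈ s, γ a k) (∑ a ∈ s, g a) := by
  classical
  induction s using Finset.induction_on with
  | empty => simpa only [Finset.sum_empty] using HS.zero
  | insert a s ha ih => simpa only [Finset.sum_insert ha] using (h a).add ih

/-- Near the point g coincides with the termwise sum, whose derivative is known. Evaluating it on a
basis vector leaves one partial derivative. -/
theorem HS.deriv (h : HS γ g) (i : κ) : HS (fun k => deriv V i (γ k)) (deriv V i g) := by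
  refine ⟨h.1.deriv i, fun x => ?_⟩
  have h1 := ((h.1.deriv i).summable x).hasSum
  convert h1 using 1
  have h2 : fderiv ℝ (zeroExt V g.1) x = _ := ((h.1.hasFDerivAt x.2).congr_of_eventuallyEq
    (Filter.eventually_of_mem (V.isOpen.mem_nhds x.2) fun y hy => by
      rw [zeroExt_eq g ⟨y, hy⟩, ← (h.2 ⟨y, hy⟩).tsum_eq]
      exact tsum_congr fun k => (zeroExt_eq (γ k) ⟨y, hy⟩).symm)).fderiv
  rw [evalAt_apply, deriv_apply, pd, h2, _root_.sum_apply, Finset.sum_eq_single i]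
  · simp [prj_apply, zeroExt_eq]
  · intro b _ hb; simp [prj_apply, Pi.single_eq_of_ne hb]
  · simp

theorem deriv_ofFun_eq {F : (κ → ℝ) → ℂ} (hF : ContDiffOn ℝ ∞ F V) (i : κ) :
    deriv V i (ofFun V F hF) = ofFun V (pd i F) (contDiffOn_pd hF i) :=
  evalAt_injective fun x => by
    rw [evalAt_apply, deriv_apply]
    exact pd_congrOn (fun y hy => zeroExt_of_mem V _ hy) x.2 i

/-- A partial derivative is the total derivative followed by evaluation at a basis vector, and that
evaluation has norm at most one since the vector has sup norm one. -/
theorem norm_iteratedFDeriv_pd_le {F : (κ → ℝ) → ℂ} {x : κ → ℝ} (hF : ContDiffAt ℝ ∞ F x) (i : κ)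
    (n : ℕ) : ‖iteratedFDeriv ℝ n (pd i F) x‖ ≤ ‖iteratedFDeriv ℝ (n + 1) F x‖ := by
  have h1 : ContDiffAt ℝ ∞ (fderiv ℝ F) x := hF.fderiv_right (m := ∞) (by simp)
  let L : ((κ → ℝ) →L[ℝ] ℂ) →L[ℝ] ℂ := ContinuousLinearMap.apply ℝ ℂ (Pi.single i 1)
  have h2 := L.norm_iteratedFDeriv_comp_left h1 (n := n) (by exact_mod_cast le_top)
  have hL : ‖L‖ ≤ 1 := ContinuousLinearMap.opNorm_le_bound _ zero_le_one fun z => by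
    rw [one_mul]
    refine (z.le_opNorm (Pi.single i 1)).trans ?_
    rw [Pi.norm_single, norm_one, mul_one]
  rw [← norm_iteratedFDeriv_fderiv]
  exact h2.trans (mul_le_of_le_one_left (norm_nonneg _) hL)

/-- Normal convergence of the Taylor coefficients gives normal convergence in the ring. -/
theorem nc_of_iteratedFDeriv {G : J → (κ → ℝ) → ℂ} (hG : ∀ k, ContDiffOn ℝ ∞ (G k) V)
    {s : Set J} (hs : s.Finite)
    (hb : ∀ (n : ℕ) (K : Set (κ → ℝ)), IsCompact K → K ⊆ V → ∃ u : J → ℝ, Summable u ∧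
      ∀ k ∉ s, ∀ x ∈ K, ‖iteratedFDeriv ℝ n (G k) x‖ ≤ u k) :
    NC fun k => ofFun V (G k) (hG k) := by
  intro n
  induction n generalizing G with
  | zero =>
    intro K hK hKV
    obtain ⟨u, hu, hu'⟩ := hb 0 K hK hKV
    choose C hC0 hC using fun k => exists_bound (ofFun V (G k) (hG k)) hK hKV
    classical
    -- No uniform bound is assumed on the finite exceptional set. There the bound of each single
    -- function on the compact set is used, and changing finitely many terms does not affect
    -- summability.
    refine ⟨fun k => if k ∈ s then C k else u k, ?_, fun k x hx => ?_⟩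
    · refine (summable_congr_cofinite ?_).1 hu
      filter_upwards [hs.compl_mem_cofinite] with k hk
      exact (if_neg hk).symm
    · by_cases hk : k ∈ s
      · simp only [if_pos hk]; exact hC k x hx
      · simp only [if_neg hk]
        exact (norm_iteratedFDeriv_zero (𝕜 := ℝ) (f := G k)).symm.trans_le (hu' k hk x hx)
  | succ n ih =>
    refine ⟨ih hG hb, fun i => ?_⟩
    simp only [deriv_ofFun_eq]
    refine ih (fun k => contDiffOn_pd (hG k) i) fun m K hK hKV => ?_
    obtain ⟨u, hu, hu'⟩ := hb (m + 1) K hK hKV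
    exact ⟨u, hu, fun k hk x hx => (norm_iteratedFDeriv_pd_le
      ((hG k).contDiffAt (V.isOpen.mem_nhds (hKV hx))) i m).trans (hu' k hk x hx)⟩

end Families

/-! ### The Legendre equation -/

section Legendre

-- The polynomial U = (X² - 1)^l satisfies (X² - 1) U' = 2l X U. Differentiating this j + 1 times
-- gives the relation; the case j = l + m is the differential equation of the m-th derivative of
-- P_l.
open Polynomial in
theorem legendre_ode (l j : ℕ) :
    (X ^ 2 - 1) * derivative^[j + 2] ((X ^ 2 - 1 : ℝ[X]) ^ l)
      + C (2 * ((j : ℝ) + 1 - l)) * X * derivative^[j + 1] ((X ^ 2 - 1 : ℝ[X]) ^ l)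
      + C (((j : ℝ) + 1) * (j - 2 * l)) * derivative^[j] ((X ^ 2 - 1 : ℝ[X]) ^ l) = 0 := by
  induction j with
  | zero =>
    have h0 : (X ^ 2 - 1) * derivative ((X ^ 2 - 1 : ℝ[X]) ^ l)
        = C (2 * (l : ℝ)) * X * (X ^ 2 - 1 : ℝ[X]) ^ l := by
      rcases l with _ | l
      · simp
      · rw [derivative_pow_succ]
        simp only [derivative_sub, derivative_X_pow, derivative_one, map_mul, map_add, map_one,
          map_natCast, Nat.cast_succ, Nat.cast_ofNat, map_ofNat, sub_zero]
        ring
    have h1 := congrArg derivative h0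
    simp only [derivative_mul, derivative_sub, derivative_X_pow, derivative_one, derivative_C,
      derivative_X, map_natCast, Nat.cast_ofNat, sub_zero, zero_mul, zero_add, mul_one] at h1
    simp only [Function.iterate_succ, Function.iterate_zero, Function.comp, id, Nat.cast_zero,
      map_mul, map_add, map_sub, map_one, map_natCast, map_ofNat, map_zero] at h1 ⊢
    simp only [Nat.add_one_sub_one, pow_one] at h1
    linear_combination h1
  | succ j ih =>
    have h1 := congrArg derivative ih
    simp only [derivative_mul, derivative_add, derivative_sub, derivative_X_pow, derivative_one, derivative_C,
      derivative_X, map_natCast, Nat.cast_ofNat, sub_zero, zero_mul, zero_add, mul_one,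
      ← Function.iterate_succ_apply' derivative, derivative_zero] at h1
    simp only [Nat.succ_eq_add_one, add_assoc, Nat.cast_add, Nat.cast_one,
      map_mul, map_add, map_sub, map_one, map_natCast, map_ofNat, map_zero] at h1 ⊢
    norm_num at h1 ⊢
    linear_combination h1

end Legendre

/-! ### The angular equation -/

section Angular

/-- `A'' + cot θ A' + λ A = (μ / sin² θ) A` on `(0, π)`, with `A' = A₁`, `A'' = A₂`. -/
structure Sturm (lam mu : ℝ) (A A1 A2 : ℝ → ℝ) : Prop where
  smooth : ContDiffOn ℝ ∞ A (Set.Ioo 0 Real.pi)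
  d1 : ∀ t ∈ Set.Ioo 0 Real.pi, HasDerivAt A (A1 t) t
  d2 : ∀ t ∈ Set.Ioo 0 Real.pi, HasDerivAt A1 (A2 t) t
  ode : ∀ t ∈ Set.Ioo 0 Real.pi,
    A2 t + Real.cos t / Real.sin t * A1 t + lam * A t = mu / Real.sin t ^ 2 * A t

theorem sin_pos {t : ℝ} (ht : t ∈ Set.Ioo 0 Real.pi) : 0 < Real.sin t :=
  Real.sin_pos_of_pos_of_lt_pi ht.1 ht.2

/-- The associated Legendre function of `cos θ`. -/
def legA (l m : ℕ) (t : ℝ) : ℝ := Real.sin t ^ m * legendreDeriv l m (Real.cos t)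

theorem hasDerivAt_legendreDeriv (l m : ℕ) (z : ℝ) :
    HasDerivAt (legendreDeriv l m) (legendreDeriv l (m + 1) z) z := by
  unfold legendreDeriv
  have := (Polynomial.hasDerivAt (Polynomial.derivative^[l + m]
    ((Polynomial.X ^ 2 - 1 : Polynomial ℝ) ^ l)) z).div_const (2 ^ l * (l.factorial : ℝ))
  rw [← Function.iterate_succ_apply' Polynomial.derivative] at this
  exact this

theorem legendreDeriv_ode (l m : ℕ) (z : ℝ) :
    (z ^ 2 - 1) * legendreDeriv l (m + 2) z + 2 * (m + 1) * z * legendreDeriv l (m + 1) z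
      + (l + m + 1) * (m - l) * legendreDeriv l m z = 0 := by
  have h := congrArg (Polynomial.eval z) (legendre_ode l (l + m))
  simp only [Polynomial.eval_add, Polynomial.eval_mul, Polynomial.eval_sub, Polynomial.eval_pow,
    Polynomial.eval_X, Polynomial.eval_one, Polynomial.eval_C, Polynomial.eval_zero] at h
  push_cast at h
  unfold legendreDeriv
  simp only [← add_assoc]
  linear_combination (1 / (2 ^ l * (l.factorial : ℝ))) * h

theorem contDiff_legendreDeriv (l m : ℕ) : ContDiff ℝ ∞ (legendreDeriv l m) :=
by
  have := (Polynomial.contDiff_aeval (𝕜 := ℝ) (Polynomial.derivative^[l + m]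
    ((Polynomial.X ^ 2 - 1 : Polynomial ℝ) ^ l)) ∞).div_const (2 ^ l * (l.factorial : ℝ))
  simp only [Polynomial.coe_aeval_eq_eval] at this
  unfold legendreDeriv
  exact this

theorem contDiff_legA (l m : ℕ) : ContDiff ℝ ∞ (legA l m) :=
  (Real.contDiff_sin.pow m).mul ((contDiff_legendreDeriv l m).comp Real.contDiff_cos)

theorem hasDerivAt_sin_pow (m : ℕ) {t : ℝ} (ht : Real.sin t ≠ 0) :
    HasDerivAt (fun t => Real.sin t ^ m) (m * Real.sin t ^ m * (Real.cos t / Real.sin t)) t := by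
  refine ((Real.hasDerivAt_sin t).pow m).congr_deriv ?_
  rcases m with _ | m
  · simp
  · rw [Nat.add_sub_cancel, pow_succ]; field_simp

theorem hasDerivAt_legA (l m : ℕ) {t : ℝ} (ht : Real.sin t ≠ 0) :
    HasDerivAt (legA l m) (Real.sin t ^ m * (m * (Real.cos t / Real.sin t)
      * legendreDeriv l m (Real.cos t) - Real.sin t * legendreDeriv l (m + 1) (Real.cos t))) t := by
  have h2 := (hasDerivAt_legendreDeriv l m (Real.cos t)).comp t (Real.hasDerivAt_cos t)
  refine ((hasDerivAt_sin_pow m ht).mul h2).congr_deriv ?_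
  simp only [Function.comp]
  ring

theorem hasDerivAt_cot {t : ℝ} (ht : Real.sin t ≠ 0) :
    HasDerivAt (fun t => Real.cos t / Real.sin t) (-(1 / Real.sin t ^ 2)) t := by
  refine ((Real.hasDerivAt_cos t).div (Real.hasDerivAt_sin t) ht).congr_deriv ?_
  have := Real.sin_sq_add_cos_sq t
  field_simp
  linarith

/-- Substituting sin^m θ times the m-th derivative of P_l at cos θ turns the Legendre equation for
that derivative into the associated one, with μ = m². -/
theorem sturm_legA (l m : ℕ) : ∃ A1 A2, Sturm (l * (l + 1)) (m ^ 2) (legA l m) A1 A2 := by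
  refine ⟨fun t => Real.sin t ^ m * (m * (Real.cos t / Real.sin t)
      * legendreDeriv l m (Real.cos t) - Real.sin t * legendreDeriv l (m + 1) (Real.cos t)), ?w,
    (contDiff_legA l m).contDiffOn, fun t ht => hasDerivAt_legA l m (sin_pos ht).ne',
    fun t ht => ?_, ?_⟩
  case w => exact fun t => m * Real.sin t ^ m * (Real.cos t / Real.sin t) * (m * (Real.cos t / Real.sin t)
      * legendreDeriv l m (Real.cos t) - Real.sin t * legendreDeriv l (m + 1) (Real.cos t))
      + Real.sin t ^ m * (m * (-(1 / Real.sin t ^ 2)) * legendreDeriv l m (Real.cos t)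
        + m * (Real.cos t / Real.sin t) * (legendreDeriv l (m + 1) (Real.cos t) * -Real.sin t)
        - (Real.cos t * legendreDeriv l (m + 1) (Real.cos t)
          + Real.sin t * (legendreDeriv l (m + 2) (Real.cos t) * -Real.sin t)))
  · have hs := (sin_pos ht).ne'
    have h1 := (hasDerivAt_legendreDeriv l m (Real.cos t)).comp t (Real.hasDerivAt_cos t)
    have h2 := (hasDerivAt_legendreDeriv l (m + 1) (Real.cos t)).comp t (Real.hasDerivAt_cos t)
    exact (hasDerivAt_sin_pow m hs).mul ((((hasDerivAt_cot hs).const_mul (m : ℝ)).mul h1).sub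
      ((Real.hasDerivAt_sin t).mul h2))
  · intro t ht
    have hs := (sin_pos ht).ne'
    have h := legendreDeriv_ode l m (Real.cos t)
    have h2 := Real.sin_sq_add_cos_sq t
    simp only [legA]
    -- The Legendre equation is solved for the highest derivative, with z² - 1 = -sin² θ. Afterwards
    -- only two independent derivatives remain.
    have e : Real.sin t ^ 2 * (legendreDeriv l (m + 2) (Real.cos t))
        = 2 * (m + 1) * Real.cos t * legendreDeriv l (m + 1) (Real.cos t)
          + (l + m + 1) * (m - l) * legendreDeriv l m (Real.cos t) := by
      rw [Real.sin_sq]; linear_combination -h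
    have e2 : legendreDeriv l (m + 2) (Real.cos t) = (2 * (m + 1) * Real.cos t
        * legendreDeriv l (m + 1) (Real.cos t)
          + (l + m + 1) * (m - l) * legendreDeriv l m (Real.cos t)) / Real.sin t ^ 2 := by
      rw [← e]; field_simp
    rw [e2]
    field_simp
    linear_combination ((m : ℝ) ^ 2 + m) * legendreDeriv l m (Real.cos t) * h2

/-- `½ ln ((1 + cos θ) / (1 - cos θ))`. -/
def lnc (t : ℝ) : ℝ := (1 / 2) * Real.log ((1 + Real.cos t) / (1 - Real.cos t))

theorem one_add_cos_pos {t : ℝ} (ht : t ∈ Set.Ioo 0 Real.pi) : 0 < 1 + Real.cos t := by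
  nlinarith [Real.sin_sq_add_cos_sq t, sin_pos ht, pow_pos (sin_pos ht) 2, Real.cos_le_one t]

theorem one_sub_cos_pos {t : ℝ} (ht : t ∈ Set.Ioo 0 Real.pi) : 0 < 1 - Real.cos t := by
  nlinarith [Real.sin_sq_add_cos_sq t, sin_pos ht, pow_pos (sin_pos ht) 2, Real.neg_one_le_cos t]

theorem hasDerivAt_lnc {t : ℝ} (ht : t ∈ Set.Ioo 0 Real.pi) :
    HasDerivAt lnc (-(1 / Real.sin t)) t := by
  have h1 := one_add_cos_pos ht
  have h2 := one_sub_cos_pos ht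
  have hs := sin_pos ht
  have := ((((Real.hasDerivAt_cos t).const_add 1).div ((Real.hasDerivAt_cos t).const_sub 1)
    h2.ne').log (div_pos h1 h2).ne').const_mul (1 / 2 : ℝ)
  refine this.congr_deriv ?_
  have e := Real.sin_sq_add_cos_sq t
  simp only [Pi.div_apply]
  field_simp
  linear_combination (-2) * e

theorem contDiffOn_lnc : ContDiffOn ℝ ∞ lnc (Set.Ioo 0 Real.pi) :=
  contDiffOn_const.mul (((contDiffOn_const.add Real.contDiff_cos.contDiffOn).div
    (contDiffOn_const.sub Real.contDiff_cos.contDiffOn)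
      fun _ ht => (one_sub_cos_pos ht).ne').log
    fun _ ht => (div_pos (one_add_cos_pos ht) (one_sub_cos_pos ht)).ne')

/-- `lnc` is the Legendre function Q₀ of cos θ, with derivative -1/sin θ. The terms with δ in the
low harmonics are second solutions built from it: -Q₀ for l = 0, Q₁ for l = 1 and m = 0, and sin θ
Q₀ + cot θ for l = 1 and m = ±1. They are singular at the poles, which is harmless on the open
interval. -/
theorem sturm_zero (δ : ℝ) : Sturm 0 0 (fun t => 1 - δ * lnc t) (fun t => δ * (1 / Real.sin t))
    (fun t => -(δ * (Real.cos t / Real.sin t ^ 2))) where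
  smooth := contDiffOn_const.sub (contDiffOn_const.mul contDiffOn_lnc)
  d1 t ht := (((hasDerivAt_lnc ht).const_mul δ).const_sub 1).congr_deriv (by ring)
  d2 t ht := by
    have hs := (sin_pos ht).ne'
    refine (((hasDerivAt_const t (1 : ℝ)).div (Real.hasDerivAt_sin t) hs).const_mul δ).congr_deriv ?_
    field_simp
    ring
  ode t ht := by
    have hs := (sin_pos ht).ne'
    field_simp
    ring

theorem sturm_one_zero (δ : ℝ) : Sturm 2 0 (fun t => Real.cos t + δ * (Real.cos t * lnc t - 1))
    (fun t => -Real.sin t + δ * (-(Real.sin t * lnc t) - Real.cos t / Real.sin t))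
    (fun t => -Real.cos t + δ * (-(Real.cos t * lnc t) + 1 + 1 / Real.sin t ^ 2)) where
  smooth := Real.contDiff_cos.contDiffOn.add (contDiffOn_const.mul
    ((Real.contDiff_cos.contDiffOn.mul contDiffOn_lnc).sub contDiffOn_const))
  d1 t ht := by
    have hs := (sin_pos ht).ne'
    refine ((Real.hasDerivAt_cos t).add ((((Real.hasDerivAt_cos t).mul
      (hasDerivAt_lnc ht)).sub_const 1).const_mul δ)).congr_deriv ?_
    ring
  d2 t ht := by
    have hs := (sin_pos ht).ne'
    refine ((Real.hasDerivAt_sin t).neg.add ((((Real.hasDerivAt_sin t).mul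
      (hasDerivAt_lnc ht)).neg.sub (hasDerivAt_cot hs)).const_mul δ)).congr_deriv ?_
    field_simp
    ring
  ode t ht := by
    have hs := (sin_pos ht).ne'
    have e := Real.sin_sq_add_cos_sq t
    field_simp
    linear_combination (-δ) * e

theorem sturm_one_one (δ : ℝ) : Sturm 2 1
    (fun t => Real.sin t + δ * (Real.sin t * lnc t + Real.cos t / Real.sin t))
    (fun t => Real.cos t + δ * (Real.cos t * lnc t - 1 - 1 / Real.sin t ^ 2))
    (fun t => -Real.sin t + δ * (-(Real.sin t * lnc t) - Real.cos t / Real.sin t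
      + 2 * Real.cos t / Real.sin t ^ 3)) where
  smooth := Real.contDiff_sin.contDiffOn.add (contDiffOn_const.mul
    ((Real.contDiff_sin.contDiffOn.mul contDiffOn_lnc).add
      (Real.contDiff_cos.contDiffOn.div Real.contDiff_sin.contDiffOn fun t ht => (sin_pos ht).ne')))
  d1 t ht := by
    have hs := (sin_pos ht).ne'
    refine ((Real.hasDerivAt_sin t).add ((((Real.hasDerivAt_sin t).mul
      (hasDerivAt_lnc ht)).add (hasDerivAt_cot hs)).const_mul δ)).congr_deriv ?_
    field_simp
    ring
  d2 t ht := by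
    have hs := (sin_pos ht).ne'
    refine ((Real.hasDerivAt_cos t).add (((((Real.hasDerivAt_cos t).mul
      (hasDerivAt_lnc ht)).sub_const 1).sub ((hasDerivAt_const t (1 : ℝ)).div
        ((Real.hasDerivAt_sin t).pow 2) (pow_ne_zero 2 hs))).const_mul δ)).congr_deriv ?_
    simp only [Pi.pow_apply]
    field_simp
    ring
  ode t ht := by
    have hs := (sin_pos ht).ne'
    field_simp
    have e := Real.sin_sq_add_cos_sq t
    linear_combination (Real.sin t ^ 2 * (1 + δ * lnc t)) * e

theorem Sturm.const_mul {lam mu : ℝ} {A A1 A2 : ℝ → ℝ} (h : Sturm lam mu A A1 A2) (c : ℝ) :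
    Sturm lam mu (fun t => c * A t) (fun t => c * A1 t) (fun t => c * A2 t) where
  smooth := contDiffOn_const.mul h.smooth
  d1 t ht := (h.d1 t ht).const_mul c
  d2 t ht := (h.d2 t ht).const_mul c
  ode t ht := by linear_combination c * h.ode t ht

/-- The normalization of `Y_{lm}`, with its sign. -/
def normY (k : Mode) : ℝ :=
  (if k.m < 0 then (-1) ^ k.m.natAbs else 1) * Real.sqrt ((2 * k.l + 1)
    * ((k.l - k.m.natAbs).factorial : ℝ) / (4 * Real.pi * ((k.l + k.m.natAbs).factorial : ℝ)))

theorem normY_ne_zero (k : Mode) : normY k ≠ 0 := by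
  have h1 : 0 < (2 * (k.l : ℝ) + 1)
    * ((k.l - k.m.natAbs).factorial : ℝ) / (4 * Real.pi * ((k.l + k.m.natAbs).factorial : ℝ)) := by
    have := Real.pi_pos
    positivity
  refine mul_ne_zero ?_ (Real.sqrt_pos.2 h1).ne'
  split_ifs
  · exact pow_ne_zero _ (by norm_num)
  · exact one_ne_zero

/-- The factor of `S_δ` that depends on `θ`. -/
def thetaPart (δ : ℝ) (k : Mode) : ℝ → ℝ :=
  if k.l = 0 then fun t => 1 - δ * lnc t
  else if k.l = 1 then
    if k.m = 0 then fun t => Real.cos t + δ * (Real.cos t * lnc t - 1)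
    else fun t => Real.sin t + δ * (Real.sin t * lnc t + Real.cos t / Real.sin t)
  else fun t => normY k * legA k.l k.m.natAbs t

theorem sphericalY_eq (k : Mode) (s : Plane) : sphericalY k s
    = ((normY k * legA k.l k.m.natAbs (s 0) : ℝ) : ℂ)
      * Complex.exp (Complex.I * (k.m : ℂ) * ((s 1 : ℝ) : ℂ)) := by
  unfold sphericalY normY legA
  split_ifs <;> push_cast <;> ring

theorem Mode.m_eq_zero {k : Mode} (h : k.l = 0) : k.m = 0 := by
  have := k.abs_le
  rw [h] at this
  exact abs_nonpos_iff.1 (by simpa using this)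

theorem Mode.m_sq {k : Mode} (h : k.l = 1) (h0 : k.m ≠ 0) : (k.m : ℝ) ^ 2 = 1 := by
  have := k.abs_le
  rw [h] at this
  have h2 : |k.m| = 1 := le_antisymm (by simpa using this) (Int.one_le_abs h0)
  have : (|k.m| : ℤ) ^ 2 = 1 := by rw [h2]; rfl
  rw [sq_abs] at this
  exact_mod_cast this

/-- Separation of variables. The restriction to the open interval matters for the logarithm: there
its argument is positive, so for l = 0 the logarithm of the square root is -`lnc`. -/
theorem harm_eq (δ : ℝ) (k : Mode) {s : Plane} (hs : s 0 ∈ Set.Ioo 0 Real.pi) : harm δ k s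
    = ((thetaPart δ k (s 0) : ℝ) : ℂ) * Complex.exp (Complex.I * (k.m : ℂ) * ((s 1 : ℝ) : ℂ)) := by
  unfold harm thetaPart
  have e : Real.cot (s 0) = Real.cos (s 0) / Real.sin (s 0) := Real.cot_eq_cos_div_sin _
  by_cases h0 : k.l = 0
  · rw [if_pos h0, if_pos h0, k.m_eq_zero h0, kernelZero, lnc]
    have h1 : (1 - Real.cos (s 0)) / (1 + Real.cos (s 0))
        = ((1 + Real.cos (s 0)) / (1 - Real.cos (s 0)))⁻¹ := by rw [inv_div]
    rw [Real.log_sqrt (div_pos (one_sub_cos_pos hs) (one_add_cos_pos hs)).le, h1, Real.log_inv]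
    push_cast
    simp only [mul_zero, zero_mul, Complex.exp_zero, mul_one]
    ring
  · rw [if_neg h0, if_neg h0]
    by_cases h1 : k.l = 1
    · rw [if_pos h1, if_pos h1]
      unfold kernelOne lnc
      by_cases hm : k.m = 0
      · rw [if_pos hm, if_pos hm, hm]
        push_cast
        simp only [mul_zero, zero_mul, Complex.exp_zero, mul_one]
        ring
      · rw [if_neg hm, if_neg hm, e]
        push_cast
        ring
    · rw [if_neg h1, if_neg h1, sphericalY_eq]

theorem sturm_thetaPart (δ : ℝ) (k : Mode) :
    ∃ A1 A2, Sturm (k.l * (k.l + 1)) ((k.m : ℝ) ^ 2) (thetaPart δ k) A1 A2 := by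
  unfold thetaPart
  by_cases h0 : k.l = 0
  · rw [if_pos h0, k.m_eq_zero h0, h0]
    simpa using ⟨_, _, sturm_zero δ⟩
  · rw [if_neg h0]
    by_cases h1 : k.l = 1
    · rw [if_pos h1, h1]
      by_cases hm : k.m = 0
      · rw [if_pos hm, hm]
        have := sturm_one_zero δ
        norm_num
        exact ⟨_, _, this⟩
      · rw [if_neg hm, k.m_sq h1 hm]
        have := sturm_one_one δ
        norm_num
        exact ⟨_, _, this⟩
    · rw [if_neg h1]
      obtain ⟨A1, A2, h⟩ := sturm_legA k.l k.m.natAbs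
      have := h.const_mul (normY k)
      have e : ((k.m.natAbs : ℕ) : ℝ) ^ 2 = (k.m : ℝ) ^ 2 := by
        rw [← Int.cast_natCast, ← Int.cast_pow, Int.natAbs_sq, Int.cast_pow]
      rw [e] at this
      exact ⟨_, _, this⟩

end Angular

/-! ### Harmonics and mode coefficients as elements of the ring -/

section Elements

variable {Ω : Set Plane} (hΩ : IsOpen Ω)

theorem contDiffOn_base {c : Plane → ℂ} (hc : ContDiffOn ℝ ∞ c Ω) :
    ContDiffOn ℝ ∞ (fun x : Pt => c (base x)) (chartO Ω hΩ) := by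
  have hb : ContDiff ℝ ∞ base := by unfold base; fun_prop
  exact hc.comp hb.contDiffOn fun x hx => (mem_chart hΩ ⟨x, hx⟩).1

/-- A function on the orbit space. -/
def baseR (c : Plane → ℂ) (hc : ContDiffOn ℝ ∞ c Ω) : smoothRing (chartO Ω hΩ) :=
  ofFun _ (fun x => c (base x)) (contDiffOn_base hΩ hc)

theorem rep_baseR {c : Plane → ℂ} (hc : ContDiffOn ℝ ∞ c Ω) :
    Rep (V := chartO Ω hΩ) Sum.inl c (baseR hΩ c hc) := fun _ => rfl

theorem contDiffOn_pd' {c : Plane → ℂ} (hΩ : IsOpen Ω) (hc : ContDiffOn ℝ ∞ c Ω) (A : Fin 2) :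
    ContDiffOn ℝ ∞ (pd A c) Ω := contDiffOn_pd (V := ⟨Ω, hΩ⟩) hc A

theorem deriv_baseR {c : Plane → ℂ} (hc : ContDiffOn ℝ ∞ c Ω) (A : Fin 2) :
    deriv _ (Sum.inl A) (baseR hΩ c hc) = baseR hΩ (pd A c) (contDiffOn_pd' hΩ hc A) :=
  evalAt_injective fun x => ((rep_baseR hΩ hc).pd Sum.inl_injective A x).symm

theorem pd_eq_zero_of_indep {κ : Type} [Fintype κ] [DecidableEq κ] {F : (κ → ℝ) → ℂ} {i : κ}
    (h : ∀ x (t : ℝ), F (x + t • Pi.single i 1) = F x) (x : κ → ℝ) : pd i F x = 0 := by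
  by_cases hd : DifferentiableAt ℝ F x
  · have h1 : HasDerivAt (fun t : ℝ => F (x + t • Pi.single i 1)) (pd i F x) 0 := by
      have h2 : HasDerivAt (fun t : ℝ => x + t • (Pi.single i 1 : κ → ℝ)) (Pi.single i 1) 0 := by
        simpa using ((hasDerivAt_id (0 : ℝ)).smul_const (Pi.single i 1 : κ → ℝ)).const_add x
      have h3 : HasFDerivAt F (fderiv ℝ F x) (x + (0 : ℝ) • (Pi.single i 1 : κ → ℝ)) := by
        simpa using hd.hasFDerivAt
      exact h3.comp_hasDerivAt (0 : ℝ) h2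
    simp only [h] at h1
    exact h1.unique (hasDerivAt_const _ _)
  -- At points where F is not differentiable, `fderiv` has the default value zero, so the claim
  -- holds there as well.
  · rw [pd, fderiv_zero_of_not_differentiableAt hd]; rfl

theorem isBase_baseR {c : Plane → ℂ} (hc : ContDiffOn ℝ ∞ c Ω) :
    IsBase (deriv _) (baseR hΩ c hc) := fun p => evalAt_injective fun x => by
  rw [baseR, deriv_ofFun, map_zero]
  refine pd_eq_zero_of_indep (fun y t => ?_) _
  congr 1
  funext A
  simp [base]

/-- A function of `θ`. -/
def thR (A : ℝ → ℝ) (hA : ContDiffOn ℝ ∞ A (Set.Ioo 0 Real.pi)) : smoothRing (chartO Ω hΩ) :=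
  ofFun _ (fun x : Pt => ((A (x (Sum.inr 0)) : ℝ) : ℂ))
    (contDiffOn_coord hΩ (a := Sum.inr 0) (contDiff_ofReal.comp_contDiffOn hA)
      fun x => (mem_chart hΩ x).2)

theorem contDiffOn_of_hasDerivAt {A A1 : ℝ → ℝ} {s : Set ℝ} (hs : IsOpen s)
    (hA : ContDiffOn ℝ ∞ A s) (h : ∀ t ∈ s, HasDerivAt A (A1 t) t) : ContDiffOn ℝ ∞ A1 s :=
  ((contDiffOn_infty_iff_deriv_of_isOpen hs).1 hA).2.congr fun t ht => (h t ht).deriv.symm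

theorem evalAt_thR {A : ℝ → ℝ} (hA : ContDiffOn ℝ ∞ A (Set.Ioo 0 Real.pi)) (x : chartO Ω hΩ) :
    evalAt x (thR hΩ A hA) = ((A (x.1 (Sum.inr 0)) : ℝ) : ℂ) := rfl

theorem deriv_thR {A A1 : ℝ → ℝ} (hA : ContDiffOn ℝ ∞ A (Set.Ioo 0 Real.pi))
    (hA1 : ContDiffOn ℝ ∞ A1 (Set.Ioo 0 Real.pi))
    (h : ∀ t ∈ Set.Ioo 0 Real.pi, HasDerivAt A (A1 t) t) :
    deriv _ (Sum.inr 0) (thR hΩ A hA) = thR hΩ A1 hA1 :=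
  evalAt_injective fun x => by
    rw [thR, deriv_coord hΩ (φ := fun t => ((A t : ℝ) : ℂ)) (ψ := fun t => ((A1 t : ℝ) : ℂ)) _
      fun x => (h _ (mem_chart hΩ x).2).ofReal_comp, if_pos rfl]
    rfl

theorem deriv_thR_of_ne {A A1 : ℝ → ℝ} (hA : ContDiffOn ℝ ∞ A (Set.Ioo 0 Real.pi))
    (h : ∀ t ∈ Set.Ioo 0 Real.pi, HasDerivAt A (A1 t) t) {a : Fin 2 ⊕ Fin 2} (ha : a ≠ Sum.inr 0) :
    deriv _ a (thR hΩ A hA) = 0 :=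
  evalAt_injective fun x => by
    rw [thR, deriv_coord hΩ (φ := fun t => ((A t : ℝ) : ℂ)) (ψ := fun t => ((A1 t : ℝ) : ℂ)) _
      fun x => (h _ (mem_chart hΩ x).2).ofReal_comp, if_neg ha, map_zero]

theorem contDiff_exp_phi (m : ℤ) :
    ContDiff ℝ ∞ fun t : ℝ => Complex.exp (Complex.I * (m : ℂ) * ((t : ℝ) : ℂ)) :=
  (contDiff_const.mul contDiff_ofReal).cexp

/-- The function `e^{imφ}`. -/
def exR (m : ℤ) : smoothRing (chartO Ω hΩ) :=
  ofFun _ (fun x : Pt => Complex.exp (Complex.I * (m : ℂ) * ((x (Sum.inr 1) : ℝ) : ℂ)))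
    (contDiffOn_coord hΩ (a := Sum.inr 1) (s := Set.univ) (contDiff_exp_phi m).contDiffOn
      fun _ => trivial)

theorem evalAt_exR (m : ℤ) (x : chartO Ω hΩ) : evalAt x (exR hΩ m)
    = Complex.exp (Complex.I * (m : ℂ) * ((x.1 (Sum.inr 1) : ℝ) : ℂ)) := rfl

theorem hasDerivAt_exp_phi (m : ℤ) (t : ℝ) :
    HasDerivAt (fun t : ℝ => Complex.exp (Complex.I * (m : ℂ) * ((t : ℝ) : ℂ)))
      (Complex.I * (m : ℂ) * Complex.exp (Complex.I * (m : ℂ) * ((t : ℝ) : ℂ))) t :=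
  (((hasDerivAt_ofReal t).const_mul (Complex.I * (m : ℂ))).cexp).congr_deriv (by ring)

theorem deriv_exR (m : ℤ) : deriv _ (Sum.inr 1) (exR hΩ m) = (Complex.I * (m : ℂ)) • exR hΩ m :=
  evalAt_injective fun x => by
    rw [exR, deriv_coord hΩ (φ := fun t : ℝ => Complex.exp (Complex.I * (m : ℂ) * ((t : ℝ) : ℂ)))
      (ψ := fun t => Complex.I * (m : ℂ) * Complex.exp (Complex.I * (m : ℂ) * ((t : ℝ) : ℂ)))
      _ fun x => hasDerivAt_exp_phi m _, if_pos rfl, ev_smul]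
    rfl

theorem deriv_exR_of_ne (m : ℤ) {a : Fin 2 ⊕ Fin 2} (ha : a ≠ Sum.inr 1) :
    deriv _ a (exR hΩ m) = 0 :=
  evalAt_injective fun x => by
    rw [exR, deriv_coord hΩ (φ := fun t : ℝ => Complex.exp (Complex.I * (m : ℂ) * ((t : ℝ) : ℂ)))
      (ψ := fun t => Complex.I * (m : ℂ) * Complex.exp (Complex.I * (m : ℂ) * ((t : ℝ) : ℂ)))
      _ fun x => hasDerivAt_exp_phi m _, if_neg ha, map_zero]

theorem smooth_thetaPart (δ : ℝ) (k : Mode) : ContDiffOn ℝ ∞ (thetaPart δ k) (Set.Ioo 0 Real.pi) := by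
  obtain ⟨A1, A2, h⟩ := sturm_thetaPart δ k
  exact h.smooth

/-- The harmonic `S_δ`. -/
def SR (δ : ℝ) (k : Mode) : smoothRing (chartO Ω hΩ) :=
  thR hΩ (thetaPart δ k) (smooth_thetaPart δ k) * exR hΩ k.m

theorem rep_SR (δ : ℝ) (k : Mode) : Rep (V := chartO Ω hΩ) Sum.inr (harm δ k) (SR hΩ δ k) :=
  fun x => by
    rw [SR, ev_mul, evalAt_thR, evalAt_exR]
    exact harm_eq δ k (s := sph x) (mem_chart hΩ x).2

theorem SR_derivs (δ : ℝ) (k : Mode) {A1 A2 : ℝ → ℝ} {lam mu : ℝ}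
    (h : Sturm lam mu (thetaPart δ k) A1 A2) (x : chartO Ω hΩ) :
    evalAt x (SR hΩ δ k) = thetaPart δ k (x.1 (Sum.inr 0)) * evalAt x (exR hΩ k.m) ∧
    evalAt x (deriv _ (Sum.inr 0) (SR hΩ δ k)) = A1 (x.1 (Sum.inr 0)) * evalAt x (exR hΩ k.m) ∧
    evalAt x (deriv _ (Sum.inr 1) (SR hΩ δ k))
      = thetaPart δ k (x.1 (Sum.inr 0)) * (Complex.I * k.m * evalAt x (exR hΩ k.m)) ∧
    evalAt x (deriv _ (Sum.inr 0) (deriv _ (Sum.inr 0) (SR hΩ δ k)))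
      = A2 (x.1 (Sum.inr 0)) * evalAt x (exR hΩ k.m) ∧
    evalAt x (deriv _ (Sum.inr 0) (deriv _ (Sum.inr 1) (SR hΩ δ k)))
      = A1 (x.1 (Sum.inr 0)) * (Complex.I * k.m * evalAt x (exR hΩ k.m)) ∧
    evalAt x (deriv _ (Sum.inr 1) (deriv _ (Sum.inr 1) (SR hΩ δ k)))
      = -((k.m : ℂ) ^ 2 * thetaPart δ k (x.1 (Sum.inr 0)) * evalAt x (exR hΩ k.m)) := by
  have hA1 := contDiffOn_of_hasDerivAt isOpen_Ioo h.smooth h.d1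
  have hA2 := contDiffOn_of_hasDerivAt isOpen_Ioo hA1 h.d2
  have n1 : (Sum.inr 0 : Fin 2 ⊕ Fin 2) ≠ Sum.inr 1 := by simp
  have e0 := deriv_thR hΩ (smooth_thetaPart δ k) hA1 h.d1
  have e1 := deriv_thR hΩ hA1 hA2 h.d2
  have e2 := deriv_thR_of_ne hΩ (smooth_thetaPart δ k) h.d1 n1.symm
  have e3 := deriv_exR_of_ne hΩ k.m n1
  have e4 := deriv_exR hΩ k.m
  unfold SR
  simp only [der_mul, der_smul, der_zero, e0, e1, e2, e3, e4, mul_zero, add_zero, zero_add,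
    smul_zero, ev_mul, ev_smul, evalAt_thR, true_and]
  and_intros
  all_goals first
    | ring1
    | linear_combination ((thetaPart δ k (x.1 (Sum.inr 0)) : ℝ) : ℂ) * (k.m : ℂ) ^ 2
      * evalAt x (exR hΩ k.m) * Complex.I_sq

theorem SR_base (δ : ℝ) (k : Mode) (A : Fin 2) : deriv _ (Sum.inl A) (SR hΩ δ k) = 0 := by
  obtain ⟨A1, A2, h⟩ := sturm_thetaPart δ k
  rw [SR, der_mul, deriv_exR_of_ne hΩ k.m (by simp),
    deriv_thR_of_ne hΩ (smooth_thetaPart δ k) h.d1 (by simp), mul_zero, mul_zero, add_zero]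

/-- The factor e^{imφ} turns ∂_φ² into -m², and the equation for the remaining factor is the angular
equation with μ = m². The value of δ plays no role, since the equation is only needed away from the
poles. -/
theorem isHarm_SR (δ : ℝ) (k : Mode) :
    IsHarm (deriv _) (sR hΩ) (kR hΩ) (SR hΩ δ k) k.ev where
  base := SR_base hΩ δ k
  lap := by
    obtain ⟨A1, A2, h⟩ := sturm_thetaPart δ k
    refine evalAt_injective fun x => ?_
    obtain ⟨h1, h2, h3, h4, h5, h6⟩ := SR_derivs hΩ δ k h x
    have es : evalAt x (sR hΩ) = ((Real.sin (x.1 (Sum.inr 0)) : ℝ) : ℂ) := rfl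
    have ek : evalAt x (kR hΩ) = ((Real.cos (x.1 (Sum.inr 0)) : ℝ) : ℂ)
      / ((Real.sin (x.1 (Sum.inr 0)) : ℝ) : ℂ) := rfl
    simp only [ev_neg, ev_mul, ev_add, ev_smul, h1, h2, h4, h6, es, ek, Mode.ev]
    have hs := sin_ne_zero hΩ x
    have hode := congrArg (fun z : ℝ => (z : ℂ)) (h.ode _ (mem_chart hΩ x).2)
    push_cast at hode hs ⊢
    field_simp at hode ⊢
    linear_combination evalAt x (exR hΩ k.m) * hode

end Elements

/-! ### Differential operators on the sphere -/

theorem Rep.congr_right {κ ι : Type} [Fintype κ] [DecidableEq κ] {V : Opens (κ → ℝ)} {j : ι → κ}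
    {F : (ι → ℝ) → ℂ} {f g : smoothRing V} (h : Rep j F f) (e : f = g) : Rep j F g := e ▸ h

section SphereOps

variable {Ω : Set Plane} (hΩ : IsOpen Ω) (M : ℝ) (hr : ∀ q ∈ Ω, 0 < q 1 ∧ q 1 ≠ 2 * M)
  {S : Plane → ℂ} {σ : smoothRing (chartO Ω hΩ)}

theorem rep_gradDn (h : Rep Sum.inr S σ) (p : Fin 2) :
    Rep Sum.inr (gradDn S p) (deriv _ (Sum.inr p) σ) := h.pd Sum.inr_injective p

theorem rep_gradUp (h : Rep Sum.inr S σ) (p : Fin 2) :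
    Rep Sum.inr (gradUp S p) (gamR (siR hΩ) p p * deriv _ (Sum.inr p) σ) := by
  refine (Rep.sum fun q => (rep_gam_inv hΩ p q).mul (rep_gradDn hΩ h q)).congr_right ?_
  revert p
  simp only [Fin.forall_fin_two, Fin.sum_univ_two, gamR_00, gamR_01, gamR_10, gamR_11]
  constructor <;> ring

/-- `ε_{pq}`. -/
def epsR (p q : Fin 2) : smoothRing (chartO Ω hΩ) := !![0, sR hΩ; -sR hΩ, 0] p q

theorem epsR_00 : epsR hΩ 0 0 = 0 := rfl
theorem epsR_01 : epsR hΩ 0 1 = sR hΩ := rfl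
theorem epsR_10 : epsR hΩ 1 0 = -sR hΩ := rfl
theorem epsR_11 : epsR hΩ 1 1 = 0 := rfl

theorem rep_epsDn : ∀ p q, Rep (V := chartO Ω hΩ) Sum.inr (epsDn p q) (epsR hΩ p q) := by
  simp only [Fin.forall_fin_two, epsR_00, epsR_01, epsR_10, epsR_11]
  exact ⟨⟨Rep.zero, fun _ => rfl⟩, fun _ => rfl, Rep.zero⟩

theorem rep_epsUp (p q : Fin 2) : Rep (V := chartO Ω hΩ) Sum.inr (epsUp p q)
    (∑ u, ∑ v, gamR (siR hΩ) p u * gamR (siR hΩ) q v * epsR hΩ u v) :=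
  Rep.sum fun u => Rep.sum fun v =>
    ((rep_gam_inv hΩ p u).mul (rep_gam_inv hΩ q v)).mul (rep_epsDn hΩ u v)

theorem sR_mul_siR : sR hΩ * siR hΩ = 1 :=
  evalAt_injective fun x => mul_inv_cancel₀ (sin_ne_zero hΩ x)

theorem rep_curlDn (h : Rep Sum.inr S σ) (p : Fin 2) :
    Rep Sum.inr (curlDn S p) (curlR (deriv _) (sR hΩ) (siR hΩ) σ p) := by
  refine (Rep.sum fun q => (rep_epsDn hΩ p q).mul (rep_gradUp hΩ h q)).congr_right ?_
  revert p
  simp only [Fin.forall_fin_two, Fin.sum_univ_two, gamR_00, gamR_11, epsR_00, epsR_01, epsR_10,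
    epsR_11, curlR_0, curlR_1]
  refine ⟨?_, by ring⟩
  linear_combination siR hΩ * deriv _ (Sum.inr 1) σ * sR_mul_siR hΩ

theorem rep_curlUp (h : Rep Sum.inr S σ) (p : Fin 2) : Rep Sum.inr (curlUp S p)
    (gamR (siR hΩ) p p * curlR (deriv _) (sR hΩ) (siR hΩ) σ p) := by
  refine (Rep.sum fun q => (rep_epsUp hΩ p q).mul (rep_gradDn hΩ h q)).congr_right ?_
  revert p
  simp only [Fin.forall_fin_two, Fin.sum_univ_two, gamR_00, gamR_01, gamR_10, gamR_11,
    epsR_00, epsR_01, epsR_10, epsR_11, curlR_0, curlR_1]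
  refine ⟨?_, by ring⟩
  linear_combination siR hΩ * deriv _ (Sum.inr 1) σ * sR_mul_siR hΩ

/-- `D_p D_q S`. -/
def hessR (σ : smoothRing (chartO Ω hΩ)) (p q : Fin 2) : smoothRing (chartO Ω hΩ) :=
  cv1 (fun p => deriv _ (Sum.inr p)) (chrS (sR hΩ) (kR hΩ)) (fun p => deriv _ (Sum.inr p) σ) p q

theorem rep_hessDn (M : ℝ) (hr : ∀ q ∈ Ω, 0 < q 1 ∧ q 1 ≠ 2 * M) (h : Rep Sum.inr S σ)
    (p q : Fin 2) : Rep Sum.inr (hessDn S p q) (hessR hΩ σ p q) :=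
  rep_cov1 Sum.inr_injective (rep_chrS hΩ M hr) (rep_gradDn hΩ h) p q

theorem rep_hessMix (M : ℝ) (hr : ∀ q ∈ Ω, 0 < q 1 ∧ q 1 ≠ 2 * M) (h : Rep Sum.inr S σ)
    (p q : Fin 2) : Rep Sum.inr (hessMix S p q) (gamR (siR hΩ) q q * hessR hΩ σ p q) := by
  refine (Rep.sum fun u => (rep_gam_inv hΩ q u).mul (rep_hessDn hΩ M hr h p u)).congr_right ?_
  revert q
  simp only [Fin.forall_fin_two, Fin.sum_univ_two, gamR_00, gamR_01, gamR_10, gamR_11]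
  constructor <;> ring

theorem rep_hessUp (M : ℝ) (hr : ∀ q ∈ Ω, 0 < q 1 ∧ q 1 ≠ 2 * M) (h : Rep Sum.inr S σ)
    (p q : Fin 2) : Rep Sum.inr (hessUp S p q)
      (gamR (siR hΩ) p p * (gamR (siR hΩ) q q * hessR hΩ σ p q)) := by
  refine (Rep.sum fun u => (rep_gam_inv hΩ p u).mul (rep_hessMix hΩ M hr h u q)).congr_right ?_
  revert p
  simp only [Fin.forall_fin_two, Fin.sum_univ_two, gamR_00, gamR_01, gamR_10, gamR_11]
  constructor <;> ring

theorem hessR_table : hessR hΩ σ 0 0 = deriv _ (Sum.inr 0) (deriv _ (Sum.inr 0) σ) ∧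
    hessR hΩ σ 0 1 = deriv _ (Sum.inr 0) (deriv _ (Sum.inr 1) σ) - kR hΩ * deriv _ (Sum.inr 1) σ ∧
    hessR hΩ σ 1 0 = deriv _ (Sum.inr 0) (deriv _ (Sum.inr 1) σ) - kR hΩ * deriv _ (Sum.inr 1) σ ∧
    hessR hΩ σ 1 1 = deriv _ (Sum.inr 1) (deriv _ (Sum.inr 1) σ)
      + sR hΩ * sR hΩ * kR hΩ * deriv _ (Sum.inr 0) σ := by
  simp only [hessR, cv1, Fin.sum_univ_two, chrS_000, chrS_001, chrS_010, chrS_011, chrS_100,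
    chrS_101, chrS_110, chrS_111]
  rw [deriv_comm (Sum.inr 1) (Sum.inr 0)]
  and_intros <;> ring

theorem kron_eq (p q : Fin 2) : kron p q = (!![1, 0; 0, 1] : Matrix (Fin 2) (Fin 2) ℂ) p q := by
  revert p q
  simp only [Fin.forall_fin_two, kron]
  norm_num

/-- The eigenvalue equation is not used: subtracting half the trace of the Hessian gives the
operator `evOp` for every function of the angles. -/
theorem rep_evenMix (M : ℝ) (hr : ∀ q ∈ Ω, 0 < q 1 ∧ q 1 ≠ 2 * M) (h : Rep Sum.inr S σ)
    (p q : Fin 2) : Rep Sum.inr (evenMix S p q) (evOp (deriv _) (siR hΩ) (kR hΩ) σ p q) := by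
  refine ((rep_hessMix hΩ M hr h p q).sub ((Rep.sum fun u =>
    rep_hessMix hΩ M hr h u u).const_mul (1 / 2 * kron p q))).congr_right ?_
  obtain ⟨h00, h01, h10, h11⟩ := hessR_table hΩ (σ := σ)
  refine evalAt_injective fun x => ?_
  have hs : evalAt x (sR hΩ) ≠ 0 := sin_ne_zero hΩ x
  have hsi : evalAt x (siR hΩ) = (evalAt x (sR hΩ))⁻¹ := rfl
  revert p q
  simp only [Fin.forall_fin_two, Fin.sum_univ_two, gamR_00, gamR_11, h00, h01, h10, h11, evOp,
    Matrix.cons_val_zero, Matrix.cons_val_one, Matrix.of_apply, Matrix.cons_val',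
    Matrix.cons_val_fin_one, kron_eq, ev_smul, ev_mul, ev_add, ev_sub, ev_neg, ev_one, hsi,
    mul_zero, zero_mul, mul_one, one_mul, sub_zero]
  and_intros <;> (try field_simp) <;> first | trivial | ring

theorem rep_oddMix (M : ℝ) (hr : ∀ q ∈ Ω, 0 < q 1 ∧ q 1 ≠ 2 * M) (h : Rep Sum.inr S σ)
    (p q : Fin 2) :
    Rep Sum.inr (oddMix S p q) (odOp (deriv _) (sR hΩ) (siR hΩ) (kR hΩ) σ p q) := by
  refine ((Rep.sum fun u => (rep_epsUp hΩ u q).mul (rep_hessDn hΩ M hr h p u)).add (Rep.sum fun u =>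
    (rep_epsDn hΩ u p).mul (rep_hessUp hΩ M hr h q u))).congr_right ?_
  obtain ⟨h00, h01, h10, h11⟩ := hessR_table hΩ (σ := σ)
  refine evalAt_injective fun x => ?_
  have hs : evalAt x (sR hΩ) ≠ 0 := sin_ne_zero hΩ x
  have hsi : evalAt x (siR hΩ) = (evalAt x (sR hΩ))⁻¹ := rfl
  revert p q
  simp only [Fin.forall_fin_two, Fin.sum_univ_two, gamR_00, gamR_01, gamR_10, gamR_11,
    epsR_00, epsR_01, epsR_10, epsR_11, h00, h01, h10, h11, odOp,
    Matrix.cons_val_zero, Matrix.cons_val_one, Matrix.of_apply, Matrix.cons_val',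
    Matrix.cons_val_fin_one, ev_smul, ev_mul, ev_add, ev_sub, ev_neg, ev_one, ev_zero, ev_ofNat, hsi,
    mul_zero, zero_mul, mul_one, one_mul, sub_zero, add_zero, zero_add]
  and_intros <;> (try field_simp) <;> first | trivial | ring

end SphereOps

/-! ### Term by term tensor calculus -/

section HSTensor

variable {κ : Type} [Fintype κ] [DecidableEq κ] {V : Opens (κ → ℝ)} {J : Type}
  (Γ : κ → κ → κ → smoothRing V)

/-- Every tensor operation is a finite combination of derivations and multiplications by fixed ring
elements, and both respect termwise convergence. The lemmas for the other operations follow the same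
pattern. -/
theorem hs_cv2 {γ : J → κ → κ → smoothRing V} {g : κ → κ → smoothRing V}
    (h : ∀ a b, HS (fun k => γ k a b) (g a b)) (a b c : κ) :
    HS (fun k => cv2 (deriv V) Γ (γ k) a b c) (cv2 (deriv V) Γ g a b c) :=
  (((h b c).deriv a).sub (HS.sum fun e => (h e c).const_mul _)).sub
    (HS.sum fun e => (h b e).const_mul _)

theorem hs_cv3 {γ : J → κ → κ → κ → smoothRing V} {g : κ → κ → κ → smoothRing V}
    (h : ∀ a b c, HS (fun k => γ k a b c) (g a b c)) (a b c f : κ) :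
    HS (fun k => cv3 (deriv V) Γ (γ k) a b c f) (cv3 (deriv V) Γ g a b c f) :=
  ((((h b c f).deriv a).sub (HS.sum fun e => (h e c f).const_mul _)).sub
    (HS.sum fun e => (h b e f).const_mul _)).sub (HS.sum fun e => (h b c e).const_mul _)

theorem hs_lnH {γ : J → κ → κ → smoothRing V} {g : κ → κ → smoothRing V}
    (h : ∀ a b, HS (fun k => γ k a b) (g a b)) (a b c : κ) :
    HS (fun k => lnH (deriv V) Γ (γ k) a b c) (lnH (deriv V) Γ g a b c) :=
  (((hs_cv2 Γ h a b c).add (hs_cv2 Γ h b a c)).smul _).sub ((hs_cv2 Γ h c a b).smul _)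

theorem hs_lnSigma (gi : κ → κ → smoothRing V) {γ : J → κ → κ → smoothRing V}
    {g : κ → κ → smoothRing V} (h : ∀ a b, HS (fun k => γ k a b) (g a b)) (a b : κ) :
    HS (fun k => lnSigma (deriv V) Γ gi (γ k) a b) (lnSigma (deriv V) Γ gi g a b) :=
  HS.neg (HS.sum fun c =>
    (HS.sum fun e => HS.sum fun f => (hs_cv3 Γ (hs_lnH Γ h) a c e f).const_mul _).sub
    (HS.sum fun e => HS.sum fun f => (hs_cv3 Γ (hs_lnH Γ h) c a e f).const_mul _))

theorem hs_dvm {γ : J → κ → κ → smoothRing V}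
    {g : κ → κ → smoothRing V} (h : ∀ a b, HS (fun k => γ k a b) (g a b)) (b : κ) :
    HS (fun k => dvm (deriv V) Γ (γ k) b) (dvm (deriv V) Γ g b) :=
  HS.sum fun a => (((h b a).deriv a).sub (HS.sum fun e => (h e a).const_mul _)).add
    (HS.sum fun e => (h b e).const_mul _)

end HSTensor

/-! ### Termwise action of the operators that build tensors from scalar potentials -/

section HSMode

variable {V : Opens Pt} {J : Type} (r ri f fi s si k : smoothRing V)

theorem hs_curlR {γ : J → smoothRing V} {g : smoothRing V} (h : HS γ g) : ∀ p,
    HS (fun j => curlR (deriv V) s si (γ j) p) (curlR (deriv V) s si g p) := by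
  simp only [Fin.forall_fin_two, curlR_0, curlR_1]
  exact ⟨(h.deriv _).const_mul _, ((h.deriv _).const_mul _).neg⟩

theorem hs_evOp {γ : J → smoothRing V} {g : smoothRing V} (h : HS γ g) : ∀ p q,
    HS (fun j => evOp (deriv V) si k (γ j) p q) (evOp (deriv V) si k g p q) := by
  have h1 := (((((h.deriv (.inr 0)).deriv (.inr 0)).sub ((h.deriv (.inr 0)).const_mul k)).sub
    (((h.deriv (.inr 1)).deriv (.inr 1)).const_mul (si * si))).smul (1 / 2 : ℂ))
  have h2 := (((h.deriv (.inr 1)).deriv (.inr 0)).sub ((h.deriv (.inr 1)).const_mul k))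
  simp only [Fin.forall_fin_two]
  exact ⟨⟨h1, h2.const_mul _⟩, h2, h1.neg⟩

theorem hs_odOp {γ : J → smoothRing V} {g : smoothRing V} (h : HS γ g) : ∀ p q,
    HS (fun j => odOp (deriv V) s si k (γ j) p q) (odOp (deriv V) s si k g p q) := by
  have h1 := ((((h.deriv (.inr 0)).deriv (.inr 0)).sub ((h.deriv (.inr 0)).const_mul k)).sub
    (((h.deriv (.inr 1)).deriv (.inr 1)).const_mul (si * si)))
  have h2 := (((h.deriv (.inr 1)).deriv (.inr 0)).sub ((h.deriv (.inr 1)).const_mul k))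
  simp only [Fin.forall_fin_two]
  exact ⟨⟨(h2.const_mul _).neg, h1.const_mul _⟩, h1.const_mul _, h2.const_mul _⟩

/-- Term by term convergence of all potentials. -/
structure HSrc (τ : J → Src (smoothRing V)) (t : Src (smoothRing V)) : Prop where
  AB : ∀ A B, HS (fun j => (τ j).AB A B) (t.AB A B)
  e1 : ∀ A, HS (fun j => (τ j).e1 A) (t.e1 A)
  o1 : ∀ A, HS (fun j => (τ j).o1 A) (t.o1 A)
  e0 : HS (fun j => (τ j).e0) t.e0
  e2 : HS (fun j => (τ j).e2) t.e2
  o2 : HS (fun j => (τ j).o2) t.o2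

theorem hs_matOp {τ : J → Src (smoothRing V)} {t : Src (smoothRing V)} (h : HSrc τ t)
    (a b : Fin 2 ⊕ Fin 2) : HS (fun j => matOp (deriv V) r ri f fi s si k (τ j) a b)
      (matOp (deriv V) r ri f fi s si k t a b) := by
  rcases a with A | p <;> rcases b with B | q
  · exact (h.AB A B).const_mul _
  · exact ((((h.e1 A).deriv _).add (hs_curlR s si (h.o1 A) q)).const_mul _).const_mul _
  · exact ((((h.e1 B).deriv _).add (hs_curlR s si (h.o1 B) p)).const_mul _).const_mul _
  · exact (((h.e0.smul _).const_mul _).add (hs_evOp si k h.e2 p q)).add (hs_odOp s si k h.o2 p q)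

/-- The metric perturbation with given scalar potentials. -/
def modeOp (d : Fin 2 ⊕ Fin 2 → Derivation ℂ (smoothRing V) (smoothRing V)) (r s si : smoothRing V)
    (w : Fin 2 → Fin 2 → smoothRing V) (v : Fin 2 → smoothRing V) (u : smoothRing V) :
    Fin 2 ⊕ Fin 2 → Fin 2 ⊕ Fin 2 → smoothRing V
  | .inl A, .inl B => w A B
  | .inl A, .inr p => r * curlR d s si (v A) p
  | .inr p, .inl A => r * curlR d s si (v A) p
  | .inr p, .inr q => (1 / 2 : ℂ) • (gamR s p q * (r * r) * u)

/-- The counterpart of `matOp_mul` for the metric perturbation: the operator acts on summed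
potentials, the single mode on separated coefficients. -/
theorem modeOp_mul {w : Fin 2 → Fin 2 → smoothRing V} {v : Fin 2 → smoothRing V}
    {u S : smoothRing V} (hv : ∀ A, IsBase (deriv V) (v A)) (a b : Fin 2 ⊕ Fin 2) :
    modeOp (deriv V) r s si (fun A B => w A B * S) (fun A => v A * S) (u * S) a b
      = modeR (deriv V) r s si S w v u a b := by
  rcases a with A | p <;> rcases b with B | q <;>
    simp only [modeOp, modeR, curlR_mul (hv _)]

theorem hs_modeOp {wj : J → Fin 2 → Fin 2 → smoothRing V} {ν : J → Fin 2 → smoothRing V}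
    {υ : J → smoothRing V} {w : Fin 2 → Fin 2 → smoothRing V} {v : Fin 2 → smoothRing V}
    {u : smoothRing V} (hw : ∀ A B, HS (fun j => wj j A B) (w A B))
    (hv : ∀ A, HS (fun j => ν j A) (v A)) (hu : HS υ u) (a b : Fin 2 ⊕ Fin 2) :
    HS (fun j => modeOp (deriv V) r s si (wj j) (ν j) (υ j) a b)
      (modeOp (deriv V) r s si w v u a b) := by
  rcases a with A | p <;> rcases b with B | q
  · exact hw A B
  · exact (hs_curlR s si (hv A) q).const_mul _
  · exact (hs_curlR s si (hv B) p).const_mul _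
  · exact (hu.const_mul _).smul _

end HSMode

/-! ### Mode sums on the chart -/

section ModeSums

variable {Ω : Set Plane} (hΩ : IsOpen Ω) (δ : ℝ)

theorem finite_low_modes : {k : Mode | ¬ 2 ≤ k.l}.Finite := by
  have : Function.Injective fun k : Mode => ((k.l : ℤ), k.m) := fun a b h => by
    simp only [Prod.mk.injEq, Nat.cast_inj] at h
    exact Mode.ext h.1 h.2
  refine Set.Finite.of_finite_image (f := fun k : Mode => ((k.l : ℤ), k.m)) ?_ this.injOn
  refine ((Set.finite_Icc (0 : ℤ) 1).prod (Set.finite_Icc (-1 : ℤ) 1)).subset ?_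
  rintro _ ⟨k, hk, rfl⟩
  simp only [Set.mem_ofPred_eq, not_le] at hk
  have h1 := abs_le.1 k.abs_le
  simp only [Set.mem_prod, Set.mem_Icc]
  omega

/-- For l ≥ 2 the harmonic is Y_lm and the hypothesis applies directly, with weight exponent 0. The
finitely many low modes are smooth on the chart, and their singularities lie at the poles, which the
chart omits. -/
theorem nc_modes {c : Mode → Plane → ℂ} (hc : SmoothModes Ω c) :
    NC fun k => baseR hΩ (c k) (hc.1 k) * SR hΩ δ k := by
  have hG : ∀ k, ContDiffOn ℝ ∞ (fun z : Pt => c k (base z) * harm δ k (sph z)) (chartO Ω hΩ) :=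
    fun k => by
      refine (baseR hΩ (c k) (hc.1 k) * SR hΩ δ k).2.congr fun x hx => ?_
      rw [zeroExt_eq _ ⟨x, hx⟩, ev_mul, ← rep_SR hΩ δ k ⟨x, hx⟩]
      rfl
  have key := nc_of_iteratedFDeriv hG finite_low_modes fun n K hK hKV => by
    obtain ⟨u, hu, hu'⟩ := hc.2 n 0 K hK fun x hx => (mem_chart hΩ ⟨x, hKV hx⟩).1
    refine ⟨u, hu, fun k hk x hx => ?_⟩
    have hk' : 2 ≤ k.l := not_not.1 hk
    have := hu' k hk' x hx
    rw [pow_zero, one_mul] at this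
    have e : harm δ k = sphericalY k := by
      rw [harm, if_neg (by omega), if_neg (by omega)]
    simpa only [e] using this
  have e : (fun k => ofFun (chartO Ω hΩ) _ (hG k))
      = fun k => baseR hΩ (c k) (hc.1 k) * SR hΩ δ k := funext fun k =>
    evalAt_injective fun x => by
      rw [ev_mul, ← rep_SR hΩ δ k x]
      rfl
  rwa [e] at key

/-- The coefficients of a single mode. -/
def srcR {T : MatterModes} (hT : T.Smooth Ω) (k : Mode) : Src (smoothRing (chartO Ω hΩ)) where
  AB A B := baseR hΩ (T.TAB k A B) ((hT.TAB A B).1 k)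
  e1 A := baseR hΩ (T.Te1 k A) ((hT.Te1 A).1 k)
  o1 A := baseR hΩ (T.To1 k A) ((hT.To1 A).1 k)
  e0 := baseR hΩ (T.Te0 k) (hT.Te0.1 k)
  e2 := baseR hΩ (T.Te2 k) (hT.Te2.1 k)
  o2 := baseR hΩ (T.To2 k) (hT.To2.1 k)

variable {T : MatterModes} (hT : T.Smooth Ω)

theorem srcR_isBase (k : Mode) : (srcR hΩ hT k).IsBase (deriv _) :=
  ⟨fun A B => isBase_baseR hΩ ((hT.TAB A B).1 k), fun A => isBase_baseR hΩ ((hT.Te1 A).1 k),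
    fun A => isBase_baseR hΩ ((hT.To1 A).1 k), isBase_baseR hΩ (hT.Te0.1 k),
    isBase_baseR hΩ (hT.Te2.1 k), isBase_baseR hΩ (hT.To2.1 k)⟩

theorem srcR_symm (k : Mode) (A B : Fin 2) : (srcR hΩ hT k).AB A B = (srcR hΩ hT k).AB B A := by
  simp only [srcR, hT.symm k A B]

theorem exists_hsrc : ∃ t, HSrc (fun k => (srcR hΩ hT k).map (· * SR hΩ δ k)) t := by
  choose tAB hAB using fun A B => (nc_modes hΩ δ (hT.TAB A B)).exists_hs
  choose te1 he1 using fun A => (nc_modes hΩ δ (hT.Te1 A)).exists_hs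
  choose to1 ho1 using fun A => (nc_modes hΩ δ (hT.To1 A)).exists_hs
  obtain ⟨te0, he0⟩ := (nc_modes hΩ δ hT.Te0).exists_hs
  obtain ⟨te2, he2⟩ := (nc_modes hΩ δ hT.Te2).exists_hs
  obtain ⟨to2, ho2⟩ := (nc_modes hΩ δ hT.To2).exists_hs
  exact ⟨⟨tAB, te1, to1, te0, te2, to2⟩, ⟨hAB, he1, ho1, he0, he2, ho2⟩⟩

variable (M : ℝ) (hr : ∀ q ∈ Ω, 0 < q 1 ∧ q 1 ≠ 2 * M)

/-- The mixed tensor of a single mode on the chart. -/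
def matC (ev : ℂ) (S : smoothRing (chartO Ω hΩ)) (t : Src (smoothRing (chartO Ω hΩ))) :
    Fin 2 ⊕ Fin 2 → Fin 2 ⊕ Fin 2 → smoothRing (chartO Ω hΩ) :=
  matR (deriv _) (rR hΩ) (riR hΩ M hr) (fR hΩ M hr) (fiR hΩ M hr) (sR hΩ) (siR hΩ) (kR hΩ) S ev t

/-- A single term of the series for `T_a{}^b`. -/
def termT (M δ : ℝ) (T : MatterModes) (a b : Fin 2 ⊕ Fin 2) (x : Pt) (k : Mode) : ℂ :=
  match a, b with
  | Sum.inl A, Sum.inl B =>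
      raise M (base x) (fun E => T.TAB k A E (base x)) B * harm δ k (sph x)
  | Sum.inl A, Sum.inr q => 1 / rad (base x) *
      (T.Te1 k A (base x) * gradUp (harm δ k) q (sph x)
        + T.To1 k A (base x) * curlUp (harm δ k) q (sph x))
  | Sum.inr p, Sum.inl B => rad (base x) *
      (raise M (base x) (fun E => T.Te1 k E (base x)) B * gradDn (harm δ k) p (sph x)
        + raise M (base x) (fun E => T.To1 k E (base x)) B * curlDn (harm δ k) p (sph x))
  | Sum.inr p, Sum.inr q =>
      (T.Te0 k (base x) * ((1 / 2) * kron p q * harm δ k (sph x))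
        + T.Te2 k (base x) * evenMix (harm δ k) p q (sph x)
        + T.To2 k (base x) * oddMix (harm δ k) p q (sph x))

theorem calT_eq_tsum (M δ : ℝ) (T : MatterModes) (a b : Fin 2 ⊕ Fin 2) (x : Pt) :
    calT M δ T a b x = ∑' k, termT M δ T a b x k := by
  rcases a with A | p <;> rcases b with B | q
  · rfl
  · exact tsum_mul_left.symm
  · exact tsum_mul_left.symm
  · rfl

/-- Only the values of the coefficients at one base point are compared, not the functions. This
permits applying it to coefficients that are frozen at a point, as in `einsteinComponents`. -/
theorem termT_eq {t : Src (smoothRing (chartO Ω hΩ))} {k : Mode} (x : chartO Ω hΩ)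
    (hAB : ∀ A B, T.TAB k A B (base x) = evalAt x (t.AB A B))
    (he1 : ∀ A, T.Te1 k A (base x) = evalAt x (t.e1 A))
    (ho1 : ∀ A, T.To1 k A (base x) = evalAt x (t.o1 A))
    (he0 : T.Te0 k (base x) = evalAt x t.e0) (he2 : T.Te2 k (base x) = evalAt x t.e2)
    (ho2 : T.To2 k (base x) = evalAt x t.o2) (a b : Fin 2 ⊕ Fin 2) :
    termT M δ T a b x k = evalAt x (matC hΩ M hr k.ev (SR hΩ δ k) t a b) := by
  have hB := bg_chart hΩ M hr
  have hS := isHarm_SR hΩ δ k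
  have hrep := rep_SR hΩ δ k
  have g1 : ∀ p, gradDn (harm δ k) p (sph x) = _ := fun p => rep_gradDn hΩ hrep p x
  have g2 : ∀ p, gradUp (harm δ k) p (sph x) = _ := fun p => rep_gradUp hΩ hrep p x
  have g3 : ∀ p, curlDn (harm δ k) p (sph x) = _ := fun p => rep_curlDn hΩ hrep p x
  have g4 : ∀ p, curlUp (harm δ k) p (sph x) = _ := fun p => rep_curlUp hΩ hrep p x
  have g5 : ∀ p q, evenMix (harm δ k) p q (sph x) = _ := fun p q => rep_evenMix hΩ M hr hrep p q x
  have g6 : ∀ p q, oddMix (harm δ k) p q (sph x) = _ := fun p q => rep_oddMix hΩ M hr hrep p q x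
  have g0 : harm δ k (sph x) = _ := hrep x
  have hri : evalAt x (riR hΩ M hr) = 1 / rad (base x) := (one_div _).symm
  -- The product formula with coefficient 1, which is trivially independent of the angles.
  have e5 : ∀ p q, evOp (deriv _) (siR hΩ) (kR hΩ) (SR hΩ δ k) p q
      = evenR (deriv _) (siR hΩ) (kR hΩ) (SR hΩ δ k) k.ev p q := fun p q => by
    have := evOp_mul hB hS (a := 1) (fun p => der_one _) p q
    rwa [one_mul, one_mul] at this
  have e6 : ∀ p q, odOp (deriv _) (sR hΩ) (siR hΩ) (kR hΩ) (SR hΩ δ k) p q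
      = oddR (deriv _) (sR hΩ) (siR hΩ) (kR hΩ) (SR hΩ δ k) k.ev p q := fun p q => by
    have := odOp_mul hB hS (a := 1) (fun p => der_one _) p q
    rwa [one_mul, one_mul] at this
  rcases a with A | p <;> rcases b with B | q
  · simp only [termT, matC, matR, raise_base hΩ M hr, hAB, g0, ev_mul]
  · simp only [termT, matC, matR, he1, ho1, g2, g4, ev_mul, ev_add, hri]
  · simp only [termT, matC, matR, raise_base hΩ M hr, he1, ho1, g1, g3, ev_mul, ev_add,
      rad_base]
  · have hk : evalAt x ((!![1, 0; 0, 1] : Matrix (Fin 2) (Fin 2) (smoothRing (chartO Ω hΩ))) p q)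
        = kron p q := by
      rw [kron_eq]
      revert p q
      simp only [Fin.forall_fin_two]
      exact ⟨⟨ev_one _, ev_zero _⟩, ev_zero _, ev_one _⟩
    simp only [termT, matC, matR, he0, he2, ho2, g0, g5, g6, e5, e6, ev_mul, ev_add, ev_smul, hk]
    ring

theorem termT_srcR (k : Mode) (x : chartO Ω hΩ) (a b : Fin 2 ⊕ Fin 2) :
    termT M δ T a b x k = evalAt x (matC hΩ M hr k.ev (SR hΩ δ k) (srcR hΩ hT k) a b) :=
  termT_eq hΩ δ M hr x (fun _ _ => rfl) (fun _ => rfl) (fun _ => rfl) rfl rfl rfl a b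

/-- The scalar potentials are summed first; the tensor is then one differential operator applied to
these sums, and it equals the sum of the single modes. -/
theorem exists_calT : ∃ t : Fin 2 ⊕ Fin 2 → Fin 2 ⊕ Fin 2 → smoothRing (chartO Ω hΩ),
    (∀ a b, HS (fun k => matC hΩ M hr k.ev (SR hΩ δ k) (srcR hΩ hT k) a b) (t a b)) ∧
    ∀ a b, Rep id (calT M δ T a b) (t a b) := by
  obtain ⟨t, ht⟩ := exists_hsrc hΩ δ hT
  have h := fun a b => (hs_matOp (rR hΩ) (riR hΩ M hr) (fR hΩ M hr) (fiR hΩ M hr) (sR hΩ) (siR hΩ)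
    (kR hΩ) ht a b).congr fun k => (matOp_mul (bg_chart hΩ M hr) (isHarm_SR hΩ δ k)
      (srcR_isBase hΩ hT k) a b).symm
  refine ⟨_, h, fun a b x => ?_⟩
  change calT M δ T a b x = _
  rw [calT_eq_tsum, ← ((h a b).2 x).tsum_eq]
  exact tsum_congr fun k => termT_srcR hΩ δ hT M hr k x a b

end ModeSums

/-! ### The mode expansion of the linearized Einstein tensor -/

section Einstein

variable {Ω : Set Plane} (hΩ : IsOpen Ω) (M δ : ℝ) (hr : ∀ q ∈ Ω, 0 < q 1 ∧ q 1 ≠ 2 * M)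
  {F : InvModes} (hF : F.Smooth Ω)

/-- The coefficients `F_{AB}` in the ring. -/
def wF (k : Mode) (A B : Fin 2) : smoothRing (chartO Ω hΩ) :=
  baseR hΩ (F.FAB k A B) ((hF.FAB A B).1 k)

/-- The coefficients `F_A` in the ring. -/
def vF (k : Mode) (A : Fin 2) : smoothRing (chartO Ω hΩ) := baseR hΩ (F.FA k A) ((hF.FA A).1 k)

/-- The coefficients `F` in the ring. -/
def uF (k : Mode) : smoothRing (chartO Ω hΩ) := baseR hΩ (F.F k) (hF.F.1 k)

theorem wF_symm (k : Mode) (A B : Fin 2) : wF hΩ hF k A B = wF hΩ hF k B A := by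
  simp only [wF, hF.symm k A B]

/-- The coefficients of the linearized Einstein tensor in the ring. -/
def einC (k : Mode) : Src (smoothRing (chartO Ω hΩ)) :=
  einR (deriv _) (rR hΩ) (riR hΩ M hr) (fR hΩ M hr) (fiR hΩ M hr) k.ev (wF hΩ hF k) (vF hΩ hF k)
    (uF hΩ hF k)

theorem exists_calF : ∃ g : Fin 2 ⊕ Fin 2 → Fin 2 ⊕ Fin 2 → smoothRing (chartO Ω hΩ),
    (∀ a b, HS (fun k => modeR (deriv _) (rR hΩ) (sR hΩ) (siR hΩ) (SR hΩ δ k) (wF hΩ hF k)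
      (vF hΩ hF k) (uF hΩ hF k) a b) (g a b)) ∧
    ∀ a b, Rep id (calF δ F a b) (g a b) := by
  choose w hw using fun A B => (nc_modes hΩ δ (hF.FAB A B)).exists_hs
  choose v hv using fun A => (nc_modes hΩ δ (hF.FA A)).exists_hs
  obtain ⟨u, hu⟩ := (nc_modes hΩ δ hF.F).exists_hs
  have h := fun a b => (hs_modeOp (rR hΩ) (sR hΩ) (siR hΩ) hw hv hu a b).congr
    (η := fun k => modeR (deriv _) (rR hΩ) (sR hΩ) (siR hΩ) (SR hΩ δ k) (wF hΩ hF k)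
      (vF hΩ hF k) (uF hΩ hF k) a b) fun k =>
    (modeOp_mul _ _ _ (fun A => isBase_baseR hΩ ((hF.FA A).1 k)) a b).symm
  refine ⟨_, h, fun a b x => ?_⟩
  have g3 : ∀ k p, curlDn (harm δ k) p (sph x) = _ := fun k p =>
    rep_curlDn hΩ (rep_SR hΩ δ k) p x
  have g0 : ∀ k, harm δ k (sph x) = _ := fun k => rep_SR hΩ δ k x
  have hg : ∀ p q, gam (sph x) p q = _ := fun p q => rep_gam hΩ p q x
  change calF δ F a b x = _
  rw [← ((h a b).2 x).tsum_eq]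
  rcases a with A | p <;> rcases b with B | q
  · refine tsum_congr fun k => ?_
    simp only [modeR, ev_mul, g0]; rfl
  · refine tsum_mul_left.symm.trans (tsum_congr fun k => ?_)
    simp only [modeR, ev_mul, g3]; rfl
  · refine tsum_mul_left.symm.trans (tsum_congr fun k => ?_)
    simp only [modeR, ev_mul, g3]; rfl
  · refine tsum_mul_left.symm.trans (tsum_congr fun k => ?_)
    have hu' : F.F k (base x) = evalAt x (uF hΩ hF k) := rfl
    simp only [modeR, ev_mul, ev_smul, g0, hg, hu', rad_base]
    ring

/-- Linearity lets 𝒢 act term by term on the series of the perturbation. The background Ricci tensor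
vanishes by `ric_chrG`, and `lnEinstein_modeR` identifies each term. -/
theorem exists_einstein : ∃ G : Fin 2 ⊕ Fin 2 → Fin 2 ⊕ Fin 2 → smoothRing (chartO Ω hΩ),
    (∀ a b, HS (fun k => matC hΩ M hr k.ev (SR hΩ δ k) (einC hΩ M hr hF k) a b) (G a b)) ∧
    ∀ a b, Rep id (linEinstein (gMet M) (calF δ F) a b) (G a b) := by
  have hB := bg_chart hΩ M hr
  obtain ⟨g, hg, hg'⟩ := exists_calF hΩ δ hF
  have h1 := fun a b => hs_lnSigma (chrG (rR hΩ) (riR hΩ M hr) (fR hΩ M hr) (fiR hΩ M hr)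
    (nR hΩ M hr) (sR hΩ) (kR hΩ)) (gR (riR hΩ M hr) (fiR hΩ M hr) (fR hΩ M hr) (siR hΩ)) hg a b
  have h2 := fun a b => rep_linSigma Function.injective_id (rep_gMet_inv hΩ M hr)
    (rep_chrG hΩ M hr) (ric_chrG hB) hg' a b
  refine ⟨_, fun a b => ((h1 a b).sub ((HS.sum fun c => h1 c c).smul
    (1 / 2 * (if a = b then 1 else 0) : ℂ))).congr fun k => ?_, fun a b =>
      (h2 a b).sub ((Rep.sum fun c => h2 c c).const_mul _)⟩
  exact (lnEinstein_modeR hB (isHarm_SR hΩ δ k) (wF_symm hΩ hF k)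
    (fun A B => isBase_baseR hΩ ((hF.FAB A B).1 k)) (fun A => isBase_baseR hΩ ((hF.FA A).1 k))
    (isBase_baseR hΩ (hF.F.1 k)) a b).symm

/-- The values of the coefficients of the linearized Einstein tensor. -/
theorem einC_values (k : Mode) (x : chartO Ω hΩ) :
    (∀ A B, (1 / 2) * raise M (base x) (fun E => gABfirst M F k A E (base x)) B
        + (1 / 2) * kron A B * gABsecond M F k (base x)
      = raise M (base x) (fun E => evalAt x ((einC hΩ M hr hF k).AB A E)) B) ∧
    (∀ A, 1 / (2 * rad (base x)) * gEven M F k A (base x) = evalAt x ((einC hΩ M hr hF k).e1 A)) ∧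
    (∀ A, (1 / 2) * gOdd M F k A (base x) = evalAt x ((einC hΩ M hr hF k).o1 A)) ∧
    gTrace M F k (base x) = evalAt x (einC hΩ M hr hF k).e0 ∧
    1 / (2 * rad (base x) ^ 2) * -trace2 M (F.FAB k) (base x)
      = evalAt x (einC hΩ M hr hF k).e2 ∧
    1 / (2 * rad (base x) ^ 2) * -div1 M (rFA F k) (base x)
      = evalAt x (einC hΩ M hr hF k).o2 := by
  have hw : ∀ A B, Rep Sum.inl (F.FAB k A B) (wF hΩ hF k A B) := fun A B => rep_baseR hΩ _
  have hv : ∀ A, Rep Sum.inl (F.FA k A) (vF hΩ hF k A) := fun A => rep_baseR hΩ _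
  have hu : Rep Sum.inl (F.F k) (uF hΩ hF k) := rep_baseR hΩ _
  have hs := wF_symm hΩ hF k
  have hri : evalAt x (riR hΩ M hr) = (rad (base x))⁻¹ := rfl
  have htr : trace2 M (F.FAB k) (base x) = _ := rep_trace2 hΩ M hr hw x
  refine ⟨fun A B => ?_, fun A => ?_, fun A => ?_, ?_, ?_, ?_⟩
  · rw [gAB_base hΩ M hr F k hw hu hs, raise_base hΩ M hr, ev_mul]; rfl
  · rw [gEven_base hΩ M hr F k hw hu hs, einC, einR, ev_smul, ev_mul, hri]; ring
  · rw [gOdd_base hΩ M hr F k hv, einC, einR, ev_smul]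
  · rw [gTrace_base hΩ M hr F k hw hu hs, einC, einR]
  · rw [htr, einC, einR, ev_neg, ev_smul, ev_mul, ev_mul, hri]; ring
  · rw [div_rFA_base hΩ M hr F k hv, einC, einR, ev_neg, ev_smul, ev_mul, ev_mul, hri]; ring

theorem einsteinComponents (hr : ∀ q ∈ Ω, 0 < q 1 ∧ q 1 ≠ 2 * M) (hF : F.Smooth Ω)
    (x : chartO Ω hΩ) : EinsteinComponents M δ F x := by
  obtain ⟨G, hG, hG'⟩ := exists_einstein hΩ M δ hr hF
  -- Fictitious matter whose coefficients are constant, equal to those of the Einstein tensor at x.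
  -- A term of `calT` involves only the values at the base point, so the series of 𝒢 at x can be
  -- read as an energy-momentum series.
  let T' : MatterModes :=
    { TAB := fun k A B _ => evalAt x ((einC hΩ M hr hF k).AB A B)
      Te1 := fun k A _ => evalAt x ((einC hΩ M hr hF k).e1 A)
      To1 := fun k A _ => evalAt x ((einC hΩ M hr hF k).o1 A)
      Te0 := fun k _ => evalAt x (einC hΩ M hr hF k).e0
      Te2 := fun k _ => evalAt x (einC hΩ M hr hF k).e2
      To2 := fun k _ => evalAt x (einC hΩ M hr hF k).o2 }
  have hterm : ∀ a b, HasSum (fun k => termT M δ T' a b x k)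
      (linEinstein (gMet M) (calF δ F) a b x) := fun a b => by
    have h1 : linEinstein (gMet M) (calF δ F) a b x = _ := hG' a b x
    rw [h1]
    refine ((hG a b).2 x).congr_fun ?_
    intro k
    exact termT_eq hΩ δ M hr x (fun _ _ => rfl) (fun _ => rfl) (fun _ => rfl) rfl rfl rfl a b
  have hr0 : rad (base x) ≠ 0 := (bg_chart hΩ M hr).r_ne (evalAt x)
  refine ⟨fun A B => ?_, fun A q => ?_, fun p B => ?_, fun p q => ?_⟩
  all_goals
    refine (hterm _ _).congr_fun ?_
    intro k
    obtain ⟨h1, h2, h3, h4, h5, h6⟩ := einC_values hΩ M hr hF k x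
    simp only [termT, T']
  · rw [← h1]; ring
  · rw [← h2, ← h3]; field_simp
  · simp only [← h2, ← h3, raise_base hΩ M hr]; field_simp
  · rw [← h4, ← h5, ← h6]; field_simp; ring

end Einstein

/-! ### The divergence of the energy-momentum tensor -/

section Divergence

variable {Ω : Set Plane} (hΩ : IsOpen Ω) (M δ : ℝ) (hr : ∀ q ∈ Ω, 0 < q 1 ∧ q 1 ≠ 2 * M)
  {T : MatterModes} (hT : T.Smooth Ω)

/-- The base part of the divergence. -/
def caC (ev : ℂ) (t : Src (smoothRing (chartO Ω hΩ))) (B : Fin 2) : smoothRing (chartO Ω hΩ) :=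
  caR (deriv _) (riR hΩ M hr) (fR hΩ M hr) (fiR hΩ M hr) (nR hΩ M hr) ev t B

/-- The even angular part of the divergence. -/
def cbC (ev : ℂ) (t : Src (smoothRing (chartO Ω hΩ))) : smoothRing (chartO Ω hΩ) :=
  cbR (deriv _) (riR hΩ M hr) (fR hΩ M hr) (fiR hΩ M hr) (nR hΩ M hr) ev t

/-- The odd angular part of the divergence. -/
def ccC (ev : ℂ) (t : Src (smoothRing (chartO Ω hΩ))) : smoothRing (chartO Ω hΩ) :=
  ccR (deriv _) (riR hΩ M hr) (fR hΩ M hr) (fiR hΩ M hr) (nR hΩ M hr) ev t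

/-- Stated for arbitrary coefficient families, because it is applied both to the matter and, in the
extraction, to the difference of the two sides of the Einstein equation. -/
theorem hs_divergence {τ : Mode → Src (smoothRing (chartO Ω hΩ))}
    {g : Fin 2 ⊕ Fin 2 → Fin 2 ⊕ Fin 2 → smoothRing (chartO Ω hΩ)}
    (hτ : ∀ k, (τ k).IsBase (deriv _)) (hs : ∀ k A B, (τ k).AB A B = (τ k).AB B A)
    (h : ∀ a b, HS (fun k => matC hΩ M hr k.ev (SR hΩ δ k) (τ k) a b) (g a b)) :
    (∀ B, HS (fun k => caC hΩ M hr k.ev (τ k) B * SR hΩ δ k) (dvm (deriv _) (chrG (rR hΩ)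
      (riR hΩ M hr) (fR hΩ M hr) (fiR hΩ M hr) (nR hΩ M hr) (sR hΩ) (kR hΩ)) g (.inl B))) ∧
    ∀ p, HS (fun k => rR hΩ * (cbC hΩ M hr k.ev (τ k) * deriv _ (.inr p) (SR hΩ δ k)
        + ccC hΩ M hr k.ev (τ k) * curlR (deriv _) (sR hΩ) (siR hΩ) (SR hΩ δ k) p))
      (dvm (deriv _) (chrG (rR hΩ)
        (riR hΩ M hr) (fR hΩ M hr) (fiR hΩ M hr) (nR hΩ M hr) (sR hΩ) (kR hΩ)) g (.inr p)) := by
  have hB := bg_chart hΩ M hr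
  refine ⟨fun B => (hs_dvm _ h _).congr fun k => ?_, fun p => (hs_dvm _ h _).congr fun k => ?_⟩
  · exact ((dvm_matR hB (isHarm_SR hΩ δ k) (hτ k) (hs k)).1 B).symm
  · exact ((dvm_matR hB (isHarm_SR hΩ δ k) (hτ k) (hs k)).2 p).symm

/-- The continuity equations in terms of the ring. -/
theorem continuityEqs_iff (k : Mode) (x : chartO Ω hΩ) :
    (ContinuityBase M T k (base x) ↔ ∀ B, evalAt x (caC hΩ M hr k.ev (srcR hΩ hT k) B) = 0) ∧
    (ContinuityEven M T k (base x) ↔ evalAt x (cbC hΩ M hr k.ev (srcR hΩ hT k)) = 0) ∧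
    (ContinuityOdd M T k (base x) ↔ evalAt x (ccC hΩ M hr k.ev (srcR hΩ hT k)) = 0) := by
  have hB := bg_chart hΩ M hr
  have hri : evalAt x (riR hΩ M hr) = (rad (base x))⁻¹ := rfl
  have hr0 : rad (base x) ≠ 0 := hB.r_ne (evalAt x)
  have rAB : ∀ A B, Rep Sum.inl (T.TAB k A B) ((srcR hΩ hT k).AB A B) := fun A B =>
    rep_baseR hΩ ((hT.TAB A B).1 k)
  have re1 : ∀ A, Rep Sum.inl (T.Te1 k A) ((srcR hΩ hT k).e1 A) := fun A =>
    rep_baseR hΩ ((hT.Te1 A).1 k)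
  have ro1 : ∀ A, Rep Sum.inl (T.To1 k A) ((srcR hΩ hT k).o1 A) := fun A =>
    rep_baseR hΩ ((hT.To1 A).1 k)
  have a1 : ∀ A B C, D2 M (T.TAB k) A B C (base x) = _ := fun A B C => rep_D2 hΩ M hr rAB A B C x
  have a2 : ∀ A B, T.TAB k A B (base x) = _ := fun A B => rAB A B x
  have a3 : ∀ A, T.Te1 k A (base x) = _ := fun A => re1 A x
  have a4 : ∀ A, T.To1 k A (base x) = _ := fun A => ro1 A x
  have a5 : T.Te0 k (base x) = evalAt x (srcR hΩ hT k).e0 := rfl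
  have a6 : T.Te2 k (base x) = evalAt x (srcR hΩ hT k).e2 := rfl
  have a7 : T.To2 k (base x) = evalAt x (srcR hΩ hT k).o2 := rfl
  have a8 : div1 M (T.Te1 k) (base x) = _ := rep_div1 hΩ M hr re1 x
  have a9 : div1 M (T.To1 k) (base x) = _ := rep_div1 hΩ M hr ro1 x
  have hdY : dY hΩ = fun A => deriv (chartO Ω hΩ) (Sum.inl A) := rfl
  have hev : k.ev' = k.ev - 2 := by simp only [Mode.ev, Mode.ev']; ring
  have hd0 : dr 0 (base x) = 0 := by
    rw [dr_base hΩ]; exact (congrArg (evalAt x) hB.r0).trans (ev_zero _)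
  have hd1 : dr 1 (base x) = 1 := by
    rw [dr_base hΩ]; exact (congrArg (evalAt x) hB.r1).trans (ev_one _)
  refine ⟨forall_congr' fun B => Eq.congr_left ?_, Eq.congr_left ?_, Eq.congr_left ?_⟩
  · revert B
    simp only [Fin.forall_fin_two, ctr_base hΩ M hr, a1, a2, a3, a5, hd0, hd1, caC, caR, hdY, gY,
      ev_add, ev_sub, ev_mul, ev_smul, ev_ofNat, ev_zero, ev_one, hri, Matrix.cons_val_zero,
      Matrix.cons_val_one]
    constructor <;> ring
  · simp only [a8, a6, a5, a3, ctr_base hΩ M hr, hd0, hd1, cbC, cbR, hdY, gY, hev,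
      ev_add, ev_sub, ev_mul, ev_smul, ev_ofNat, ev_zero, ev_one, hri]
    ring
  · simp only [a9, a7, a4, ctr_base hΩ M hr, hd0, hd1, ccC, ccR, hdY, gY, hev,
      ev_add, ev_sub, ev_mul, ev_smul, ev_ofNat, ev_zero, ev_one, hri]
    ring

theorem continuityEq_of_modes (hΩ : IsOpen Ω) (hr : ∀ q ∈ Ω, 0 < q 1 ∧ q 1 ≠ 2 * M)
    (hT : T.Smooth Ω) (h : ∀ k : Mode, ∀ q ∈ Ω, ContinuityEqs M T k q) :
    ContinuityEq M δ Ω T := by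
  obtain ⟨t, ht, ht'⟩ := exists_calT hΩ δ hT M hr
  have hd := hs_divergence hΩ M δ hr (srcR_isBase hΩ hT) (srcR_symm hΩ hT) ht
  intro x hx b
  have hrep : divMixed (gMet M) (calT M δ T) b x = _ :=
    rep_divMixed Function.injective_id (rep_chrG hΩ M hr) ht' b (⟨x, hx⟩ : chartO Ω hΩ)
  rw [hrep]
  let X : chartO Ω hΩ := ⟨x, hx⟩
  have hk := fun k => continuityEqs_iff hΩ M hr hT k X
  have h' := fun k => h k (base x) (mem_chart hΩ X).1
  rcases b with B | p
  · refine ((hd.1 B).2 X).unique ?_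
    simp only [ev_mul, (hk _).1.1 (h' _).1 B, zero_mul]
    exact hasSum_zero
  · refine ((hd.2 p).2 X).unique ?_
    simp only [ev_mul, ev_add, (hk _).2.1.1 (h' _).2.1, (hk _).2.2.1 (h' _).2.2, zero_mul, add_zero,
      mul_zero]
    exact hasSum_zero

end Divergence

/-! ### The mode equations -/

section Bianchi

variable {R : Type} [CommRing R] [Algebra ℂ R]
  {d : Fin 2 ⊕ Fin 2 → Derivation ℂ R R} {r ri f fi n s si k : R} {ev : ℂ}
  {w : Fin 2 → Fin 2 → R} {v : Fin 2 → R} {u : R}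

set_option maxHeartbeats 1000000 in
/-- The linearized Bianchi identity. -/
theorem caR_einR (hB : Bg d r ri f fi n s si k) (hw : ∀ A B, w A B = w B A) : ∀ B,
    caR d ri f fi n ev (einR d r ri f fi ev w v u) B = 0 := by
  have hw10 := hw 1 0
  have hc1 := fun x => hB.comm (.inl 0) (.inl 1) x
  simp only [Fin.forall_fin_two]
  and_intros
  all_goals
    apply hB.sep
    intro φ
    have h1 := hB.r_ne φ
    have h2 := hB.f_ne φ
    simp only [caR, einR, cv2, eR, e00R, e01R, e11R, gER, gTR, Fin.sum_univ_two,
      chrY_000, chrY_001, chrY_010, chrY_011, chrY_100, chrY_101, chrY_110, chrY_111, hw10, hc1,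
      Matrix.cons_val_zero, Matrix.cons_val_one, Matrix.of_apply, Matrix.cons_val',
      Matrix.cons_val_fin_one, hB.ri0, hB.ri1, hB.f0, hB.f1, hB.fi0, hB.fi1, hB.r0, hB.r1, der_mul,
      hB.n0, hB.n1, der_neg, der_zero, mul_zero, zero_mul, add_zero, zero_add, sub_zero, zero_sub,
      neg_zero, smul_zero, der_one, der_ofNat, mul_one, one_mul, der_add, der_sub, der_smul]
    simp only [ev_smul, ev_mul, ev_add, ev_sub, ev_neg, ev_one, ev_zero, ev_ofNat,
      hB.eval_ri, hB.eval_fi, hB.eval_n]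
    field_simp
    ring

-- The even angular component of the Bianchi identity. It holds identically in the coefficients and
-- for every complex eigenvalue, without a harmonic, and it is what makes equation (b) for the
-- matter carry the information about e0.
set_option maxHeartbeats 1000000 in
theorem cbR_einR (hB : Bg d r ri f fi n s si k) (hw : ∀ A B, w A B = w B A) :
    cbR d ri f fi n ev (einR d r ri f fi ev w v u) = 0 := by
  have hw10 := hw 1 0
  have hc1 := fun x => hB.comm (.inl 0) (.inl 1) x
  apply hB.sep
  intro φ
  have h1 := hB.r_ne φ
  have h2 := hB.f_ne φ
  simp only [cbR, einR, cv1, trR, gER, gTR, Fin.sum_univ_two,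
      chrY_000, chrY_001, chrY_010, chrY_011, chrY_100, chrY_101, chrY_110, chrY_111, hw10, hc1,
      Matrix.cons_val_zero, Matrix.cons_val_one,
      hB.ri0, hB.ri1, hB.f0, hB.f1, hB.fi0, hB.fi1, hB.r0, hB.r1, der_mul,
      hB.n0, hB.n1, der_neg, der_zero, mul_zero, zero_mul, add_zero, zero_add, sub_zero, zero_sub,
      neg_zero, smul_zero, der_one, der_ofNat, mul_one, one_mul, der_add, der_sub, der_smul]
  simp only [ev_smul, ev_mul, ev_add, ev_sub, ev_neg, ev_one, ev_zero, ev_ofNat,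
      hB.eval_ri, hB.eval_fi, hB.eval_n]
  field_simp
  ring

set_option maxHeartbeats 1000000 in
theorem ccR_einR (hB : Bg d r ri f fi n s si k) :
    ccR d ri f fi n ev (einR d r ri f fi ev w v u) = 0 := by
  have hc1 := fun x => hB.comm (.inl 0) (.inl 1) x
  apply hB.sep
  intro φ
  have h1 := hB.r_ne φ
  have h2 := hB.f_ne φ
  simp only [ccR, einR, cv1, dvR, gOR, Fin.sum_univ_two,
      chrY_000, chrY_001, chrY_010, chrY_011, chrY_100, chrY_101, chrY_110, chrY_111, hc1,
      Matrix.cons_val_zero, Matrix.cons_val_one,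
      hB.ri0, hB.ri1, hB.f0, hB.f1, hB.fi0, hB.fi1, hB.r0, hB.r1, der_mul,
      hB.n0, hB.n1, der_neg, der_zero, mul_zero, zero_mul, add_zero, zero_add, sub_zero, zero_sub,
      neg_zero, smul_zero, der_one, der_ofNat, mul_one, one_mul, der_add, der_sub, der_smul]
  simp only [ev_smul, ev_mul, ev_add, ev_sub, ev_neg, ev_one, ev_zero, ev_ofNat,
      hB.eval_ri, hB.eval_fi, hB.eval_n]
  field_simp
  ring

variable (d r f fi n ev) (t : Src R)

/-- The source of the even divergence equation. -/
def sDiv (A : Fin 2) : R := r * t.e1 A - (1 / 2 : ℂ) • (r * r * d (.inl A) t.e2)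

/-- The source of the odd evolution equation. -/
def sOdd (A : Fin 2) : R := r * (t.o1 A + r * d (.inl A) t.o2)

/-- The contributions of the vector and tensor coefficients to `S_{(F)}`. -/
def sScal : R := 4 * f * t.e1 1 - 2 * r * f * d (.inl 1) t.e2 - (ev + 2) • t.e2

/-- The contributions of the vector and tensor coefficients to `S_{(𝔽)AB}`. -/
def sTens (A B : Fin 2) : R :=
  -(cv1 (fun A => d (.inl A)) (chrY f fi n) (fun A => r * t.e1 A) A B
      + cv1 (fun A => d (.inl A)) (chrY f fi n) (fun A => r * t.e1 A) B A)
    + yR f fi A B * (f * cv1 (fun A => d (.inl A)) (chrY f fi n) (fun A => r * t.e1 A) 1 1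
      - fi * cv1 (fun A => d (.inl A)) (chrY f fi n) (fun A => r * t.e1 A) 0 0)
    + (![0, 1] A * d (.inl B) (r * t.e2) + ![0, 1] B * d (.inl A) (r * t.e2))
    - yR f fi A B * (f * d (.inl 1) (r * t.e2))
    + r * cv1 (fun A => d (.inl A)) (chrY f fi n) (fun A => d (.inl A) (r * t.e2)) A B
    - (1 / 2 : ℂ) • (r * yR f fi A B
      * (f * cv1 (fun A => d (.inl A)) (chrY f fi n) (fun A => d (.inl A) (r * t.e2)) 1 1
        - fi * cv1 (fun A => d (.inl A)) (chrY f fi n) (fun A => d (.inl A) (r * t.e2)) 0 0))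
    + 2 * ![0, 1] A * ![0, 1] B * t.e2 - yR f fi A B * f * t.e2
    + 2 * yR f fi A B * f * t.e1 1 - r * yR f fi A B * f * d (.inl 1) t.e2

end Bianchi

/-! ### Each mode equation as equality of one linear operator on two coefficient tuples -/

section ModeEquations

variable {Ω : Set Plane} (hΩ : IsOpen Ω) (M : ℝ) (hr : ∀ q ∈ Ω, 0 < q 1 ∧ q 1 ≠ 2 * M)
  {F : InvModes} (hF : F.Smooth Ω) {T : MatterModes} (hT : T.Smooth Ω) (k : Mode) (x : chartO Ω hΩ)

theorem dr_values (M : ℝ) (hr : ∀ q ∈ Ω, 0 < q 1 ∧ q 1 ≠ 2 * M) :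
    dr 0 (base x) = 0 ∧ dr 1 (base x) = 1 := by
  have hB := bg_chart hΩ M hr
  rw [dr_base hΩ, dr_base hΩ]
  exact ⟨(congrArg (evalAt x) hB.r0).trans (ev_zero _),
    (congrArg (evalAt x) hB.r1).trans (ev_one _)⟩

/-- This puts the equation into the common form used for all of them: an operator applied to the
coefficients of 𝒢 equals 8π times the same operator applied to the matter coefficients. Here the
operator is the component e2. -/
theorem evenTrace_iff : EvenTrace M F T k (base x) ↔
    evalAt x (einC hΩ M hr hF k).e2 = 8 * Real.pi * evalAt x (srcR hΩ hT k).e2 := by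
  obtain ⟨-, -, -, -, h, -⟩ := einC_values hΩ M hr hF k x
  have hr0 : rad (base x) ≠ 0 := (bg_chart hΩ M hr).r_ne (evalAt x)
  have e : T.Te2 k (base x) = evalAt x (srcR hΩ hT k).e2 := rfl
  rw [EvenTrace, ← h, ← e]
  field_simp
  constructor <;> intro h' <;> linear_combination (-1) * h'

theorem oddConstraint_iff : OddConstraint M F T k (base x) ↔
    evalAt x (einC hΩ M hr hF k).o2 = 8 * Real.pi * evalAt x (srcR hΩ hT k).o2 := by
  obtain ⟨-, -, -, -, -, h⟩ := einC_values hΩ M hr hF k x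
  have hr0 : rad (base x) ≠ 0 := (bg_chart hΩ M hr).r_ne (evalAt x)
  have e : T.To2 k (base x) = evalAt x (srcR hΩ hT k).o2 := rfl
  rw [OddConstraint, ← h, ← e]
  field_simp
  constructor <;> intro h' <;> linear_combination (-1) * h'

theorem rep_FF (A B : Fin 2) : Rep (V := chartO Ω hΩ) Sum.inl (FF M F k A B)
    (wF hΩ hF k A B - ((1 / 2 : ℂ) • yR (fR hΩ M hr) (fiR hΩ M hr) A B)
      * trR (fR hΩ M hr) (fiR hΩ M hr) (wF hΩ hF k)) :=
  (rep_baseR hΩ ((hF.FAB A B).1 k)).sub (((rep_yMet hΩ M hr A B).const_mul _).mul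
    (rep_trace2 hΩ M hr fun A B => rep_baseR hΩ ((hF.FAB A B).1 k)))

set_option maxHeartbeats 1000000 in
theorem evenDivergence_iff : EvenDivergence M F T k (base x) ↔ ∀ A : Fin 2,
    evalAt x (sDiv (deriv _) (rR hΩ) (einC hΩ M hr hF k) A)
      = 8 * Real.pi * evalAt x (sDiv (deriv _) (rR hΩ) (srcR hΩ hT k) A) := by
  have hB := bg_chart hΩ M hr
  have h1 := hB.r_ne (evalAt x)
  have h2 := hB.f_ne (evalAt x)
  have hs10 := wF_symm hΩ hF k 1 0
  have e1 : ∀ A, div2 M (FF M F k) A (base x) = _ :=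
    fun A => rep_div2 hΩ M hr (rep_FF hΩ M hr hF k) A x
  have e2 : ∀ A, D0 (F.F k) A (base x) = _ := fun A => rep_D0 hΩ (rep_baseR hΩ (hF.F.1 k)) A x
  have e3 : ∀ A, D0 (T.Te2 k) A (base x) = _ := fun A => rep_D0 hΩ (rep_baseR hΩ (hT.Te2.1 k)) A x
  have e4 : ∀ A, T.Te1 k A (base x) = evalAt x ((srcR hΩ hT k).e1 A) := fun A => rfl
  have e5 : ∀ A, evalAt x (deriv (chartO Ω hΩ) (.inl A) (baseR hΩ (T.Te2 k) (hT.Te2.1 k)))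
    = evalAt x (deriv _ (.inl A) (srcR hΩ hT k).e2) := fun A => rfl
  have hu : baseR hΩ (F.F k) (hF.F.1 k) = uF hΩ hF k := rfl
  -- The left side, which involves the metric variables, is twice the source operator applied to the
  -- coefficients of 𝒢; the same factor 2 turns 8π into 16π in all the remaining equations.
  have key : ∀ A, div2 M (FF M F k) A (base x) - (1 / 2) * D0 (F.F k) A (base x)
      = 2 * evalAt x (sDiv (deriv _) (rR hΩ) (einC hΩ M hr hF k) A) := by
    simp only [Fin.forall_fin_two]
    and_intros
    all_goals
      simp only [e1, e2, hu, dY, gY, cv1, cv2, trR, Fin.sum_univ_two,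
        yR_00, yR_01, yR_10, yR_11, chrY_000, chrY_001,
        chrY_010, chrY_011, chrY_100, chrY_101, chrY_110, chrY_111, hs10, sDiv, einC, einR, gER,
        Matrix.cons_val_zero, Matrix.cons_val_one,
        hB.ri0, hB.ri1, hB.f0, hB.f1, hB.fi0, hB.fi1, hB.r0, hB.r1, der_mul, hB.n0, hB.n1,
        der_neg, der_zero, mul_zero, zero_mul, add_zero, zero_add, sub_zero, zero_sub, neg_zero,
        smul_zero, der_one, der_ofNat, mul_one, one_mul, der_add, der_sub, der_smul]
      simp only [ev_smul, ev_mul, ev_add, ev_sub, ev_neg, ev_one, ev_zero, ev_ofNat,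
        hB.eval_ri, hB.eval_fi, hB.eval_n]
      field_simp
      ring
  have hs : ∀ A, sDiv (deriv (chartO Ω hΩ)) (rR hΩ) (srcR hΩ hT k) A
    = rR hΩ * (srcR hΩ hT k).e1 A
      - (1 / 2 : ℂ) • (rR hΩ * rR hΩ * deriv _ (.inl A) (srcR hΩ hT k).e2) := fun A => rfl
  refine forall_congr' fun A => ?_
  rw [key, e3, e4]
  simp only [dY, e5, hs, ev_sub, ev_mul, ev_smul, rad_base]
  constructor <;> intro h'
  · linear_combination (1 / 2 : ℂ) * h'
  · linear_combination (2 : ℂ) * h'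

set_option maxHeartbeats 1000000 in
theorem oddEvolution_iff : OddEvolution M F T k (base x) ↔ ∀ A : Fin 2,
    evalAt x (sOdd (deriv _) (rR hΩ) (einC hΩ M hr hF k) A)
      = 8 * Real.pi * evalAt x (sOdd (deriv _) (rR hΩ) (srcR hΩ hT k) A) := by
  have hB := bg_chart hΩ M hr
  have h1 := hB.r_ne (evalAt x)
  have h2 := hB.f_ne (evalAt x)
  have hc1 := fun y => hB.comm (.inl 0) (.inl 1) y
  have rv : ∀ A, Rep Sum.inl (rFA F k A) (rR hΩ * vF hΩ hF k A) := fun A =>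
    (rep_rad hΩ).mul (rep_baseR hΩ ((hF.FA A).1 k))
  have e1 : ∀ A, rFA F k A (base x) = _ := fun A => rv A x
  have e2 : ∀ A B, D1 M (rFA F k) A B (base x) = _ := fun A B => rep_D1 hΩ M hr rv A B x
  have e6 : ∀ A B C, DD1 M (rFA F k) A B C (base x) = _ :=
    fun A B C => rep_DD1 hΩ M hr rv A B C x
  have e3 : ∀ A, D0 (T.To2 k) A (base x) = _ := fun A => rep_D0 hΩ (rep_baseR hΩ (hT.To2.1 k)) A x
  have e4 : ∀ A, T.To1 k A (base x) = evalAt x ((srcR hΩ hT k).o1 A) := fun A => rfl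
  have e5 : ∀ A, evalAt x (deriv (chartO Ω hΩ) (.inl A) (baseR hΩ (T.To2 k) (hT.To2.1 k)))
    = evalAt x (deriv _ (.inl A) (srcR hΩ hT k).o2) := fun A => rfl
  obtain ⟨hd0, hd1⟩ := dr_values hΩ x M hr
  -- The gradient of the constraint component o2 in `sOdd` cancels the second derivatives of F_A
  -- that are not in wave-operator form.
  have key : ∀ A, - ((ctr M (base x) fun D E => DD1 M (rFA F k) D E A (base x))
          - k.ev / rad (base x) ^ 2 * rFA F k A (base x))
      - 2 / rad (base x) ^ 2 * (ctr M (base x) fun D E => dr D (base x) * dr A (base x)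
          * rFA F k E (base x))
      + 2 / rad (base x) * (ctr M (base x) fun D E => dr D (base x) * D1 M (rFA F k) A E (base x))
      = 2 * evalAt x (sOdd (deriv _) (rR hΩ) (einC hΩ M hr hF k) A) := by
    simp only [Fin.forall_fin_two]
    and_intros
    all_goals
      simp only [ctr_base hΩ M hr, hd0, hd1, rad_base, e1, e2, e6, dY, gY, cv1, cv2, Fin.sum_univ_two, hc1,
        chrY_000, chrY_001,
        chrY_010, chrY_011, chrY_100, chrY_101, chrY_110, chrY_111, sOdd, einC, einR, gOR, dvR,
        Matrix.cons_val_zero, Matrix.cons_val_one,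
        hB.ri0, hB.ri1, hB.f0, hB.f1, hB.fi0, hB.fi1, hB.r0, hB.r1, der_mul, hB.n0, hB.n1,
        der_neg, der_zero, mul_zero, zero_mul, add_zero, zero_add, sub_zero, zero_sub, neg_zero,
        smul_zero, der_one, der_ofNat, mul_one, one_mul, der_add, der_sub, der_smul]
      simp only [ev_smul, ev_mul, ev_add, ev_sub, ev_neg, ev_one, ev_zero, ev_ofNat,
        hB.eval_ri, hB.eval_fi, hB.eval_n]
      field_simp
      ring
  have hs : ∀ A, sOdd (deriv (chartO Ω hΩ)) (rR hΩ) (srcR hΩ hT k) A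
    = rR hΩ * ((srcR hΩ hT k).o1 A + rR hΩ * deriv _ (.inl A) (srcR hΩ hT k).o2) := fun A => rfl
  refine forall_congr' fun A => ?_
  rw [key, e3, e4]
  simp only [dY, e5, hs, ev_add, ev_mul, rad_base]
  constructor <;> intro h'
  · linear_combination (1 / 2 : ℂ) * h'
  · linear_combination (2 : ℂ) * h'

theorem Mode.ev'_eq (k : Mode) : k.ev' = k.ev - 2 := by
  simp only [Mode.ev, Mode.ev']; ring

theorem sourceF_base : sourceF M T k (base x) = evalAt x (trR (fR hΩ M hr) (fiR hΩ M hr)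
    (srcR hΩ hT k).AB + sScal (deriv _) (rR hΩ) (fR hΩ M hr) k.ev (srcR hΩ hT k)) := by
  obtain ⟨hd0, hd1⟩ := dr_values hΩ x M hr
  have a0 : trace2 M (T.TAB k) (base x) = _ :=
    rep_trace2 hΩ M hr (fun A B => rep_baseR hΩ ((hT.TAB A B).1 k)) x
  have a3 : ∀ A, T.Te1 k A (base x) = evalAt x ((srcR hΩ hT k).e1 A) := fun A => rfl
  have a6 : T.Te2 k (base x) = evalAt x (srcR hΩ hT k).e2 := rfl
  have a7 : ∀ A, D0 (T.Te2 k) A (base x) = evalAt x (deriv _ (.inl A) (srcR hΩ hT k).e2) :=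
    fun A => rep_D0 hΩ (rep_baseR hΩ (hT.Te2.1 k)) A x
  have a8 : (fun A B => baseR hΩ (T.TAB k A B) ((hT.TAB A B).1 k)) = (srcR hΩ hT k).AB := rfl
  simp only [sourceF, a0, a3, a6, a7, a8, ctr_base hΩ M hr, hd0, hd1, sScal, rad_base,
    ev_add, ev_sub, ev_mul, ev_smul, ev_ofNat]
  ring

set_option maxHeartbeats 1000000 in
theorem evenScalar_iff : EvenScalar M F T k (base x) ↔
    evalAt x (trR (fR hΩ M hr) (fiR hΩ M hr) (einC hΩ M hr hF k).AB
      + sScal (deriv _) (rR hΩ) (fR hΩ M hr) k.ev (einC hΩ M hr hF k))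
    = 8 * Real.pi * evalAt x (trR (fR hΩ M hr) (fiR hΩ M hr) (srcR hΩ hT k).AB
      + sScal (deriv _) (rR hΩ) (fR hΩ M hr) k.ev (srcR hΩ hT k)) := by
  have hB := bg_chart hΩ M hr
  have h1 := hB.r_ne (evalAt x)
  have h2 := hB.f_ne (evalAt x)
  have hs10 := wF_symm hΩ hF k 1 0
  have hc1 := fun y => hB.comm (.inl 0) (.inl 1) y
  obtain ⟨hd0, hd1⟩ := dr_values hΩ x M hr
  have e1 : ∀ A, D0 (F.F k) A (base x) = _ := fun A => rep_D0 hΩ (rep_baseR hΩ (hF.F.1 k)) A x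
  have e2 : ∀ A B, DD0 M (F.F k) A B (base x) = _ :=
    fun A B => rep_DD0 hΩ M hr (rep_baseR hΩ (hF.F.1 k)) A B x
  have e3 : ∀ A B, FF M F k A B (base x) = _ := fun A B => rep_FF hΩ M hr hF k A B x
  have e4 : F.F k (base x) = evalAt x (uF hΩ hF k) := rfl
  have hu : baseR hΩ (F.F k) (hF.F.1 k) = uF hΩ hF k := rfl
  have key : (ctr M (base x) fun D E => DD0 M (F.F k) D E (base x))
      + 2 / rad (base x) * (ctr M (base x) fun D E => dr D (base x) * D0 (F.F k) E (base x))
      - k.ev' / rad (base x) ^ 2 * F.F k (base x)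
      - 4 / rad (base x) ^ 2 *
        (ctr M (base x) fun C C' => ctr M (base x) fun D D' =>
          dr C (base x) * dr D (base x) * FF M F k C' D' (base x))
      = 2 * evalAt x (trR (fR hΩ M hr) (fiR hΩ M hr) (einC hΩ M hr hF k).AB
      + sScal (deriv _) (rR hΩ) (fR hΩ M hr) k.ev (einC hΩ M hr hF k)) := by
    simp only [ctr_base hΩ M hr, hd0, hd1, rad_base, e1, e2, e3, e4, hu, k.ev'_eq, dY, gY, cv1, trR,
      Fin.sum_univ_two, hc1, yR_00, yR_01, yR_10, yR_11,
      chrY_000, chrY_001, chrY_010, chrY_011, chrY_100, chrY_101, chrY_110, chrY_111, hs10,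
      sScal, einC, einR, eR, e00R, e01R, e11R, gER,
      Matrix.cons_val_zero, Matrix.cons_val_one, Matrix.of_apply, Matrix.cons_val',
      Matrix.cons_val_fin_one,
      hB.ri0, hB.ri1, hB.f0, hB.f1, hB.fi0, hB.fi1, hB.r0, hB.r1, der_mul, hB.n0, hB.n1,
      der_neg, der_zero, mul_zero, zero_mul, add_zero, zero_add, sub_zero, zero_sub, neg_zero,
      smul_zero, der_one, der_ofNat, mul_one, one_mul, der_add, der_sub, der_smul]
    simp only [ev_smul, ev_mul, ev_add, ev_sub, ev_neg, ev_one, ev_zero, ev_ofNat,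
      hB.eval_ri, hB.eval_fi, hB.eval_n]
    field_simp
    ring
  rw [EvenScalar, key, sourceF_base hΩ M hr hT]
  constructor <;> intro h'
  · linear_combination (1 / 2 : ℂ) * h'
  · linear_combination (2 : ℂ) * h'

theorem sourceFF_base : ∀ A B, sourceFF M T k A B (base x) = evalAt x ((srcR hΩ hT k).AB A B
    - ((1 / 2 : ℂ) • yR (fR hΩ M hr) (fiR hΩ M hr) A B)
      * trR (fR hΩ M hr) (fiR hΩ M hr) (srcR hΩ hT k).AB
    + sTens (deriv _) (rR hΩ) (fR hΩ M hr) (fiR hΩ M hr) (nR hΩ M hr) (srcR hΩ hT k) A B) := by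
  obtain ⟨hd0, hd1⟩ := dr_values hΩ x M hr
  have re1 : ∀ A, Rep Sum.inl (rTe1 T k A) (rR hΩ * (srcR hΩ hT k).e1 A) := fun A =>
    (rep_rad hΩ).mul (rep_baseR hΩ ((hT.Te1 A).1 k))
  have re2 : Rep Sum.inl (rTe2 T k) (rR hΩ * (srcR hΩ hT k).e2) :=
    (rep_rad hΩ).mul (rep_baseR hΩ (hT.Te2.1 k))
  have a0 : trace2 M (T.TAB k) (base x) = evalAt x (trR (fR hΩ M hr) (fiR hΩ M hr)
      (srcR hΩ hT k).AB) :=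
    rep_trace2 hΩ M hr (fun A B => rep_baseR hΩ ((hT.TAB A B).1 k)) x
  have a1 : ∀ A B, T.TAB k A B (base x) = evalAt x ((srcR hΩ hT k).AB A B) := fun A B => rfl
  have a2 : ∀ A B, yMet M (base x) A B = _ := fun A B => rep_yMet hΩ M hr A B x
  have a3 : ∀ A, T.Te1 k A (base x) = evalAt x ((srcR hΩ hT k).e1 A) := fun A => rfl
  have a4 : ∀ A B, D1 M (rTe1 T k) A B (base x) = _ := fun A B => rep_D1 hΩ M hr re1 A B x
  have a5 : div1 M (rTe1 T k) (base x) = _ := rep_div1 hΩ M hr re1 x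
  have a6 : T.Te2 k (base x) = evalAt x (srcR hΩ hT k).e2 := rfl
  have a7 : ∀ A, D0 (T.Te2 k) A (base x) = evalAt x (deriv _ (.inl A) (srcR hΩ hT k).e2) :=
    fun A => rep_D0 hΩ (rep_baseR hΩ (hT.Te2.1 k)) A x
  have a8 : ∀ A, D0 (rTe2 T k) A (base x) = _ := fun A => rep_D0 hΩ re2 A x
  have a9 : ∀ A B, DD0 M (rTe2 T k) A B (base x) = _ := fun A B => rep_DD0 hΩ M hr re2 A B x
  have hdY : dY hΩ = fun A => deriv (chartO Ω hΩ) (Sum.inl A) := rfl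
  have hgY : gY hΩ M hr = chrY (fR hΩ M hr) (fiR hΩ M hr) (nR hΩ M hr) := rfl
  simp only [Fin.forall_fin_two]
  and_intros
  all_goals
    simp only [sourceFF, drSq, a0, a1, a2, a3, a4, a5, a6, a7, a8, a9, ctr_base hΩ M hr, hd0, hd1,
      sTens, rad_base, hdY, hgY,
      Matrix.cons_val_zero, Matrix.cons_val_one,
      ev_add, ev_sub, ev_neg, ev_mul, ev_smul, ev_ofNat, ev_zero, ev_one]
    ring

/-- The trace-free part `𝔽_{AB}` in the ring. -/
def ffR {R : Type} [CommRing R] [Algebra ℂ R] (f fi : R) (w : Fin 2 → Fin 2 → R) (A B : Fin 2) : R :=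
  !![(1 / 2 : ℂ) • (w 0 0 + f * f * w 1 1), w 0 1; w 0 1, (1 / 2 : ℂ) • (w 1 1 + fi * fi * w 0 0)] A B

theorem rep_ffR (A B : Fin 2) : Rep (V := chartO Ω hΩ) Sum.inl (FF M F k A B)
    (ffR (fR hΩ M hr) (fiR hΩ M hr) (wF hΩ hF k) A B) := by
  have hB := bg_chart hΩ M hr
  refine (rep_FF hΩ M hr hF k A B).congr_right (evalAt_injective fun y => ?_)
  have h2 := hB.f_ne (evalAt y)
  have hs10 := wF_symm hΩ hF k 1 0
  revert A B
  simp only [Fin.forall_fin_two, ffR, trR, yR_00, yR_01, yR_10, yR_11, hs10,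
    Matrix.cons_val_zero, Matrix.cons_val_one, Matrix.of_apply, Matrix.cons_val',
    Matrix.cons_val_fin_one, ev_smul, ev_mul, ev_add, ev_sub, ev_neg, ev_one, ev_zero, ev_ofNat,
    hB.eval_fi]
  and_intros <;> field_simp <;> ring

-- The hardest of these identities: the derivatives of e1 and e2 contained in `sTens` convert the
-- Einstein bracket into a wave operator acting on 𝔽_{AB}. It is verified from the explicit
-- trace-free components `ffR`.
set_option maxHeartbeats 4000000 in
theorem evenTensor_lhs : ∀ A B : Fin 2,
    - (ctr M (base x) fun D E => DD2 M (FF M F k) D E A B (base x))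
      - 2 / rad (base x) * (ctr M (base x) fun D E => dr D (base x) * D2 M (FF M F k) E A B (base x))
      + 4 / rad (base x) * (ctr M (base x) fun D E => DD0 M rad D E (base x)) * FF M F k A B (base x)
      + k.ev / rad (base x) ^ 2 * FF M F k A B (base x)
      + 4 / rad (base x) * (ctr M (base x) fun D E => dr D (base x) *
          ((1 / 2) * (D2 M (FF M F k) A B E (base x) + D2 M (FF M F k) B A E (base x))))
      - 2 / rad (base x) * ((1 / 2) * (dr A (base x) * D0 (F.F k) B (base x)
        + dr B (base x) * D0 (F.F k) A (base x)))
    = 2 * evalAt x ((einC hΩ M hr hF k).AB A B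
    - ((1 / 2 : ℂ) • yR (fR hΩ M hr) (fiR hΩ M hr) A B)
      * trR (fR hΩ M hr) (fiR hΩ M hr) (einC hΩ M hr hF k).AB
    + sTens (deriv _) (rR hΩ) (fR hΩ M hr) (fiR hΩ M hr) (nR hΩ M hr) (einC hΩ M hr hF k) A B) := by
  have hB := bg_chart hΩ M hr
  have h1 := hB.r_ne (evalAt x)
  have h2 := hB.f_ne (evalAt x)
  have hs10 := wF_symm hΩ hF k 1 0
  have hc1 := fun y => hB.comm (.inl 0) (.inl 1) y
  obtain ⟨hd0, hd1⟩ := dr_values hΩ x M hr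
  have hW := rep_ffR hΩ M hr hF k
  have e1 : ∀ A, D0 (F.F k) A (base x) = _ := fun A => rep_D0 hΩ (rep_baseR hΩ (hF.F.1 k)) A x
  have e2 : ∀ A B, DD0 M rad A B (base x) = _ := fun A B => rep_DD0 hΩ M hr (rep_rad hΩ) A B x
  have e3 : ∀ A B, FF M F k A B (base x) = _ := fun A B => hW A B x
  have e5 : ∀ A B C, D2 M (FF M F k) A B C (base x) = _ := fun A B C => rep_D2 hΩ M hr hW A B C x
  have e6 : ∀ A B C D, DD2 M (FF M F k) A B C D (base x) = _ :=
    fun A B C D => rep_DD2 hΩ M hr hW A B C D x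
  have hu : baseR hΩ (F.F k) (hF.F.1 k) = uF hΩ hF k := rfl
  simp only [Fin.forall_fin_two]
  and_intros
  all_goals
    simp only [ctr_base hΩ M hr, hd0, hd1, rad_base, e1, e2, e3, e5, e6, hu, dY, gY, cv1, cv2, cv3,
      trR, ffR, Fin.sum_univ_two, hc1, yR_00, yR_01, yR_10, yR_11,
      chrY_000, chrY_001, chrY_010, chrY_011, chrY_100, chrY_101, chrY_110, chrY_111, hs10,
      Matrix.cons_val_zero, Matrix.cons_val_one, Matrix.of_apply, Matrix.cons_val',
      Matrix.cons_val_fin_one,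
      hB.ri0, hB.ri1, hB.f0, hB.f1, hB.fi0, hB.fi1, hB.r0, hB.r1, der_mul, hB.n0, hB.n1,
      der_neg, der_zero, mul_zero, zero_mul, add_zero, zero_add, sub_zero, zero_sub, neg_zero,
      smul_zero, der_one, der_ofNat, mul_one, one_mul, der_add, der_sub, der_smul]
    simp only [sTens, einC, einR, eR, e00R, e01R, e11R, gER, cv1, trR, Fin.sum_univ_two, hc1,
      yR_00, yR_01, yR_10, yR_11,
      chrY_000, chrY_001, chrY_010, chrY_011, chrY_100, chrY_101, chrY_110, chrY_111, hs10,
      Matrix.cons_val_zero, Matrix.cons_val_one, Matrix.of_apply, Matrix.cons_val',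
      Matrix.cons_val_fin_one,
      hB.ri0, hB.ri1, hB.f0, hB.f1, hB.fi0, hB.fi1, hB.r0, hB.r1, der_mul, hB.n0, hB.n1,
      der_neg, der_zero, mul_zero, zero_mul, add_zero, zero_add, sub_zero, zero_sub, neg_zero,
      smul_zero, der_one, der_ofNat, mul_one, one_mul, der_add, der_sub, der_smul]
    simp only [ev_smul, ev_mul, ev_add, ev_sub, ev_neg, ev_one, ev_zero, ev_ofNat,
      hB.eval_ri, hB.eval_fi, hB.eval_n]
    field_simp
    ring

theorem evenTensor_iff : EvenTensor M F T k (base x) ↔ ∀ A B : Fin 2,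
    evalAt x ((einC hΩ M hr hF k).AB A B
    - ((1 / 2 : ℂ) • yR (fR hΩ M hr) (fiR hΩ M hr) A B)
      * trR (fR hΩ M hr) (fiR hΩ M hr) (einC hΩ M hr hF k).AB
    + sTens (deriv _) (rR hΩ) (fR hΩ M hr) (fiR hΩ M hr) (nR hΩ M hr) (einC hΩ M hr hF k) A B)
    = 8 * Real.pi * evalAt x ((srcR hΩ hT k).AB A B
    - ((1 / 2 : ℂ) • yR (fR hΩ M hr) (fiR hΩ M hr) A B)
      * trR (fR hΩ M hr) (fiR hΩ M hr) (srcR hΩ hT k).AB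
    + sTens (deriv _) (rR hΩ) (fR hΩ M hr) (fiR hΩ M hr) (nR hΩ M hr) (srcR hΩ hT k) A B) := by
  refine forall₂_congr fun A B => ?_
  rw [evenTensor_lhs hΩ M hr hF, sourceFF_base hΩ M hr hT]
  constructor <;> intro h'
  · linear_combination (1 / 2 : ℂ) * h'
  · linear_combination (2 : ℂ) * h'

end ModeEquations

/-! ### The mode equations and the components of the Einstein equation -/

section Sources

variable {R : Type} [CommRing R] [Algebra ℂ R]
  {d : Fin 2 ⊕ Fin 2 → Derivation ℂ R R} {r ri f fi n s si k : R} {ev : ℂ}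

theorem Src.ext_of {a b : Src R} (h1 : ∀ A B, a.AB A B = b.AB A B) (h2 : ∀ A, a.e1 A = b.e1 A)
    (h3 : ∀ A, a.o1 A = b.o1 A) (h4 : a.e0 = b.e0) (h5 : a.e2 = b.e2) (h6 : a.o2 = b.o2) :
    a = b := by
  obtain ⟨a1, a2, a3, a4, a5, a6⟩ := a
  obtain ⟨b1, b2, b3, b4, b5, b6⟩ := b
  obtain rfl : a1 = b1 := funext fun A => funext fun B => h1 A B
  obtain rfl : a2 = b2 := funext h2
  obtain rfl : a3 = b3 := funext h3
  obtain rfl : a4 = b4 := h4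
  obtain rfl : a5 = b5 := h5
  obtain rfl : a6 = b6 := h6
  rfl

/-- The system is triangular. The components e2 and o2 are given, `sDiv` and `sOdd` then determine
e1 and o1 since their derivative terms agree, `sScal` leaves the trace of the orbit part, and
`sTens` with that trace leaves the orbit part itself. -/
theorem src_eq_of_sources (hr : ri * r = 1) {a b : Src R} (h2 : a.e2 = b.e2) (ho2 : a.o2 = b.o2)
    (hd : ∀ A, sDiv d r a A = sDiv d r b A) (ho : ∀ A, sOdd d r a A = sOdd d r b A)
    (hs : trR f fi a.AB + sScal d r f ev a = trR f fi b.AB + sScal d r f ev b)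
    (ht : ∀ A B, a.AB A B - ((1 / 2 : ℂ) • yR f fi A B) * trR f fi a.AB + sTens d r f fi n a A B
      = b.AB A B - ((1 / 2 : ℂ) • yR f fi A B) * trR f fi b.AB + sTens d r f fi n b A B)
    (hc : cbR d ri f fi n ev a = cbR d ri f fi n ev b) : a = b := by
  have he1 : a.e1 = b.e1 := funext fun A => by
    have := hd A
    simp only [sDiv, h2, sub_left_inj] at this
    linear_combination ri * this + (b.e1 A - a.e1 A) * hr
  have ho1 : a.o1 = b.o1 := funext fun A => by
    have := ho A
    simp only [sOdd, ho2] at this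
    linear_combination ri * this + (b.o1 A - a.o1 A) * hr
  have htr : trR f fi a.AB = trR f fi b.AB := by
    simpa only [sScal, he1, h2, add_left_inj] using hs
  -- The component e0 occurs in none of the source operators; it is recovered from (b), where its
  -- coefficient 1/(2r) is invertible.
  have he0 : a.e0 = b.e0 := by
    simp only [cbR, he1, h2, sub_left_inj, add_right_inj] at hc
    have h := congrArg (fun x => (2 : ℂ) • (r * x)) hc
    simp only [mul_smul_comm, smul_smul] at h
    norm_num at h
    linear_combination h + (b.e0 - a.e0) * hr
  refine Src.ext_of (fun A B => ?_) (congrFun he1) (congrFun ho1) he0 h2 ho2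
  have := ht A B
  simpa only [sTens, he1, h2, htr, add_left_inj, sub_left_inj] using this

variable (c : ℂ) (t : Src R)

theorem sDiv_smul (A : Fin 2) : sDiv d r (t.map (c • ·)) A = c • sDiv d r t A := by
  simp only [sDiv, Src.map, der_smul]
  simp only [Algebra.smul_def]; ring

theorem sOdd_smul (A : Fin 2) : sOdd d r (t.map (c • ·)) A = c • sOdd d r t A := by
  simp only [sOdd, Src.map, der_smul]
  simp only [Algebra.smul_def]; ring

theorem trR_smul : trR f fi (t.map (c • ·)).AB = c • trR f fi t.AB := by
  simp only [trR, Src.map, Algebra.smul_def]; ring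

theorem sScal_smul : sScal d r f ev (t.map (c • ·)) = c • sScal d r f ev t := by
  simp only [sScal, Src.map, der_smul]
  simp only [Algebra.smul_def]; ring

theorem cv1_smul (Γ : Fin 2 → Fin 2 → Fin 2 → R) (v : Fin 2 → R) (A B : Fin 2) :
    cv1 (fun A => d (.inl A)) Γ (fun A => c • v A) A B
      = c • cv1 (fun A => d (.inl A)) Γ v A B := by
  simp only [cv1, der_smul, Fin.sum_univ_two]
  simp only [Algebra.smul_def]; ring

theorem sTens_smul (A B : Fin 2) :
    sTens d r f fi n (t.map (c • ·)) A B = c • sTens d r f fi n t A B := by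
  simp only [sTens, Src.map, der_smul, mul_smul_comm, cv1_smul]
  simp only [Algebra.smul_def]; ring

theorem caR_smul (B : Fin 2) :
    caR d ri f fi n ev (t.map (c • ·)) B = c • caR d ri f fi n ev t B := by
  simp only [caR, Src.map, der_smul, cv2, Fin.sum_univ_two]
  simp only [Algebra.smul_def]; ring

theorem cbR_smul : cbR d ri f fi n ev (t.map (c • ·)) = c • cbR d ri f fi n ev t := by
  simp only [cbR, Src.map, der_smul, cv1, Fin.sum_univ_two]
  simp only [Algebra.smul_def]; ring

theorem ccR_smul : ccR d ri f fi n ev (t.map (c • ·)) = c • ccR d ri f fi n ev t := by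
  simp only [ccR, Src.map, der_smul, cv1, Fin.sum_univ_two]
  simp only [Algebra.smul_def]; ring

end Sources

/-! ### Equivalence of the mode equations and the equality of coefficients -/

section Equations

variable {Ω : Set Plane} (hΩ : IsOpen Ω) (M δ : ℝ) (hr : ∀ q ∈ Ω, 0 < q 1 ∧ q 1 ≠ 2 * M)
  {F : InvModes} (hF : F.Smooth Ω) {T : MatterModes} (hT : T.Smooth Ω)

/-- The equations for a single mode follow from the equality of the components. -/
theorem modeEqs_of_einC {k : Mode}
    (h : einC hΩ M hr hF k = (srcR hΩ hT k).map ((8 * Real.pi : ℂ) • ·)) (x : chartO Ω hΩ) :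
    OddEqs M F T k (base x) ∧ EvenEqs M F T k (base x) ∧ ContinuityEqs M T k (base x) := by
  have hB := bg_chart hΩ M hr
  have hpi : (8 * Real.pi : ℂ) ≠ 0 := mul_ne_zero (by norm_num) (by exact_mod_cast Real.pi_ne_zero)
  have z : ∀ {a : smoothRing (chartO Ω hΩ)}, (8 * Real.pi : ℂ) • a = 0 → evalAt x a = 0 :=
    fun {a} ha => by
      have := congrArg (evalAt x) ha
      rw [ev_smul, ev_zero] at this
      exact (mul_eq_zero.1 this).resolve_left hpi
  obtain ⟨i1, i2, i3⟩ := continuityEqs_iff hΩ M hr hT k x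
  refine ⟨⟨(oddConstraint_iff hΩ M hr hF hT k x).2 ?_, (oddEvolution_iff hΩ M hr hF hT k x).2 ?_⟩,
    ⟨(evenTrace_iff hΩ M hr hF hT k x).2 ?_, (evenDivergence_iff hΩ M hr hF hT k x).2 ?_,
      (evenScalar_iff hΩ M hr hF hT k x).2 ?_, (evenTensor_iff hΩ M hr hF hT k x).2 ?_⟩,
    i1.2 ?_, i2.2 ?_, i3.2 ?_⟩
  · rw [h]; exact ev_smul _ _ _
  · intro A; rw [h, sOdd_smul, ev_smul]
  · rw [h]; exact ev_smul _ _ _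
  · intro A; rw [h, sDiv_smul, ev_smul]
  · rw [h, trR_smul, sScal_smul, ← smul_add, ev_smul]
  · intro A B
    rw [h, trR_smul, sTens_smul, mul_smul_comm]
    simp only [Src.map, ← smul_sub, ← smul_add, ev_smul]
  · intro B
    -- The divergence of 8π times the matter coefficients is the divergence of the coefficients of
    -- 𝒢, which vanishes by the Bianchi identity; the factor 8π is then cancelled.
    exact z ((caR_smul _ _ _).symm.trans (h ▸ caR_einR hB (wF_symm hΩ hF k) B))
  · exact z ((cbR_smul _ _).symm.trans (h ▸ cbR_einR hB (wF_symm hΩ hF k)))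
  · exact z ((ccR_smul _ _).symm.trans (h ▸ ccR_einR hB))

/-- A point of the chart over a given point of the orbit space. -/
theorem exists_base {q : Plane} (hq : q ∈ Ω) : ∃ x : chartO Ω hΩ, base x = q :=
  ⟨⟨Sum.elim q ![Real.pi / 2, 0], hq, half_pos Real.pi_pos, half_lt_self Real.pi_pos⟩, rfl⟩

/-- The hypotheses of `src_eq_of_sources` are the mode equations one by one. Equations at all points
of Ω are needed, since equality is required in the ring of functions. -/
theorem einC_of_modeEqs {k : Mode} (h : ∀ q ∈ Ω,
    OddEqs M F T k q ∧ EvenEqs M F T k q ∧ ContinuityEven M T k q) :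
    einC hΩ M hr hF k = (srcR hΩ hT k).map ((8 * Real.pi : ℂ) • ·) := by
  have hB := bg_chart hΩ M hr
  have h' := fun x : chartO Ω hΩ => h (base x) (mem_chart hΩ x).1
  have hri : riR hΩ M hr * rR hΩ = 1 := evalAt_injective fun x =>
    inv_mul_cancel₀ (hB.r_ne (evalAt x))
  refine src_eq_of_sources (d := deriv _) (f := fR hΩ M hr) (fi := fiR hΩ M hr) (n := nR hΩ M hr)
    (ev := k.ev) hri ?_ ?_ ?_ ?_ ?_ ?_ ?_
  · exact evalAt_injective fun x => ((evenTrace_iff hΩ M hr hF hT k x).1 (h' x).2.1.1).trans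
      (ev_smul _ _ _).symm
  · exact evalAt_injective fun x => ((oddConstraint_iff hΩ M hr hF hT k x).1 (h' x).1.1).trans
      (ev_smul _ _ _).symm
  · intro A
    refine evalAt_injective fun x => ?_
    rw [sDiv_smul, ev_smul]
    exact (evenDivergence_iff hΩ M hr hF hT k x).1 (h' x).2.1.2.1 A
  · intro A
    refine evalAt_injective fun x => ?_
    rw [sOdd_smul, ev_smul]
    exact (oddEvolution_iff hΩ M hr hF hT k x).1 (h' x).1.2 A
  · refine evalAt_injective fun x => ?_
    rw [trR_smul, sScal_smul, ← smul_add, ev_smul]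
    exact (evenScalar_iff hΩ M hr hF hT k x).1 (h' x).2.1.2.2.1
  · intro A B
    refine evalAt_injective fun x => ?_
    rw [trR_smul, sTens_smul, mul_smul_comm]
    simp only [Src.map, ← smul_sub, ← smul_add, ev_smul]
    exact (evenTensor_iff hΩ M hr hF hT k x).1 (h' x).2.1.2.2.2 A B
  -- Both sides of (b) vanish: for 𝒢 by the Bianchi identity, for the matter by assumption.
  · rw [cbR_smul]
    have e1 : cbR (deriv (chartO Ω hΩ)) (riR hΩ M hr) (fR hΩ M hr) (fiR hΩ M hr) (nR hΩ M hr) k.ev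
      (einC hΩ M hr hF k) = 0 := cbR_einR hB (wF_symm hΩ hF k)
    have e2 : cbR (deriv (chartO Ω hΩ)) (riR hΩ M hr) (fR hΩ M hr) (fiR hΩ M hr) (nR hΩ M hr) k.ev
      (srcR hΩ hT k) = 0 := evalAt_injective fun x =>
        ((continuityEqs_iff hΩ M hr hT k x).2.1.1 (h' x).2.2).trans (ev_zero _).symm
    rw [e1, e2, smul_zero]

theorem matC_smul (c ev : ℂ) (S : smoothRing (chartO Ω hΩ)) (t : Src (smoothRing (chartO Ω hΩ)))
    (a b : Fin 2 ⊕ Fin 2) :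
    matC hΩ M hr ev S (t.map (c • ·)) a b = c • matC hΩ M hr ev S t a b := by
  rcases a with A | p <;> rcases b with B | q <;>
    simp only [matC, matR, Src.map, Algebra.smul_def] <;> ring

theorem einsteinEq_of_modes (hΩ : IsOpen Ω) (hr : ∀ q ∈ Ω, 0 < q 1 ∧ q 1 ≠ 2 * M)
    (hF : F.Smooth Ω) (hT : T.Smooth Ω) (h : ∀ k : Mode, ∀ q ∈ Ω,
      OddEqs M F T k q ∧ EvenEqs M F T k q ∧ ContinuityEven M T k q) :
    EinsteinEq M δ Ω F T := by
  obtain ⟨G, hG, hG'⟩ := exists_einstein hΩ M δ hr hF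
  obtain ⟨t, ht, ht'⟩ := exists_calT hΩ δ hT M hr
  intro x hx a b
  have h1 : linEinstein (gMet M) (calF δ F) a b x = _ := hG' a b (⟨x, hx⟩ : chartO Ω hΩ)
  have h2 : calT M δ T a b x = _ := ht' a b (⟨x, hx⟩ : chartO Ω hΩ)
  rw [h1, h2, ← ev_smul]
  congr 1
  refine (hG a b).unique (((ht a b).smul _).congr fun k => ?_)
  rw [einC_of_modeEqs hΩ M hr hF hT (h k), matC_smul]

end Equations

/-! ### Rapidly decreasing mode coefficients -/

section Rapid

variable {Ω : Set Plane} (hΩ : IsOpen Ω)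

theorem contDiff_sphericalY (k : Mode) : ContDiff ℝ ∞ (sphericalY k) := by
  have h : sphericalY k = fun s => ((normY k * legA k.l k.m.natAbs (s 0) : ℝ) : ℂ)
      * Complex.exp (Complex.I * (k.m : ℂ) * ((s 1 : ℝ) : ℂ)) := funext (sphericalY_eq k)
  rw [h]
  have h0 : ContDiff ℝ ∞ fun s : Plane => s 0 := contDiff_apply ℝ ℝ 0
  have h1 : ContDiff ℝ ∞ fun s : Plane => s 1 := contDiff_apply ℝ ℝ 1
  exact (contDiff_ofReal.comp (contDiff_const.mul ((contDiff_legA _ _).comp h0))).mul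
    ((contDiff_exp_phi k.m).comp h1)

/-- The harmonic does not depend on t and r, so differentiating the coefficient is differentiating
the product. The bound of order n + 1 for the product therefore serves as a bound of order n. -/
theorem SmoothModes.pd (hΩ : IsOpen Ω) {c : Mode → Plane → ℂ} (hc : SmoothModes Ω c) (A : Fin 2) :
    SmoothModes Ω fun k => pd A (c k) := by
  refine ⟨fun k => contDiffOn_pd' hΩ (hc.1 k) A, fun n N K hK hKΩ => ?_⟩
  obtain ⟨u, hu, hu'⟩ := hc.2 (n + 1) N K hK hKΩ
  refine ⟨u, hu, fun k hk x hx => (mul_le_mul_of_nonneg_left ?_ (by positivity)).trans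
    (hu' k hk x hx)⟩
  have hb : ContDiff ℝ ∞ base := by unfold base; fun_prop
  have hs : ContDiff ℝ ∞ sph := by unfold sph; fun_prop
  have hY : ContDiff ℝ ∞ fun z : Pt => sphericalY k (sph z) := (contDiff_sphericalY k).comp hs
  have hG : ∀ z : Pt, base z ∈ Ω →
      ContDiffAt ℝ ∞ (fun z : Pt => c k (base z) * sphericalY k (sph z)) z := fun z hz =>
    (((hc.1 k).contDiffAt (hΩ.mem_nhds hz)).comp z hb.contDiffAt).mul hY.contDiffAt
  have hpd : ∀ z : Pt, base z ∈ Ω → SchwarzschildModes.pd A (c k) (base z) * sphericalY k (sph z)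
      = SchwarzschildModes.pd (Sum.inl A) (fun z : Pt => c k (base z) * sphericalY k (sph z)) z :=
    fun z hz => by
      have h1 : HasFDerivAt (fun z : Pt => c k (base z)) _ z :=
        (((hc.1 k).contDiffAt (hΩ.mem_nhds hz)).differentiableAt (by simp)).hasFDerivAt.comp z
          (hb.differentiable (by simp) z).hasFDerivAt
      have h2 : HasFDerivAt (fun z : Pt => sphericalY k (sph z)) _ z :=
        ((contDiff_sphericalY k).differentiable (by simp) (sph z)).hasFDerivAt.comp z
          (hs.differentiable (by simp) z).hasFDerivAt
      have e1 : fderiv ℝ base z (Pi.single (Sum.inl A) 1) = Pi.single A 1 := by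
        have : HasFDerivAt base (ContinuousLinearMap.pi fun B : Fin 2 =>
            (prj (Sum.inl B : Fin 2 ⊕ Fin 2))) z := by
          rw [hasFDerivAt_pi]
          exact fun B => (prj (Sum.inl B : Fin 2 ⊕ Fin 2)).hasFDerivAt
        rw [this.fderiv]
        funext B
        simp [prj_apply, Pi.single_apply]
      have e2 : fderiv ℝ sph z (Pi.single (Sum.inl A) 1) = 0 := by
        have : HasFDerivAt sph (ContinuousLinearMap.pi fun B : Fin 2 =>
            (prj (Sum.inr B : Fin 2 ⊕ Fin 2))) z := by
          rw [hasFDerivAt_pi]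
          exact fun B => (prj (Sum.inr B : Fin 2 ⊕ Fin 2)).hasFDerivAt
        rw [this.fderiv]
        funext B
        simp [prj_apply]
      have h12 := (h1.mul h2).fderiv
      change _ = fderiv ℝ ((fun z : Pt => c k (base z)) * fun z => sphericalY k (sph z)) z _
      rw [h12]
      simp [e1, e2, SchwarzschildModes.pd, mul_comm]
  have hev : (fun z : Pt => SchwarzschildModes.pd A (c k) (base z) * sphericalY k (sph z))
      =ᶠ[𝓝 x] SchwarzschildModes.pd (Sum.inl A)
        (fun z : Pt => c k (base z) * sphericalY k (sph z)) :=
    Filter.eventually_of_mem ((hΩ.preimage hb.continuous).mem_nhds (hKΩ x hx)) hpd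
  rw [(hev.iteratedFDeriv ℝ n).eq_of_nhds]
  exact norm_iteratedFDeriv_pd_le (hG x (hKΩ x hx)) _ n

/-- The sup norm of `γ Y` over a sphere is rapidly decreasing in `l`. -/
def Rp : ℕ → (Mode → smoothRing (chartO Ω hΩ)) → Prop
  | 0, γ => ∀ (N : ℕ) (x : chartO Ω hΩ), ∃ u : Mode → ℝ, Summable u ∧
      ∀ k : Mode, 2 ≤ k.l → ∀ t ∈ Set.Icc 0 Real.pi, ((k.l : ℝ) + 1) ^ N * (‖evalAt x (γ k)‖
        * |normY k * legA k.l k.m.natAbs t|) ≤ u k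
  | n + 1, γ => Rp n γ ∧ ∀ A : Fin 2, Rp n fun k => deriv _ (Sum.inl A) (γ k)

/-- All derivatives along the orbit space are rapidly decreasing in `l`. -/
def Rapid (γ : Mode → smoothRing (chartO Ω hΩ)) : Prop := ∀ n, Rp hΩ n γ

theorem rapid_baseR {c : Mode → Plane → ℂ} (hc : SmoothModes Ω c) :
    Rapid hΩ fun k => baseR hΩ (c k) (hc.1 k) := by
  intro n
  induction n generalizing c with
  | zero =>
    intro N x
    -- The meridian φ = 0 over the base point of x, with both poles included; it is compact, so the
    -- hypothesis bounds the series on it. Other values of φ change no absolute value.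
    let e : ℝ → Pt := fun t => Sum.elim (base x) ![t, 0]
    have he : Continuous e := by
      refine continuous_pi fun a => ?_
      rcases a with A | p
      · exact continuous_const
      · revert p
        simp only [Fin.forall_fin_two]
        exact ⟨continuous_id, continuous_const⟩
    obtain ⟨u, hu, hu'⟩ := hc.2 0 N (e '' Set.Icc 0 Real.pi) (isCompact_Icc.image he) (by
      rintro _ ⟨t, -, rfl⟩
      exact (mem_chart hΩ x).1)
    refine ⟨u, hu, fun k hk t ht => ?_⟩
    have := hu' k hk (e t) ⟨t, ht, rfl⟩
    rw [norm_iteratedFDeriv_zero, norm_mul, sphericalY_eq, norm_mul, Complex.norm_real] at this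
    have h1 : sph (e t) 1 = 0 := rfl
    rw [h1, Complex.ofReal_zero, mul_zero, Complex.exp_zero, norm_one, mul_one] at this
    exact this
  | succ n ih =>
    refine ⟨ih hc, fun A => ?_⟩
    simp only [deriv_baseR]
    exact ih (hc.pd hΩ A)

variable {hΩ} {γ η : Mode → smoothRing (chartO Ω hΩ)}

theorem Rp.add {n : ℕ} : ∀ {γ η : Mode → smoothRing (chartO Ω hΩ)}, Rp hΩ n γ → Rp hΩ n η →
    Rp hΩ n fun k => γ k + η k := by
  induction n with
  | zero =>
    intro γ η h1 h2 N x
    obtain ⟨u, hu, hu'⟩ := h1 N x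
    obtain ⟨w, hw, hw'⟩ := h2 N x
    refine ⟨fun k => u k + w k, hu.add hw, fun k hk t ht => ?_⟩
    refine le_trans ?_ (add_le_add (hu' k hk t ht) (hw' k hk t ht))
    rw [← mul_add, ← add_mul, ev_add]
    gcongr
    exact norm_add_le _ _
  | succ n ih =>
    intro γ η h1 h2
    refine ⟨ih h1.1 h2.1, fun A => ?_⟩
    simp only [der_add]
    exact ih (h1.2 A) (h2.2 A)

theorem Rp.const_mul {n : ℕ} : ∀ {γ : Mode → smoothRing (chartO Ω hΩ)} (a : smoothRing (chartO Ω hΩ)),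
    Rp hΩ n γ → Rp hΩ n fun k => a * γ k := by
  induction n with
  | zero =>
    intro γ a h N x
    obtain ⟨u, hu, hu'⟩ := h N x
    refine ⟨fun k => ‖evalAt x a‖ * u k, hu.mul_left _, fun k hk t ht => ?_⟩
    refine le_trans (le_of_eq ?_) (mul_le_mul_of_nonneg_left (hu' k hk t ht) (norm_nonneg _))
    rw [ev_mul, norm_mul]
    ring
  | succ n ih =>
    intro γ a h
    refine ⟨ih a h.1, fun i => ?_⟩
    simp only [der_mul, mul_comm (γ _)]
    exact (ih a (h.2 i)).add (ih _ h.1)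

/-- At most polynomial growth in `l`. -/
def PolyGrowth (z : Mode → ℂ) : Prop :=
  ∃ (C : ℝ) (N : ℕ), 0 ≤ C ∧ ∀ k, ‖z k‖ ≤ C * ((k.l : ℝ) + 1) ^ N

/-- A factor of polynomial growth in l is absorbed by a larger exponent of the weight. This is why
rapid decrease, rather than mere summability, is carried along. -/
theorem Rp.smul {n : ℕ} : ∀ {γ : Mode → smoothRing (chartO Ω hΩ)} {z : Mode → ℂ}, PolyGrowth z →
    Rp hΩ n γ → Rp hΩ n fun k => z k • γ k := by
  induction n with
  | zero =>
    intro γ z hz h N x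
    obtain ⟨C, N', hC, hz'⟩ := hz
    obtain ⟨u, hu, hu'⟩ := h (N + N') x
    refine ⟨fun k => C * u k, hu.mul_left _, fun k hk t ht => ?_⟩
    refine le_trans ?_ (mul_le_mul_of_nonneg_left (hu' k hk t ht) hC)
    rw [ev_smul, norm_mul]
    calc _ ≤ ((k.l : ℝ) + 1) ^ N * (C * ((k.l : ℝ) + 1) ^ N' * ‖evalAt x (γ k)‖
          * |normY k * legA k.l k.m.natAbs t|) := by
          gcongr
          exact hz' k
      _ = _ := by ring
  | succ n ih =>
    intro γ z hz h
    refine ⟨ih hz h.1, fun A => ?_⟩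
    simp only [der_smul]
    exact ih hz (h.2 A)

theorem PolyGrowth.const (c : ℂ) : PolyGrowth fun _ => c :=
  ⟨‖c‖, 0, norm_nonneg _, fun k => by simp⟩

theorem PolyGrowth.ev : PolyGrowth Mode.ev := by
  refine ⟨1, 2, zero_le_one, fun k => ?_⟩
  have e : k.ev = (((k.l : ℝ) * ((k.l : ℝ) + 1) : ℝ) : ℂ) := by
    rw [Mode.ev]; push_cast; rfl
  rw [e, Complex.norm_real, Real.norm_of_nonneg (by positivity)]
  nlinarith [(Nat.cast_nonneg k.l : (0 : ℝ) ≤ k.l)]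

theorem PolyGrowth.add {z w : Mode → ℂ} (hz : PolyGrowth z) (hw : PolyGrowth w) :
    PolyGrowth fun k => z k + w k := by
  obtain ⟨C, N, hC, h⟩ := hz
  obtain ⟨C', N', hC', h'⟩ := hw
  refine ⟨C + C', N + N', add_nonneg hC hC', fun k => (norm_add_le _ _).trans ?_⟩
  have h1 : (1 : ℝ) ≤ (k.l : ℝ) + 1 := by simp
  have e1 := pow_le_pow_right₀ h1 (Nat.le_add_right N N')
  have e2 := pow_le_pow_right₀ h1 (Nat.le_add_left N' N)
  rw [add_mul]
  exact add_le_add ((h k).trans (mul_le_mul_of_nonneg_left e1 hC))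
    ((h' k).trans (mul_le_mul_of_nonneg_left e2 hC'))

theorem PolyGrowth.mul {z w : Mode → ℂ} (hz : PolyGrowth z) (hw : PolyGrowth w) :
    PolyGrowth fun k => z k * w k := by
  obtain ⟨C, N, hC, h⟩ := hz
  obtain ⟨C', N', hC', h'⟩ := hw
  refine ⟨C * C', N + N', mul_nonneg hC hC', fun k => ?_⟩
  rw [norm_mul, pow_add]
  calc ‖z k‖ * ‖w k‖ ≤ (C * ((k.l : ℝ) + 1) ^ N) * (C' * ((k.l : ℝ) + 1) ^ N') :=
        mul_le_mul (h k) (h' k) (norm_nonneg _) (by positivity)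
    _ = _ := by ring

theorem PolyGrowth.sub_const {z : Mode → ℂ} (hz : PolyGrowth z) (c : ℂ) :
    PolyGrowth fun k => z k - c := by
  simpa only [sub_eq_add_neg] using hz.add (PolyGrowth.const (-c))

theorem Rapid.add (h1 : Rapid hΩ γ) (h2 : Rapid hΩ η) : Rapid hΩ fun k => γ k + η k :=
  fun n => (h1 n).add (h2 n)

theorem Rapid.const_mul (a : smoothRing (chartO Ω hΩ)) (h : Rapid hΩ γ) :
    Rapid hΩ fun k => a * γ k := fun n => (h n).const_mul a

theorem Rapid.smul {z : Mode → ℂ} (hz : PolyGrowth z) (h : Rapid hΩ γ) :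
    Rapid hΩ fun k => z k • γ k := fun n => (h n).smul hz

theorem Rapid.neg (h : Rapid hΩ γ) : Rapid hΩ fun k => -γ k := by
  simpa only [neg_smul, one_smul] using h.smul (PolyGrowth.const (-1))

theorem Rapid.sub (h1 : Rapid hΩ γ) (h2 : Rapid hΩ η) : Rapid hΩ fun k => γ k - η k := by
  simpa only [sub_eq_add_neg] using h1.add h2.neg

theorem Rapid.deriv (h : Rapid hΩ γ) (A : Fin 2) : Rapid hΩ fun k => deriv _ (Sum.inl A) (γ k) :=
  fun n => (h (n + 1)).2 A

end Rapid

/-! ### Uniqueness of expansions in spherical harmonics -/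

section Uniqueness

open MeasureTheory

/-- Sturm-Liouville orthogonality: the Wronskian sin θ (A'B - AB') has derivative (l'(l'+1) -
l(l+1)) sin θ A B and vanishes at both ends because of sin θ. The common value of m makes the
singular terms cancel. -/
theorem integral_legA_mul (l l' m : ℕ) (h : l ≠ l') :
    ∫ t in (0 : ℝ)..Real.pi, Real.sin t * (legA l m t * legA l' m t) = 0 := by
  obtain ⟨A1, A2, hA⟩ := sturm_legA l m
  obtain ⟨B1, B2, hB⟩ := sturm_legA l' m
  have cA := contDiff_legA l m
  have cB := contDiff_legA l' m
  -- The derivatives in `Sturm` are specified only inside the interval; `_root_.deriv` agrees with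
  -- them there and is continuous up to the end points.
  have dA : ∀ t ∈ Set.Ioo 0 Real.pi, HasDerivAt (_root_.deriv (legA l m)) (A2 t) t := fun t ht =>
    (hA.d2 t ht).congr_of_eventuallyEq (Filter.eventually_of_mem (isOpen_Ioo.mem_nhds ht)
      fun s hs => (hA.d1 s hs).deriv)
  have dB : ∀ t ∈ Set.Ioo 0 Real.pi, HasDerivAt (_root_.deriv (legA l' m)) (B2 t) t := fun t ht =>
    (hB.d2 t ht).congr_of_eventuallyEq (Filter.eventually_of_mem (isOpen_Ioo.mem_nhds ht)
      fun s hs => (hB.d1 s hs).deriv)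
  have key := intervalIntegral.integral_eq_sub_of_hasDerivAt_of_le Real.pi_pos.le
    (f := fun t => Real.sin t * (_root_.deriv (legA l m) t * legA l' m t
      - legA l m t * _root_.deriv (legA l' m) t))
    (f' := fun t => ((l' * (l' + 1) - l * (l + 1) : ℝ)) *
      (Real.sin t * (legA l m t * legA l' m t)))
    ((Real.continuous_sin.mul (((cA.continuous_deriv (by simp)).mul cB.continuous).sub
      (cA.continuous.mul (cB.continuous_deriv (by simp))))).continuousOn)
    (fun t ht => by
      have hs := (sin_pos ht).ne'
      have o1 := hA.ode t ht
      have o2 := hB.ode t ht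
      have e1 := (hA.d1 t ht).deriv
      have e2 := (hB.d1 t ht).deriv
      refine ((Real.hasDerivAt_sin t).mul (((dA t ht).mul (hB.d1 t ht)).sub
        ((hA.d1 t ht).mul (dB t ht)))).congr_deriv ?_
      rw [Pi.sub_apply, Pi.mul_apply, Pi.mul_apply, e1, e2]
      field_simp at o1 o2 ⊢
      have hs2 := pow_ne_zero 2 hs
      refine mul_left_cancel₀ hs ?_
      linear_combination (legA l' m t) * o1 - (legA l m t) * o2)
    ((continuous_const.mul (Real.continuous_sin.mul
      (cA.continuous.mul cB.continuous))).intervalIntegrable _ _)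
  rw [intervalIntegral.integral_const_mul, Real.sin_pi, Real.sin_zero, zero_mul, zero_mul,
    sub_zero] at key
  refine (mul_eq_zero.1 key).resolve_left fun h0 => h ?_
  have h1 : ((l' : ℝ) - l) * (l' + l + 1) = 0 := by linear_combination h0
  have h2 : ((l' : ℝ) + l + 1) ≠ 0 := by positivity
  have h3 := (mul_eq_zero.1 h1).resolve_right h2
  exact_mod_cast (sub_eq_zero.1 h3).symm

/-- Otherwise the derivative of order l + m of (X² - 1)^l would vanish on (-1, 1), hence
identically. This polynomial has degree 2l ≥ l + m, so that is impossible. -/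
theorem exists_legA_ne_zero {l m : ℕ} (h : m ≤ l) : ∃ t ∈ Set.Ioo 0 Real.pi, legA l m t ≠ 0 := by
  by_contra! h0
  have hd : Polynomial.derivative^[l + m] ((Polynomial.X ^ 2 - 1 : Polynomial ℝ) ^ l) = 0 := by
    refine Polynomial.eq_zero_of_infinite_isRoot _ ((Set.Ioo_infinite
      (show (-1 : ℝ) < 1 by norm_num)).mono fun z hz => ?_)
    have ht : Real.arccos z ∈ Set.Ioo 0 Real.pi :=
      ⟨Real.arccos_pos.2 hz.2, by
        rw [← Real.arccos_neg_one]
        exact Real.strictAntiOn_arccos (by simp) ⟨hz.1.le, hz.2.le⟩ hz.1⟩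
    have h1 := h0 _ ht
    rw [legA, Real.cos_arccos hz.1.le hz.2.le, legendreDeriv] at h1
    have h2 := (mul_eq_zero.1 h1).resolve_left (pow_ne_zero _ (sin_pos ht).ne')
    exact (div_eq_zero_iff.1 h2).resolve_right (by positivity)
  -- The leading coefficient: position l - m of the derivative comes from position 2l of a monic
  -- polynomial and equals a nonzero falling factorial.
  have hc := congrArg (fun p => Polynomial.coeff p (l - m)) hd
  have hm : Polynomial.Monic ((Polynomial.X ^ 2 - 1 : Polynomial ℝ) ^ l) :=
    (Polynomial.monic_X_pow_sub_C (1 : ℝ) two_ne_zero).pow l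
  have hn : ((Polynomial.X ^ 2 - 1 : Polynomial ℝ) ^ l).natDegree = l - m + (l + m) := by
    have hm2 : Polynomial.Monic (Polynomial.X ^ 2 - 1 : Polynomial ℝ) :=
      Polynomial.monic_X_pow_sub_C (1 : ℝ) two_ne_zero
    rw [hm2.natDegree_pow, show (Polynomial.X ^ 2 - 1 : Polynomial ℝ).natDegree = 2 from
      Polynomial.natDegree_X_pow_sub_C (n := 2) (r := (1 : ℝ))]
    omega
  simp only [Polynomial.coeff_iterate_derivative, Polynomial.coeff_zero, ← hn, hm.coeff_natDegree,
    nsmul_eq_mul, mul_one, Nat.cast_eq_zero] at hc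
  rw [hn, Nat.descFactorial_eq_zero_iff_lt] at hc
  omega

theorem integral_legA_sq_pos {l m : ℕ} (h : m ≤ l) :
    0 < ∫ t in (0 : ℝ)..Real.pi, Real.sin t * (legA l m t * legA l m t) := by
  obtain ⟨t, ht, h0⟩ := exists_legA_ne_zero h
  have c := (contDiff_legA l m).continuous
  refine intervalIntegral.integral_pos Real.pi_pos
    (Real.continuous_sin.mul (c.mul c)).continuousOn (fun s hs => mul_nonneg
      (Real.sin_nonneg_of_nonneg_of_le_pi hs.1.le hs.2) (mul_self_nonneg _))
    ⟨t, Set.Ioo_subset_Icc_self ht, mul_pos (sin_pos ht) (mul_self_pos.2 h0)⟩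

instance : Countable Mode := by
  have : Function.Injective fun k : Mode => (k.l, k.m) := fun a b h => by
    simp only [Prod.mk.injEq] at h
    exact Mode.ext h.1 h.2
  exact this.countable

theorem integral_exp_phi (n : ℤ) : ∫ φ in (0 : ℝ)..(2 * Real.pi),
    Complex.exp (Complex.I * (n : ℂ) * (φ : ℂ)) = if n = 0 then (2 * Real.pi : ℂ) else 0 := by
  split_ifs with h
  · simp [h]
  · have hc : Complex.I * (n : ℂ) ≠ 0 := mul_ne_zero Complex.I_ne_zero (by exact_mod_cast h)
    rw [integral_exp_mul_complex hc]
    have e : Complex.I * (n : ℂ) * ((2 * Real.pi : ℝ) : ℂ) = n * (2 * Real.pi * Complex.I) := by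
      push_cast; ring
    rw [e, Complex.exp_int_mul_two_pi_mul_I]
    simp

theorem norm_exp_phi (n : ℤ) (φ : ℝ) : ‖Complex.exp (Complex.I * (n : ℂ) * (φ : ℂ))‖ = 1 := by
  have e : Complex.I * (n : ℂ) * (φ : ℂ) = ((n * φ : ℝ) : ℂ) * Complex.I := by push_cast; ring
  rw [e, Complex.norm_exp_ofReal_mul_I]

/-- The Fourier modes in `φ` of a vanishing sum vanish. -/
theorem hasSum_fourier {f : Mode → ℂ} (hf : Summable fun k => ‖f k‖) (h : ∀ φ : ℝ,
    HasSum (fun k : Mode => f k * Complex.exp (Complex.I * (k.m : ℂ) * (φ : ℂ))) 0) (m : ℤ) :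
    HasSum (fun k : Mode => if k.m = m then f k else 0) 0 := by
  -- The sum is multiplied by e^{-imφ} and integrated over a period; the absolute values of the
  -- coefficients dominate.
  have key := intervalIntegral.hasSum_integral_of_dominated_convergence (a := 0)
    (b := 2 * Real.pi) (μ := volume) (f := fun _ => (0 : ℂ))
    (F := fun (k : Mode) (φ : ℝ) => f k * Complex.exp (Complex.I * ((k.m - m : ℤ) : ℂ) * (φ : ℂ)))
    (fun k _ => ‖f k‖)
    (fun k => (Continuous.aestronglyMeasurable (by fun_prop)))
    (fun k => Filter.Eventually.of_forall fun φ _ => by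
      rw [norm_mul, norm_exp_phi, mul_one])
    (Filter.Eventually.of_forall fun φ _ => hf) (by simp)
    (Filter.Eventually.of_forall fun φ _ => by
      have := (h φ).mul_right (Complex.exp (Complex.I * ((-m : ℤ) : ℂ) * (φ : ℂ)))
      rw [zero_mul] at this
      refine this.congr_fun ?_
      intro k
      rw [mul_assoc (f k), ← Complex.exp_add]
      congr 2
      push_cast
      ring)
  simp only [intervalIntegral.integral_const_mul, integral_exp_phi, intervalIntegral.integral_zero,
    sub_eq_zero] at key
  have hpi : (2 * Real.pi : ℂ) ≠ 0 := mul_ne_zero two_ne_zero (by exact_mod_cast Real.pi_ne_zero)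
  have := key.mul_right (2 * Real.pi : ℂ)⁻¹
  rw [zero_mul] at this
  refine this.congr_fun ?_
  intro k
  split_ifs
  · field_simp
  · simp

/-- Uniqueness of normally convergent expansions in spherical harmonics. -/
theorem eq_zero_of_hasSum_sphericalY {c : Mode → ℂ} {u : Mode → ℝ} (hu : Summable u)
    (hc : ∀ k : Mode, ∀ t ∈ Set.Icc 0 Real.pi, ‖c k‖ * |normY k * legA k.l k.m.natAbs t| ≤ u k)
    (h : ∀ t ∈ Set.Ioo 0 Real.pi, ∀ φ : ℝ, HasSum (fun k : Mode => c k
      * ((normY k * legA k.l k.m.natAbs t : ℝ) : ℂ)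
      * Complex.exp (Complex.I * (k.m : ℂ) * (φ : ℂ))) 0) (k₀ : Mode) : c k₀ = 0 := by
  have cA : ∀ k : Mode, Continuous (legA k.l k.m.natAbs) := fun k => (contDiff_legA _ _).continuous
  -- First the projection in φ at fixed θ leaves only the modes with the same m as `k₀`.
  have h1 : ∀ t ∈ Set.Ioo 0 Real.pi, HasSum (fun k : Mode => if k.m = k₀.m then
      c k * ((normY k * legA k.l k.m.natAbs t : ℝ) : ℂ) else 0) 0 := fun t ht =>
    hasSum_fourier (Summable.of_nonneg_of_le (fun k => norm_nonneg _) (fun k => by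
      rw [norm_mul, Complex.norm_real]
      exact hc k t (Set.Ioo_subset_Icc_self ht)) hu) (h t ht) k₀.m
  obtain ⟨C, hC⟩ := isCompact_Icc.exists_bound_of_continuousOn (s := Set.Icc 0 Real.pi)
    (Real.continuous_sin.mul (cA k₀)).continuousOn
  have hu0 : ∀ k, 0 ≤ u k := fun k => le_trans (by positivity) (hc k 0 ⟨le_rfl, Real.pi_pos.le⟩)
  have hι : ∀ t, t ∈ Set.uIoc 0 Real.pi → t ∈ Set.Icc 0 Real.pi := fun t ht => by
    rw [Set.uIoc_of_le Real.pi_pos.le] at ht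
    exact Set.Ioc_subset_Icc_self ht
  -- Then integration in θ against sin θ times the function of `k₀`. The domination needs the bounds
  -- up to the poles, which is the reason for including the end points in the hypothesis.
  have key := intervalIntegral.hasSum_integral_of_dominated_convergence (a := 0)
    (b := Real.pi) (μ := volume) (f := fun _ => (0 : ℂ))
    (F := fun (k : Mode) (t : ℝ) => (if k.m = k₀.m then c k * normY k else 0)
      * ((Real.sin t * (legA k.l k.m.natAbs t * legA k₀.l k₀.m.natAbs t) : ℝ) : ℂ))
    (fun k _ => u k * C)
    (fun k => (continuous_const.mul (Complex.continuous_ofReal.comp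
      (Real.continuous_sin.mul ((cA k).mul (cA k₀))))).aestronglyMeasurable)
    (fun k => Filter.Eventually.of_forall fun t ht => by
      have h2 := hC t (hι t ht)
      have h3 := hc k t (hι t ht)
      have hC0 := (norm_nonneg _).trans h2
      split_ifs
      · rw [norm_mul, norm_mul, Complex.norm_real, Complex.norm_real]
        refine le_trans (le_of_eq ?_) (mul_le_mul h3 h2 (norm_nonneg _) (hu0 k))
        simp only [Real.norm_eq_abs, abs_mul, Pi.mul_apply]
        ring
      · rw [zero_mul, norm_zero]
        exact mul_nonneg (hu0 k) hC0)
    (Filter.Eventually.of_forall fun t _ => hu.mul_right C) (by simp) (by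
      -- The integral runs over (0, π], while the vanishing of the sum is known only in the open
      -- interval; the end point is a null set.
      have hne : ∀ᵐ t : ℝ ∂volume, t ≠ Real.pi :=
        compl_mem_ae_iff.2 (Real.volume_singleton (a := Real.pi))
      filter_upwards [hne] with t ht hι'
      rw [Set.uIoc_of_le Real.pi_pos.le] at hι'
      have ht' : t ∈ Set.Ioo 0 Real.pi := ⟨hι'.1, lt_of_le_of_ne hι'.2 ht⟩
      have := (h1 t ht').mul_right (((Real.sin t * legA k₀.l k₀.m.natAbs t : ℝ)) : ℂ)
      rw [zero_mul] at this
      refine this.congr_fun ?_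
      intro k
      split_ifs
      · push_cast; ring
      · simp)
  simp only [intervalIntegral.integral_const_mul, intervalIntegral.integral_zero] at key
  have hs := hasSum_single (f := fun k : Mode => (if k.m = k₀.m then c k * normY k else 0)
    * ∫ t in (0 : ℝ)..Real.pi,
      ((Real.sin t * (legA k.l k.m.natAbs t * legA k₀.l k₀.m.natAbs t) : ℝ) : ℂ)) k₀ fun k hk => by
    split_ifs with hm
    · have hl : k.l ≠ k₀.l := fun hl => hk (Mode.ext hl hm)
      rw [intervalIntegral.integral_ofReal, hm, integral_legA_mul _ _ _ hl]
      simp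
    · rw [zero_mul]
  have h0 := hs.unique key
  rw [if_pos rfl, intervalIntegral.integral_ofReal] at h0
  have hm : k₀.m.natAbs ≤ k₀.l := by
    exact Int.ofNat_le.1 (by rw [Int.natCast_natAbs]; exact k₀.abs_le)
  have hp := integral_legA_sq_pos hm
  have h2 := (mul_eq_zero.1 h0).resolve_right (by exact_mod_cast hp.ne')
  exact (mul_eq_zero.1 h2).resolve_right (by exact_mod_cast normY_ne_zero k₀)

/-- Modes with a single `l` are determined by their `φ` dependence. -/
theorem eq_zero_of_hasSum_phi {f : Mode → ℂ} {l : ℕ} (hl : l < 2) (hf : ∀ k, k.l ≠ l → f k = 0)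
    (h : ∀ φ : ℝ, HasSum (fun k : Mode => f k
      * Complex.exp (Complex.I * (k.m : ℂ) * (φ : ℂ))) 0) (k₀ : Mode) : f k₀ = 0 := by
  by_cases hk : k₀.l = l
  · have hfin : Summable fun k => ‖f k‖ := by
      refine summable_of_hasFiniteSupport (finite_low_modes.subset fun k hk => ?_)
      have : k.l = l := by
        by_contra h0
        exact hk (by simp only [hf k h0, norm_zero])
      simp only [Set.mem_ofPred_eq]
      omega
    have h1 := hasSum_fourier hfin h k₀.m
    have h2 := hasSum_single (f := fun k : Mode => if k.m = k₀.m then f k else 0) k₀ fun k hk' => by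
      by_cases hm : k.m = k₀.m
      · simp only [if_pos hm]
        exact hf k fun hl' => hk' (Mode.ext (hl'.trans hk.symm) hm)
      · exact if_neg hm
    have := h2.unique h1
    rwa [if_pos rfl] at this
  · exact hf k₀ hk

end Uniqueness

/-! ### Extraction of the mode coefficients -/

section Angle

variable {R : Type} [CommRing R] [Algebra ℂ R]
  {d : Fin 2 ⊕ Fin 2 → Derivation ℂ R R} {r ri f fi n s si k S a b : R} {ev : ℂ}

/-- The Laplacian of a base function times a harmonic. -/
theorem lap_base_mul (hB : Bg d r ri f fi n s si k) (hS : IsHarm d s k S ev) (ha : IsBase d a) :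
    -(d (.inr 0) (d (.inr 0) (a * S)) + k * d (.inr 0) (a * S)
      + si * si * d (.inr 1) (d (.inr 1) (a * S))) = (ev • a) * S := by
  apply hB.sep
  intro φ
  have h3 := hB.s_ne φ
  simp only [IsBase] at ha
  simp only [der_mul, ha, mul_zero, add_zero, hS.lap, ev_smul, ev_mul, ev_add, ev_neg, hB.eval_si]
  field_simp
  ring

/-- The divergence of a covector field of a single mode. -/
theorem div_covector (hB : Bg d r ri f fi n s si k) (hS : IsHarm d s k S ev) (ha : IsBase d a)
    (hb : IsBase d b) :
    -(d (.inr 0) (a * d (.inr 0) S + b * curlR d s si S 0)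
      + k * (a * d (.inr 0) S + b * curlR d s si S 0)
      + si * si * d (.inr 1) (a * d (.inr 1) S + b * curlR d s si S 1)) = (ev • a) * S := by
  apply hB.sep
  intro φ
  have h3 := hB.s_ne φ
  have hc := hB.comm (.inr 1) (.inr 0) S
  simp only [IsBase] at ha hb
  simp only [curlR_0, curlR_1, der_add, der_neg, der_mul, ha, hb, hB.si1, hB.si2, hB.s1, hB.s2, hc,
    mul_zero, add_zero, hS.lap, ev_smul, ev_mul, ev_add, ev_neg, hB.eval_si, ev_zero]
  field_simp
  ring

/-- The curl of a covector field of a single mode. -/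
theorem curl_covector (hB : Bg d r ri f fi n s si k) (hS : IsHarm d s k S ev) (ha : IsBase d a)
    (hb : IsBase d b) :
    si * (d (.inr 0) (a * d (.inr 1) S + b * curlR d s si S 1)
      - d (.inr 1) (a * d (.inr 0) S + b * curlR d s si S 0)) = (ev • b) * S := by
  apply hB.sep
  intro φ
  have h3 := hB.s_ne φ
  have hc := hB.comm (.inr 1) (.inr 0) S
  simp only [IsBase] at ha hb
  simp only [curlR_0, curlR_1, der_add, der_neg, der_mul, ha, hb, hB.si1, hB.si2, hB.s1, hB.s2, hc,
    mul_zero, add_zero, hS.lap, ev_smul, ev_mul, ev_add, ev_sub, ev_neg, hB.eval_si, ev_zero]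
  field_simp
  ring

end Angle

/-! ### Vanishing scalar and covector series -/

section Extraction

variable {Ω : Set Plane} (hΩ : IsOpen Ω) (M δ : ℝ) (hr : ∀ q ∈ Ω, 0 < q 1 ∧ q 1 ≠ 2 * M)

/-- A base function only depends on the base point. -/
theorem evalAt_congr_base {a : smoothRing (chartO Ω hΩ)} (ha : IsBase (deriv _) a)
    {x y : chartO Ω hΩ} (h : base x = base y) : evalAt x a = evalAt y a := by
  -- The segment between the two points stays in the fibre over the common base point, which is
  -- convex; along it only angular derivatives occur, and they vanish.
  let g : ℝ → Pt := fun τ => x.1 + τ • (y.1 - x.1)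
  have hb : ∀ A, (y.1 - x.1) (Sum.inl A) = 0 := fun A => sub_eq_zero.2 (congrFun h A).symm
  have hg : ∀ τ ∈ Set.Icc (0 : ℝ) 1, g τ ∈ chartO Ω hΩ := fun τ hτ => by
    have hx := mem_chart hΩ x
    have e : base (g τ) = base x := by
      funext A
      change x.1 (Sum.inl A) + τ * (y.1 - x.1) (Sum.inl A) = _
      rw [hb, mul_zero, add_zero]
      rfl
    refine ⟨e ▸ hx.1, ?_⟩
    have hc := (convex_Ioo (0 : ℝ) Real.pi).add_smul_sub_mem hx.2 (mem_chart hΩ y).2 hτ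
    exact hc
  have hd : ∀ τ ∈ Set.Icc (0 : ℝ) 1, HasDerivAt (fun τ => zeroExt _ a.1 (g τ)) 0 τ := fun τ hτ => by
    have h1 := (diffAt_zeroExt a (hg τ hτ)).hasFDerivAt
    have h2 : HasDerivAt g (y.1 - x.1) τ := by
      exact (((hasDerivAt_id τ).smul_const (y.1 - x.1)).const_add x.1).congr_deriv (one_smul _ _)
    refine (h1.comp_hasDerivAt τ h2).congr_deriv ?_
    have h3 : ∀ p, fderiv ℝ (zeroExt _ a.1) (g τ) (Pi.single (Sum.inr p) 1) = 0 := fun p =>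
      congrArg (evalAt (⟨g τ, hg τ hτ⟩ : chartO Ω hΩ)) (ha p)
    rw [continuousLinearMap_eq_sum (fderiv ℝ (zeroExt _ a.1) (g τ)), _root_.sum_apply,
      Fintype.sum_sum_type]
    simp only [ContinuousLinearMap.smulRight_apply, prj_apply, hb, h3, zero_smul, smul_zero,
      Finset.sum_const_zero, add_zero]
  have key := constant_of_has_deriv_right_zero (fun τ hτ => (hd τ hτ).continuousAt.continuousWithinAt)
    (fun τ hτ => (hd τ ⟨hτ.1, hτ.2.le⟩).hasDerivWithinAt) 1 ⟨zero_le_one, le_rfl⟩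
  have e1 : g 1 = y.1 := by simp [g]
  have e0 : g 0 = x.1 := by simp [g]
  simp only [e1, e0, zeroExt_eq] at key
  exact key.symm

/-- The point with given angles over the base point of `x`. -/
def movePt (x : chartO Ω hΩ) (t φ : ℝ) (ht : t ∈ Set.Ioo 0 Real.pi) : chartO Ω hΩ :=
  ⟨Sum.elim (base x) ![t, φ], (mem_chart hΩ x).1, ht⟩

theorem evalAt_movePt {a : smoothRing (chartO Ω hΩ)} (ha : IsBase (deriv _) a) (x : chartO Ω hΩ)
    {t : ℝ} (φ : ℝ) (ht : t ∈ Set.Ioo 0 Real.pi) :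
    evalAt (movePt hΩ x t φ ht) a = evalAt x a := evalAt_congr_base hΩ ha rfl

theorem evalAt_SR_movePt (k : Mode) (x : chartO Ω hΩ) {t : ℝ} (φ : ℝ)
    (ht : t ∈ Set.Ioo 0 Real.pi) : evalAt (movePt hΩ x t φ ht) (SR hΩ δ k)
      = thetaPart δ k t * Complex.exp (Complex.I * (k.m : ℂ) * (φ : ℂ)) := by
  rw [SR, ev_mul, evalAt_thR, evalAt_exR]
  rfl

theorem isBase_smul {a : smoothRing (chartO Ω hΩ)} (ha : IsBase (deriv _) a) (z : ℂ) :
    IsBase (deriv _) (z • a) := fun p => by rw [der_smul, ha p, smul_zero]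

variable {γ : Mode → smoothRing (chartO Ω hΩ)}

/-- Applying -Δ term by term multiplies each coefficient by its eigenvalue l(l+1). -/
theorem hs_ev_smul (M : ℝ) (hr : ∀ q ∈ Ω, 0 < q 1 ∧ q 1 ≠ 2 * M) (hb : ∀ k, IsBase (deriv _) (γ k))
    (h : HS (fun k => γ k * SR hΩ δ k) 0) : HS (fun k => (k.ev • γ k) * SR hΩ δ k) 0 := by
  have h1 := ((((h.deriv (.inr 0)).deriv (.inr 0)).add ((h.deriv (.inr 0)).const_mul (kR hΩ))).add
    (((h.deriv (.inr 1)).deriv (.inr 1)).const_mul (siR hΩ * siR hΩ))).neg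
  simp only [der_zero, mul_zero, add_zero, neg_zero] at h1
  exact h1.congr fun k => (lap_base_mul (bg_chart hΩ M hr) (isHarm_SR hΩ δ k) (hb k)).symm

theorem thetaPart_of_two_le {k : Mode} (h : 2 ≤ k.l) :
    thetaPart δ k = fun t => normY k * legA k.l k.m.natAbs t := by
  rw [thetaPart, if_neg (by omega), if_neg (by omega)]

theorem polyGrowth_ev_mul : PolyGrowth fun k => k.ev * (k.ev - 2) :=
  PolyGrowth.ev.mul (PolyGrowth.ev.sub_const 2)

theorem ev_mul_ne_zero {k : Mode} (h : 2 ≤ k.l) : k.ev * (k.ev - 2) ≠ 0 := by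
  have e : k.ev * (k.ev - 2)
      = (((k.l : ℝ) * ((k.l : ℝ) + 1) * (((k.l : ℝ) - 1) * ((k.l : ℝ) + 2)) : ℝ) : ℂ) := by
    rw [Mode.ev]; push_cast; ring
  have h2 : (2 : ℝ) ≤ k.l := by exact_mod_cast h
  rw [e]
  have : 0 < (k.l : ℝ) * ((k.l : ℝ) + 1) * (((k.l : ℝ) - 1) * ((k.l : ℝ) + 2)) := by
    have : 0 < (k.l : ℝ) - 1 := by linarith
    positivity
  exact_mod_cast this.ne'

theorem ev_of_l_eq_zero {k : Mode} (h : k.l = 0) : k.ev = 0 := by simp [Mode.ev, h]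

theorem ev_of_l_eq_one {k : Mode} (h : k.l = 1) : k.ev = 2 := by norm_num [Mode.ev, h]

theorem ev_ne_zero {k : Mode} (h : k.l ≠ 0) : k.ev ≠ 0 := by
  rw [Mode.ev]
  exact mul_ne_zero (by exact_mod_cast h) (Nat.cast_add_one_ne_zero _)

theorem pi_div_two_mem : Real.pi / 2 ∈ Set.Ioo 0 Real.pi :=
  ⟨half_pos Real.pi_pos, half_lt_self Real.pi_pos⟩

theorem lnc_pi_div_two : lnc (Real.pi / 2) = 0 := by simp [lnc]

/-- Mode coefficients are determined by the sum of the series. -/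
theorem eq_zero_of_hs_harm (M : ℝ) (hr : ∀ q ∈ Ω, 0 < q 1 ∧ q 1 ≠ 2 * M)
    (hb : ∀ k, IsBase (deriv _) (γ k)) (hrap : Rapid hΩ γ)
    (h : HS (fun k => γ k * SR hΩ δ k) 0) (k : Mode) : γ k = 0 := by
  have h1 := hs_ev_smul hΩ δ M hr hb h
  have hb1 : ∀ k : Mode, IsBase (deriv _) (k.ev • γ k) := fun k => isBase_smul hΩ (hb k) _
  -- The operator Δ(Δ + 2) annihilates l = 0 and l = 1, hence all harmonics that may be singular at
  -- the poles, and multiplies the others by a nonzero number.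
  have h2 : HS (fun k : Mode => ((k.ev * (k.ev - 2)) • γ k) * SR hΩ δ k) 0 := by
    have := (hs_ev_smul hΩ δ M hr hb1 h1).sub (h1.smul (2 : ℂ))
    rw [smul_zero, sub_zero] at this
    refine this.congr fun k => ?_
    simp only [Algebra.smul_def, map_mul, map_sub]
    ring
  have high : ∀ k : Mode, 2 ≤ k.l → γ k = 0 := fun k hk => by
    refine evalAt_injective fun x => ?_
    obtain ⟨u, hu, hu'⟩ := hrap.smul polyGrowth_ev_mul 0 0 x
    have hc : ∀ k : Mode, ¬ 2 ≤ k.l → evalAt x ((k.ev * (k.ev - 2)) • γ k) = 0 := fun k hk => by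
      have : k.l = 0 ∨ k.l = 1 := by omega
      rcases this with h0 | h0
      · rw [ev_smul, ev_of_l_eq_zero h0, zero_mul, zero_mul]
      · rw [ev_smul, ev_of_l_eq_one h0, sub_self, mul_zero, zero_mul]
    have key := eq_zero_of_hasSum_sphericalY (c := fun k : Mode =>
      evalAt x ((k.ev * (k.ev - 2)) • γ k)) hu.abs (fun k t ht => by
        by_cases hk : 2 ≤ k.l
        · refine le_trans (le_of_eq ?_) ((hu' k hk t ht).trans (le_abs_self _))
          rw [pow_zero, one_mul]
        · rw [hc k hk, norm_zero, zero_mul]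
          exact abs_nonneg _) (fun t ht φ => by
        have := h2.2 (movePt hΩ x t φ ht)
        rw [ev_zero] at this
        refine this.congr_fun ?_
        intro k
        rw [ev_mul, evalAt_movePt hΩ (isBase_smul hΩ (hb k) _), evalAt_SR_movePt]
        by_cases hk : 2 ≤ k.l
        · rw [thetaPart_of_two_le δ hk, mul_assoc]
        · rw [hc k hk, zero_mul, zero_mul, zero_mul]) k
    rw [ev_smul] at key
    rw [ev_zero]
    exact (mul_eq_zero.1 key).resolve_left (ev_mul_ne_zero hk)
  -- For a family supported on one value of l < 2 the sum is finite, and the modes are told apart by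
  -- their dependence on φ at any fixed θ.
  have low : ∀ (l : ℕ) (η : Mode → smoothRing (chartO Ω hΩ)), l < 2 →
      (∀ k, IsBase (deriv _) (η k)) → (∀ k, k.l ≠ l → η k = 0) →
      HS (fun k => η k * SR hΩ δ k) 0 → ∀ k, ∀ t ∈ Set.Ioo 0 Real.pi, ∀ x,
      evalAt x (η k) * thetaPart δ k t = 0 := fun l η hl hη h0 hs k t ht x =>
    eq_zero_of_hasSum_phi (f := fun k => evalAt x (η k) * thetaPart δ k t) hl
      (fun k hk => by simp only [h0 k hk, ev_zero, zero_mul]) (fun φ => by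
        have := hs.2 (movePt hΩ x t φ ht)
        rw [ev_zero] at this
        refine this.congr_fun ?_
        intro k
        rw [ev_mul, evalAt_movePt hΩ (hη k), evalAt_SR_movePt, mul_assoc]) k
  -- The series multiplied by the eigenvalue is used: it contains no l = 0 term, and l ≥ 2 has
  -- already been removed.
  have one : ∀ k : Mode, k.l = 1 → γ k = 0 := fun k hk => by
    have h3 := low 1 _ one_lt_two hb1 (fun k hk => by
      by_cases h0 : k.l = 0
      · rw [ev_of_l_eq_zero h0, zero_smul]
      · rw [high k (by omega), smul_zero]) h1 k
    refine evalAt_injective fun x => ?_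
    rw [ev_zero]
    have h4 : ∀ t ∈ Set.Ioo 0 Real.pi, evalAt x (γ k) * thetaPart δ k t = 0 := fun t ht => by
      have := h3 t ht x
      rw [ev_smul, ev_of_l_eq_one hk, mul_assoc] at this
      exact (mul_eq_zero.1 this).resolve_left two_ne_zero
    by_cases hm : k.m = 0
    · have e : thetaPart δ k = fun t => Real.cos t + δ * (Real.cos t * lnc t - 1) := by
        rw [thetaPart, if_neg (by omega), if_pos hk, if_pos hm]
      have h5 := h4 _ pi_div_two_mem
      have h6 := h4 (Real.pi / 3) ⟨by positivity, by linarith [Real.pi_pos]⟩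
      rw [e] at h5 h6
      simp only [Real.cos_pi_div_two, Real.cos_pi_div_three] at h5 h6
      push_cast at h5 h6
      -- At π/2 the function is -δ, and at π/3 it is 1/2 plus a multiple of δ. The combination
      -- eliminates δ, so no assumption on δ is needed.
      linear_combination 2 * h6 + (2 * (1 / 2 * (lnc (Real.pi / 3) : ℂ) - 1)) * h5
    · have e : thetaPart δ k = fun t => Real.sin t
          + δ * (Real.sin t * lnc t + Real.cos t / Real.sin t) := by
        rw [thetaPart, if_neg (by omega), if_pos hk, if_neg hm]
      have h5 := h4 _ pi_div_two_mem
      rw [e] at h5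
      simpa [lnc_pi_div_two] using h5
  by_cases h0 : k.l = 0
  · have h3 := low 0 _ two_pos hb (fun k hk => by
      by_cases h1 : k.l = 1
      · exact one k h1
      · exact high k (by omega)) h k
    refine evalAt_injective fun x => ?_
    have h5 := h3 _ pi_div_two_mem x
    rw [thetaPart, if_pos h0] at h5
    simpa [lnc_pi_div_two] using h5
  · by_cases h1 : k.l = 1
    · exact one k h1
    · exact high k (by omega)

/-- The coefficients of a covector field are determined by the sum of the series. -/
theorem eq_zero_of_hs_covector (M : ℝ) (hr : ∀ q ∈ Ω, 0 < q 1 ∧ q 1 ≠ 2 * M)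
    {α β : Mode → smoothRing (chartO Ω hΩ)} (hα : ∀ k, IsBase (deriv _) (α k))
    (hβ : ∀ k, IsBase (deriv _) (β k)) (rα : Rapid hΩ α) (rβ : Rapid hΩ β)
    (h : ∀ p, HS (fun k => α k * deriv _ (.inr p) (SR hΩ δ k)
      + β k * curlR (deriv _) (sR hΩ) (siR hΩ) (SR hΩ δ k) p) 0) {k : Mode} (hk : δ ≠ 0 ∨ k.l ≠ 0) :
    α k = 0 ∧ β k = 0 := by
  have hB := bg_chart hΩ M hr
  have h1 : HS (fun k => (k.ev • α k) * SR hΩ δ k) 0 := by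
    have := ((((h 0).deriv (.inr 0)).add ((h 0).const_mul (kR hΩ))).add
      (((h 1).deriv (.inr 1)).const_mul (siR hΩ * siR hΩ))).neg
    simp only [der_zero, mul_zero, add_zero, neg_zero] at this
    exact this.congr fun k => (div_covector hB (isHarm_SR hΩ δ k) (hα k) (hβ k)).symm
  have h2 : HS (fun k => (k.ev • β k) * SR hΩ δ k) 0 := by
    have := ((((h 1).deriv (.inr 0)).sub ((h 0).deriv (.inr 1))).const_mul (siR hΩ))
    simp only [der_zero, mul_zero, sub_zero] at this
    exact this.congr fun k => (curl_covector hB (isHarm_SR hΩ δ k) (hα k) (hβ k)).symm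
  have h3 : ∀ k : Mode, k.l ≠ 0 → α k = 0 ∧ β k = 0 := fun k hk =>
    ⟨(smul_eq_zero.1 (eq_zero_of_hs_harm hΩ δ M hr (fun k => isBase_smul hΩ (hα k) _)
      (rα.smul PolyGrowth.ev) h1 k)).resolve_left (ev_ne_zero hk),
    (smul_eq_zero.1 (eq_zero_of_hs_harm hΩ δ M hr (fun k => isBase_smul hΩ (hβ k) _)
      (rβ.smul PolyGrowth.ev) h2 k)).resolve_left (ev_ne_zero hk)⟩
  by_cases h0 : k.l = 0
  -- Divergence and curl lose the mode l = 0, whose eigenvalue is zero. It is the only mode left, so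
  -- its term vanishes pointwise, and ∂_θ S = δ / sin θ is nonzero.
  · have hδ : δ ≠ 0 := hk.resolve_right (not_not.2 h0)
    have e : thetaPart δ k = fun t => 1 - δ * lnc t := by rw [thetaPart, if_pos h0]
    have hm := k.m_eq_zero h0
    have key : ∀ p x, evalAt x (α k * deriv _ (.inr p) (SR hΩ δ k)
        + β k * curlR (deriv _) (sR hΩ) (siR hΩ) (SR hΩ δ k) p) = 0 := fun p x => by
      refine (hasSum_single (f := fun k => evalAt x (α k * deriv _ (.inr p) (SR hΩ δ k)
        + β k * curlR (deriv _) (sR hΩ) (siR hΩ) (SR hΩ δ k) p)) k fun k' hk' => ?_).unique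
          (by simpa only [ev_zero] using (h p).2 x)
      have h4 := h3 k' fun hl => hk' (Mode.ext (hl.trans h0.symm) ((k'.m_eq_zero hl).trans hm.symm))
      rw [h4.1, h4.2, zero_mul, zero_mul, add_zero, ev_zero]
    have hS : Sturm 0 0 (thetaPart δ k) (fun t => δ * (1 / Real.sin t))
        (fun t => -(δ * (Real.cos t / Real.sin t ^ 2))) := e ▸ sturm_zero δ
    have hδ' : (δ : ℂ) ≠ 0 := by exact_mod_cast hδ
    have hd : ∀ x : chartO Ω hΩ, evalAt x (deriv _ (.inr 0) (SR hΩ δ k)) ≠ 0 := fun x => by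
      rw [(SR_derivs hΩ δ k hS x).2.1, evalAt_exR]
      refine mul_ne_zero ?_ (Complex.exp_ne_zero _)
      push_cast
      exact mul_ne_zero hδ' (one_div_ne_zero (by exact_mod_cast sin_ne_zero hΩ x))
    have hd1 : ∀ x : chartO Ω hΩ, evalAt x (deriv _ (.inr 1) (SR hΩ δ k)) = 0 := fun x => by
      rw [(SR_derivs hΩ δ k hS x).2.2.1, hm]
      simp
    constructor
    · refine evalAt_injective fun x => ?_
      have := key 0 x
      rw [curlR_0, ev_add, ev_mul, ev_mul,
        ev_mul, hd1, mul_zero, mul_zero, add_zero] at this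
      rw [ev_zero]
      exact (mul_eq_zero.1 this).resolve_right (hd x)
    · refine evalAt_injective fun x => ?_
      have := key 1 x
      rw [curlR_1, ev_add, ev_mul, ev_mul, ev_neg,
        ev_mul, hd1, mul_zero, zero_add] at this
      rw [ev_zero]
      exact (mul_eq_zero.1 this).resolve_right (neg_ne_zero.2 (mul_ne_zero (sin_ne_zero hΩ x) (hd x)))
  · exact h3 k h0

end Extraction

/-! ### Extraction from tensor fields -/

section Tensors

variable {Ω : Set Plane} (hΩ : IsOpen Ω) (M δ : ℝ) (hr : ∀ q ∈ Ω, 0 < q 1 ∧ q 1 ≠ 2 * M)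

/-- Rapidly decreasing coefficients. -/
structure RapidSrc (τ : Mode → Src (smoothRing (chartO Ω hΩ))) : Prop where
  AB : ∀ A B, Rapid hΩ fun k => (τ k).AB A B
  e1 : ∀ A, Rapid hΩ fun k => (τ k).e1 A
  o1 : ∀ A, Rapid hΩ fun k => (τ k).o1 A
  e0 : Rapid hΩ fun k => (τ k).e0
  e2 : Rapid hΩ fun k => (τ k).e2
  o2 : Rapid hΩ fun k => (τ k).o2

theorem rapidSrc_srcR {T : MatterModes} (hT : T.Smooth Ω) : RapidSrc hΩ (srcR hΩ hT) :=
  ⟨fun A B => rapid_baseR hΩ (hT.TAB A B), fun A => rapid_baseR hΩ (hT.Te1 A),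
    fun A => rapid_baseR hΩ (hT.To1 A), rapid_baseR hΩ hT.Te0, rapid_baseR hΩ hT.Te2,
    rapid_baseR hΩ hT.To2⟩

theorem polyGrowth_half_ev : PolyGrowth fun k => 1 / 2 * k.ev :=
  (PolyGrowth.const _).mul PolyGrowth.ev

theorem polyGrowth_ev_sub (c : ℂ) : PolyGrowth fun k => c * (k.ev - 2) :=
  (PolyGrowth.const _).mul (PolyGrowth.ev.sub_const 2)

variable {τ : Mode → Src (smoothRing (chartO Ω hΩ))}

theorem RapidSrc.caC (h : RapidSrc hΩ τ) (B : Fin 2) :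
    Rapid hΩ fun k => caC hΩ M hr k.ev (τ k) B := by
  have h1 := h.AB
  have h2 := h.e1 B
  have h3 := h.e0
  have h4 := fun A B C => (h1 A B).deriv C
  simp only [SchwarzschildModes.caC, caR, cv2, Fin.sum_univ_two]
  repeat' with_reducible first
    | exact h1 _ _
    | exact h2
    | exact h3
    | exact h4 _ _ _
    | exact PolyGrowth.ev
    | refine Rapid.sub ?_ ?_
    | refine Rapid.add ?_ ?_
    | refine Rapid.smul ?_ ?_
    | refine Rapid.const_mul _ ?_

theorem RapidSrc.cbC (h : RapidSrc hΩ τ) : Rapid hΩ fun k => cbC hΩ M hr k.ev (τ k) := by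
  have h2 := h.e1
  have h3 := h.e0
  have h4 := fun A C => (h2 A).deriv C
  have h5 := h.e2
  simp only [SchwarzschildModes.cbC, cbR, cv1, Fin.sum_univ_two]
  repeat' with_reducible first
    | exact h2 _
    | exact h3
    | exact h4 _ _
    | exact h5
    | exact polyGrowth_ev_sub _
    | exact PolyGrowth.const _
    | refine Rapid.sub ?_ ?_
    | refine Rapid.add ?_ ?_
    | refine Rapid.smul ?_ ?_
    | refine Rapid.const_mul _ ?_

theorem RapidSrc.ccC (h : RapidSrc hΩ τ) : Rapid hΩ fun k => ccC hΩ M hr k.ev (τ k) := by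
  have h2 := h.o1
  have h4 := fun A C => (h2 A).deriv C
  have h5 := h.o2
  simp only [SchwarzschildModes.ccC, ccR, cv1, Fin.sum_univ_two]
  repeat' with_reducible first
    | exact h2 _
    | exact h4 _ _
    | exact h5
    | exact PolyGrowth.ev.sub_const _
    | refine Rapid.sub ?_ ?_
    | refine Rapid.add ?_ ?_
    | refine Rapid.smul ?_ ?_
    | refine Rapid.const_mul _ ?_

-- The coefficients of 𝒢 contain at most two derivatives along the orbit space and one factor
-- l(l+1), and rapid decrease is stable under both.
set_option maxHeartbeats 1000000 in
theorem rapidSrc_einC {F : InvModes} (hF : F.Smooth Ω) : RapidSrc hΩ (einC hΩ M hr hF) := by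
  have w0 : ∀ A B, Rapid hΩ fun k => wF hΩ hF k A B := fun A B => rapid_baseR hΩ (hF.FAB A B)
  have v0 : ∀ A, Rapid hΩ fun k => vF hΩ hF k A := fun A => rapid_baseR hΩ (hF.FA A)
  have u0 : Rapid hΩ fun k => uF hΩ hF k := rapid_baseR hΩ hF.F
  have w1 := fun A B C => (w0 A B).deriv C
  have v1 := fun A C => (v0 A).deriv C
  have u1 := fun C => u0.deriv C
  have w2 := fun A B C D => (w1 A B C).deriv D
  have v2 := fun A C D => (v1 A C).deriv D
  have u2 := fun C D => (u1 C).deriv D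
  constructor
  all_goals
    simp only [Fin.forall_fin_two, einC, einR, eR, e00R, e01R, e11R, gER, gOR, gTR, trR, dvR,
      Matrix.cons_val_zero, Matrix.cons_val_one, Matrix.of_apply, Matrix.cons_val',
      Matrix.cons_val_fin_one]
    and_intros
  all_goals
    repeat' with_reducible first
      | exact w0 _ _
      | exact v0 _
      | exact u0
      | exact w1 _ _ _
      | exact v1 _ _
      | exact u1 _
      | exact w2 _ _ _ _
      | exact v2 _ _ _
      | exact u2 _ _
      | exact PolyGrowth.const _
      | exact polyGrowth_ev_sub _
      | exact polyGrowth_half_ev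
      | exact PolyGrowth.ev.sub_const _
      | refine Rapid.neg ?_
      | refine Rapid.sub ?_ ?_
      | refine Rapid.add ?_ ?_
      | refine Rapid.smul ?_ ?_
      | refine Rapid.const_mul _ ?_

theorem einC_isBase {F : InvModes} (hF : F.Smooth Ω) (k : Mode) :
    (einC hΩ M hr hF k).IsBase (deriv _) := by
  have hB := bg_chart hΩ M hr
  have w0 : ∀ A B, IsBase (deriv _) (wF hΩ hF k A B) := fun A B => isBase_baseR hΩ ((hF.FAB A B).1 k)
  have v0 : ∀ A, IsBase (deriv _) (vF hΩ hF k A) := fun A => isBase_baseR hΩ ((hF.FA A).1 k)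
  have u0 : IsBase (deriv _) (uF hΩ hF k) := isBase_baseR hΩ (hF.F.1 k)
  have w1 := fun A B C => IsBase.deriv hB (w0 A B) C
  have v1 := fun A C => IsBase.deriv hB (v0 A) C
  have u1 := fun C => IsBase.deriv hB u0 C
  have w2 := fun A B C D => IsBase.deriv hB (w1 A B C) D
  have v2 := fun A C D => IsBase.deriv hB (v1 A C) D
  have u2 := fun C D => IsBase.deriv hB (u1 C) D
  simp only [IsBase] at w0 v0 u0 w1 v1 u1 w2 v2 u2
  constructor
  all_goals
    simp only [IsBase, Fin.forall_fin_two, einC, einR, eR, e00R, e01R, e11R, gER, gOR, gTR, trR, dvR,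
      Matrix.cons_val_zero, Matrix.cons_val_one, Matrix.of_apply, Matrix.cons_val',
      Matrix.cons_val_fin_one, der_add, der_sub, der_neg, der_smul, der_mul, w0, v0, u0, w1, v1, u1,
      w2, v2, u2, hB.f2, hB.fi2, hB.ri2, hB.r2, der_one, der_ofNat, mul_zero, add_zero, smul_zero,
      sub_zero, neg_zero, and_self]

end Tensors

/-! ### Vanishing tensor series -/

section TensorExtraction

variable {Ω : Set Plane} (hΩ : IsOpen Ω) (M δ : ℝ) (hr : ∀ q ∈ Ω, 0 < q 1 ∧ q 1 ≠ 2 * M)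
  {ρ : Mode → Src (smoothRing (chartO Ω hΩ))}

theorem isBase_divergence {ev : ℂ} {t : Src (smoothRing (chartO Ω hΩ))} (ht : t.IsBase (deriv _)) :
    (∀ B, IsBase (deriv _) (caC hΩ M hr ev t B)) ∧ IsBase (deriv _) (cbC hΩ M hr ev t) ∧
      IsBase (deriv _) (ccC hΩ M hr ev t) := by
  have hB := bg_chart hΩ M hr
  have a1 := ht.AB
  have a2 := ht.e1
  have a3 := ht.o1
  have a4 := ht.e0
  have a5 := ht.e2
  have a6 := ht.o2
  have b1 := fun A B C => IsBase.deriv hB (a1 A B) C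
  have b2 := fun A C => IsBase.deriv hB (a2 A) C
  have b3 := fun A C => IsBase.deriv hB (a3 A) C
  simp only [IsBase] at a1 a2 a3 a4 a5 a6 b1 b2 b3
  simp only [IsBase, Fin.forall_fin_two, caC, cbC, ccC, caR, cbR, ccR, cv1, cv2, Fin.sum_univ_two,
    chrY_000, chrY_001, chrY_010, chrY_011, chrY_100, chrY_101, chrY_110, chrY_111,
    Matrix.cons_val_zero, Matrix.cons_val_one, der_add, der_sub, der_neg, der_smul, der_mul,
    a1, a2, a3, a4, a5, a6, b1, b2, b3, hB.f2, hB.fi2, hB.ri2, hB.n2, der_one, der_zero, der_ofNat,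
    mul_zero, add_zero, smul_zero, sub_zero, neg_zero, and_self]

/-- The base part of a vanishing mixed tensor vanishes mode by mode. -/
theorem divergence_eq_zero (hb : ∀ k, (ρ k).IsBase (deriv _)) (hrap : RapidSrc hΩ ρ)
    (h1 : ∀ B, HS (fun k => caC hΩ M hr k.ev (ρ k) B * SR hΩ δ k) 0)
    (h2 : ∀ p, HS (fun k => rR hΩ * (cbC hΩ M hr k.ev (ρ k) * deriv _ (.inr p) (SR hΩ δ k)
        + ccC hΩ M hr k.ev (ρ k) * curlR (deriv _) (sR hΩ) (siR hΩ) (SR hΩ δ k) p)) 0) (k : Mode) :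
    (∀ B, caC hΩ M hr k.ev (ρ k) B = 0) ∧ (δ ≠ 0 ∨ k.l ≠ 0 →
      cbC hΩ M hr k.ev (ρ k) = 0 ∧ ccC hΩ M hr k.ev (ρ k) = 0) := by
  have hB := bg_chart hΩ M hr
  have hb' := fun k : Mode => isBase_divergence hΩ M hr (ev := k.ev) (hb k)
  refine ⟨fun B => eq_zero_of_hs_harm hΩ δ M hr (fun k => (hb' k).1 B)
    (hrap.caC hΩ M hr B) (h1 B) k, fun hk => ?_⟩
  refine eq_zero_of_hs_covector hΩ δ M hr (fun k => (hb' k).2.1) (fun k => (hb' k).2.2)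
    (hrap.cbC hΩ M hr) (hrap.ccC hΩ M hr) (fun p => ?_) hk
  have := (h2 p).const_mul (riR hΩ M hr)
  rw [mul_zero] at this
  refine this.congr fun k => ?_
  rw [← mul_assoc, mul_comm (riR hΩ M hr), hB.hr, one_mul]

/-- The values of the trace-free tensor harmonics with `l = 1` on the equator. -/
theorem tensor_harm_one {k : Mode} (hk : k.l = 1) {A1 A2 : ℝ → ℝ}
    (h : Sturm (k.l * (k.l + 1)) ((k.m : ℝ) ^ 2) (thetaPart δ k) A1 A2) (x : chartO Ω hΩ) (φ : ℝ) :
    let y := movePt hΩ x (Real.pi / 2) φ pi_div_two_mem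
    let e := Complex.exp (Complex.I * (k.m : ℂ) * (φ : ℂ))
    let a : ℂ := ((k.m : ℂ) ^ 2 - 1) * thetaPart δ k (Real.pi / 2)
    let b : ℂ := A1 (Real.pi / 2) * (Complex.I * k.m)
    evalAt y (evenR (deriv _) (siR hΩ) (kR hΩ) (SR hΩ δ k) k.ev 0 0) = a * e ∧
    evalAt y (evenR (deriv _) (siR hΩ) (kR hΩ) (SR hΩ δ k) k.ev 0 1) = b * e ∧
    evalAt y (oddR (deriv _) (sR hΩ) (siR hΩ) (kR hΩ) (SR hΩ δ k) k.ev 0 0) = -2 * b * e ∧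
    evalAt y (oddR (deriv _) (sR hΩ) (siR hΩ) (kR hΩ) (SR hΩ δ k) k.ev 0 1) = 2 * a * e := by
  intro y e a b
  obtain ⟨h1, h2, h3, h4, h5, -⟩ := SR_derivs hΩ δ k h y
  have ht : y.1 (Sum.inr 0) = Real.pi / 2 := rfl
  have he : evalAt y (exR hΩ k.m) = e := rfl
  have es : evalAt y (siR hΩ) = 1 := by
    change ((Real.sin (Real.pi / 2) : ℝ) : ℂ)⁻¹ = 1
    simp
  have ek : evalAt y (kR hΩ) = 0 := by
    change ((Real.cos (Real.pi / 2) : ℝ) : ℂ) / ((Real.sin (Real.pi / 2) : ℝ) : ℂ) = 0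
    simp
  have hode := h.ode _ pi_div_two_mem
  rw [hk] at hode
  simp only [Real.cos_pi_div_two, Real.sin_pi_div_two, zero_div, zero_mul, add_zero, one_pow,
    div_one] at hode
  have hA2 : (A2 (Real.pi / 2) : ℂ) + thetaPart δ k (Real.pi / 2) = a := by
    have := congrArg (fun z : ℝ => (z : ℂ)) hode
    push_cast at this
    simp only [a]
    linear_combination this
  rw [ht, he] at h1 h2 h3 h4 h5
  simp only [evenR, oddR, Matrix.cons_val_zero, Matrix.cons_val_one, Matrix.of_apply,
    Matrix.cons_val', Matrix.cons_val_fin_one, ev_add, ev_sub, ev_neg, ev_mul, ev_smul, ev_ofNat,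
    h1, h2, h3, h4, h5, es, ek, ev_of_l_eq_one hk, ← hA2, b]
  refine ⟨?_, ?_, ?_, ?_⟩ <;> ring

/-- The divergence gives no information for l = 1, so the components θθ and θφ are evaluated on the
equator. They form a linear system in e2 and o2 with the entries a and b of `tensor_harm_one`: for m
= 0 one has a = δ and b = 0, for m = ±1 one has a = 0 and b = -2iδm. It is nondegenerate exactly
because δ ≠ 0. -/
theorem tensor_eq_zero_of_l_one (hδ : δ ≠ 0) (he2 : ∀ k : Mode, k.l ≠ 1 → (ρ k).e2 = 0)
    (ho2 : ∀ k : Mode, k.l ≠ 1 → (ρ k).o2 = 0) (hb : ∀ k, (ρ k).IsBase (deriv _))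
    (h : ∀ p q, HS (fun k : Mode => (ρ k).e2 * evenR (deriv _) (siR hΩ) (kR hΩ) (SR hΩ δ k) k.ev p q
      + (ρ k).o2 * oddR (deriv _) (sR hΩ) (siR hΩ) (kR hΩ) (SR hΩ δ k) k.ev p q) 0) {k : Mode}
    (hk : k.l = 1) : (ρ k).e2 = 0 ∧ (ρ k).o2 = 0 := by
  choose A1 A2 hA using sturm_thetaPart δ
  have hδ' : (δ : ℂ) ≠ 0 := by exact_mod_cast hδ
  have key : ∀ x : chartO Ω hΩ,
      evalAt x (ρ k).e2 * (((k.m : ℂ) ^ 2 - 1) * thetaPart δ k (Real.pi / 2))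
        + evalAt x (ρ k).o2 * (-2 * (A1 k (Real.pi / 2) * (Complex.I * k.m))) = 0 ∧
      evalAt x (ρ k).e2 * (A1 k (Real.pi / 2) * (Complex.I * k.m))
        + evalAt x (ρ k).o2 * (2 * (((k.m : ℂ) ^ 2 - 1) * thetaPart δ k (Real.pi / 2))) = 0 :=
    fun x => by
      constructor
      · refine eq_zero_of_hasSum_phi (f := fun k : Mode =>
          evalAt x (ρ k).e2 * (((k.m : ℂ) ^ 2 - 1) * thetaPart δ k (Real.pi / 2))
            + evalAt x (ρ k).o2 * (-2 * (A1 k (Real.pi / 2) * (Complex.I * k.m)))) one_lt_two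
          (fun k hk => by simp only [he2 k hk, ho2 k hk, ev_zero, zero_mul, add_zero]) (fun φ => ?_) k
        have := (h 0 0).2 (movePt hΩ x (Real.pi / 2) φ pi_div_two_mem)
        rw [ev_zero] at this
        refine this.congr_fun ?_
        intro k
        by_cases hk : k.l = 1
        · obtain ⟨e1, -, e3, -⟩ := tensor_harm_one hΩ δ hk (hA k) x φ
          simp only [ev_add, ev_mul, e1, e3, evalAt_movePt hΩ (hb k).e2,
            evalAt_movePt hΩ (hb k).o2]
          ring
        · simp only [he2 k hk, ho2 k hk, ev_add, ev_mul, ev_zero, zero_mul, add_zero]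
      · refine eq_zero_of_hasSum_phi (f := fun k : Mode =>
          evalAt x (ρ k).e2 * (A1 k (Real.pi / 2) * (Complex.I * k.m))
            + evalAt x (ρ k).o2 * (2 * (((k.m : ℂ) ^ 2 - 1) * thetaPart δ k (Real.pi / 2))))
          one_lt_two
          (fun k hk => by simp only [he2 k hk, ho2 k hk, ev_zero, zero_mul, add_zero]) (fun φ => ?_) k
        have := (h 0 1).2 (movePt hΩ x (Real.pi / 2) φ pi_div_two_mem)
        rw [ev_zero] at this
        refine this.congr_fun ?_
        intro k
        by_cases hk : k.l = 1
        · obtain ⟨-, e2, -, e4⟩ := tensor_harm_one hΩ δ hk (hA k) x φ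
          simp only [ev_add, ev_mul, e2, e4, evalAt_movePt hΩ (hb k).e2,
            evalAt_movePt hΩ (hb k).o2]
          ring
        · simp only [he2 k hk, ho2 k hk, ev_add, ev_mul, ev_zero, zero_mul, add_zero]
  suffices hx : ∀ x : chartO Ω hΩ, evalAt x (ρ k).e2 = 0 ∧ evalAt x (ρ k).o2 = 0 from
    ⟨evalAt_injective fun x => (hx x).1.trans (ev_zero _).symm,
      evalAt_injective fun x => (hx x).2.trans (ev_zero _).symm⟩
  intro x
  obtain ⟨k1, k2⟩ := key x
  by_cases hm : k.m = 0
  · have e : thetaPart δ k (Real.pi / 2) = -δ := by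
      rw [thetaPart, if_neg (by omega), if_pos hk, if_pos hm]
      simp
    rw [hm, e] at k1 k2
    push_cast at k1 k2
    simp only [mul_zero, add_zero, zero_add] at k1 k2
    refine ⟨?_, ?_⟩
    · refine (mul_eq_zero.1 (?_ : evalAt x (ρ k).e2 * (δ : ℂ) = 0)).resolve_right hδ'
      linear_combination k1
    · refine (mul_eq_zero.1 (?_ : evalAt x (ρ k).o2 * (δ : ℂ) = 0)).resolve_right hδ'
      linear_combination (1 / 2 : ℂ) * k2
  · have e : thetaPart δ k = fun t => Real.sin t
        + δ * (Real.sin t * lnc t + Real.cos t / Real.sin t) := by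
      rw [thetaPart, if_neg (by omega), if_pos hk, if_neg hm]
    have e1 : A1 k (Real.pi / 2) = -2 * δ := by
      have h1 := (hA k).d1 _ pi_div_two_mem
      rw [e] at h1
      rw [h1.unique ((sturm_one_one δ).d1 _ pi_div_two_mem)]
      simp only [Real.cos_pi_div_two, Real.sin_pi_div_two]
      ring
    have hm2 : ((k.m : ℂ)) ^ 2 = 1 := by exact_mod_cast Mode.m_sq hk hm
    have hm' : (k.m : ℂ) ≠ 0 := by exact_mod_cast hm
    rw [hm2, e1] at k1 k2
    push_cast at k1 k2
    have hz : (δ : ℂ) * (Complex.I * k.m) ≠ 0 :=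
      mul_ne_zero hδ' (mul_ne_zero Complex.I_ne_zero hm')
    refine ⟨?_, ?_⟩
    · refine (mul_eq_zero.1 (?_ : evalAt x (ρ k).e2 * ((δ : ℂ) * (Complex.I * k.m)) = 0)).resolve_right
        hz
      linear_combination (-1 / 2 : ℂ) * k2
    · refine (mul_eq_zero.1 (?_ : evalAt x (ρ k).o2 * ((δ : ℂ) * (Complex.I * k.m)) = 0)).resolve_right
        hz
      linear_combination (1 / 4 : ℂ) * k1

/-- The coefficients of a mixed tensor field are determined by the sum of the series. -/
theorem eq_zero_of_hs_matC (hb : ∀ k, (ρ k).IsBase (deriv _))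
    (hs : ∀ k A B, (ρ k).AB A B = (ρ k).AB B A) (hrap : RapidSrc hΩ ρ)
    (h : ∀ a b, HS (fun k => matC hΩ M hr k.ev (SR hΩ δ k) (ρ k) a b) 0) {k : Mode}
    (hk : δ ≠ 0 ∨ 2 ≤ k.l) : (∀ A B, (ρ k).AB A B = 0) ∧ (∀ A, (ρ k).e1 A = 0) ∧
      (∀ A, (ρ k).o1 A = 0) ∧ (ρ k).e0 = 0 ∧ (ρ k).e2 = 0 ∧ (ρ k).o2 = 0 := by
  have hB := bg_chart hΩ M hr
  have hy : ∀ B, ∃ c, IsBase (deriv _) c ∧ c * yR (fiR hΩ M hr) (fR hΩ M hr) B B = 1 := by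
    simp only [Fin.forall_fin_two, yR_00, yR_11]
    refine ⟨⟨-fR hΩ M hr, fun p => by rw [der_neg, hB.f2, neg_zero], ?_⟩,
      ⟨fiR hΩ M hr, fun p => hB.fi2 p, ?_⟩⟩
    · linear_combination hB.hf
    · linear_combination hB.hf
  have hAB : ∀ A B k, (ρ k).AB A B = 0 := fun A B => by
    obtain ⟨c, -, hc⟩ := hy B
    have h1 := (h (.inl A) (.inl B)).const_mul c
    rw [mul_zero] at h1
    exact eq_zero_of_hs_harm hΩ δ M hr (fun k => (hb k).AB A B) (hrap.AB A B)
      (h1.congr fun k => by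
        simp only [matC, matR]
        linear_combination (-((ρ k).AB A B * SR hΩ δ k)) * hc)
  have hg : ∀ q, ∃ c, c * gamR (siR hΩ) q q = 1 := by
    simp only [Fin.forall_fin_two, gamR_00, gamR_11]
    refine ⟨⟨1, one_mul _⟩, ⟨sR hΩ * sR hΩ, ?_⟩⟩
    linear_combination (sR hΩ * siR hΩ + 1) * hB.hs
  have h1 : ∀ A k, δ ≠ 0 ∨ k.l ≠ 0 → (ρ k).e1 A = 0 ∧ (ρ k).o1 A = 0 := fun A k hk =>
    eq_zero_of_hs_covector hΩ δ M hr (fun k => (hb k).e1 A) (fun k => (hb k).o1 A) (hrap.e1 A)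
      (hrap.o1 A) (fun q => by
        obtain ⟨c, hc⟩ := hg q
        have h1 := (h (.inl A) (.inr q)).const_mul (rR hΩ * c)
        rw [mul_zero] at h1
        refine h1.congr fun k => ?_
        simp only [matC, matR]
        linear_combination (-((ρ k).e1 A * deriv _ (.inr q) (SR hΩ δ k)
          + (ρ k).o1 A * curlR (deriv _) (sR hΩ) (siR hΩ) (SR hΩ δ k) q))
          * (hB.hr + rR hΩ * riR hΩ M hr * hc)) hk
  -- The angular trace isolates e0, since both tensor harmonics are trace-free.
  have h0 : ∀ k, (ρ k).e0 = 0 := by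
    have h2 := (h (.inr 0) (.inr 0)).add (h (.inr 1) (.inr 1))
    rw [add_zero] at h2
    refine eq_zero_of_hs_harm hΩ δ M hr (fun k => (hb k).e0) hrap.e0 (h2.congr fun k => ?_)
    have hhalf : ((1 / 2 : ℂ) • SR hΩ δ k) + ((1 / 2 : ℂ) • SR hΩ δ k) = SR hΩ δ k := by
      rw [← add_smul]; norm_num
    simp only [matC, matR, evenR, oddR, Matrix.cons_val_zero, Matrix.cons_val_one, Matrix.of_apply,
      Matrix.cons_val', Matrix.cons_val_fin_one]
    linear_combination (-(ρ k).e0) * hhalf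
  -- The sum of the series is the zero tensor, so its divergence series also vanishes.
  have hd := hs_divergence hΩ M δ hr hb hs (g := fun _ _ => 0) h
  have hz : ∀ b, dvm (deriv _) (chrG (rR hΩ) (riR hΩ M hr) (fR hΩ M hr) (fiR hΩ M hr) (nR hΩ M hr)
      (sR hΩ) (kR hΩ)) (fun _ _ => 0) b = 0 := fun b => by
    simp only [dvm, der_zero, mul_zero, Finset.sum_const_zero, add_zero, sub_zero]
  simp only [hz] at hd
  have hri : ∀ (z : ℂ) (a : smoothRing (chartO Ω hΩ)), z ≠ 0 → z • (riR hΩ M hr * a) = 0 → a = 0 :=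
    fun z a hz' ha => by
      have := (smul_eq_zero.1 ha).resolve_left hz'
      linear_combination rR hΩ * this - a * hB.hr
  -- With e1, o1 and e0 already zero, the angular divergence coefficients reduce to (ev - 2) e2 and
  -- (ev - 2) o2 up to nonzero factors, and ev = 2 only for l = 1.
  have h2 : ∀ k : Mode, δ ≠ 0 ∨ k.l ≠ 0 → k.l ≠ 1 → (ρ k).e2 = 0 ∧ (ρ k).o2 = 0 := fun k hk hl => by
    obtain ⟨c1, c2⟩ := (divergence_eq_zero hΩ M δ hr hb hrap hd.1 hd.2 k).2 hk
    have e1 := fun A => (h1 A k hk).1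
    have o1 := fun A => (h1 A k hk).2
    have hev : k.ev - 2 ≠ 0 := by
      by_cases hl0 : k.l = 0
      · rw [ev_of_l_eq_zero hl0]; norm_num
      · exact right_ne_zero_of_mul (ev_mul_ne_zero (k := k) (by omega))
    simp only [cbC, ccC, cbR, ccR, cv1, Fin.sum_univ_two, e1, o1, h0, der_zero, mul_zero, add_zero,
      sub_zero, smul_zero, zero_sub, zero_add, neg_eq_zero] at c1 c2
    exact ⟨hri _ _ (mul_ne_zero (by norm_num) hev) c1, hri _ _ hev c2⟩
  have hl0 : δ ≠ 0 ∨ k.l ≠ 0 := hk.imp_right fun h => by omega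
  refine ⟨fun A B => hAB A B k, fun A => (h1 A k hl0).1, fun A => (h1 A k hl0).2, h0 k, ?_⟩
  by_cases hl : k.l = 1
  -- For δ ≠ 0 the previous step covers every mode with l ≠ 1, including l = 0, so the remaining
  -- tensor series consists of l = 1 terms only.
  · have hδ : δ ≠ 0 := hk.resolve_right (by omega)
    refine tensor_eq_zero_of_l_one hΩ δ hδ (fun k hk => (h2 k (Or.inl hδ) hk).1)
      (fun k hk => (h2 k (Or.inl hδ) hk).2) hb (fun p q => ?_) hl
    refine (h (.inr p) (.inr q)).congr fun k => ?_
    simp only [matC, matR, h0, zero_mul, zero_add]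
  · exact h2 k hl0 hl

end TensorExtraction

/-! ### From the tensor equations back to the modes -/

section Main

variable {Ω : Set Plane} (hΩ : IsOpen Ω) (M δ : ℝ) (hr : ∀ q ∈ Ω, 0 < q 1 ∧ q 1 ≠ 2 * M)
  {F : InvModes} (hF : F.Smooth Ω) {T : MatterModes} (hT : T.Smooth Ω)

/-- The difference of coefficients. -/
def Src.sub {R : Type} [Sub R] (s t : Src R) : Src R :=
  ⟨fun A B => s.AB A B - t.AB A B, fun A => s.e1 A - t.e1 A, fun A => s.o1 A - t.o1 A,
    s.e0 - t.e0, s.e2 - t.e2, s.o2 - t.o2⟩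

theorem matC_sub (ev : ℂ) (S : smoothRing (chartO Ω hΩ)) (s t : Src (smoothRing (chartO Ω hΩ)))
    (a b : Fin 2 ⊕ Fin 2) :
    matC hΩ M hr ev S (s.sub t) a b = matC hΩ M hr ev S s a b - matC hΩ M hr ev S t a b := by
  rcases a with A | p <;> rcases b with B | q <;>
    simp only [matC, matR, Src.sub] <;> ring

/-- The tensor field 𝒢 - 8π T vanishes and has the mixed form of an energy-momentum tensor with
coefficients `einC` - 8π `srcR`. These are symmetric in the orbit indices, independent of the angles
and rapidly decreasing, so `eq_zero_of_hs_matC` applies. -/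
theorem einC_of_einsteinEq (h : EinsteinEq M δ Ω F T) {k : Mode} (hk : δ ≠ 0 ∨ 2 ≤ k.l) :
    einC hΩ M hr hF k = (srcR hΩ hT k).map ((8 * Real.pi : ℂ) • ·) := by
  obtain ⟨G, hG, hG'⟩ := exists_einstein hΩ M δ hr hF
  obtain ⟨t, ht, ht'⟩ := exists_calT hΩ δ hT M hr
  have hGt : ∀ a b, G a b - (8 * Real.pi : ℂ) • t a b = 0 := fun a b => evalAt_injective fun x => by
    have h1 : linEinstein (gMet M) (calF δ F) a b x = _ := hG' a b x
    have h2 : calT M δ T a b x = _ := ht' a b x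
    have h3 := h x x.2 a b
    rw [h1, h2] at h3
    rw [ev_sub, ev_smul, ev_zero]
    exact sub_eq_zero.2 h3
  have base_sub : ∀ {a b : smoothRing (chartO Ω hΩ)}, IsBase (deriv _) a → IsBase (deriv _) b →
      IsBase (deriv _) (a - (8 * Real.pi : ℂ) • b) := fun ha hb p => by
    rw [der_sub, der_smul, ha p, hb p, smul_zero, sub_zero]
  have rapid_sub : ∀ {a b : Mode → smoothRing (chartO Ω hΩ)}, Rapid hΩ a → Rapid hΩ b →
      Rapid hΩ fun k => a k - (8 * Real.pi : ℂ) • b k := fun ha hb =>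
    ha.sub (hb.smul (PolyGrowth.const _))
  have b1 := einC_isBase hΩ M hr hF
  have b2 := srcR_isBase hΩ hT
  have r1 := rapidSrc_einC hΩ M hr hF
  have r2 := rapidSrc_srcR hΩ hT
  have key := eq_zero_of_hs_matC hΩ M δ hr
    (ρ := fun k => (einC hΩ M hr hF k).sub ((srcR hΩ hT k).map ((8 * Real.pi : ℂ) • ·)))
    (fun k => ⟨fun A B => base_sub ((b1 k).AB A B) ((b2 k).AB A B),
      fun A => base_sub ((b1 k).e1 A) ((b2 k).e1 A), fun A => base_sub ((b1 k).o1 A) ((b2 k).o1 A),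
      base_sub (b1 k).e0 (b2 k).e0, base_sub (b1 k).e2 (b2 k).e2, base_sub (b1 k).o2 (b2 k).o2⟩)
    (fun k A B => by
      have e2 : (einC hΩ M hr hF k).AB A B = (einC hΩ M hr hF k).AB B A := by
        revert A B
        simp only [Fin.forall_fin_two]
        exact ⟨⟨trivial, rfl⟩, rfl, trivial⟩
      have e1 := srcR_symm hΩ hT k A B
      simp only [Src.sub, Src.map, e1, e2])
    ⟨fun A B => rapid_sub (r1.AB A B) (r2.AB A B), fun A => rapid_sub (r1.e1 A) (r2.e1 A),
      fun A => rapid_sub (r1.o1 A) (r2.o1 A), rapid_sub r1.e0 r2.e0, rapid_sub r1.e2 r2.e2,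
      rapid_sub r1.o2 r2.o2⟩
    (fun a b => by
      have := (hG a b).sub ((ht a b).smul (8 * Real.pi : ℂ))
      rw [hGt] at this
      refine this.congr fun k => ?_
      rw [matC_sub, matC_smul]) hk
  obtain ⟨k1, k2, k3, k4, k5, k6⟩ := key
  exact Src.ext_of (fun A B => sub_eq_zero.1 (k1 A B)) (fun A => sub_eq_zero.1 (k2 A))
    (fun A => sub_eq_zero.1 (k3 A)) (sub_eq_zero.1 k4) (sub_eq_zero.1 k5) (sub_eq_zero.1 k6)

/-- The divergence is itself a covector field: its orbit part is a scalar series for each component,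
its angular part a covector series, and both are extracted mode by mode. -/
theorem continuityEqs_of_continuityEq (hΩ : IsOpen Ω) (hr : ∀ q ∈ Ω, 0 < q 1 ∧ q 1 ≠ 2 * M)
    (hT : T.Smooth Ω) (h : ContinuityEq M δ Ω T) (k : Mode) (hk : δ ≠ 0 ∨ 2 ≤ k.l) (q : Plane)
    (hq : q ∈ Ω) : ContinuityEqs M T k q := by
  obtain ⟨t, ht, ht'⟩ := exists_calT hΩ δ hT M hr
  have hd := hs_divergence hΩ M δ hr (srcR_isBase hΩ hT) (srcR_symm hΩ hT) ht
  have hz : ∀ b, dvm (deriv _) (chrG (rR hΩ) (riR hΩ M hr) (fR hΩ M hr) (fiR hΩ M hr) (nR hΩ M hr)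
      (sR hΩ) (kR hΩ)) t b = 0 := fun b => evalAt_injective fun x => by
    have hrep : divMixed (gMet M) (calT M δ T) b x = _ :=
      rep_divMixed Function.injective_id (rep_chrG hΩ M hr) ht' b x
    exact (hrep.symm.trans (h x x.2 b)).trans (ev_zero _).symm
  simp only [hz] at hd
  obtain ⟨c1, c2⟩ := divergence_eq_zero hΩ M δ hr (srcR_isBase hΩ hT) (rapidSrc_srcR hΩ hT)
    hd.1 hd.2 k
  obtain ⟨c2, c3⟩ := c2 (hk.imp_right fun h => by omega)
  obtain ⟨x, rfl⟩ := exists_base hΩ hq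
  obtain ⟨i1, i2, i3⟩ := continuityEqs_iff hΩ M hr hT k x
  exact ⟨i1.2 fun B => by rw [c1 B, ev_zero], i2.2 (by rw [c2, ev_zero]), i3.2 (by rw [c3, ev_zero])⟩

end Main

end SchwarzschildModes

end

/-! ### The theorem -/

theorem mainTheorem3 (M δ : ℝ) (Ω : Set Plane) (hΩ : IsOpen Ω)
    (hr : ∀ q ∈ Ω, 0 < q 1 ∧ q 1 ≠ 2 * M)
    (h : MetricModes) (hF : (h.inv M).Smooth Ω)
    (T : MatterModes) (hT : T.Smooth Ω) :
    -- the mode-by-mode components of the linearized Einstein tensor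
    (∀ x ∈ chart Ω, EinsteinComponents M δ (h.inv M) x) ∧
    -- the linearized Einstein equation yields the mode equations
    (EinsteinEq M δ Ω (h.inv M) T →
      ∀ k : Mode, (δ ≠ 0 ∨ 2 ≤ k.l) → ∀ q ∈ Ω,
        OddEqs M (h.inv M) T k q ∧ EvenEqs M (h.inv M) T k q ∧ ContinuityEqs M T k q) ∧
    -- conversely, the mode equations yield the linearized Einstein equation
    ((∀ k : Mode, ∀ q ∈ Ω,
        OddEqs M (h.inv M) T k q ∧ EvenEqs M (h.inv M) T k q ∧ ContinuityEven M T k q) →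
      EinsteinEq M δ Ω (h.inv M) T) ∧
    -- the mode form of the linearized continuity equation
    (ContinuityEq M δ Ω T →
      ∀ k : Mode, (δ ≠ 0 ∨ 2 ≤ k.l) → ∀ q ∈ Ω, ContinuityEqs M T k q) ∧
    ((∀ k : Mode, ∀ q ∈ Ω, ContinuityEqs M T k q) → ContinuityEq M δ Ω T) := by
  refine ⟨fun x hx => einsteinComponents hΩ M δ hr hF ⟨x, hx⟩, fun hE k hk q hq => ?_,
    einsteinEq_of_modes M δ hΩ hr hF hT,
    fun hC k hk q hq => continuityEqs_of_continuityEq M δ hΩ hr hT hC k hk q hq,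
    continuityEq_of_modes M δ hΩ hr hT⟩
  obtain ⟨x, rfl⟩ := exists_base hΩ hq
  exact modeEqs_of_einC hΩ M hr hF hT (einC_of_einsteinEq hΩ M δ hr hF hT hE hk) x
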